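/- Let $0<T\le\infty$. Let $L^2_{\mathrm{uloc}}(0,T)$ be the class of measurable vector fields $u\colon\mathbb R^3\times(0,T)\to\mathbb R^3$ with $\operatorname{ess\,sup}_{0<t<T}\sup_{x_0\in\mathbb R^3}\|u(t)\|_{L^2(B_1(x_0))}<\infty$. Repeated indices $i,j$ are summed over $\{1,2,3\}$; the index $k$ is not summed. **Weak solutions.** Let $u_0\in L^1_{\mathrm{loc}}(\mathbb R^3;\mathbb R^3)$ be divergence-free in the sense of distributions. A pair $(u,p)$ with $u\in L^2_{\mathrm{uloc}}(0,T)$ and $p\in\mathcal D'(\mathbb R^3\times(0,T))$ is a weak solution for $u_0$ if 1. $\partial_tu-\Delta u+u\cdot\nabla u+\nabla p=0$ and $\nabla\cdot u=0$ in $\mathcal D'(\mathbb R^3\times(0,T))$; 2. for every $\psi\in C_0^\infty(\mathbb R^3\times[0,T))$ and every $k\in\{1,2,3\}$ the limit $\int_{0+}^T\langle p,\partial_k\psi\rangle\,dt=\lim_{\epsilon\to0^+}\int_\epsilon^T\langle p,\partial_k\psi\rangle\,dt$ exists. Here $\langle p,\partial_k\psi\rangle$ is the distribution $\eta\mapsto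 p(\eta\,\partial_k\psi)$ in $\mathcal D'(0,T)$, the function $\epsilon\mapsto\int_\epsilon^T\langle p,\partial_k\psi\rangle\,dt$ is the function $G\in L^1_{\mathrm{loc}}(0,T)$ with $G'=-\langle p,\partial_k\psi\rangle$ in $\mathcal D'(0,T)$ and $G=0$ near $T$, and, since $G$ is defined almost everywhere only, the limit is taken outside of a null set of $\epsilon$; 3. for every such $\psi$ and $k$, $$\int_0^T\!\!\int u_k\,(\partial_t\psi+\Delta\psi+u_j\partial_j\psi)\,dx\,dt+\int_{0+}^T\langle p,\partial_k\psi\rangle\,dt=-\int u_{0k}\,\psi(\cdot,0)\,dx .$$ **Distributional local pressure expansion.** Fix $\Theta\in C_c^\infty(\mathbb R^3)$ with $\Theta=1$ on $B_2(0)$ and $\operatorname{supp}\Theta\subset B_4(0)$, and put $\theta_R(x)=\Theta(x/R)$. Let $K_{ij}(y)=\partial_i\partial_j\frac1{4\pi|y|}=\frac{-\delta_{ij}|y|^2+3y_iy_j}{4\pi|y|^5}$ and $R_iR_jf(x)=-\frac13\delta_{ij}f(x)+\mathrm{p.v.}\!\int K_{ij}(x-y)f(y)\,dy$. A distribution $p\in\mathcal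 D'(\mathbb R^3\times(0,T))$ satisfies the distributional local pressure expansion for $u\in L^2_{\mathrm{uloc}}(0,T)$ if for every $R>0$ and $x_0\in\mathbb R^3$ there is a function $c_{x_0,R}(t)$, in $L^1(0,T')$ for every finite $T'\le T$ (so in $L^1(0,T)$ if $T<\infty$), such that for every scalar $\psi\in\mathcal D(B_R(x_0)\times(0,T))$ $$\begin{aligned}\langle p-c_{x_0,R},\psi\rangle&=\int_0^T\!\!\int u_iu_j\,\theta_R(x_0-x)\,R_iR_j\psi\,dx\,dt\\&\quad+\int_0^T\!\!\int\!\Big(\int\big(K_{ij}(x-y)-K_{ij}(x_0-y)\big)\big(1-\theta_R(x_0-y)\big)u_iu_j(y,t)\,dy\Big)\psi(x,t)\,dx\,dt .\end{aligned}$$ **Theorem (Structure of weak solutions).** Let $u_0\in L^1_{\mathrm{loc}}(\mathbb R^3;\mathbb R^3)$ be divergence-free and let $(u,p)$ be a weak solution for $u_0$ on $\mathbb R^3\times(0,T)$. Then there exist a weak solution $(\tilde u,\tilde p)$ for the same $u_0$ on $\mathbb R^3\times(0,T)$, such that $\tilde p$ satisfies the distributional local pressure expansion for $\tilde u$, and a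 function $\phi\in L^\infty(0,T;\mathbb R^3)$ with $\lim_{t\to0^+}\phi(t)=0$, such that $$\tilde u(x,t)=u(x-\Phi(t),t)+\phi(t),\qquad \Phi(t)=\int_0^t\phi(s)\,ds .$$ -/

import Mathlib

open MeasureTheory Filter Set Topology
open scoped Distributions LineDeriv ContDiff

namespace NSStructure

/-- Three-dimensional Euclidean space. -/
abbrev E3 : Type := EuclideanSpace ℝ (Fin 3)

/-- The open time interval `(0, T)`, where `0 < T ≤ ∞`. -/
def timeInterval (T : EReal) : TopologicalSpace.Opens ℝ :=
  ⟨{t : ℝ | 0 < t ∧ (t : EReal) < T},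
    (isOpen_lt continuous_const continuous_id).inter
      (isOpen_lt continuous_coe_real_ereal continuous_const)⟩

/-- The space-time domain `ℝ³ × (0, T)`. -/
def slab (T : EReal) : TopologicalSpace.Opens (E3 × ℝ) :=
  ⟨{z : E3 × ℝ | z.2 ∈ timeInterval T}, (timeInterval T).isOpen.preimage continuous_snd⟩

/-- The set `ℝ³ × (-∞, T)`.  The restrictions to `t ≥ 0` of its test functions are exactly the
elements of `C₀^∞(ℝ³ × [0, T))`: smooth up to `t = 0`, compactly supported in `ℝ³ × [0, T)`, with no
vanishing condition at `t = 0`. -/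
def pastSlab (T : EReal) : TopologicalSpace.Opens (E3 × ℝ) :=
  ⟨{z : E3 × ℝ | (z.2 : EReal) < T},
    isOpen_lt (continuous_coe_real_ereal.comp continuous_snd) continuous_const⟩

/-- The `k`-th spatial coordinate direction in space-time. -/
noncomputable def ex (k : Fin 3) : E3 × ℝ := (EuclideanSpace.single k 1, 0)

/-- The time direction in space-time. -/
def et : E3 × ℝ := (0, 1)

/-- The class `L²_uloc(0, T)`: the essential supremum over `0 < t < T` of
`‖u(t)‖_{L²_uloc} = sup_{x₀} ‖u(t)‖_{L²(B₁(x₀))}` is finite. -/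
def MemL2uloc (T : EReal) (u : E3 → ℝ → E3) : Prop :=
  AEStronglyMeasurable (fun z : E3 × ℝ => u z.1 z.2) (volume.restrict (slab T : Set (E3 × ℝ))) ∧
  essSup (fun t : ℝ => ⨆ x₀ : E3,
      eLpNorm (fun x => u x t) 2 (volume.restrict (Metric.ball x₀ 1)))
    (volume.restrict (timeInterval T : Set ℝ)) < ⊤

/-- A locally integrable vector field on `ℝ³` is divergence free in the sense of distributions. -/
def IsDivFree (v : E3 → E3) : Prop :=
  ∀ χ : 𝓓((⊤ : TopologicalSpace.Opens E3), ℝ),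
    ∫ x, ∑ k : Fin 3, v x k * (∂_{(EuclideanSpace.single k (1 : ℝ) : E3)} χ) x = 0

/-- The integrand `u_k (∂ₜψ + Δψ + u_j ∂_j ψ)` (sum over `j`, no sum over `k`). -/
noncomputable def momentumIntegrand {Ω : TopologicalSpace.Opens (E3 × ℝ)} (u : E3 → ℝ → E3)
    (k : Fin 3) (ψ : 𝓓(Ω, ℝ)) (x : E3) (t : ℝ) : ℝ :=
  u x t k * ((∂_{et} ψ) (x, t) + ∑ j : Fin 3, (∂_{ex j} (∂_{ex j} ψ)) (x, t)
    + ∑ j : Fin 3, u x t j * (∂_{ex j} ψ) (x, t))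

/-- `(u, p)` solves
`∂ₜu - Δu + u·∇u + ∇p = 0`, `∇·u = 0` in `𝓓'(ℝ³ × (0, T))`. -/
structure SolvesNSE (T : EReal) (u : E3 → ℝ → E3) (p : 𝓓'(slab T, ℝ)) : Prop where
  momentum : ∀ (k : Fin 3) (ψ : 𝓓(slab T, ℝ)),
    (∫ t in (timeInterval T : Set ℝ), ∫ x, momentumIntegrand u k ψ x t) + p (∂_{ex k} ψ) = 0
  divFree : ∀ ψ : 𝓓(slab T, ℝ),
    ∫ t in (timeInterval T : Set ℝ), ∫ x, ∑ k : Fin 3, u x t k * (∂_{ex k} ψ) (x, t) = 0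

/-- The product `η(t) ψ(x, t)` of a test function `η` on `(0, T)` and a test function `ψ` on
`ℝ³ × (-∞, T)`; it is a test function on `ℝ³ × (0, T)`. -/
noncomputable def timeCut {T : EReal} (η : 𝓓(timeInterval T, ℝ)) (ψ : 𝓓(pastSlab T, ℝ)) : 𝓓(slab T, ℝ) where
  toFun z := η z.2 * ψ z
  contDiff' := (η.contDiff.comp contDiff_snd).mul ψ.contDiff
  hasCompactSupport' := ψ.hasCompactSupport.mul_left
  tsupport_subset' := by
    intro z hz
    have h1 : tsupport (fun z : E3 × ℝ => η z.2 * ψ z) ⊆ (Prod.snd ⁻¹' tsupport η) := by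
      refine closure_minimal (fun w hw => ?_) ((isClosed_tsupport _).preimage continuous_snd)
      exact subset_tsupport _ (left_ne_zero_of_mul hw)
    exact η.tsupport_subset (h1 hz)

/-- For a distribution `S` in time on `(0, T)`, vanishing near `T`, the (a.e. defined) function
`G(ε) = ∫_ε^T S dt`: the primitive `G' = -S` in `𝓓'(0, T)` that vanishes near `T`.
If `S` is an integrable function with support bounded away from `T`, this is the usual integral. -/
structure IsTailIntegral (T : EReal) (S : 𝓓(timeInterval T, ℝ) → ℝ) (G : ℝ → ℝ) : Prop where
  locallyIntegrable : LocallyIntegrableOn G (timeInterval T : Set ℝ)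
  eventually_zero : ∃ a : ℝ, (a : EReal) < T ∧
    ∀ᵐ t ∂(volume.restrict (timeInterval T : Set ℝ)), a < t → G t = 0
  primitive : ∀ η : 𝓓(timeInterval T, ℝ),
    S η = ∫ t in (timeInterval T : Set ℝ), G t * deriv η t

/-- `∫_{0+}^T ⟨p, ∂_k ψ⟩ dt = L`, i.e. `lim_{ε → 0+} ∫_ε^T ⟨p, ∂_k ψ⟩ dt` exists and equals `L`.
Here `⟨p, ∂_k ψ⟩` is the distribution `η ↦ p(η ∂_k ψ)` in time.  As its integral from `ε` to `T` is
defined for almost every `ε` only, the limit is the limit in `ε` outside of a null set. -/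
def HasPressureLimit (T : EReal) (p : 𝓓'(slab T, ℝ)) (k : Fin 3) (ψ : 𝓓(pastSlab T, ℝ))
    (L : ℝ) : Prop :=
  ∃ G : ℝ → ℝ, IsTailIntegral T (fun η => p (timeCut η (∂_{ex k} ψ))) G ∧
    Tendsto G (𝓝[>] (0 : ℝ) ⊓ ae volume) (𝓝 L)

/-- `(u, p)` is a weak solution of the Navier-Stokes equations on `ℝ³ × (0, T)` for `u₀`. -/
structure IsWeakSolution (T : EReal) (u₀ : E3 → E3) (u : E3 → ℝ → E3) (p : 𝓓'(slab T, ℝ)) :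
    Prop where
  memL2uloc : MemL2uloc T u
  solves : SolvesNSE T u p
  exists_limit : ∀ (k : Fin 3) (ψ : 𝓓(pastSlab T, ℝ)), ∃ L : ℝ, HasPressureLimit T p k ψ L
  weak_form : ∀ (k : Fin 3) (ψ : 𝓓(pastSlab T, ℝ)) (L : ℝ), HasPressureLimit T p k ψ L →
    (∫ t in (timeInterval T : Set ℝ), ∫ x, momentumIntegrand u k ψ x t) + L
      = - ∫ x, u₀ x k * ψ (x, 0)

/-- The kernel `K_ij(y) = ∂_i ∂_j (1 / (4π|y|)) = (-δ_ij |y|² + 3 y_i y_j) / (4π |y|⁵)`. -/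
noncomputable def kernelK (i j : Fin 3) (y : E3) : ℝ :=
  (-(if i = j then 1 else 0) * ‖y‖ ^ 2 + 3 * y i * y j) / (4 * Real.pi * ‖y‖ ^ 5)

/-- `R_i R_j f = (-Δ⁻¹ div div)_ij f = -(1/3) δ_ij f + p.v. ∫ K_ij(x - y) f(y) dy`, for smooth
compactly supported `f`. -/
noncomputable def rieszRR (i j : Fin 3) (f : E3 → ℝ) (x : E3) : ℝ :=
  -(1 / 3) * (if i = j then 1 else 0) * f x +
    limUnder (𝓝[>] (0 : ℝ))
      (fun ε : ℝ => ∫ y in {y : E3 | ε < ‖x - y‖}, kernelK i j (x - y) * f y)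

/-- The profile `Θ ∈ C_c^∞` of the cut-offs: `Θ = 1` on `B₂(0)` and `supp Θ ⊂ B₄(0)`. -/
structure IsCutoff (Θ : E3 → ℝ) : Prop where
  smooth : ContDiff ℝ ∞ Θ
  tsupport_subset : tsupport Θ ⊆ Metric.ball 0 4
  eq_one : ∀ x ∈ Metric.ball (0 : E3) 2, Θ x = 1

/-- The rescaled cut-off `θ_R(x) = Θ(x / R)`. -/
noncomputable def cutoffR (Θ : E3 → ℝ) (R : ℝ) (x : E3) : ℝ := Θ (R⁻¹ • x)

/-- `∫₀ᵀ ⟨p_near, ψ⟩ dt = ∫₀ᵀ ∫ u_i u_j θ_R(x₀ - x) (R_i R_j ψ(·, t))(x) dx dt`. -/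
noncomputable def pressureNear (T : EReal) (Θ : E3 → ℝ) (u : E3 → ℝ → E3) (R : ℝ) (x₀ : E3)
    (ψ : 𝓓(slab T, ℝ)) : ℝ :=
  ∫ t in (timeInterval T : Set ℝ), ∫ x, ∑ i : Fin 3, ∑ j : Fin 3,
    u x t i * u x t j * cutoffR Θ R (x₀ - x) * rieszRR i j (fun y => ψ (y, t)) x

/-- `∫₀ᵀ ⟨p_far, ψ⟩ dt =
∫₀ᵀ ∫ ∫ (K_ij(x - y) - K_ij(x₀ - y)) (1 - θ_R(x₀ - y)) (u_i u_j)(y, t) dy ψ(x, t) dx dt`. -/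
noncomputable def pressureFar (T : EReal) (Θ : E3 → ℝ) (u : E3 → ℝ → E3) (R : ℝ) (x₀ : E3)
    (ψ : 𝓓(slab T, ℝ)) : ℝ :=
  ∫ t in (timeInterval T : Set ℝ), ∫ x,
    (∫ y, ∑ i : Fin 3, ∑ j : Fin 3,
      (kernelK i j (x - y) - kernelK i j (x₀ - y)) * (1 - cutoffR Θ R (x₀ - y))
        * (u y t i * u y t j)) * ψ (x, t)

/-- `p` satisfies the distributional local pressure expansion for `u`: on each ball `B_R(x₀)`,
`p = p_near + p_far + c(t)`.  The function `c` is integrable on `(0, T')` for every finite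
`T' ≤ T`; for `T < ∞` this is `c ∈ L¹(0, T)`. -/
def HasLocalPressureExpansion (T : EReal) (Θ : E3 → ℝ) (u : E3 → ℝ → E3)
    (p : 𝓓'(slab T, ℝ)) : Prop :=
  ∀ R : ℝ, 0 < R → ∀ x₀ : E3, ∃ c : ℝ → ℝ,
    (∀ T' : ℝ, (T' : EReal) ≤ T → IntegrableOn c (Ioo 0 T')) ∧
    ∀ ψ : 𝓓(slab T, ℝ), (∀ z ∈ tsupport ψ, z.1 ∈ Metric.ball x₀ R) →
      p ψ - ∫ t in (timeInterval T : Set ℝ), ∫ x, c t * ψ (x, t)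
        = pressureNear T Θ u R x₀ ψ + pressureFar T Θ u R x₀ ψ

end NSStructure

/-! The velocity determines the pressure gradient up to a function of time alone, and passing to an
accelerated frame removes that function.

Let p_R (`rieszPressure`) be the distribution formally equal to R_i R_j (u_i u_j). Since R_i R_j ψ
decays only like |x|^{-3} and u ⊗ u is merely uniformly locally integrable, its pairing with ψ needs
ψ to have mean zero on every time slice. Subtracting from ψ a fixed profile `rho` times the slice
mean makes the pairing converge and fixes the free function of time; the local pressure expansion
then holds with an explicit c(t). Write ℓ_k(f) for the integral of `residual u k f`, the k-th
momentum equation tested with f and with p_R in place of p. It is always defined because ∂_k f has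
mean zero on slices.

The divergence of the momentum equation gives ℓ_k(Δg) = 0, so ℓ_k is harmonic in x and a Liouville
argument applies. Up to a Laplacian of a test function, f equals `far R f`. If f has mean zero on
slices, then this function and the other quantities entering ℓ_k are bounded by R^{-1/2} times an
integrable weight. Letting R → ∞ yields ℓ_k(f) = 0 (`SolvesNSE.integral_residual_eq_zero`). Hence
ℓ_k(f) depends only on the slice mass m(t) = ∫ f(x, t) dx, and ℓ_k(f) = -∫ m' φ_k for a drift φ_k:
accumulated force minus mean velocity, both measured with `rho`. Dilating `rho` by R changes the
drift by a constant only, while the force becomes O(1/R) and the mean velocity stays bounded. So the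
drift is bounded on all of (0, T), also when T = ∞ (`SolvesNSE.exists_driftOf_bound`).

The tail integrals of the pressure are a continuous function plus m φ_k. Existence of their limit at
t = 0 therefore forces φ_k to have a limit outside a null set. After this constant is subtracted,
the weak form reads ℓ_k(ψ) + ∫ m' φ_k = -∫ u₀_k ψ(·, 0) with φ_k → 0
(`IsWeakSolution.exists_drift`).

It remains to compute the residual of the boosted velocity u(x - Φ, t) + φ. In the moving frame the
difference to the sheared residual of u consists of constants or u paired with gradients of decaying
functions, which integrate to zero, and of φ_k ∂_t f, which integrates to exactly the drift term
(`SolvesNSE.integral_residual_boost`). Shearing a test function requires a smooth Φ, so the identity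
for the bounded measurable φ is obtained by mollification and dominated convergence
(`integral_shearedResidual`). -/

namespace NSStructure

/-! ### The Newtonian potential, its gradient and the kernel K. -/

/-- The `i`-th coordinate vector of `ℝ³`. -/
noncomputable abbrev bv (i : Fin 3) : E3 := EuclideanSpace.single i 1

/-- The Newtonian potential `1 / (4π|x|)`. -/
noncomputable def newton (x : E3) : ℝ := (4 * Real.pi * ‖x‖)⁻¹

/-- The `j`-th partial derivative of the Newtonian potential. -/
noncomputable def gradNewton (j : Fin 3) (x : E3) : ℝ := -(x j) / (4 * Real.pi * ‖x‖ ^ 3)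

theorem hasDerivAt_norm_line {x : E3} (hx : x ≠ 0) (i : Fin 3) :
    HasDerivAt (fun t : ℝ => ‖x + t • bv i‖) (x i / ‖x‖) 0 := by
  have h1 : HasDerivAt (fun t : ℝ => x + t • bv i) (bv i) 0 := by
    simpa using ((hasDerivAt_id (0 : ℝ)).smul_const (bv i)).const_add x
  have h2 := h1.norm_sq
  have hn : ‖x‖ ≠ 0 := norm_ne_zero_iff.2 hx
  have h3 := h2.sqrt (by simpa using hn)
  simp only [Real.sqrt_sq (norm_nonneg _)] at h3
  convert h3 using 1
  simp [EuclideanSpace.inner_single_right]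
  field_simp

theorem hasDerivAt_coord_line (x : E3) (i j : Fin 3) :
    HasDerivAt (fun t : ℝ => (x + t • bv i) j) (if i = j then 1 else 0) 0 := by
  have : (fun t : ℝ => (x + t • bv i) j) = fun t => x j + t * (if i = j then 1 else 0) := by
    funext t
    simp [eq_comm]
  rw [this]
  simpa using ((hasDerivAt_id (0 : ℝ)).mul_const (if i = j then (1 : ℝ) else 0)).const_add (x j)

theorem hasLineDerivAt_newton {x : E3} (hx : x ≠ 0) (i : Fin 3) :
    HasLineDerivAt ℝ newton (gradNewton i x) x (bv i) := by
  have hn : ‖x‖ ≠ 0 := norm_ne_zero_iff.2 hx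
  have h := ((hasDerivAt_norm_line hx i).const_mul (4 * Real.pi)).inv
    (by simpa [Real.pi_ne_zero] using hx)
  unfold HasLineDerivAt newton
  refine h.congr_deriv ?_
  simp only [zero_smul, add_zero, gradNewton]
  field_simp

theorem hasLineDerivAt_gradNewton {x : E3} (hx : x ≠ 0) (i j : Fin 3) :
    HasLineDerivAt ℝ (gradNewton j) (kernelK i j x) x (bv i) := by
  have hn : ‖x‖ ≠ 0 := norm_ne_zero_iff.2 hx
  have h := (hasDerivAt_coord_line x i j).neg.div
    (((hasDerivAt_norm_line hx i).pow 3).const_mul (4 * Real.pi))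
    (by simpa [Real.pi_ne_zero] using hx)
  unfold HasLineDerivAt gradNewton
  refine h.congr_deriv ?_
  simp only [zero_smul, add_zero, kernelK, Pi.neg_apply, Pi.pow_apply]
  by_cases hij : i = j
  · subst hij
    simp
    field_simp
  · simp [hij]
    field_simp

theorem contDiffAt_newton {x : E3} (hx : x ≠ 0) : ContDiffAt ℝ ∞ newton x := by
  unfold newton
  refine ContDiffAt.inv (contDiffAt_const.mul (contDiffAt_norm ℝ hx)) ?_
  simpa [Real.pi_ne_zero] using hx

theorem contDiffAt_gradNewton {x : E3} (hx : x ≠ 0) (j : Fin 3) :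
    ContDiffAt ℝ ∞ (gradNewton j) x := by
  unfold gradNewton
  refine ContDiffAt.div ?_ (contDiffAt_const.mul ((contDiffAt_norm ℝ hx).pow 3)) ?_
  · fun_prop
  · simpa [Real.pi_ne_zero] using hx

theorem fderiv_newton {x : E3} (hx : x ≠ 0) (i : Fin 3) :
    fderiv ℝ newton x (bv i) = gradNewton i x := by
  rw [← ((contDiffAt_newton hx).differentiableAt (by simp)).lineDeriv_eq_fderiv]
  exact (hasLineDerivAt_newton hx i).lineDeriv

theorem fderiv_gradNewton {x : E3} (hx : x ≠ 0) (i j : Fin 3) :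
    fderiv ℝ (gradNewton j) x (bv i) = kernelK i j x := by
  rw [← ((contDiffAt_gradNewton hx j).differentiableAt (by simp)).lineDeriv_eq_fderiv]
  exact (hasLineDerivAt_gradNewton hx i j).lineDeriv

theorem norm_gradNewton_le (j : Fin 3) (x : E3) :
    ‖gradNewton j x‖ ≤ (4 * Real.pi)⁻¹ * ‖x‖ ^ (-(2 : ℝ)) := by
  by_cases hx : x = 0
  · subst hx; simp [gradNewton]
  have hn : 0 < ‖x‖ := norm_pos_iff.2 hx
  have h1 : |x j| ≤ ‖x‖ := by simpa using PiLp.norm_apply_le x j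
  rw [gradNewton, norm_div, norm_neg, Real.norm_eq_abs, Real.rpow_neg hn.le]
  have : ‖4 * Real.pi * ‖x‖ ^ 3‖ = 4 * Real.pi * ‖x‖ ^ 3 := by
    rw [Real.norm_eq_abs, abs_of_pos]; positivity
  rw [this, div_le_iff₀ (by positivity)]
  have : (4 * Real.pi)⁻¹ * (‖x‖ ^ (2 : ℝ))⁻¹ * (4 * Real.pi * ‖x‖ ^ 3) = ‖x‖ := by
    norm_cast
    field_simp
  rw [this]; exact h1

theorem measurable_newton : Measurable newton := by unfold newton; fun_prop

theorem measurable_gradNewton (j : Fin 3) : Measurable (gradNewton j) := by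
  unfold gradNewton; fun_prop

theorem measurable_kernelK (i j : Fin 3) : Measurable (kernelK i j) := by
  unfold kernelK; fun_prop

theorem locallyIntegrable_newton : LocallyIntegrable newton (volume : Measure E3) := by
  refine locallyIntegrable_of_norm_le_rpow (C := (4 * Real.pi)⁻¹) (α := 1) (by simp) (by simp) ?_
    measurable_newton.aestronglyMeasurable
  refine Eventually.of_forall fun x => ?_
  rw [Real.rpow_neg_one, newton, mul_inv, norm_mul, norm_inv, norm_inv, norm_norm,
    Real.norm_of_nonneg (by positivity)]

theorem locallyIntegrable_gradNewton (j : Fin 3) :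
    LocallyIntegrable (gradNewton j) (volume : Measure E3) :=
  locallyIntegrable_of_norm_le_rpow (C := (4 * Real.pi)⁻¹) (α := 2) (by simp) (by simp; norm_num)
    (Eventually.of_forall (norm_gradNewton_le j)) (measurable_gradNewton j).aestronglyMeasurable

/-! ### Regularized potentials and the limit of truncated singular integrals. -/

/-- The Newtonian potential cut off to a constant inside the ball of radius `ε`. -/
noncomputable def newtonReg (ε : ℝ) (x : E3) : ℝ := (4 * Real.pi * max ‖x‖ ε)⁻¹

/-- The gradient of the Newtonian potential made linear inside the ball of radius `ε`. -/
noncomputable def gradNewtonReg (ε : ℝ) (j : Fin 3) (x : E3) : ℝ :=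
  -(x j) / (4 * Real.pi * max ‖x‖ ε ^ 3)

theorem lipschitz_max_norm (ε : ℝ) (x y : E3) : |max ‖x‖ ε - max ‖y‖ ε| ≤ ‖x - y‖ :=
  (abs_max_sub_max_le_abs _ _ _).trans (abs_norm_sub_norm_le _ _)

/-- Lipschitz regularizations permit integration by parts on the whole space without a boundary term
on the sphere of radius ε. -/
theorem lipschitzWith_newtonReg {ε : ℝ} (hε : 0 < ε) :
    LipschitzWith (Real.toNNReal ((4 * Real.pi * ε ^ 2)⁻¹)) (newtonReg ε) := by
  refine LipschitzWith.of_dist_le_mul fun x y => ?_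
  rw [Real.coe_toNNReal _ (by positivity), Real.dist_eq, dist_eq_norm]
  set a := max ‖x‖ ε with ha
  set b := max ‖y‖ ε with hb
  have ha' : ε ≤ a := le_max_right _ _
  have hb' : ε ≤ b := le_max_right _ _
  have ha0 : 0 < a := hε.trans_le ha'
  have hb0 : 0 < b := hε.trans_le hb'
  have h := lipschitz_max_norm ε x y
  rw [← ha, ← hb] at h
  have e : newtonReg ε x - newtonReg ε y = (4 * Real.pi * (a * b))⁻¹ * (b - a) := by
    simp only [newtonReg, ← ha, ← hb]
    field_simp
  rw [e, abs_mul, abs_of_pos (by positivity)]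
  gcongr
  · nlinarith
  · rwa [abs_sub_comm]

/-- The factor 4 is 1 + 3: the variation of the numerator contributes 1, and b³ - a³ = (b - a)(b² +
ab + a²) ≤ 3b²(b - a) contributes 3 for the denominator. By symmetry only ‖x‖ ≤ ‖y‖ needs treatment.
-/
theorem lipschitzWith_gradNewtonReg {ε : ℝ} (hε : 0 < ε) (j : Fin 3) :
    LipschitzWith (Real.toNNReal (4 * (4 * Real.pi * ε ^ 3)⁻¹)) (gradNewtonReg ε j) := by
  have key : ∀ x y : E3, ‖x‖ ≤ ‖y‖ → |gradNewtonReg ε j x - gradNewtonReg ε j y|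
      ≤ 4 * (4 * Real.pi * ε ^ 3)⁻¹ * ‖x - y‖ := by
    intro x y hxy
    set a := max ‖x‖ ε with ha
    set b := max ‖y‖ ε with hb
    have ha' : ε ≤ a := le_max_right _ _
    have hab : a ≤ b := max_le_max_right _ hxy
    have ha0 : 0 < a := hε.trans_le ha'
    have hb0 : 0 < b := ha0.trans_le hab
    have h := lipschitz_max_norm ε x y
    rw [← ha, ← hb, abs_sub_comm, abs_of_nonneg (by linarith)] at h
    have hj : |x j - y j| ≤ ‖x - y‖ := by simpa using PiLp.norm_apply_le (x - y) j
    have hxj : |x j| ≤ a := by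
      have := PiLp.norm_apply_le x j
      rw [Real.norm_eq_abs] at this
      exact this.trans (le_max_left _ _)
    have e : gradNewtonReg ε j x - gradNewtonReg ε j y =
        (4 * Real.pi)⁻¹ * (-(x j - y j) * (b ^ 3)⁻¹ - x j * ((b - a) * (b ^ 2 + a * b + a ^ 2) *
          (a ^ 3 * b ^ 3)⁻¹)) := by
      simp only [gradNewtonReg, ← ha, ← hb]
      field_simp
      ring
    have e1 : 4 * (4 * Real.pi * ε ^ 3)⁻¹ * ‖x - y‖ =
        (4 * Real.pi)⁻¹ * (4 * ((ε ^ 3)⁻¹ * ‖x - y‖)) := by rw [mul_inv]; ring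
    rw [e, e1, abs_mul, abs_of_pos (by positivity : 0 < (4 * Real.pi)⁻¹)]
    refine mul_le_mul_of_nonneg_left ?_ (by positivity)
    have e3 : (b ^ 3)⁻¹ ≤ (ε ^ 3)⁻¹ := by gcongr; exact ha'.trans hab
    have t1 : |-(x j - y j) * (b ^ 3)⁻¹| ≤ (ε ^ 3)⁻¹ * ‖x - y‖ := by
      rw [abs_mul, abs_neg, abs_of_pos (by positivity : 0 < (b ^ 3)⁻¹), mul_comm]
      gcongr
    have t2 : |x j * ((b - a) * (b ^ 2 + a * b + a ^ 2) * (a ^ 3 * b ^ 3)⁻¹)|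
        ≤ 3 * ((ε ^ 3)⁻¹ * ‖x - y‖) := by
      rw [abs_mul, abs_of_nonneg (a := (b - a) * (b ^ 2 + a * b + a ^ 2) * (a ^ 3 * b ^ 3)⁻¹)
        (by have : 0 ≤ b - a := by linarith
            positivity)]
      have h3 : b ^ 2 + a * b + a ^ 2 ≤ 3 * b ^ 2 := by nlinarith
      calc |x j| * ((b - a) * (b ^ 2 + a * b + a ^ 2) * (a ^ 3 * b ^ 3)⁻¹)
          ≤ a * (‖x - y‖ * (3 * b ^ 2) * (a ^ 3 * b ^ 3)⁻¹) := by gcongr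
        _ = 3 * ((a ^ 2 * b)⁻¹ * ‖x - y‖) := by field_simp
        _ ≤ 3 * ((ε ^ 3)⁻¹ * ‖x - y‖) := by
          gcongr
          calc ε ^ 3 = ε ^ 2 * ε := by ring
            _ ≤ a ^ 2 * b := by gcongr; exact ha'.trans hab
    exact (abs_sub _ _).trans (by linarith)
  refine LipschitzWith.of_dist_le_mul fun x y => ?_
  rw [Real.coe_toNNReal _ (by positivity), Real.dist_eq, dist_eq_norm]
  rcases le_total ‖x‖ ‖y‖ with h | h
  · exact key x y h
  · rw [abs_sub_comm, norm_sub_rev]; exact key y x h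

theorem newtonReg_eq_of_lt {ε : ℝ} {x : E3} (h : ε < ‖x‖) : newtonReg ε x = newton x := by
  simp [newtonReg, newton, max_eq_left h.le]

theorem gradNewtonReg_eq_of_lt {ε : ℝ} {x : E3} (h : ε < ‖x‖) (j : Fin 3) :
    gradNewtonReg ε j x = gradNewton j x := by
  simp [gradNewtonReg, gradNewton, max_eq_left h.le]

theorem lineDeriv_newtonReg {ε : ℝ} (hε : 0 < ε) {x : E3} (hx : ‖x‖ ≠ ε) (i : Fin 3) :
    lineDeriv ℝ (newtonReg ε) x (bv i) =
      ({y : E3 | ε < ‖y‖}).indicator (gradNewton i) x := by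
  rcases lt_or_gt_of_ne hx with h | h
  · have h1 : newtonReg ε =ᶠ[𝓝 x] fun _ => (4 * Real.pi * ε)⁻¹ := by
      filter_upwards [(isOpen_lt continuous_norm continuous_const).mem_nhds h] with y hy
      simp [newtonReg, max_eq_right (le_of_lt hy)]
    rw [h1.lineDeriv_eq, indicator_of_notMem (by simpa using h.le)]
    simp [lineDeriv]
  · have h1 : newtonReg ε =ᶠ[𝓝 x] newton := by
      filter_upwards [(isOpen_lt continuous_const continuous_norm).mem_nhds h] with y hy
      exact newtonReg_eq_of_lt hy
    rw [h1.lineDeriv_eq, indicator_of_mem (by simpa using h)]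
    exact (hasLineDerivAt_newton (norm_pos_iff.1 (hε.trans h)) i).lineDeriv

/-- Inside the ball the field is linear with constant derivative -δ_ij / (4πε³). This replaces the
surface term of the usual computation and becomes the local term δ_ij/3 in the limit. -/
theorem lineDeriv_gradNewtonReg {ε : ℝ} (hε : 0 < ε) {x : E3} (hx : ‖x‖ ≠ ε) (i j : Fin 3) :
    lineDeriv ℝ (gradNewtonReg ε j) x (bv i) =
      ({y : E3 | ε < ‖y‖}).indicator (kernelK i j) x -
        (Metric.ball (0 : E3) ε).indicator
          (fun _ => (if i = j then 1 else 0) / (4 * Real.pi * ε ^ 3)) x := by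
  rcases lt_or_gt_of_ne hx with h | h
  · have h1 : gradNewtonReg ε j =ᶠ[𝓝 x] fun y => -(y j) / (4 * Real.pi * ε ^ 3) := by
      filter_upwards [(isOpen_lt continuous_norm continuous_const).mem_nhds h] with y hy
      simp [gradNewtonReg, max_eq_right (le_of_lt hy)]
    rw [h1.lineDeriv_eq, indicator_of_notMem (by simpa using h.le),
      indicator_of_mem (by simpa using h)]
    have := (hasDerivAt_coord_line x i j).neg.div_const (4 * Real.pi * ε ^ 3)
    have h2 : HasLineDerivAt ℝ (fun y : E3 => -(y j) / (4 * Real.pi * ε ^ 3))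
      (-(if i = j then 1 else 0) / (4 * Real.pi * ε ^ 3)) x (bv i) := this
    rw [h2.lineDeriv]
    ring
  · have h1 : gradNewtonReg ε j =ᶠ[𝓝 x] gradNewton j := by
      filter_upwards [(isOpen_lt continuous_const continuous_norm).mem_nhds h] with y hy
      exact gradNewtonReg_eq_of_lt hy j
    rw [h1.lineDeriv_eq, indicator_of_mem (by simpa using h),
      indicator_of_notMem (by simpa using h.le), sub_zero]
    exact (hasLineDerivAt_gradNewton (norm_pos_iff.1 (hε.trans h)) i j).lineDeriv

theorem ae_norm_ne (ε : ℝ) (hε : 0 < ε) : ∀ᵐ x : E3, ‖x‖ ≠ ε := by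
  have : volume (Metric.sphere (0 : E3) ε) = 0 := Measure.addHaar_sphere_of_ne_zero _ _ hε.ne'
  filter_upwards [measure_eq_zero_iff_ae_notMem.1 this] with x hx
  simpa using hx

theorem lipschitz_of_test {g : E3 → ℝ} (hg : ContDiff ℝ ∞ g) (hc : HasCompactSupport g) :
    ∃ C, LipschitzWith C g :=
  ContDiff.lipschitzWith_of_hasCompactSupport hc (hg.of_le (by simp : (1 : ℕ∞ω) ≤ ∞)) (by simp)

theorem lineDeriv_neg_of_test {g : E3 → ℝ} (hg : ContDiff ℝ ∞ g) (x v : E3) :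
    lineDeriv ℝ g x (-v) = - fderiv ℝ g x v := by
  rw [((hg.differentiable (by simp)) x).lineDeriv_eq_fderiv, map_neg]

theorem integrable_locallyIntegrable_mul {κ g : E3 → ℝ} (hκ : LocallyIntegrable κ)
    (hg : Continuous g) (hc : HasCompactSupport g) : Integrable (fun x => κ x * g x) := by
  simpa [mul_comm] using hκ.integrable_smul_left_of_hasCompactSupport hg hc

/-- Integration by parts holds exactly for the regularized potential at each ε > 0; dominated
convergence applies on both sides because 1/|x| and its gradient are locally integrable. -/
theorem integral_newton_mul_fderiv {g : E3 → ℝ} (hg : ContDiff ℝ ∞ g) (hc : HasCompactSupport g)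
    (i : Fin 3) :
    ∫ y, newton y * fderiv ℝ g y (bv i) = - ∫ y, gradNewton i y * g y := by
  obtain ⟨C, hC⟩ := lipschitz_of_test hg hc
  have hgc : Continuous (fun y => fderiv ℝ g y (bv i)) :=
    (hg.continuous_fderiv (by simp)).clm_apply continuous_const
  have hcc : HasCompactSupport (fun y => fderiv ℝ g y (bv i)) := hc.fderiv_apply ℝ (bv i)
  have e : ∀ ε : ℝ, 0 < ε → ∫ y, ({y : E3 | ε < ‖y‖}).indicator (gradNewton i) y * g y =
      - ∫ y, newtonReg ε y * fderiv ℝ g y (bv i) := by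
    intro ε hε
    have := LipschitzWith.integral_lineDeriv_mul_eq (μ := (volume : Measure E3))
      (lipschitzWith_newtonReg hε) hC hc (bv i)
    rw [← integral_neg]
    refine Eq.trans (integral_congr_ae ?_) (this.trans (integral_congr_ae ?_))
    · filter_upwards [ae_norm_ne ε hε] with y hy
      rw [lineDeriv_newtonReg hε hy]
    · refine Eventually.of_forall fun y => ?_
      simp only [lineDeriv_neg_of_test hg]
      ring
  have hpos : ∀ᶠ ε : ℝ in 𝓝[>] 0, 0 < ε := self_mem_nhdsWithin
  have hlt : ∀ x : E3, x ≠ 0 → ∀ᶠ ε : ℝ in 𝓝[>] 0, ε < ‖x‖ := fun x hx =>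
    nhdsWithin_le_nhds (Iio_mem_nhds (norm_pos_iff.2 hx))
  have hne : ∀ᵐ x : E3, x ≠ 0 := by simp [ae_iff]
  have l1 : Tendsto (fun ε : ℝ => ∫ y, ({y : E3 | ε < ‖y‖}).indicator (gradNewton i) y * g y)
      (𝓝[>] 0) (𝓝 (∫ y, gradNewton i y * g y)) := by
    refine tendsto_integral_filter_of_dominated_convergence (fun y => ‖gradNewton i y * g y‖) ?_ ?_
      (integrable_locallyIntegrable_mul (locallyIntegrable_gradNewton i) hg.continuous hc).norm ?_
    · refine Eventually.of_forall fun ε => ?_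
      exact (((measurable_gradNewton i).indicator
        (measurableSet_lt measurable_const measurable_norm)).mul
        hg.continuous.measurable).aestronglyMeasurable
    · refine Eventually.of_forall fun ε => Eventually.of_forall fun y => ?_
      rw [norm_mul, norm_mul]
      gcongr
      exact norm_indicator_le_norm_self _ _
    · filter_upwards [hne] with x hx
      refine tendsto_const_nhds.congr' ?_
      filter_upwards [hlt x hx] with ε h
      rw [indicator_of_mem (by simpa using h)]
  have l2 : Tendsto (fun ε : ℝ => ∫ y, newtonReg ε y * fderiv ℝ g y (bv i))
      (𝓝[>] 0) (𝓝 (∫ y, newton y * fderiv ℝ g y (bv i))) := by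
    refine tendsto_integral_filter_of_dominated_convergence
      (fun y => ‖newton y * fderiv ℝ g y (bv i)‖) ?_ ?_
      (integrable_locallyIntegrable_mul locallyIntegrable_newton hgc hcc).norm ?_
    · filter_upwards [hpos] with ε hε
      exact ((lipschitzWith_newtonReg hε).continuous.mul hgc).aestronglyMeasurable
    · filter_upwards [hpos] with ε hε
      filter_upwards [hne] with y hy
      rw [norm_mul, norm_mul]
      gcongr
      have : 0 < ‖y‖ := norm_pos_iff.2 hy
      rw [newtonReg, newton, Real.norm_of_nonneg (by positivity),
        Real.norm_of_nonneg (by positivity)]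
      gcongr
      exact le_max_left _ _
    · filter_upwards [hne] with x hx
      refine tendsto_const_nhds.congr' ?_
      filter_upwards [hlt x hx] with ε h
      rw [newtonReg_eq_of_lt h]
  have l3 := l2.neg
  have l4 := l1.congr' (by filter_upwards [hpos] with ε hε using e ε hε)
  have := tendsto_nhds_unique l4 l3
  linarith

/-- The normalization 4πε³ is three times the volume of the ball, whence g(0)/3. -/
theorem tendsto_ball_average {g : E3 → ℝ} (hg : Continuous g) :
    Tendsto (fun ε : ℝ => (4 * Real.pi * ε ^ 3)⁻¹ * ∫ y in Metric.ball (0 : E3) ε, g y)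
      (𝓝[>] 0) (𝓝 (g 0 / 3)) := by
  have hv : ∀ ε : ℝ, 0 < ε → volume.real (Metric.ball (0 : E3) ε) = 4 * Real.pi * ε ^ 3 / 3 := by
    intro ε hε
    rw [Measure.real, EuclideanSpace.volume_ball_fin_three, ENNReal.toReal_mul,
      ENNReal.toReal_pow, ENNReal.toReal_ofReal hε.le, ENNReal.toReal_ofReal (by positivity)]
    ring
  rw [Metric.tendsto_nhdsWithin_nhds]
  intro δ hδ
  obtain ⟨r, hr, hr'⟩ := Metric.continuous_iff.1 hg 0 δ hδ
  refine ⟨r, hr, fun {ε} hε hεr => ?_⟩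
  have hε : 0 < ε := hε
  rw [Real.dist_eq, sub_zero, abs_of_pos hε] at hεr
  have hi : IntegrableOn g (Metric.ball (0 : E3) ε) :=
    (hg.continuousOn.integrableOn_compact (isCompact_closedBall 0 ε)).mono_set
      Metric.ball_subset_closedBall
  have e : (4 * Real.pi * ε ^ 3)⁻¹ * (∫ y in Metric.ball (0 : E3) ε, g y) - g 0 / 3 =
      (4 * Real.pi * ε ^ 3)⁻¹ * ∫ y in Metric.ball (0 : E3) ε, (g y - g 0) := by
    rw [integral_sub hi (integrableOn_const measure_ball_lt_top.ne)]
    simp only [setIntegral_const, hv ε hε, smul_eq_mul]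
    field_simp
  rw [Real.dist_eq, e, abs_mul, abs_of_pos (by positivity)]
  have h2 : ‖∫ y in Metric.ball (0 : E3) ε, (g y - g 0)‖ ≤
      δ * volume.real (Metric.ball (0 : E3) ε) := by
    refine norm_setIntegral_le_of_norm_le_const measure_ball_lt_top fun y hy => ?_
    exact (hr' y ((Metric.mem_ball.1 hy).trans hεr)).le
  rw [hv ε hε, Real.norm_eq_abs] at h2
  calc _ ≤ (4 * Real.pi * ε ^ 3)⁻¹ * (δ * (4 * Real.pi * ε ^ 3 / 3)) := by gcongr
    _ = δ / 3 := by field_simp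
    _ < δ := by linarith

theorem norm_kernelK_le (i j : Fin 3) (x : E3) : |kernelK i j x| ≤ ‖x‖⁻¹ ^ 3 := by
  by_cases hx : x = 0
  · subst hx; simp [kernelK]
  have hn : 0 < ‖x‖ := norm_pos_iff.2 hx
  have h1 : |x i| ≤ ‖x‖ := by simpa using PiLp.norm_apply_le x i
  have h2 : |x j| ≤ ‖x‖ := by simpa using PiLp.norm_apply_le x j
  have hnum : |-(if i = j then 1 else 0) * ‖x‖ ^ 2 + 3 * x i * x j| ≤ 4 * ‖x‖ ^ 2 := by
    refine (abs_add_le _ _).trans ?_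
    have a1 : |-(if i = j then (1 : ℝ) else 0) * ‖x‖ ^ 2| ≤ ‖x‖ ^ 2 := by
      split_ifs <;> simp
    have a2 : |3 * x i * x j| ≤ 3 * ‖x‖ ^ 2 := by
      rw [abs_mul, abs_mul, abs_of_pos (by norm_num : (0 : ℝ) < 3)]
      calc 3 * |x i| * |x j| ≤ 3 * ‖x‖ * ‖x‖ := by gcongr
        _ = _ := by ring
    linarith
  rw [kernelK, abs_div, abs_of_pos (by positivity : 0 < 4 * Real.pi * ‖x‖ ^ 5),
    div_le_iff₀ (by positivity)]
  calc _ ≤ 4 * ‖x‖ ^ 2 := hnum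
    _ ≤ 4 * Real.pi * ‖x‖ ^ 2 := by nlinarith [Real.pi_gt_three, sq_nonneg ‖x‖]
    _ = _ := by field_simp

theorem integrableOn_kernelK_mul {g : E3 → ℝ} (hg : Continuous g) (hc : HasCompactSupport g)
    (i j : Fin 3) {ε : ℝ} (hε : 0 < ε) :
    IntegrableOn (fun y => kernelK i j y * g y) {y : E3 | ε < ‖y‖} := by
  refine Integrable.mono' (g := fun y => ε⁻¹ ^ 3 * |g y|)
    ((hg.abs.integrable_of_hasCompactSupport hc.abs).const_mul _).integrableOn
    ((measurable_kernelK i j).mul hg.measurable).aestronglyMeasurable ?_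
  refine (ae_restrict_iff' (measurableSet_lt measurable_const measurable_norm)).2
    (Eventually.of_forall fun y hy => ?_)
  have hy : ε < ‖y‖ := hy
  rw [norm_mul, Real.norm_eq_abs, Real.norm_eq_abs]
  gcongr
  refine (norm_kernelK_le i j y).trans ?_
  gcongr

/-- This proves that the principal value exists. Integrating by parts against the regularized
gradient leaves the ball average, with limit δ_ij g(0)/3, and an absolutely convergent integral. The
first term cancels the -δ_ij/3 in the definition of `rieszRR`. -/
theorem tendsto_kernelK_truncated {g : E3 → ℝ} (hg : ContDiff ℝ ∞ g) (hc : HasCompactSupport g)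
    (i j : Fin 3) :
    Tendsto (fun ε : ℝ => ∫ y in {y : E3 | ε < ‖y‖}, kernelK i j y * g y) (𝓝[>] 0)
      (𝓝 ((if i = j then 1 else 0) * g 0 / 3 - ∫ y, gradNewton j y * fderiv ℝ g y (bv i))) := by
  obtain ⟨C, hC⟩ := lipschitz_of_test hg hc
  have hgc : Continuous (fun y => fderiv ℝ g y (bv i)) :=
    (hg.continuous_fderiv (by simp)).clm_apply continuous_const
  have hcc : HasCompactSupport (fun y => fderiv ℝ g y (bv i)) := hc.fderiv_apply ℝ (bv i)
  have hpos : ∀ᶠ ε : ℝ in 𝓝[>] 0, 0 < ε := self_mem_nhdsWithin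
  have hne : ∀ᵐ x : E3, x ≠ 0 := by simp [ae_iff]
  have e : ∀ ε : ℝ, 0 < ε → ∫ y in {y : E3 | ε < ‖y‖}, kernelK i j y * g y =
      (if i = j then 1 else 0) * ((4 * Real.pi * ε ^ 3)⁻¹ * ∫ y in Metric.ball (0 : E3) ε, g y)
      - ∫ y, gradNewtonReg ε j y * fderiv ℝ g y (bv i) := by
    intro ε hε
    have h1 := LipschitzWith.integral_lineDeriv_mul_eq (μ := (volume : Measure E3))
      (lipschitzWith_gradNewtonReg hε j) hC hc (bv i)
    have hm : MeasurableSet {y : E3 | ε < ‖y‖} := measurableSet_lt measurable_const measurable_norm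
    have h2 : ∫ y, lineDeriv ℝ (gradNewtonReg ε j) y (bv i) * g y =
        ∫ y, (({y : E3 | ε < ‖y‖}).indicator (fun y => kernelK i j y * g y) y -
        (Metric.ball (0 : E3) ε).indicator
          (fun y => (if i = j then 1 else 0) / (4 * Real.pi * ε ^ 3) * g y) y) := by
      refine integral_congr_ae ?_
      filter_upwards [ae_norm_ne ε hε] with y hy
      rw [lineDeriv_gradNewtonReg hε hy, sub_mul, ← indicator_mul_left, ← indicator_mul_left]
    rw [integral_sub ((integrable_indicator_iff hm).2 (integrableOn_kernelK_mul hg.continuous hc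
        i j hε)) ((integrable_indicator_iff Metric.isOpen_ball.measurableSet).2
        ((hg.continuous.integrable_of_hasCompactSupport hc).const_mul _).integrableOn),
      integral_indicator hm, integral_indicator Metric.isOpen_ball.measurableSet,
      integral_const_mul, h1] at h2
    simp only [lineDeriv_neg_of_test hg, neg_mul, integral_neg] at h2
    have h3 : ∫ y, gradNewtonReg ε j y * fderiv ℝ g y (bv i) =
        ∫ y, fderiv ℝ g y (bv i) * gradNewtonReg ε j y := by simp only [mul_comm]
    rw [h3]
    linear_combination -h2
  have l2 : Tendsto (fun ε : ℝ => ∫ y, gradNewtonReg ε j y * fderiv ℝ g y (bv i))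
      (𝓝[>] 0) (𝓝 (∫ y, gradNewton j y * fderiv ℝ g y (bv i))) := by
    refine tendsto_integral_filter_of_dominated_convergence
      (fun y => ‖gradNewton j y * fderiv ℝ g y (bv i)‖) ?_ ?_
      (integrable_locallyIntegrable_mul (locallyIntegrable_gradNewton j) hgc hcc).norm ?_
    · filter_upwards [hpos] with ε hε
      exact ((lipschitzWith_gradNewtonReg hε j).continuous.mul hgc).aestronglyMeasurable
    · filter_upwards [hpos] with ε hε
      filter_upwards [hne] with y hy
      rw [norm_mul, norm_mul]
      gcongr
      have : 0 < ‖y‖ := norm_pos_iff.2 hy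
      have hm : 0 < max ‖y‖ ε := lt_max_of_lt_left this
      rw [gradNewtonReg, gradNewton, norm_div, norm_div, Real.norm_of_nonneg
        (by positivity : 0 ≤ 4 * Real.pi * max ‖y‖ ε ^ 3),
        Real.norm_of_nonneg (by positivity : 0 ≤ 4 * Real.pi * ‖y‖ ^ 3)]
      gcongr
      exact le_max_left _ _
    · filter_upwards [hne] with x hx
      refine tendsto_const_nhds.congr' ?_
      filter_upwards [nhdsWithin_le_nhds (Iio_mem_nhds (norm_pos_iff.2 hx))] with ε h
      rw [gradNewtonReg_eq_of_lt h]
  have l3 := ((tendsto_ball_average hg.continuous).const_mul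
    (if i = j then (1 : ℝ) else 0)).sub l2
  rw [mul_div_assoc]
  refine l3.congr' ?_
  filter_upwards [hpos] with ε hε using (e ε hε).symm

/-! ### Riesz transforms of test functions on ℝ³. -/

theorem contDiff_sub_left {f : E3 → ℝ} (hf : ContDiff ℝ ∞ f) (x : E3) :
    ContDiff ℝ ∞ (fun y => f (x - y)) := hf.comp (contDiff_const.sub contDiff_id)

theorem hasCompactSupport_sub_left {f : E3 → ℝ} (hf : HasCompactSupport f) (x : E3) :
    HasCompactSupport (fun y => f (x - y)) :=
  hf.comp_homeomorph (Homeomorph.subLeft x)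

theorem fderiv_sub_left {f : E3 → ℝ} (hf : ContDiff ℝ ∞ f) (x y v : E3) :
    fderiv ℝ (fun y => f (x - y)) y v = - fderiv ℝ f (x - y) v := by
  have h := ((hf.differentiable (by simp)) (x - y)).hasFDerivAt.comp y
    ((hasFDerivAt_id y).const_sub x)
  have h2 : fderiv ℝ (fun y => f (x - y)) y = _ := h.fderiv
  rw [h2]
  simp

/-- The truncated singular integral converges, and the Riesz transform is the convolution of the
gradient of the Newtonian potential with the gradient of the function. -/
theorem rieszRR_eq_gradNewton {f : E3 → ℝ} (hf : ContDiff ℝ ∞ f) (hc : HasCompactSupport f)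
    (i j : Fin 3) (x : E3) :
    rieszRR i j f x = ∫ y, gradNewton j y * fderiv ℝ f (x - y) (bv i) := by
  have h1 := tendsto_kernelK_truncated (contDiff_sub_left hf x) (hasCompactSupport_sub_left hc x) i j
  have h2 : ∀ ε : ℝ, ∫ y in {y : E3 | ε < ‖x - y‖}, kernelK i j (x - y) * f y =
      ∫ y in {y : E3 | ε < ‖y‖}, kernelK i j y * f (x - y) := by
    intro ε
    rw [← integral_indicator (measurableSet_lt measurable_const (by fun_prop)),
      ← integral_indicator (measurableSet_lt measurable_const (by fun_prop)),
      ← integral_sub_left_eq_self _ volume x]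
    congr 1
    funext y
    simp [indicator]
  simp only [rieszRR, h2]
  rw [h1.limUnder_eq]
  simp only [fderiv_sub_left hf, sub_zero, mul_neg, integral_neg]
  ring

theorem rieszRR_eq_newton {f : E3 → ℝ} (hf : ContDiff ℝ ∞ f) (hc : HasCompactSupport f)
    (i j : Fin 3) (x : E3) :
    rieszRR i j f x = ∫ y, newton y *
      fderiv ℝ (fun z => fderiv ℝ f z (bv i)) (x - y) (bv j) := by
  have h1 : ContDiff ℝ ∞ (fun z => fderiv ℝ f z (bv i)) :=
    (hf.fderiv_right (by simp)).clm_apply contDiff_const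
  have h2 : HasCompactSupport (fun z => fderiv ℝ f z (bv i)) := hc.fderiv_apply ℝ (bv i)
  have h3 := integral_newton_mul_fderiv (contDiff_sub_left h1 x) (hasCompactSupport_sub_left h2 x) j
  rw [rieszRR_eq_gradNewton hf hc]
  simp only [fderiv_sub_left h1, mul_neg, integral_neg] at h3
  linarith

theorem kernelK_trace (x : E3) : ∑ i : Fin 3, kernelK i i x = 0 := by
  have h : ‖x‖ ^ 2 = x 0 ^ 2 + x 1 ^ 2 + x 2 ^ 2 := by
    rw [EuclideanSpace.norm_sq_eq, Fin.sum_univ_three]; simp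
  simp only [kernelK, if_true, ← Finset.sum_div, Fin.sum_univ_three, h]
  ring

theorem kernelK_symm (i j : Fin 3) (x : E3) : kernelK i j x = kernelK j i x := by
  simp only [kernelK, eq_comm (a := i)]
  ring

theorem kernelK_neg (i j : Fin 3) (x : E3) : kernelK i j (-x) = kernelK i j x := by
  simp [kernelK]

theorem rieszRR_symm (i j : Fin 3) (f : E3 → ℝ) (x : E3) : rieszRR i j f x = rieszRR j i f x := by
  simp only [rieszRR, kernelK_symm i j, eq_comm (a := i)]

/-- The kernel is trace free because 1/|x| is harmonic away from the origin, so the truncated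
integrals sum to zero for every ε. Only the three local terms -f/3 remain. -/
theorem rieszRR_trace {f : E3 → ℝ} (hf : ContDiff ℝ ∞ f) (hc : HasCompactSupport f) (x : E3) :
    ∑ i : Fin 3, rieszRR i i f x = - f x := by
  have h1 : ∀ i, Tendsto (fun ε : ℝ => ∫ y in {y : E3 | ε < ‖y‖}, kernelK i i y * f (x - y))
      (𝓝[>] 0) (𝓝 (f x / 3 + rieszRR i i f x)) := by
    intro i
    convert tendsto_kernelK_truncated (contDiff_sub_left hf x)
      (hasCompactSupport_sub_left hc x) i i using 2
    rw [rieszRR_eq_gradNewton hf hc]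
    simp only [fderiv_sub_left hf, sub_zero, mul_neg, integral_neg, if_true]
    ring
  have h2 := tendsto_finsetSum Finset.univ fun i _ => h1 i
  have h3 : Tendsto (fun ε : ℝ => ∑ i : Fin 3, ∫ y in {y : E3 | ε < ‖y‖}, kernelK i i y * f (x - y))
      (𝓝[>] 0) (𝓝 0) := by
    refine tendsto_const_nhds.congr' ?_
    filter_upwards [self_mem_nhdsWithin] with ε hε
    rw [← integral_finsetSum]
    · simp only [← Finset.sum_mul, kernelK_trace]
      simp
    · intro i _
      exact integrableOn_kernelK_mul (contDiff_sub_left hf x).continuous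
        (hasCompactSupport_sub_left hc x) i i hε
  have h4 := tendsto_nhds_unique h2 h3
  rw [Finset.sum_add_distrib] at h4
  simp at h4
  linarith

/-! ### Calculus of space-time test functions and slicewise convolutions. -/

/-- The derivative of a function on space-time in a fixed direction. -/
noncomputable def D (v : E3 × ℝ) (f : E3 × ℝ → ℝ) (z : E3 × ℝ) : ℝ := fderiv ℝ f z v

/-- Smooth functions with compact support on space-time. -/
structure IsTest (f : E3 × ℝ → ℝ) : Prop where
  contDiff : ContDiff ℝ ∞ f
  compact : HasCompactSupport f

/-- Partial convolution in space of a kernel on `ℝ³` with a function on space-time. -/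
noncomputable def cv (κ : E3 → ℝ) (f : E3 × ℝ → ℝ) (z : E3 × ℝ) : ℝ :=
  ∫ y, κ y * f (z.1 - y, z.2)

/-- The Riesz transform `R_i R_j` acting on the spatial slices of a function on space-time. -/
noncomputable def RR (i j : Fin 3) (f : E3 × ℝ → ℝ) (z : E3 × ℝ) : ℝ :=
  rieszRR i j (fun y => f (y, z.2)) z.1

/-- The spatial Laplacian. -/
noncomputable def lap (f : E3 × ℝ → ℝ) (z : E3 × ℝ) : ℝ := ∑ l : Fin 3, D (ex l) (D (ex l) f) z

theorem contDiff_D {f : E3 × ℝ → ℝ} (hf : ContDiff ℝ ∞ f) (v : E3 × ℝ) : ContDiff ℝ ∞ (D v f) :=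
  (hf.fderiv_right (by simp)).clm_apply contDiff_const

theorem D_D_eq {f : E3 × ℝ → ℝ} (hf : ContDiff ℝ ∞ f) (a b : E3 × ℝ) (z : E3 × ℝ) :
    D a (D b f) z = fderiv ℝ (fderiv ℝ f) z a b := by
  have h2 : DifferentiableAt ℝ (fderiv ℝ f) z :=
    ((hf.fderiv_right (m := ∞) (by simp)).differentiable (by simp)) z
  have := (h2.hasFDerivAt.clm_apply (hasFDerivAt_const b z)).fderiv
  change fderiv ℝ (fun y => fderiv ℝ f y b) z a = _
  rw [this]
  simp

theorem D_comm {f : E3 × ℝ → ℝ} (hf : ContDiff ℝ ∞ f) (v v' : E3 × ℝ) :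
    D v (D v' f) = D v' (D v f) := by
  funext z
  rw [D_D_eq hf, D_D_eq hf]
  exact (hf.contDiffAt.isSymmSndFDerivAt (by
    simpa using WithTop.coe_le_coe.2 (le_top (a := (2 : ℕ∞))))).eq v v'

namespace IsTest

variable {f g : E3 × ℝ → ℝ}

theorem D (hf : IsTest f) (v : E3 × ℝ) : IsTest (D v f) :=
  ⟨contDiff_D hf.contDiff v, hf.compact.fderiv_apply ℝ v⟩

theorem continuous (hf : IsTest f) : Continuous f := hf.contDiff.continuous

theorem differentiable (hf : IsTest f) : Differentiable ℝ f := hf.contDiff.differentiable (by simp)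

theorem add (hf : IsTest f) (hg : IsTest g) : IsTest (fun z => f z + g z) :=
  ⟨hf.contDiff.add hg.contDiff, hf.compact.add hg.compact⟩

theorem sub (hf : IsTest f) (hg : IsTest g) : IsTest (fun z => f z - g z) :=
  ⟨hf.contDiff.sub hg.contDiff, hf.compact.sub hg.compact⟩

theorem const_mul (hf : IsTest f) (c : ℝ) : IsTest (fun z => c * f z) :=
  ⟨contDiff_const.mul hf.contDiff, hf.compact.mul_left⟩

theorem lap (hf : IsTest f) : IsTest (lap f) := by
  have : NSStructure.lap f = fun z => NSStructure.D (ex 0) (NSStructure.D (ex 0) f) z +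
      NSStructure.D (ex 1) (NSStructure.D (ex 1) f) z +
      NSStructure.D (ex 2) (NSStructure.D (ex 2) f) z := by
    funext z; simp [NSStructure.lap, Fin.sum_univ_three]
  rw [this]
  exact (((hf.D _).D _).add ((hf.D _).D _)).add ((hf.D _).D _)

theorem exists_support_bound (hf : IsTest f) :
    ∃ M : ℝ, 1 ≤ M ∧ ∀ z, f z ≠ 0 → ‖z.1‖ ≤ M ∧ |z.2| ≤ M := by
  obtain ⟨M, hM⟩ := hf.compact.isCompact.isBounded.exists_norm_le
  refine ⟨max M 1, le_max_right _ _, fun z hz => ?_⟩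
  have h1 := (hM z (subset_tsupport _ hz)).trans (le_max_left M 1)
  exact ⟨(norm_fst_le z).trans h1, (norm_snd_le z).trans h1⟩

theorem exists_bound (hf : IsTest f) : ∃ C : ℝ, 0 < C ∧ ∀ z, |f z| ≤ C := by
  obtain ⟨C, hC⟩ := hf.continuous.bounded_above_of_compact_support hf.compact
  exact ⟨max C 1, by positivity, fun z => (hC z).trans (le_max_left _ _)⟩

theorem slice_contDiff (hf : IsTest f) (t : ℝ) : ContDiff ℝ ∞ (fun x => f (x, t)) :=
  hf.contDiff.comp (contDiff_id.prodMk contDiff_const)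

theorem slice_compact (hf : IsTest f) (t : ℝ) : HasCompactSupport (fun x => f (x, t)) := by
  obtain ⟨M, -, hM⟩ := hf.exists_support_bound
  refine HasCompactSupport.intro (isCompact_closedBall (0 : E3) M) fun x hx => ?_
  by_contra h
  exact hx (by simpa using (hM _ h).1)

theorem slice_fderiv (hf : IsTest f) (t : ℝ) (x : E3) (i : Fin 3) :
    fderiv ℝ (fun x => f (x, t)) x (bv i) = NSStructure.D (ex i) f (x, t) := by
  have h0 : HasFDerivAt (fun x : E3 => (x, t))
      ((ContinuousLinearMap.id ℝ E3).prod 0) x := (hasFDerivAt_id x).prodMk (hasFDerivAt_const t x)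
  have h := (hf.differentiable (x, t)).hasFDerivAt.comp x h0
  have h2 : fderiv ℝ (fun x => f (x, t)) x = _ := h.fderiv
  rw [h2]
  simp [NSStructure.D, ex, bv]

end IsTest

/-- With both derivatives on f, smoothness of the Riesz transform and its commutation with
derivatives reduce to convolution with a locally integrable kernel. -/
theorem RR_eq_cv {f : E3 × ℝ → ℝ} (hf : IsTest f) (i j : Fin 3) :
    RR i j f = cv newton (D (ex j) (D (ex i) f)) := by
  funext z
  rw [RR, rieszRR_eq_newton (hf.slice_contDiff z.2) (hf.slice_compact z.2), cv]
  congr 1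
  funext y
  simp only [hf.slice_fderiv, (hf.D (ex i)).slice_fderiv]

theorem cv_eq_convolution (κ : E3 → ℝ) (f : E3 × ℝ → ℝ) (z : E3 × ℝ) :
    cv κ f z = convolution κ (fun x => f (x, z.2)) (ContinuousLinearMap.lsmul ℝ ℝ) volume z.1 := by
  simp [cv, convolution]

theorem contDiff_cv {κ : E3 → ℝ} (hκ : LocallyIntegrable κ) {f : E3 × ℝ → ℝ} (hf : IsTest f) :
    ContDiff ℝ ∞ (cv κ f) := by
  obtain ⟨M, -, hM⟩ := hf.exists_support_bound
  have h := contDiffOn_convolution_right_with_param (n := ⊤) (μ := (volume : Measure E3))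
    (ContinuousLinearMap.lsmul ℝ ℝ)
    (g := fun (t : ℝ) (x : E3) => f (x, t)) (s := univ) (k := Metric.closedBall (0 : E3) M)
    isOpen_univ (isCompact_closedBall _ _) (fun p x _ hx => by
      by_contra h
      exact hx (by simpa using (hM _ h).1)) hκ
    (by
      have : ContDiff ℝ ∞ (fun q : ℝ × E3 => f (q.2, q.1)) :=
        hf.contDiff.comp (contDiff_snd.prodMk contDiff_fst)
      exact this.contDiffOn)
  rw [univ_prod_univ, contDiffOn_univ] at h
  have e : cv κ f = (fun q : ℝ × E3 => convolution κ (fun x => f (x, q.1))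
      (ContinuousLinearMap.lsmul ℝ ℝ) volume q.2) ∘ (fun z : E3 × ℝ => (z.2, z.1)) := by
    funext z
    rw [cv_eq_convolution]; rfl
  rw [e]
  exact h.comp (contDiff_snd.prodMk contDiff_fst)

theorem integrable_cv {κ : E3 → ℝ} (hκ : LocallyIntegrable κ) {f : E3 × ℝ → ℝ} (hf : IsTest f)
    (z : E3 × ℝ) : Integrable (fun y => κ y * f (z.1 - y, z.2)) :=
  integrable_locallyIntegrable_mul hκ
    (contDiff_sub_left (hf.slice_contDiff z.2) z.1).continuous
    (hasCompactSupport_sub_left (hf.slice_compact z.2) z.1)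

theorem D_cv {κ : E3 → ℝ} (hκ : LocallyIntegrable κ) {f : E3 × ℝ → ℝ} (hf : IsTest f)
    (v : E3 × ℝ) : D v (cv κ f) = cv κ (D v f) := by
  funext z
  have hdiff : DifferentiableAt ℝ (cv κ f) z := ((contDiff_cv hκ hf).differentiable (by simp)) z
  change fderiv ℝ (cv κ f) z v = _
  rw [← hdiff.lineDeriv_eq_fderiv]
  obtain ⟨M, hM1, hM⟩ := (hf.D v).exists_support_bound
  obtain ⟨C, hC0, hC⟩ := (hf.D v).exists_bound
  -- For |s| < 1 the integrand on the line z + s v vanishes for y outside this ball, so ‖κ‖ times a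
  -- constant on the ball is an integrable bound.
  set B : Set E3 := Metric.closedBall 0 (‖z.1‖ + ‖v.1‖ + M) with hB
  have hmeas : ∀ x : ℝ, AEStronglyMeasurable
      (fun y => κ y * f (z.1 + x • v.1 - y, z.2 + x * v.2)) volume := fun x =>
    (integrable_cv hκ hf (z.1 + x • v.1, z.2 + x * v.2)).aestronglyMeasurable
  have h := hasDerivAt_integral_of_dominated_loc_of_deriv_le (μ := (volume : Measure E3))
    (F := fun (s : ℝ) y => κ y * f (z.1 + s • v.1 - y, z.2 + s * v.2))
    (F' := fun (s : ℝ) y => κ y * D v f (z.1 + s • v.1 - y, z.2 + s * v.2))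
    (bound := fun y => B.indicator (fun y => ‖κ y‖ * C) y) (x₀ := 0)
    (s := Metric.ball 0 1) (Metric.ball_mem_nhds _ one_pos)
    (Eventually.of_forall hmeas)
    (by simpa using integrable_cv hκ hf z)
    (by simpa using (integrable_cv hκ (hf.D v) z).aestronglyMeasurable)
    (by
      refine Eventually.of_forall fun y s hs => ?_
      have hs : |s| < 1 := by simpa using hs
      by_cases hy : y ∈ B
      · rw [indicator_of_mem hy, norm_mul]
        gcongr
        exact hC _
      · have : D v f (z.1 + s • v.1 - y, z.2 + s * v.2) = 0 := by
          by_contra h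
          refine hy ?_
          have h1 := (hM _ h).1
          have h2 : y = z.1 + s • v.1 - (z.1 + s • v.1 - y) := by abel
          rw [hB, mem_closedBall_zero_iff, h2]
          refine (norm_sub_le _ _).trans (add_le_add ((norm_add_le _ _).trans ?_) h1)
          rw [norm_smul, Real.norm_eq_abs]
          gcongr
          nlinarith [norm_nonneg v.1]
        rw [this, indicator_of_notMem hy]; simp)
    ((integrable_indicator_iff Metric.isClosed_closedBall.measurableSet).2
      (((hκ.integrableOn_isCompact (isCompact_closedBall _ _)).norm).mul_const C))
    (by
      refine Eventually.of_forall fun y s _ => ?_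
      have hl : HasDerivAt (fun s : ℝ => (z.1 + s • v.1 - y, z.2 + s * v.2)) v s := by
        have h1 : HasDerivAt (fun s : ℝ => z.1 + s • v.1 - y) v.1 s := by
          simpa using (((hasDerivAt_id s).smul_const v.1).const_add z.1).sub_const y
        have h2 : HasDerivAt (fun s : ℝ => z.2 + s * v.2) v.2 s := by
          simpa using ((hasDerivAt_id s).mul_const v.2).const_add z.2
        exact h1.prodMk h2
      exact ((hf.differentiable _).hasFDerivAt.comp_hasDerivAt s hl).const_mul (κ y))
  have h3 : HasLineDerivAt ℝ (cv κ f) (cv κ (D v f) z) z v := by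
    have := h.2
    simp only [zero_smul, add_zero, zero_mul] at this
    exact this
  exact h3.lineDeriv

theorem isTest_cv {κ : E3 → ℝ} (hκ : LocallyIntegrable κ) (hc : HasCompactSupport κ)
    {f : E3 × ℝ → ℝ} (hf : IsTest f) : IsTest (cv κ f) := by
  refine ⟨contDiff_cv hκ hf, ?_⟩
  obtain ⟨M, -, hM⟩ := hf.exists_support_bound
  obtain ⟨M', hM'⟩ := hc.isCompact.isBounded.exists_norm_le
  refine HasCompactSupport.intro
    ((isCompact_closedBall (0 : E3) (M + M')).prod (isCompact_Icc (a := -M) (b := M))) fun z hz => ?_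
  rw [cv]
  refine integral_eq_zero_of_ae (Eventually.of_forall fun y => ?_)
  by_contra h
  have h1 : κ y ≠ 0 := left_ne_zero_of_mul h
  have h2 : f (z.1 - y, z.2) ≠ 0 := right_ne_zero_of_mul h
  refine hz ⟨?_, abs_le.1 (hM _ h2).2⟩
  rw [mem_closedBall_zero_iff]
  calc ‖z.1‖ = ‖(z.1 - y) + y‖ := by simp
    _ ≤ _ := norm_add_le _ _
    _ ≤ M + M' := add_le_add (hM _ h2).1 (hM' y (subset_tsupport _ h1))

theorem cv_lap {κ : E3 → ℝ} (hκ : LocallyIntegrable κ) {f : E3 × ℝ → ℝ} (hf : IsTest f)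
    (z : E3 × ℝ) : cv κ (lap f) z = ∑ l : Fin 3, cv κ (D (ex l) (D (ex l) f)) z := by
  simp only [cv, lap, Finset.mul_sum]
  exact integral_finsetSum _ fun l _ => integrable_cv hκ ((hf.D _).D _) z

theorem lap_cv {κ : E3 → ℝ} (hκ : LocallyIntegrable κ) {f : E3 × ℝ → ℝ} (hf : IsTest f) :
    lap (cv κ f) = cv κ (lap f) := by
  funext z
  rw [cv_lap hκ hf, lap]
  simp only [D_cv hκ hf, D_cv hκ (hf.D _)]

theorem cv_add_kernel {κ κ' : E3 → ℝ} (hκ : LocallyIntegrable κ) (hκ' : LocallyIntegrable κ')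
    {f : E3 × ℝ → ℝ} (hf : IsTest f) (z : E3 × ℝ) :
    cv (fun y => κ y + κ' y) f z = cv κ f z + cv κ' f z := by
  simp only [cv, add_mul]
  exact integral_add (integrable_cv hκ hf z) (integrable_cv hκ' hf z)

theorem cv_D_eq {κ : E3 → ℝ} (hκ : ContDiff ℝ ∞ κ) {f : E3 × ℝ → ℝ} (hf : IsTest f) (i : Fin 3)
    (z : E3 × ℝ) : cv κ (D (ex i) f) z = cv (fun y => fderiv ℝ κ y (bv i)) f z := by
  have hs := contDiff_sub_left (hf.slice_contDiff z.2) z.1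
  have hsc := hasCompactSupport_sub_left (hf.slice_compact z.2) z.1
  have hκ' : Continuous fun y => fderiv ℝ κ y (bv i) :=
    (hκ.continuous_fderiv (by simp)).clm_apply continuous_const
  have e : ∀ y, fderiv ℝ (fun y => f (z.1 - y, z.2)) y (bv i) = - D (ex i) f (z.1 - y, z.2) := by
    intro y
    rw [fderiv_sub_left (f := fun x => f (x, z.2)) (hf.slice_contDiff z.2), hf.slice_fderiv]
  have h := integral_mul_fderiv_eq_neg_fderiv_mul_of_integrable (μ := (volume : Measure E3))
    (f := κ) (g := fun y => f (z.1 - y, z.2)) (v := bv i)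
    (integrable_locallyIntegrable_mul hκ'.locallyIntegrable hs.continuous hsc)
    (by
      simp only [e, mul_neg]
      exact (integrable_cv hκ.continuous.locallyIntegrable (hf.D (ex i)) z).neg)
    (integrable_locallyIntegrable_mul hκ.continuous.locallyIntegrable hs.continuous hsc)
    (fun x _ => (hκ.differentiable (by simp)) x)
    (fun x _ => (hs.differentiable (by simp)) x)
  simp only [e, mul_neg, integral_neg, neg_inj] at h
  exact h

theorem contDiff_RR {f : E3 × ℝ → ℝ} (hf : IsTest f) (i j : Fin 3) : ContDiff ℝ ∞ (RR i j f) := by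
  rw [RR_eq_cv hf]
  exact contDiff_cv locallyIntegrable_newton ((hf.D _).D _)

theorem D_RR {f : E3 × ℝ → ℝ} (hf : IsTest f) (i j : Fin 3) (v : E3 × ℝ) :
    D v (RR i j f) = RR i j (D v f) := by
  rw [RR_eq_cv hf, RR_eq_cv (hf.D v), D_cv locallyIntegrable_newton ((hf.D _).D _),
    D_comm (hf.D _).contDiff, D_comm hf.contDiff]

theorem RR_add {f g : E3 × ℝ → ℝ} (hf : IsTest f) (hg : IsTest g) (i j : Fin 3) (z : E3 × ℝ) :
    RR i j (fun z => f z + g z) z = RR i j f z + RR i j g z := by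
  simp only [RR]
  rw [rieszRR_eq_gradNewton (hf.slice_contDiff z.2) (hf.slice_compact z.2),
    rieszRR_eq_gradNewton (hg.slice_contDiff z.2) (hg.slice_compact z.2),
    rieszRR_eq_gradNewton ((hf.add hg).slice_contDiff z.2) ((hf.add hg).slice_compact z.2)]
  simp only [hf.slice_fderiv, hg.slice_fderiv, (hf.add hg).slice_fderiv]
  rw [← integral_add (integrable_cv (locallyIntegrable_gradNewton j) (hf.D _) z)
    (integrable_cv (locallyIntegrable_gradNewton j) (hg.D _) z)]
  congr 1
  funext y
  rw [← mul_add, D, D, D, fderiv_fun_add (hf.differentiable _) (hg.differentiable _)]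
  simp

theorem RR_const_mul {f : E3 × ℝ → ℝ} (c : ℝ) (hf : IsTest f) (i j : Fin 3) (z : E3 × ℝ) :
    RR i j (fun z => c * f z) z = c * RR i j f z := by
  simp only [RR]
  rw [rieszRR_eq_gradNewton (hf.slice_contDiff z.2) (hf.slice_compact z.2),
    rieszRR_eq_gradNewton ((hf.const_mul c).slice_contDiff z.2) ((hf.const_mul c).slice_compact z.2)]
  simp only [hf.slice_fderiv, (hf.const_mul c).slice_fderiv]
  rw [← integral_const_mul]
  congr 1
  funext y
  rw [D, fderiv_const_mul (hf.differentiable _)]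
  simp [D]
  ring

theorem RR_sub {f g : E3 × ℝ → ℝ} (hf : IsTest f) (hg : IsTest g) (i j : Fin 3) (z : E3 × ℝ) :
    RR i j (fun z => f z - g z) z = RR i j f z - RR i j g z := by
  have h := RR_add hf (hg.const_mul (-1)) i j z
  rw [RR_const_mul _ hg] at h
  simpa [sub_eq_add_neg] using h

/-- `R_i R_j Δ = -∂_i ∂_j`. -/
theorem RR_lap {f : E3 × ℝ → ℝ} (hf : IsTest f) (i j : Fin 3) (z : E3 × ℝ) :
    RR i j (lap f) z = - D (ex i) (D (ex j) f) z := by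
  have hD := (hf.D (ex j)).D (ex i)
  -- As all derivatives commute, R_i R_j Δf = ∑_l R_l R_l ∂_i ∂_j f, and the trace identity applies
  -- to ∂_i ∂_j f.
  have h := rieszRR_trace (hD.slice_contDiff z.2) (hD.slice_compact z.2) z.1
  rw [show D (ex i) (D (ex j) f) z = D (ex i) (D (ex j) f) (z.1, z.2) from rfl, ← h,
    RR_eq_cv hf.lap]
  have e : D (ex j) (D (ex i) (lap f)) = lap (D (ex i) (D (ex j) f)) := by
    have e1 : ∀ (g : E3 × ℝ → ℝ), IsTest g → ∀ v, D v (lap g) = lap (D v g) := by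
      intro g hg v
      funext w
      have : fderiv ℝ (lap g) w = ∑ l : Fin 3, fderiv ℝ (D (ex l) (D (ex l) g)) w := by
        have : lap g = fun z => ∑ l : Fin 3, D (ex l) (D (ex l) g) z := rfl
        rw [this, fderiv_fun_sum fun l _ => ((hg.D _).D _).differentiable _]
      simp only [D, lap, this, sum_apply]
      refine Finset.sum_congr rfl fun l _ => ?_
      change D v (D (ex l) (D (ex l) g)) w = D (ex l) (D (ex l) (D v g)) w
      rw [D_comm (hg.D _).contDiff, D_comm hg.contDiff]
    rw [e1 f hf, e1 _ (hf.D _), D_comm hf.contDiff]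
  rw [e, cv_lap locallyIntegrable_newton hD]
  refine Finset.sum_congr rfl fun l _ => ?_
  rw [← RR_eq_cv hD]
  rfl

theorem RR_symm (i j : Fin 3) (f : E3 × ℝ → ℝ) (z : E3 × ℝ) : RR i j f z = RR j i f z :=
  rieszRR_symm i j _ _

theorem rieszRR_translate (i j : Fin 3) (f : E3 → ℝ) (a x : E3) :
    rieszRR i j (fun y => f (y + a)) x = rieszRR i j f (x + a) := by
  have h : ∀ ε : ℝ, ∫ y in {y : E3 | ε < ‖x - y‖}, kernelK i j (x - y) * f (y + a) =
      ∫ y in {y : E3 | ε < ‖x + a - y‖}, kernelK i j (x + a - y) * f y := by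
    intro ε
    rw [← integral_indicator (measurableSet_lt measurable_const (by fun_prop)),
      ← integral_indicator (measurableSet_lt measurable_const (by fun_prop)),
      ← integral_add_right_eq_self (({y : E3 | ε < ‖x + a - y‖}).indicator _) a]
    congr 1
    funext y
    simp [indicator]
  simp only [rieszRR, h]

/-! ### The weight (1 + |x|)^{-7/2}. -/

/-- An integrable weight on `ℝ³` which decays slower than `|x|⁻⁴`. -/
noncomputable def weight (x : E3) : ℝ := (1 + ‖x‖) ^ (-(7 / 2) : ℝ)

theorem weight_pos (x : E3) : 0 < weight x := by unfold weight; positivity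

theorem weight_le_one (x : E3) : weight x ≤ 1 :=
  Real.rpow_le_one_of_one_le_of_nonpos (by linarith [norm_nonneg x]) (by norm_num)

theorem continuous_weight : Continuous weight := by
  unfold weight
  refine Continuous.rpow_const (by fun_prop) fun x => Or.inl ?_
  positivity

theorem integrable_weight : Integrable weight := by
  unfold weight
  exact integrable_one_add_norm (by simp; norm_num)

theorem inv_pow_four_le_weight (x : E3) : (1 + ‖x‖)⁻¹ ^ 4 ≤ weight x := by
  unfold weight
  rw [inv_pow, ← Real.rpow_natCast, ← Real.rpow_neg (by positivity)]
  exact Real.rpow_le_rpow_of_exponent_le (by linarith [norm_nonneg x]) (by norm_num)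

/-- A Peetre inequality: translating the argument costs a polynomial factor in the translation. The
exponent 7/2 is rounded up to 4. -/
theorem weight_add_le (x a : E3) : weight (x + a) ≤ (1 + ‖a‖) ^ 4 * weight x := by
  unfold weight
  have h1 : 1 + ‖x‖ ≤ (1 + ‖x + a‖) * (1 + ‖a‖) := by
    have : ‖x‖ ≤ ‖x + a‖ + ‖a‖ := by
      calc ‖x‖ = ‖(x + a) - a‖ := by simp
        _ ≤ _ := norm_sub_le _ _
    nlinarith [norm_nonneg a, norm_nonneg (x + a), mul_nonneg (norm_nonneg (x + a)) (norm_nonneg a)]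
  have h2 : ((1 + ‖x + a‖) * (1 + ‖a‖)) ^ (-(7 / 2) : ℝ) ≤ (1 + ‖x‖) ^ (-(7 / 2) : ℝ) :=
    Real.rpow_le_rpow_of_nonpos (by positivity) h1 (by norm_num)
  rw [Real.mul_rpow (by positivity) (by positivity)] at h2
  have h3 : (1 + ‖a‖) ^ (7 / 2 : ℝ) ≤ (1 + ‖a‖) ^ 4 := by
    rw [← Real.rpow_natCast]
    exact Real.rpow_le_rpow_of_exponent_le (by linarith [norm_nonneg a]) (by norm_num)
  have h4 : (1 + ‖a‖) ^ (7 / 2 : ℝ) * (1 + ‖a‖) ^ (-(7 / 2) : ℝ) = 1 := by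
    rw [← Real.rpow_add (by positivity)]; norm_num
  calc (1 + ‖x + a‖) ^ (-(7 / 2) : ℝ)
      = (1 + ‖a‖) ^ (7 / 2 : ℝ) * ((1 + ‖x + a‖) ^ (-(7 / 2) : ℝ) * (1 + ‖a‖) ^ (-(7 / 2) : ℝ)) := by
        rw [mul_left_comm, h4, mul_one]
    _ ≤ (1 + ‖a‖) ^ (7 / 2 : ℝ) * (1 + ‖x‖) ^ (-(7 / 2) : ℝ) := by gcongr
    _ ≤ _ := by gcongr

theorem one_le_weight {x : E3} {M : ℝ} (h : ‖x‖ ≤ M) : 1 ≤ (1 + M) ^ 4 * weight x := by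
  have h1 := weight_add_le x (-x)
  simp only [add_neg_cancel, norm_neg] at h1
  have h2 : weight 0 = 1 := by simp [weight]
  rw [h2] at h1
  refine h1.trans ?_
  gcongr
  exact (weight_pos x).le

/-- The exponent 7/2 lies strictly between 3, needed for integrability, and 4, the decay of the
gradient of K. The surplus 4 - 7/2 is the factor R^{-1/2} that drives the Liouville argument. -/
theorem scaled_le_weight {R : ℝ} (hR : 1 ≤ R) (x : E3) :
    R⁻¹ ^ 4 * (1 + ‖R⁻¹ • x‖)⁻¹ ^ 4 ≤ R ^ (-(1 / 2) : ℝ) * weight x := by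
  have hR0 : 0 < R := by linarith
  have h1 := inv_pow_four_le_weight (R⁻¹ • x)
  have h2 : (1 + ‖x‖) / R ≤ 1 + ‖R⁻¹ • x‖ := by
    rw [norm_smul, norm_inv, Real.norm_of_nonneg hR0.le, add_div, div_eq_inv_mul ‖x‖, one_div]
    gcongr
    exact inv_le_one_of_one_le₀ hR
  have h3 : weight (R⁻¹ • x) ≤ R ^ (7 / 2 : ℝ) * weight x := by
    unfold weight
    refine (Real.rpow_le_rpow_of_nonpos (by positivity) h2 (by norm_num)).trans_eq ?_
    rw [div_eq_mul_inv, Real.mul_rpow (by positivity) (by positivity), Real.inv_rpow hR0.le,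
      ← Real.rpow_neg hR0.le, neg_neg, mul_comm]
  calc R⁻¹ ^ 4 * (1 + ‖R⁻¹ • x‖)⁻¹ ^ 4 ≤ R⁻¹ ^ 4 * (R ^ (7 / 2 : ℝ) * weight x) := by
        gcongr
        exact h1.trans h3
    _ = R ^ (-(1 / 2) : ℝ) * weight x := by
        rw [← mul_assoc, inv_pow, ← Real.rpow_natCast, ← Real.rpow_neg hR0.le,
          ← Real.rpow_add hR0]
        norm_num

/-! ### Near and far parts of the Newtonian potential at scale R. -/

/-- The cut-off used to split the Newtonian potential. -/
noncomputable def bumpOne : ContDiffBump (0 : E3) := ⟨1, 2, one_pos, one_lt_two⟩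

/-- The part of the Newtonian potential near the origin, at scale `R`. -/
noncomputable def newtonNear (R : ℝ) (x : E3) : ℝ := bumpOne (R⁻¹ • x) * newton x

/-- The part of the Newtonian potential away from the origin, at scale `R`. -/
noncomputable def newtonFar (R : ℝ) (x : E3) : ℝ := (1 - bumpOne (R⁻¹ • x)) * newton x

/-- The second derivatives of the far part of the Newtonian potential. -/
noncomputable def kernelFar (R : ℝ) (i j : Fin 3) (x : E3) : ℝ :=
  fderiv ℝ (fun z => fderiv ℝ (newtonFar R) z (bv j)) x (bv i)

theorem newtonNear_add_newtonFar (R : ℝ) (x : E3) :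
    newtonNear R x + newtonFar R x = newton x := by
  simp only [newtonNear, newtonFar]; ring

theorem contDiff_newtonFar {R : ℝ} (hR : 0 < R) : ContDiff ℝ ∞ (newtonFar R) := by
  rw [contDiff_iff_contDiffAt]
  intro x
  by_cases hx : x = 0
  · subst hx
    have : newtonFar R =ᶠ[𝓝 0] fun _ => 0 := by
      filter_upwards [Metric.ball_mem_nhds (0 : E3) hR] with y hy
      rw [newtonFar, bumpOne.one_of_mem_closedBall, sub_self, zero_mul]
      rw [mem_ball_zero_iff] at hy
      rw [mem_closedBall_zero_iff, norm_smul, norm_inv, Real.norm_of_nonneg hR.le]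
      change _ ≤ (1 : ℝ)
      rw [inv_mul_le_iff₀ hR]
      linarith
    exact (contDiffAt_const (c := (0 : ℝ))).congr_of_eventuallyEq this
  · refine ContDiffAt.mul ?_ (contDiffAt_newton hx)
    exact (contDiff_const.sub (bumpOne.contDiff.comp (contDiff_const_smul R⁻¹))).contDiffAt

theorem contDiff_kernelFar {R : ℝ} (hR : 0 < R) (i j : Fin 3) :
    ContDiff ℝ ∞ (kernelFar R i j) := by
  have h1 : ContDiff ℝ ∞ (fun z => fderiv ℝ (newtonFar R) z (bv j)) :=
    ((contDiff_newtonFar hR).fderiv_right (by simp)).clm_apply contDiff_const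
  exact (h1.fderiv_right (by simp)).clm_apply contDiff_const

theorem newtonNear_eq_zero {R : ℝ} (hR : 0 < R) {x : E3} (hx : 2 * R ≤ ‖x‖) :
    newtonNear R x = 0 := by
  rw [newtonNear, bumpOne.zero_of_le_dist, zero_mul]
  rw [dist_zero_right, norm_smul, norm_inv, Real.norm_of_nonneg hR.le]
  change (2 : ℝ) ≤ _
  rw [le_inv_mul_iff₀ hR]
  linarith

theorem hasCompactSupport_newtonNear {R : ℝ} (hR : 0 < R) : HasCompactSupport (newtonNear R) := by
  refine HasCompactSupport.intro (isCompact_closedBall (0 : E3) (2 * R)) fun x hx => ?_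
  refine newtonNear_eq_zero hR ?_
  rw [mem_closedBall_zero_iff, not_le] at hx
  exact hx.le

theorem locallyIntegrable_newtonNear (R : ℝ) : LocallyIntegrable (newtonNear R) := by
  unfold newtonNear
  have hc : Continuous fun x : E3 => bumpOne (R⁻¹ • x) :=
    bumpOne.continuous.comp (continuous_const_smul _)
  exact locallyIntegrable_newton.continuous_mul hc

theorem newtonFar_eq_newton {R : ℝ} (hR : 0 < R) {x : E3} (hx : 2 * R ≤ ‖x‖) :
    newtonFar R x = newton x := by
  rw [← newtonNear_add_newtonFar R, newtonNear_eq_zero hR hx, zero_add]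

/-- Equality near x, not only at x, is needed because the derivatives of the two kernels are
compared as well. -/
theorem kernelFar_eventuallyEq {x : E3} (hx : 2 < ‖x‖) (i j : Fin 3) :
    kernelFar 1 i j =ᶠ[𝓝 x] kernelK i j := by
  have ho : ∀ᶠ y : E3 in 𝓝 x, 2 < ‖y‖ := (isOpen_lt continuous_const continuous_norm).mem_nhds hx
  filter_upwards [ho] with y hy
  have e : (fun z => fderiv ℝ (newtonFar 1) z (bv j)) =ᶠ[𝓝 y] gradNewton j := by
    have ho' : ∀ᶠ y' : E3 in 𝓝 y, 2 < ‖y'‖ :=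
      (isOpen_lt continuous_const continuous_norm).mem_nhds hy
    filter_upwards [ho'] with y' hy'
    have e' : newtonFar 1 =ᶠ[𝓝 y'] newton := by
      filter_upwards [(isOpen_lt continuous_const continuous_norm).mem_nhds hy'] with v hv
      exact newtonFar_eq_newton one_pos (by rw [mul_one]; exact le_of_lt hv)
    rw [e'.fderiv_eq]
    exact fderiv_newton (norm_pos_iff.1 (by linarith)) j
  rw [kernelFar, e.fderiv_eq]
  exact fderiv_gradNewton (norm_pos_iff.1 (by linarith)) i j

theorem fderiv_scaled (g : E3 → ℝ) (c a : ℝ) (x v : E3) :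
    fderiv ℝ (fun x => c * g (a • x)) x v = c * a * fderiv ℝ g (a • x) v := by
  have h1 : fderiv ℝ (fun x => g (a • x)) x = a • fderiv ℝ g (a • x) := fderiv_comp_smul a
  have h2 : fderiv ℝ (fun x => c * g (a • x)) x = c • fderiv ℝ (fun x => g (a • x)) x := by
    have := fderiv_const_smul_field (𝕜 := ℝ) c (f := fun x => g (a • x))
    exact congrFun this x
  rw [h2, h1]
  simp [mul_assoc]

theorem newtonFar_scaled {R : ℝ} (hR : 0 < R) :
    newtonFar R = fun x => R⁻¹ * newtonFar 1 (R⁻¹ • x) := by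
  funext x
  simp only [newtonFar, newton, inv_one, one_smul, norm_smul, norm_inv, Real.norm_of_nonneg hR.le]
  field_simp

theorem kernelFar_scaled {R : ℝ} (hR : 0 < R) (i j : Fin 3) :
    kernelFar R i j = fun x => R⁻¹ ^ 3 * kernelFar 1 i j (R⁻¹ • x) := by
  funext x
  have h1 : (fun z => fderiv ℝ (newtonFar R) z (bv j)) =
      fun z => (R⁻¹ * R⁻¹) * (fun z => fderiv ℝ (newtonFar 1) z (bv j)) (R⁻¹ • z) := by
    funext z
    rw [newtonFar_scaled hR, fderiv_scaled]
  have h2 := fderiv_scaled (fun z => fderiv ℝ (newtonFar 1) z (bv j)) (R⁻¹ * R⁻¹) R⁻¹ x (bv i)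
  rw [kernelFar, h1, h2, kernelFar]
  ring

theorem kernelK_scaled {l : ℝ} (hl : 0 < l) (i j : Fin 3) :
    kernelK i j = fun x => l ^ 3 * kernelK i j (l • x) := by
  funext x
  simp only [kernelK, norm_smul, Real.norm_of_nonneg hl.le, PiLp.smul_apply, smul_eq_mul]
  field_simp

theorem contDiffAt_kernelK {x : E3} (hx : x ≠ 0) (i j : Fin 3) :
    ContDiffAt ℝ ∞ (kernelK i j) x := by
  unfold kernelK
  refine ContDiffAt.div ?_ (contDiffAt_const.mul ((contDiffAt_norm ℝ hx).pow 5)) ?_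
  · refine ContDiffAt.add (contDiffAt_const.mul ((contDiffAt_norm ℝ hx).pow 2)) ?_
    fun_prop
  · simpa [Real.pi_ne_zero] using hx

/-- K is homogeneous of degree -3, so its gradient is homogeneous of degree -4 and it suffices to
bound it on the compact unit sphere. -/
theorem exists_norm_fderiv_kernelK_le (i j : Fin 3) :
    ∃ C : ℝ, 0 < C ∧ ∀ x : E3, x ≠ 0 → ‖fderiv ℝ (kernelK i j) x‖ ≤ C * ‖x‖⁻¹ ^ 4 := by
  have hc : ContinuousOn (fderiv ℝ (kernelK i j)) (Metric.sphere (0 : E3) 1) := by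
    intro x hx
    have hx0 : x ≠ 0 := by rintro rfl; simp at hx
    exact ((contDiffAt_kernelK hx0 i j).fderiv_right (m := ∞)
      (by simp)).continuousAt.continuousWithinAt
  obtain ⟨C, hC⟩ := (isCompact_sphere (0 : E3) 1).exists_bound_of_continuousOn hc
  refine ⟨max C 1, by positivity, fun x hx => ?_⟩
  have hn : 0 < ‖x‖ := norm_pos_iff.2 hx
  have hs : ‖x‖⁻¹ • x ∈ Metric.sphere (0 : E3) 1 := by
    simp [norm_smul, hn.ne']
  refine ContinuousLinearMap.opNorm_le_bound _ (by positivity) fun v => ?_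
  have e := fderiv_scaled (kernelK i j) (‖x‖⁻¹ ^ 3) ‖x‖⁻¹ x v
  rw [← kernelK_scaled (inv_pos.2 hn)] at e
  rw [e, norm_mul, Real.norm_of_nonneg (by positivity)]
  calc ‖x‖⁻¹ ^ 3 * ‖x‖⁻¹ * ‖fderiv ℝ (kernelK i j) (‖x‖⁻¹ • x) v‖
      ≤ ‖x‖⁻¹ ^ 3 * ‖x‖⁻¹ * (max C 1 * ‖v‖) := by
        gcongr
        refine (ContinuousLinearMap.le_opNorm _ _).trans ?_
        gcongr
        exact (hC _ hs).trans (le_max_left _ _)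
    _ = _ := by ring

/-- The factor 3 serves both regimes: 1 + ‖x‖ ≤ 3‖x‖ beyond radius 2, and 1 + ‖x‖ ≤ 3 within it,
where compactness gives the bound. -/
theorem exists_bound_of_far {F : Type*} [NormedAddCommGroup F] {g : E3 → F} (hg : Continuous g)
    (n : ℕ) {C : ℝ} (h : ∀ x, 2 < ‖x‖ → ‖g x‖ ≤ C * ‖x‖⁻¹ ^ n) :
    ∃ C : ℝ, 0 < C ∧ ∀ x, ‖g x‖ ≤ C * (1 + ‖x‖)⁻¹ ^ n := by
  obtain ⟨B, hB⟩ := (isCompact_closedBall (0 : E3) 2).exists_bound_of_continuousOn hg.continuousOn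
  refine ⟨(max C 0 + max B 0) * 3 ^ n + 1, by positivity, fun x => ?_⟩
  by_cases hx : 2 < ‖x‖
  · have hn : 0 < ‖x‖ := by linarith
    have h3 : ‖x‖⁻¹ ≤ 3 * (1 + ‖x‖)⁻¹ := by
      rw [← div_eq_mul_inv, le_div_iff₀ (by positivity), inv_mul_le_iff₀ hn]
      linarith
    calc ‖g x‖ ≤ C * ‖x‖⁻¹ ^ n := h x hx
      _ ≤ max C 0 * (3 * (1 + ‖x‖)⁻¹) ^ n := by
        gcongr
        exact le_max_left _ _
      _ = max C 0 * 3 ^ n * (1 + ‖x‖)⁻¹ ^ n := by rw [mul_pow]; ring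
      _ ≤ _ := by
        gcongr
        have : 0 ≤ max B 0 * 3 ^ n := by positivity
        linarith
  · have h3 : 1 ≤ 3 * (1 + ‖x‖)⁻¹ := by
      rw [← div_eq_mul_inv, le_div_iff₀ (by positivity)]
      linarith
    calc ‖g x‖ ≤ B := hB x (by simpa using hx)
      _ ≤ max B 0 * (3 * (1 + ‖x‖)⁻¹) ^ n := by
        refine (le_max_left _ _).trans (le_mul_of_one_le_right (le_max_right _ _) ?_)
        exact one_le_pow₀ h3
      _ = max B 0 * 3 ^ n * (1 + ‖x‖)⁻¹ ^ n := by rw [mul_pow]; ring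
      _ ≤ _ := by
        gcongr
        have : 0 ≤ max C 0 * 3 ^ n := by positivity
        linarith

theorem exists_uniform_index {P : Fin 3 → Fin 3 → ℝ → Prop}
    (hmono : ∀ i j a b, a ≤ b → P i j a → P i j b) (h : ∀ i j, ∃ C, 0 < C ∧ P i j C) :
    ∃ C, 0 < C ∧ ∀ i j, P i j C := by
  choose C hC0 hC using h
  refine ⟨∑ i, ∑ j, C i j, Finset.sum_pos (fun i _ => Finset.sum_pos (fun j _ => hC0 i j) Finset.univ_nonempty)
    Finset.univ_nonempty,
    fun i j => hmono i j _ _ ?_ (hC i j)⟩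
  calc C i j ≤ ∑ j, C i j :=
        Finset.single_le_sum (f := fun j => C i j) (fun j _ => (hC0 i j).le) (Finset.mem_univ j)
    _ ≤ _ := Finset.single_le_sum (f := fun i => ∑ j, C i j)
        (fun i _ => Finset.sum_nonneg fun j _ => (hC0 i j).le) (Finset.mem_univ i)

theorem exists_kernelFar_le : ∃ C : ℝ, 0 < C ∧ ∀ (i j : Fin 3) (x : E3),
    |kernelFar 1 i j x| ≤ C * (1 + ‖x‖)⁻¹ ^ 3 := by
  refine exists_uniform_index (P := fun i j C => ∀ x, |kernelFar 1 i j x| ≤ C * (1 + ‖x‖)⁻¹ ^ 3)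
    (fun i j a b hab h x => (h x).trans (by gcongr)) fun i j => ?_
  refine exists_bound_of_far (contDiff_kernelFar one_pos i j).continuous 3 (C := 1) fun x hx => ?_
  rw [(kernelFar_eventuallyEq hx i j).eq_of_nhds, one_mul]
  exact norm_kernelK_le i j x

theorem exists_fderiv_kernelFar_le : ∃ C : ℝ, 0 < C ∧ ∀ (i j : Fin 3) (x : E3),
    ‖fderiv ℝ (kernelFar 1 i j) x‖ ≤ C * (1 + ‖x‖)⁻¹ ^ 4 := by
  refine exists_uniform_index
    (P := fun i j C => ∀ x, ‖fderiv ℝ (kernelFar 1 i j) x‖ ≤ C * (1 + ‖x‖)⁻¹ ^ 4)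
    (fun i j a b hab h x => (h x).trans (by gcongr)) fun i j => ?_
  obtain ⟨C, -, hC⟩ := exists_norm_fderiv_kernelK_le i j
  refine exists_bound_of_far ((contDiff_kernelFar one_pos i j).continuous_fderiv (by simp)) 4
    (C := C) fun x hx => ?_
  rw [(kernelFar_eventuallyEq hx i j).fderiv_eq]
  exact hC x (norm_pos_iff.1 (by linarith))

theorem exists_fderiv_kernelFar_scaled_le : ∃ C : ℝ, 0 < C ∧ ∀ (i j : Fin 3) (R : ℝ), 1 ≤ R →
    ∀ x, ‖fderiv ℝ (kernelFar R i j) x‖ ≤ C * R ^ (-(1 / 2) : ℝ) * weight x := by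
  obtain ⟨C, hC0, hC⟩ := exists_fderiv_kernelFar_le
  refine ⟨C, hC0, fun i j R hR x => ?_⟩
  have hR0 : 0 < R := by linarith
  have hw := (weight_pos x).le
  refine ContinuousLinearMap.opNorm_le_bound _ (by positivity) fun v => ?_
  rw [kernelFar_scaled hR0, fderiv_scaled, norm_mul, Real.norm_of_nonneg (by positivity)]
  calc R⁻¹ ^ 3 * R⁻¹ * ‖fderiv ℝ (kernelFar 1 i j) (R⁻¹ • x) v‖
      ≤ R⁻¹ ^ 3 * R⁻¹ * ((C * (1 + ‖R⁻¹ • x‖)⁻¹ ^ 4) * ‖v‖) := by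
        gcongr
        exact (ContinuousLinearMap.le_opNorm _ _).trans (by gcongr; exact hC i j _)
    _ = C * (R⁻¹ ^ 4 * (1 + ‖R⁻¹ • x‖)⁻¹ ^ 4) * ‖v‖ := by ring
    _ ≤ C * (R ^ (-(1 / 2) : ℝ) * weight x) * ‖v‖ := by
        gcongr C * ?_ * ‖v‖
        exact scaled_le_weight hR x
    _ = _ := by ring

/-- Mean value inequality on the segment from x to x - y. Of the power 5, four come from moving the
weight along the segment and one from the length of the segment. -/
theorem kernelFar_sub_le : ∃ C : ℝ, 0 < C ∧ ∀ (i j : Fin 3) (R : ℝ), 1 ≤ R → ∀ x y,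
    |kernelFar R i j (x - y) - kernelFar R i j x| ≤
      C * R ^ (-(1 / 2) : ℝ) * (1 + ‖y‖) ^ 5 * weight x := by
  obtain ⟨C, hC0, hC⟩ := exists_fderiv_kernelFar_scaled_le
  refine ⟨C, hC0, fun i j R hR x y => ?_⟩
  have hR0 : 0 < R := by linarith
  have hw := (weight_pos x).le
  have hq : 0 ≤ R ^ (-(1 / 2) : ℝ) := by positivity
  have hCR := hC i j R hR
  generalize R ^ (-(1 / 2) : ℝ) = q at hq hCR ⊢
  have hseg : ∀ z ∈ segment ℝ x (x - y),
      ‖fderiv ℝ (kernelFar R i j) z‖ ≤ C * q * ((1 + ‖y‖) ^ 4 * weight x) := by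
    intro z hz
    refine (hCR z).trans (mul_le_mul_of_nonneg_left ?_ (by positivity))
    rw [segment_eq_image'] at hz
    obtain ⟨s, ⟨hs0, hs1⟩, rfl⟩ := hz
    refine (weight_add_le _ _).trans (mul_le_mul_of_nonneg_right ?_ hw)
    have : ‖s • (x - y - x)‖ ≤ ‖y‖ := by
      rw [norm_smul, Real.norm_of_nonneg hs0, show x - y - x = -y by abel, norm_neg]
      exact mul_le_of_le_one_left (norm_nonneg _) hs1
    gcongr
  have h := (convex_segment (𝕜 := ℝ) x (x - y)).norm_image_sub_le_of_norm_fderiv_le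
    (fun z _ => ((contDiff_kernelFar hR0 i j).differentiable (by simp)) z) hseg
    (left_mem_segment ℝ x (x - y)) (right_mem_segment ℝ x (x - y))
  rw [Real.norm_eq_abs] at h
  refine h.trans ?_
  have : ‖x - y - x‖ ≤ 1 + ‖y‖ := by simp
  calc C * q * ((1 + ‖y‖) ^ 4 * weight x) * ‖x - y - x‖
      ≤ C * q * ((1 + ‖y‖) ^ 4 * weight x) * (1 + ‖y‖) := by gcongr
    _ = _ := by ring

theorem cv_swap (κ : E3 → ℝ) (f : E3 × ℝ → ℝ) (z : E3 × ℝ) :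
    cv κ f z = ∫ y, κ (z.1 - y) * f (y, z.2) := by
  rw [cv, ← integral_sub_left_eq_self _ volume z.1]
  simp

theorem integral_le_of_supported {F : E3 → ℝ} {M b : ℝ}
    (h0 : ∀ y, M < ‖y‖ → F y = 0) (hb : ∀ y, ‖y‖ ≤ M → |F y| ≤ b) :
    |∫ y, F y| ≤ b * volume.real (Metric.closedBall (0 : E3) M) := by
  have h1 : ∫ y in Metric.closedBall (0 : E3) M, F y = ∫ y, F y :=
    setIntegral_eq_integral_of_forall_compl_eq_zero fun y hy =>
      h0 y (not_le.1 fun h => hy (mem_closedBall_zero_iff.2 h))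
  have h2 : volume (Metric.closedBall (0 : E3) M) < ⊤ := measure_closedBall_lt_top
  rw [← h1, ← Real.norm_eq_abs]
  refine norm_setIntegral_le_of_norm_le_const h2 fun y hy => ?_
  rw [Real.norm_eq_abs]
  exact hb y (mem_closedBall_zero_iff.1 hy)

/-- Far away, convolution with the kernel sees only the mass of a slice; the error is a difference
of kernels and decays one order better. For functions of slice mass zero the whole convolution is
therefore small as R grows. -/
theorem cv_kernelFar_sub_le {M : ℝ} (hM : 0 ≤ M) : ∃ C : ℝ, 0 < C ∧ ∀ (i j : Fin 3) (R : ℝ), 1 ≤ R →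
    ∀ (f : E3 × ℝ → ℝ) (a : ℝ), IsTest f → (∀ z, f z ≠ 0 → ‖z.1‖ ≤ M) → (∀ z, |f z| ≤ a) →
    ∀ z, |cv (kernelFar R i j) f z - kernelFar R i j z.1 * ∫ y, f (y, z.2)| ≤
      C * R ^ (-(1 / 2) : ℝ) * a * weight z.1 := by
  obtain ⟨C, hC0, hC⟩ := kernelFar_sub_le
  refine ⟨C * (1 + M) ^ 5 * (volume.real (Metric.closedBall (0 : E3) M) + 1),
    by have : 0 ≤ volume.real (Metric.closedBall (0 : E3) M) := measureReal_nonneg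
       positivity, fun i j R hR f a hf hs ha z => ?_⟩
  have hR0 : 0 < R := by linarith
  have ha0 : 0 ≤ a := (abs_nonneg _).trans (ha z)
  have hw := (weight_pos z.1).le
  have hi1 : Integrable fun y => kernelFar R i j (z.1 - y) * f (y, z.2) :=
    integrable_locallyIntegrable_mul (κ := fun y => kernelFar R i j (z.1 - y))
      (contDiff_sub_left (contDiff_kernelFar hR0 i j) z.1).continuous.locallyIntegrable
      (hf.slice_contDiff z.2).continuous (hf.slice_compact z.2)
  have hi2 : Integrable fun y => kernelFar R i j z.1 * f (y, z.2) :=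
    ((hf.slice_contDiff z.2).continuous.integrable_of_hasCompactSupport
      (hf.slice_compact z.2)).const_mul _
  rw [cv_swap, ← integral_const_mul, ← integral_sub hi1 hi2]
  simp only [← sub_mul]
  have hb : 0 ≤ R ^ (-(1 / 2) : ℝ) := by positivity
  have hCR := hC i j R hR
  generalize R ^ (-(1 / 2) : ℝ) = q at hb hCR ⊢
  refine (integral_le_of_supported (F := fun y => (kernelFar R i j (z.1 - y) - kernelFar R i j z.1) *
    f (y, z.2)) (M := M) (b := C * q * (1 + M) ^ 5 * weight z.1 * a)
    (fun y hy => ?_) (fun y hy => ?_)).trans ?_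
  · have : f (y, z.2) = 0 := by
      by_contra h
      exact absurd (hs _ h) (not_le.2 hy)
    rw [this, mul_zero]
  · rw [abs_mul]
    refine mul_le_mul (hCR z.1 y |>.trans ?_) (ha _) (abs_nonneg _) (by positivity)
    gcongr
  · have : 0 ≤ C * q * (1 + M) ^ 5 * weight z.1 * a := by positivity
    nlinarith

/-- The near kernel is integrable with support in the ball of radius 2, so the convolution is
bounded and supported in radius M + 2, where the weight is bounded below. -/
theorem cv_newtonNear_le {M : ℝ} (hM : 0 ≤ M) : ∃ C : ℝ, 0 < C ∧
    ∀ (f : E3 × ℝ → ℝ) (a : ℝ), IsTest f → (∀ z, f z ≠ 0 → ‖z.1‖ ≤ M) → (∀ z, |f z| ≤ a) →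
    ∀ z, |cv (newtonNear 1) f z| ≤ C * a * weight z.1 := by
  have hint : Integrable (newtonNear 1) :=
    (integrableOn_iff_integrable_of_support_subset (subset_tsupport _)).1
      ((locallyIntegrable_newtonNear 1).integrableOn_isCompact
        (hasCompactSupport_newtonNear one_pos))
  have hI : 0 ≤ ∫ y, ‖newtonNear 1 y‖ := integral_nonneg fun _ => norm_nonneg _
  refine ⟨((∫ y, ‖newtonNear 1 y‖) + 1) * (1 + (M + 2)) ^ 4, by positivity, fun f a hf hs ha z => ?_⟩
  · have ha0 : 0 ≤ a := (abs_nonneg _).trans (ha z)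
    have hw := (weight_pos z.1).le
    by_cases hz : ‖z.1‖ ≤ M + 2
    · have h1 : |cv (newtonNear 1) f z| ≤ ∫ y, ‖newtonNear 1 y‖ * a := by
        rw [← Real.norm_eq_abs, cv]
        refine norm_integral_le_of_norm_le (hint.norm.mul_const a) (Eventually.of_forall fun y => ?_)
        rw [norm_mul]
        gcongr
        exact ha _
      rw [integral_mul_const] at h1
      have h2 := one_le_weight hz
      calc _ ≤ _ := h1
        _ ≤ ((∫ y, ‖newtonNear 1 y‖) + 1) * a * ((1 + (M + 2)) ^ 4 * weight z.1) := by
          have : (∫ y, ‖newtonNear 1 y‖) * a ≤ ((∫ y, ‖newtonNear 1 y‖) + 1) * a := by gcongr; linarith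
          exact this.trans (le_mul_of_one_le_right (by positivity) h2)
        _ = _ := by ring
    · have : cv (newtonNear 1) f z = 0 := by
        refine integral_eq_zero_of_ae (Eventually.of_forall fun y => ?_)
        by_contra h
        have h1 : newtonNear 1 y ≠ 0 := left_ne_zero_of_mul h
        have h2 := hs _ (right_ne_zero_of_mul h)
        have h3 : ‖y‖ < 2 := by
          by_contra h4
          exact h1 (newtonNear_eq_zero one_pos (by linarith))
        refine hz ?_
        calc ‖z.1‖ = ‖(z.1 - y) + y‖ := by simp
          _ ≤ _ := norm_add_le _ _
          _ ≤ M + 2 := add_le_add h2 h3.le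
      rw [this, abs_zero]
      positivity

/-- The derivatives stay on f for the singular near part and are moved onto the kernel for the
smooth far part. -/
theorem RR_eq_near_add_far {f : E3 × ℝ → ℝ} (hf : IsTest f) {R : ℝ} (hR : 0 < R) (i j : Fin 3)
    (z : E3 × ℝ) :
    RR i j f z = cv (newtonNear R) (D (ex j) (D (ex i) f)) z + cv (kernelFar R i j) f z := by
  have hN : newton = fun y => newtonNear R y + newtonFar R y := by
    funext y; rw [newtonNear_add_newtonFar]
  have h1 : ContDiff ℝ ∞ (fun z => fderiv ℝ (newtonFar R) z (bv j)) :=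
    ((contDiff_newtonFar hR).fderiv_right (by simp)).clm_apply contDiff_const
  rw [RR_eq_cv hf, hN, cv_add_kernel (locallyIntegrable_newtonNear R)
    (contDiff_newtonFar hR).continuous.locallyIntegrable ((hf.D _).D _),
    cv_D_eq (contDiff_newtonFar hR) (hf.D _), cv_D_eq h1 hf]
  rfl

/-- Up to an integrable error, the Riesz transform behaves at infinity like the kernel. -/
theorem RR_sub_kernelFar_le {M : ℝ} (hM : 0 ≤ M) : ∃ C : ℝ, 0 < C ∧ ∀ (i j : Fin 3)
    (f : E3 × ℝ → ℝ) (a : ℝ), IsTest f → (∀ z, f z ≠ 0 → ‖z.1‖ ≤ M) → (∀ z, |f z| ≤ a) →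
    (∀ z, |D (ex j) (D (ex i) f) z| ≤ a) →
    ∀ z, |RR i j f z - kernelFar 1 i j z.1 * ∫ y, f (y, z.2)| ≤ C * a * weight z.1 := by
  obtain ⟨C1, h10, h1⟩ := cv_kernelFar_sub_le hM
  obtain ⟨C2, h20, h2⟩ := cv_newtonNear_le hM
  refine ⟨C1 + C2, by positivity, fun i j f a hf hs ha hda z => ?_⟩
  have hsD : ∀ v (g : E3 × ℝ → ℝ), (∀ z, g z ≠ 0 → ‖z.1‖ ≤ M) → ∀ z, D v g z ≠ 0 → ‖z.1‖ ≤ M := by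
    intro v g hg z hz
    have hcl : IsClosed {z : E3 × ℝ | ‖z.1‖ ≤ M} :=
      isClosed_le (continuous_fst.norm) continuous_const
    have h3 : tsupport g ⊆ {z : E3 × ℝ | ‖z.1‖ ≤ M} :=
      closure_minimal (fun z hz => hg z hz) hcl
    refine h3 (support_fderiv_subset ℝ (f := g) fun h => hz ?_)
    simp [D, h]
  have e1 := h1 i j 1 le_rfl f a hf hs ha z
  have e2 := h2 _ a ((hf.D _).D _) (hsD _ _ (hsD _ _ hs)) hda z
  rw [Real.one_rpow, mul_one] at e1
  rw [RR_eq_near_add_far hf one_pos, add_sub_assoc]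
  refine (abs_add_le _ _).trans ?_
  rw [add_mul, add_mul]
  linarith

/-- Since -Δ of the Newtonian potential is the Dirac mass, f plus the Laplacian of its near
potential equals minus the Laplacian of its far potential. The identity is read off from the trace
of the Riesz transforms. -/
theorem lap_cv_newtonNear {f : E3 × ℝ → ℝ} (hf : IsTest f) {R : ℝ} (hR : 0 < R) (z : E3 × ℝ) :
    f z + lap (cv (newtonNear R) f) z = - ∑ l : Fin 3, cv (kernelFar R l l) f z := by
  have h1 : ∀ l, cv (newtonNear R) (D (ex l) (D (ex l) f)) z =
      RR l l f z - cv (kernelFar R l l) f z := by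
    intro l
    rw [RR_eq_near_add_far hf hR]; ring
  have h2 := rieszRR_trace (hf.slice_contDiff z.2) (hf.slice_compact z.2) z.1
  rw [lap_cv (locallyIntegrable_newtonNear R) hf, cv_lap (locallyIntegrable_newtonNear R) hf]
  simp only [h1, Finset.sum_sub_distrib]
  change ∑ i, RR i i f z = - f z at h2
  rw [h2]
  ring

/-- R_i R_j Δ = -∂_i ∂_j, so the added Laplacian removes precisely the near part of R_i R_j f. -/
theorem RR_add_lap_cv_newtonNear {f : E3 × ℝ → ℝ} (hf : IsTest f) {R : ℝ} (hR : 0 < R)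
    (i j : Fin 3) (z : E3 × ℝ) :
    RR i j (fun z => f z + lap (cv (newtonNear R) f) z) z = cv (kernelFar R i j) f z := by
  have hc := isTest_cv (locallyIntegrable_newtonNear R) (hasCompactSupport_newtonNear hR) hf
  rw [RR_add hf hc.lap, RR_lap hc, RR_eq_near_add_far hf hR,
    D_cv (locallyIntegrable_newtonNear R) hf, D_cv (locallyIntegrable_newtonNear R) (hf.D _),
    D_comm hf.contDiff]
  ring

/-! ### Slice masses and functions controlled by the weight. -/

/-- The spatial integral of a function on space-time. -/
noncomputable def mass (f : E3 × ℝ → ℝ) (t : ℝ) : ℝ := ∫ y, f (y, t)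

theorem cv_one (f : E3 × ℝ → ℝ) (z : E3 × ℝ) : cv (fun _ => 1) f z = mass f z.2 := by
  rw [cv_swap]; simp [mass]

theorem mass_D_ex {f : E3 × ℝ → ℝ} (hf : IsTest f) (k : Fin 3) (t : ℝ) :
    mass (D (ex k) f) t = 0 := by
  have h := cv_D_eq (κ := fun _ => 1) contDiff_const hf k (0, t)
  rw [cv_one] at h
  rw [h]
  simp [cv]

theorem contDiff_mass {f : E3 × ℝ → ℝ} (hf : IsTest f) : ContDiff ℝ ∞ (mass f) := by
  have h : mass f = cv (fun _ => 1) f ∘ fun t => (0, t) := by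
    funext t; simp [cv_one]
  rw [h]
  exact (contDiff_cv (continuous_const.locallyIntegrable) hf).comp
    (contDiff_const.prodMk contDiff_id)

theorem deriv_mass {f : E3 × ℝ → ℝ} (hf : IsTest f) (t : ℝ) :
    deriv (mass f) t = mass (D et f) t := by
  have h : mass f = cv (fun _ => 1) f ∘ fun t => (0, t) := by
    funext t; simp [cv_one]
  have hd : DifferentiableAt ℝ (cv (fun _ => 1) f) (0, t) :=
    ((contDiff_cv (continuous_const.locallyIntegrable) hf).differentiable (by simp)) _
  have h2 : HasDerivAt (fun t : ℝ => ((0 : E3), t)) et t := by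
    simpa [et] using (hasDerivAt_const t (0 : E3)).prodMk (hasDerivAt_id t)
  have h3 := hd.hasFDerivAt.comp_hasDerivAt t h2
  have h4 := congrFun (D_cv (κ := fun _ => 1) continuous_const.locallyIntegrable hf et) (0, t)
  rw [cv_one] at h4
  rw [h, h3.deriv]
  exact h4

theorem mass_eq_zero_of_support {f : E3 × ℝ → ℝ} {M : ℝ} (h : ∀ z, f z ≠ 0 → ‖z.1‖ ≤ M ∧ |z.2| ≤ M)
    {t : ℝ} (ht : M < |t|) : mass f t = 0 := by
  refine integral_eq_zero_of_ae (Eventually.of_forall fun y => ?_)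
  by_contra h'
  exact absurd (h _ h').2 (not_le.2 ht)

theorem IsTest.slice_integrable {f : E3 × ℝ → ℝ} (hf : IsTest f) (t : ℝ) :
    Integrable (fun x => f (x, t)) :=
  (hf.slice_contDiff t).continuous.integrable_of_hasCompactSupport (hf.slice_compact t)

/-- Measurable functions on space-time, bounded by a multiple of the weight and supported in a
bounded set of times. -/
structure Wt (g : E3 × ℝ → ℝ) : Prop where
  meas : Measurable g
  bound : ∃ C M : ℝ, 0 ≤ C ∧ (∀ z, |g z| ≤ C * weight z.1) ∧ ∀ z, M < |z.2| → g z = 0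

theorem IsTest.wt {f : E3 × ℝ → ℝ} (hf : IsTest f) : Wt f := by
  obtain ⟨M, hM1, hM⟩ := hf.exists_support_bound
  obtain ⟨C, hC0, hC⟩ := hf.exists_bound
  refine ⟨hf.continuous.measurable, C * (1 + M) ^ 4, M, by positivity, fun z => ?_, fun z hz => ?_⟩
  · by_cases h : f z = 0
    · rw [h, abs_zero]
      have := (weight_pos z.1).le
      positivity
    · have := one_le_weight (hM z h).1
      calc |f z| ≤ C * 1 := by rw [mul_one]; exact hC z
        _ ≤ C * ((1 + M) ^ 4 * weight z.1) := by gcongr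
        _ = _ := by ring
  · by_contra h
    exact absurd (hM z h).2 (not_le.2 hz)

theorem rieszRR_zero (i j : Fin 3) (x : E3) : rieszRR i j (fun _ => 0) x = 0 := by
  simp [rieszRR, (tendsto_const_nhds (x := (0 : ℝ)) (f := 𝓝[>] (0 : ℝ))).limUnder_eq]

theorem RR_eq_zero_of_slice {f : E3 × ℝ → ℝ} {z : E3 × ℝ} (h : ∀ y, f (y, z.2) = 0) (i j : Fin 3) :
    RR i j f z = 0 := by
  simp only [RR, h, rieszRR_zero]

theorem exists_uniform_bound_D2 {f : E3 × ℝ → ℝ} (hf : IsTest f) :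
    ∃ a : ℝ, 0 < a ∧ (∀ z, |f z| ≤ a) ∧ ∀ i j z, |D (ex j) (D (ex i) f) z| ≤ a := by
  obtain ⟨a, ha0, ha⟩ := hf.exists_bound
  obtain ⟨b, hb0, hb⟩ := exists_uniform_index
    (P := fun i j C => ∀ z, |D (ex j) (D (ex i) f) z| ≤ C)
    (fun i j a b hab h z => (h z).trans hab) fun i j => ((hf.D (ex i)).D (ex j)).exists_bound
  exact ⟨a + b, by positivity, fun z => (ha z).trans (by linarith),
    fun i j z => (hb i j z).trans (by linarith)⟩

theorem exists_RR_sub_kernelFar_le {f : E3 × ℝ → ℝ} (hf : IsTest f) : ∃ C : ℝ, 0 < C ∧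
    ∀ i j z, |RR i j f z - kernelFar 1 i j z.1 * mass f z.2| ≤ C * weight z.1 := by
  obtain ⟨M, hM1, hM⟩ := hf.exists_support_bound
  obtain ⟨a, ha0, ha, ha2⟩ := exists_uniform_bound_D2 hf
  obtain ⟨C, hC0, hC⟩ := RR_sub_kernelFar_le (M := M) (by linarith)
  exact ⟨C * a, by positivity, fun i j z => hC i j f a hf (fun z hz => (hM z hz).1) ha (ha2 i j) z⟩

/-- In general R_i R_j f decays only like |x|^{-3}, too slowly to pair with u ⊗ u. The leading term
at infinity is the kernel times the slice mass and drops out here. -/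
theorem wt_RR {f : E3 × ℝ → ℝ} (hf : IsTest f) (h0 : ∀ t, mass f t = 0) (i j : Fin 3) :
    Wt (RR i j f) := by
  obtain ⟨M, hM1, hM⟩ := hf.exists_support_bound
  obtain ⟨C, hC0, hC⟩ := exists_RR_sub_kernelFar_le hf
  refine ⟨(contDiff_RR hf i j).continuous.measurable, C, M, by positivity, fun z => ?_, fun z hz => ?_⟩
  · simpa [h0] using hC i j z
  · refine RR_eq_zero_of_slice (fun y => ?_) i j
    by_contra h
    exact absurd (hM _ h).2 (not_le.2 hz)

theorem wt_RR_D {f : E3 × ℝ → ℝ} (hf : IsTest f) (i j k : Fin 3) : Wt (RR i j (D (ex k) f)) :=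
  wt_RR (hf.D _) (mass_D_ex hf k) i j

/-! ### Weighted integrability of uniformly locally square integrable fields. -/

/-- A vector field on `ℝ³` with a finite weighted square integral. -/
structure UlocSlice (C : ℝ) (v : E3 → E3) : Prop where
  meas : AEStronglyMeasurable v volume
  bound : ∫⁻ x, ENNReal.ofReal ((1 + ‖v x‖ ^ 2) * weight x) ≤ ENNReal.ofReal C

/-- The integral of ‖v(x)‖² κ(a) over pairs with |x - a| < 1 is evaluated in both orders.
Integrating in x first gives at most U κ(a); integrating in a first gives at least a sixteenth of V
‖v(x)‖² κ(x), with V the volume of the unit ball. -/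
theorem lintegral_mul_le_of_slowly_varying {v : E3 → E3} (hv : AEStronglyMeasurable v volume) {U : ENNReal}
    {κ : E3 → ENNReal} (hwm : Measurable κ) (hκ : ∀ x a, dist x a < 1 → κ x ≤ 16 * κ a)
    (hU : ∀ x₀, ∫⁻ x in Metric.ball x₀ 1, ‖v x‖ₑ ^ 2 ≤ U) :
    ∫⁻ x, ‖v x‖ₑ ^ 2 * κ x ≤
      16 * (volume (Metric.ball (0 : E3) 1))⁻¹ * U * ∫⁻ x, κ x := by
  have hvm : AEMeasurable (fun x => ‖v x‖ₑ ^ 2) volume := hv.enorm.pow_const 2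
  have hS : MeasurableSet {q : E3 × E3 | dist q.2 q.1 < 1} :=
    measurableSet_lt (by fun_prop) measurable_const
  set V := volume (Metric.ball (0 : E3) 1) with hV
  have hV0 : V ≠ 0 := (Metric.measure_ball_pos _ _ one_pos).ne'
  have hVt : V ≠ ⊤ := measure_ball_lt_top.ne
  have e1 : ∫⁻ a, ∫⁻ x, ({q : E3 × E3 | dist q.2 q.1 < 1}).indicator
      (fun q => ‖v q.2‖ₑ ^ 2 * κ q.1) (a, x) ≤
      U * ∫⁻ x, κ x := by
    rw [← lintegral_const_mul _ hwm]
    refine lintegral_mono fun a => ?_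
    have : ∀ x, ({q : E3 × E3 | dist q.2 q.1 < 1}).indicator
      (fun q => ‖v q.2‖ₑ ^ 2 * κ q.1) (a, x) =
      (Metric.ball a 1).indicator (fun x => ‖v x‖ₑ ^ 2 * κ a) x := by
      intro x; simp [indicator]
    simp only [this]
    rw [lintegral_indicator Metric.isOpen_ball.measurableSet, lintegral_mul_const'' _ hvm.restrict]
    gcongr
    exact hU a
  rw [lintegral_lintegral_swap] at e1
  · have e2 : ∀ x, ‖v x‖ₑ ^ 2 * κ x * V ≤
        16 * ∫⁻ a, ({q : E3 × E3 | dist q.2 q.1 < 1}).indicator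
        (fun q => ‖v q.2‖ₑ ^ 2 * κ q.1) (a, x) := by
      intro x
      have : ∀ a, ({q : E3 × E3 | dist q.2 q.1 < 1}).indicator
        (fun q => ‖v q.2‖ₑ ^ 2 * κ q.1) (a, x) =
        (Metric.ball x 1).indicator (fun a => ‖v x‖ₑ ^ 2 * κ a) a := by
        intro a; simp [indicator, dist_comm]
      simp only [this]
      rw [lintegral_indicator Metric.isOpen_ball.measurableSet, lintegral_const_mul _ hwm,
        mul_left_comm, mul_assoc]
      refine mul_le_mul_right ?_ _
      have h3 : ∫⁻ a in Metric.ball x 1, κ x = κ x * V := by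
        rw [setLIntegral_const, hV, Measure.addHaar_ball_center]
      rw [← h3, ← lintegral_const_mul _ hwm]
      refine setLIntegral_mono (hwm.const_mul _) fun a ha => ?_
      exact hκ x a (by rw [dist_comm]; exact ha)
    have e3 : (∫⁻ x, ‖v x‖ₑ ^ 2 * κ x) * V ≤
        16 * (U * ∫⁻ x, κ x) := by
      rw [← lintegral_mul_const' _ _ hVt]
      refine (lintegral_mono e2).trans ?_
      rw [lintegral_const_mul' _ _ (by norm_num)]
      gcongr
    calc ∫⁻ x, ‖v x‖ₑ ^ 2 * κ x
        = (∫⁻ x, ‖v x‖ₑ ^ 2 * κ x) * V * V⁻¹ := by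
          rw [mul_assoc, ENNReal.mul_inv_cancel hV0 hVt, mul_one]
      _ ≤ 16 * (U * ∫⁻ x, κ x) * V⁻¹ := by gcongr
      _ = _ := by ring
  · refine AEMeasurable.indicator ?_ hS
    exact (hvm.comp_quasiMeasurePreserving Measure.quasiMeasurePreserving_snd).mul
      (hwm.comp measurable_fst).aemeasurable

/-- The product measure on space-time restricted to `ℝ³ × (0, T)`. -/
noncomputable def slabMeasure (T : EReal) : Measure (E3 × ℝ) :=
  volume.prod (volume.restrict (timeInterval T : Set ℝ))

theorem restrict_slab (T : EReal) :
    (volume : Measure (E3 × ℝ)).restrict (slab T : Set (E3 × ℝ)) = slabMeasure T := by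
  have h : (slab T : Set (E3 × ℝ)) = univ ×ˢ (timeInterval T : Set ℝ) := by
    ext z; simp [slab]
  rw [h, slabMeasure, Measure.volume_eq_prod, ← Measure.prod_restrict, Measure.restrict_univ]

theorem MemL2uloc.meas {T : EReal} {u : E3 → ℝ → E3} (hu : MemL2uloc T u) :
    AEStronglyMeasurable (fun z : E3 × ℝ => u z.1 z.2) (slabMeasure T) := by
  rw [← restrict_slab]; exact hu.1

/-- The dilated weight varies even more slowly when R ≥ 1, so the constant 16 = (1 + 1)⁴ serves all
R. Both sides acquire the same Jacobian R³, hence the bound is uniform in R. -/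
theorem lintegral_weight_smul_le {v : E3 → E3} (hv : AEStronglyMeasurable v volume) {U : ENNReal}
    (hU : ∀ x₀, ∫⁻ x in Metric.ball x₀ 1, ‖v x‖ₑ ^ 2 ≤ U) {R : ℝ} (hR : 1 ≤ R) :
    ∫⁻ x, ‖v (R • x)‖ₑ ^ 2 * ENNReal.ofReal (weight x) ≤
      16 * (volume (Metric.ball (0 : E3) 1))⁻¹ * U * ∫⁻ x, ENNReal.ofReal (weight x) := by
  have hR0 : R ≠ 0 := by positivity
  have hwm : Measurable fun x => ENNReal.ofReal (weight (R⁻¹ • x)) :=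
    (continuous_weight.comp (continuous_const_smul _)).measurable.ennreal_ofReal
  have h1 := lintegral_mul_le_of_slowly_varying hv (κ := fun x => ENNReal.ofReal (weight (R⁻¹ • x)))
    hwm (fun x a hxa => by
      have h4 := weight_add_le (R⁻¹ • a) (R⁻¹ • (x - a))
      rw [← smul_add, add_sub_cancel, norm_smul, Real.norm_of_nonneg (by positivity),
        ← dist_eq_norm] at h4
      have h5 : (1 + R⁻¹ * dist x a) ^ 4 ≤ (1 + 1 * 1) ^ 4 := by
        gcongr
        exact inv_le_one_of_one_le₀ hR
      have hw := (weight_pos (R⁻¹ • a)).le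
      calc ENNReal.ofReal (weight (R⁻¹ • x)) ≤ ENNReal.ofReal (16 * weight (R⁻¹ • a)) :=
            ENNReal.ofReal_le_ofReal (h4.trans (by
              refine (mul_le_mul_of_nonneg_right h5 hw).trans_eq ?_
              norm_num))
        _ = _ := by rw [ENNReal.ofReal_mul (by norm_num)]; norm_num) hU
  have h2 : ∀ F : E3 → ENNReal, ∫⁻ x, F x = ENNReal.ofReal (|R ^ 3|) * ∫⁻ x, F (R • x) := by
    intro F
    have e := Measure.map_addHaar_smul (volume : Measure E3) hR0
    have e1 : ∫⁻ x, F (R • x) = ∫⁻ x, F x ∂(Measure.map (R • ·) volume) :=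
      ((Homeomorph.smulOfNeZero R hR0).toMeasurableEquiv.measurableEmbedding.lintegral_map
        (f := F) (μ := volume)).symm
    rw [e1, e, lintegral_smul_measure, smul_eq_mul, ← mul_assoc, ← ENNReal.ofReal_mul (by positivity)]
    have : |R ^ 3| * |(R ^ Module.finrank ℝ E3)⁻¹| = 1 := by
      rw [finrank_euclideanSpace_fin, ← abs_mul, mul_inv_cancel₀ (by positivity), abs_one]
    rw [this, ENNReal.ofReal_one, one_mul]
  have h3 : ENNReal.ofReal (|R ^ 3|) ≠ 0 := by
    simpa using hR0
  rw [h2, h2 (fun x => ENNReal.ofReal (weight (R⁻¹ • x)))] at h1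
  simp only [inv_smul_smul₀ hR0] at h1
  rw [mul_left_comm] at h1
  exact (ENNReal.mul_le_mul_iff_right h3 ENNReal.ofReal_ne_top).1 h1

/-- Uniformity in R, with one null set of times for all R, is what later allows profiles of
arbitrarily large width. -/
theorem MemL2uloc.exists_slice_smul {T : EReal} {u : E3 → ℝ → E3} (hu : MemL2uloc T u) :
    ∃ C : ℝ, 0 < C ∧ ∀ᵐ t ∂(volume.restrict (timeInterval T : Set ℝ)), ∀ R : ℝ, 1 ≤ R →
      UlocSlice C (fun x => u (R • x) t) := by
  have h1 := hu.meas
  have h2 : ∀ᵐ t ∂(volume.restrict (timeInterval T : Set ℝ)),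
      AEStronglyMeasurable (fun x => u x t) volume := by
    have h3 : AEStronglyMeasurable (fun q : ℝ × E3 => u q.2 q.1)
      ((volume.restrict (timeInterval T : Set ℝ)).prod volume) := h1.prod_swap
    exact h3.prodMk_left
  set U := essSup (fun t : ℝ => ⨆ x₀ : E3,
      eLpNorm (fun x => u x t) 2 (volume.restrict (Metric.ball x₀ 1)))
    (volume.restrict (timeInterval T : Set ℝ)) with hU
  have hUt : U < ⊤ := hu.2
  have hW : ∫⁻ x, ENNReal.ofReal (weight x) < ⊤ := integrable_weight.lintegral_lt_top
  set A : ENNReal := 16 * (volume (Metric.ball (0 : E3) 1))⁻¹ * U ^ 2 *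
    (∫⁻ x, ENNReal.ofReal (weight x)) + ∫⁻ x, ENNReal.ofReal (weight x) with hA
  have hAt : A ≠ ⊤ := by
    have hV0 : volume (Metric.ball (0 : E3) 1) ≠ 0 := (Metric.measure_ball_pos _ _ one_pos).ne'
    refine ENNReal.add_ne_top.2 ⟨ENNReal.mul_ne_top (ENNReal.mul_ne_top (ENNReal.mul_ne_top
      (by norm_num) (ENNReal.inv_ne_top.2 hV0)) (ENNReal.pow_ne_top hUt.ne)) hW.ne, hW.ne⟩
  refine ⟨A.toReal + 1, by positivity, ?_⟩
  filter_upwards [h2, ENNReal.ae_le_essSup (fun t : ℝ => ⨆ x₀ : E3,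
      eLpNorm (fun x => u x t) 2 (volume.restrict (Metric.ball x₀ 1)))] with t ht1 ht2
  have hb : ∀ x₀, ∫⁻ x in Metric.ball x₀ 1, ‖u x t‖ₑ ^ 2 ≤ U ^ 2 := by
    intro x₀
    have h3 := (le_iSup (fun x₀ : E3 =>
      eLpNorm (fun x => u x t) 2 (volume.restrict (Metric.ball x₀ 1))) x₀).trans ht2
    rw [eLpNorm_eq_lintegral_rpow_enorm_toReal (by norm_num) (by norm_num)] at h3
    simp only [ENNReal.toReal_ofNat, one_div] at h3
    have h4 := ENNReal.rpow_le_rpow h3 (show (0 : ℝ) ≤ 2 by norm_num)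
    rw [← ENNReal.rpow_mul] at h4
    norm_num at h4
    exact h4
  intro R hR
  have hR0 : R ≠ 0 := by positivity
  refine ⟨ht1.comp_quasiMeasurePreserving
    (Measure.quasiMeasurePreserving_smul volume hR0), ?_⟩
  have h5 := lintegral_weight_smul_le ht1 hb hR
  have h6 : ∀ x, ENNReal.ofReal ((1 + ‖u (R • x) t‖ ^ 2) * weight x) =
      ‖u (R • x) t‖ₑ ^ 2 * ENNReal.ofReal (weight x) + ENNReal.ofReal (weight x) := by
    intro x
    have hw := (weight_pos x).le
    rw [add_mul, one_mul, ENNReal.ofReal_add hw (by positivity), add_comm,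
      ENNReal.ofReal_mul (by positivity), ENNReal.ofReal_pow (norm_nonneg _), ofReal_norm]
  simp only [h6]
  rw [lintegral_add_right _ continuous_weight.measurable.ennreal_ofReal]
  calc _ ≤ A := by rw [hA]; gcongr
    _ = ENNReal.ofReal A.toReal := (ENNReal.ofReal_toReal hAt).symm
    _ ≤ _ := ENNReal.ofReal_le_ofReal (by linarith)

theorem MemL2uloc.exists_slice {T : EReal} {u : E3 → ℝ → E3} (hu : MemL2uloc T u) :
    ∃ C : ℝ, 0 < C ∧ ∀ᵐ t ∂(volume.restrict (timeInterval T : Set ℝ)),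
      UlocSlice C (fun x => u x t) := by
  obtain ⟨C, hC0, hC⟩ := hu.exists_slice_smul
  exact ⟨C, hC0, hC.mono fun t ht => by simpa using ht 1 le_rfl⟩

theorem UlocSlice.integrable_weight {C : ℝ} {v : E3 → E3} (hv : UlocSlice C v) :
    Integrable (fun x => (1 + ‖v x‖ ^ 2) * weight x) := by
  refine ⟨((aestronglyMeasurable_const.add (hv.meas.norm.pow 2)).mul
    continuous_weight.aestronglyMeasurable), ?_⟩
  rw [hasFiniteIntegral_iff_ofReal]
  · exact hv.bound.trans_lt ENNReal.ofReal_lt_top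
  · exact Eventually.of_forall fun x => mul_nonneg (by positivity) (weight_pos x).le

theorem UlocSlice.integrable {C a : ℝ} {v : E3 → E3} (hv : UlocSlice C v) {F : E3 → ℝ}
    (hF : AEStronglyMeasurable F volume) (h : ∀ x, |F x| ≤ a * ((1 + ‖v x‖ ^ 2) * weight x)) :
    Integrable F :=
  (hv.integrable_weight.const_mul a).mono' hF (Eventually.of_forall h)

theorem UlocSlice.abs_integral_le {C a : ℝ} (hC : 0 ≤ C) (ha : 0 ≤ a) {v : E3 → E3}
    (hv : UlocSlice C v) {F : E3 → ℝ}
    (h : ∀ x, |F x| ≤ a * ((1 + ‖v x‖ ^ 2) * weight x)) : |∫ x, F x| ≤ a * C := by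
  have h1 : ∫ x, (1 + ‖v x‖ ^ 2) * weight x ≤ C := by
    rw [integral_eq_lintegral_of_nonneg_ae
      (Eventually.of_forall fun x => mul_nonneg (by positivity) (weight_pos x).le)
      hv.integrable_weight.aestronglyMeasurable]
    exact ENNReal.toReal_le_of_le_ofReal hC hv.bound
  rw [← Real.norm_eq_abs]
  refine (norm_integral_le_of_norm_le (hv.integrable_weight.const_mul a)
    (Eventually.of_forall h)).trans ?_
  rw [integral_const_mul]
  gcongr

/-- The function dominating all integrands below. -/
noncomputable def dominator (u : E3 → ℝ → E3) (M : ℝ) (z : E3 × ℝ) : ℝ :=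
  ({z : E3 × ℝ | |z.2| ≤ M}).indicator (fun z => (1 + ‖u z.1 z.2‖ ^ 2) * weight z.1) z

/-- The restriction to |t| ≤ M gives a time set of finite measure also for T = ∞; slicewise the
bound is uniform. -/
theorem MemL2uloc.integrable_dominator {T : EReal} {u : E3 → ℝ → E3} (hu : MemL2uloc T u) (M : ℝ) :
    Integrable (dominator u M) (slabMeasure T) := by
  have hS : MeasurableSet {z : E3 × ℝ | |z.2| ≤ M} := measurableSet_le (by fun_prop) measurable_const
  obtain ⟨C, hC0, hC⟩ := hu.exists_slice
  have hm : AEStronglyMeasurable (dominator u M) (slabMeasure T) :=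
    ((aestronglyMeasurable_const.add (hu.meas.norm.pow 2)).mul
      (continuous_weight.comp continuous_fst).aestronglyMeasurable).indicator hS
  have hnn : ∀ z, 0 ≤ dominator u M z := fun z =>
    indicator_nonneg (fun z _ => mul_nonneg (by positivity) (weight_pos _).le) z
  refine ⟨hm, ?_⟩
  rw [hasFiniteIntegral_iff_ofReal (Eventually.of_forall hnn), slabMeasure,
    lintegral_prod_symm _ hm.aemeasurable.ennreal_ofReal]
  have h1 : ∀ᵐ t ∂(volume.restrict (timeInterval T : Set ℝ)),
      ∫⁻ x, ENNReal.ofReal (dominator u M (x, t)) ≤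
        (Icc (-M) M).indicator (fun _ => ENNReal.ofReal C) t := by
    filter_upwards [hC] with t ht
    by_cases h : |t| ≤ M
    · rw [indicator_of_mem (show t ∈ Icc (-M) M from abs_le.1 h)]
      simpa [dominator, indicator, h] using ht.bound
    · simp [dominator, indicator, h]
  refine (lintegral_mono_ae h1).trans_lt ?_
  rw [lintegral_indicator measurableSet_Icc, setLIntegral_const]
  refine ENNReal.mul_lt_top ENNReal.ofReal_lt_top ?_
  refine (Measure.restrict_apply_le _ _).trans_lt ?_
  exact isCompact_Icc.measure_lt_top

theorem Wt.integrable_mul {T : EReal} {u : E3 → ℝ → E3} (hu : MemL2uloc T u) {g : E3 × ℝ → ℝ}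
    (hg : Wt g) {c : E3 × ℝ → ℝ} (hc : AEStronglyMeasurable c (slabMeasure T)) {B : ℝ}
    (hB : ∀ z, |c z| ≤ B * (1 + ‖u z.1 z.2‖ ^ 2)) :
    Integrable (fun z => c z * g z) (slabMeasure T) := by
  obtain ⟨C, M, hC0, hC, hM⟩ := hg.bound
  refine ((hu.integrable_dominator M).const_mul (B * C)).mono'
    (hc.mul hg.meas.aestronglyMeasurable) (Eventually.of_forall fun z => ?_)
  have hB0 : 0 ≤ B * (1 + ‖u z.1 z.2‖ ^ 2) := (abs_nonneg _).trans (hB z)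
  by_cases h : |z.2| ≤ M
  · rw [dominator, indicator_of_mem (by exact h), norm_mul, Real.norm_eq_abs, Real.norm_eq_abs]
    calc |c z| * |g z| ≤ (B * (1 + ‖u z.1 z.2‖ ^ 2)) * (C * weight z.1) := by
          gcongr
          · exact hB z
          · exact hC z
      _ = _ := by ring
  · rw [hM z (not_le.1 h), dominator, indicator_of_notMem (by exact h)]
    simp

theorem abs_coord_le (v : E3) (k : Fin 3) : |v k| ≤ 1 + ‖v‖ ^ 2 := by
  have : |v k| ≤ ‖v‖ := by simpa using PiLp.norm_apply_le v k
  nlinarith [sq_nonneg (‖v‖ - 1), norm_nonneg v]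

theorem abs_coord_mul_le (v : E3) (i j : Fin 3) : |v i * v j| ≤ 1 + ‖v‖ ^ 2 := by
  have h1 : |v i| ≤ ‖v‖ := by simpa using PiLp.norm_apply_le v i
  have h2 : |v j| ≤ ‖v‖ := by simpa using PiLp.norm_apply_le v j
  rw [abs_mul]
  calc |v i| * |v j| ≤ ‖v‖ * ‖v‖ := by gcongr
    _ ≤ _ := by nlinarith

theorem aestronglyMeasurable_coord {α : Type*} [MeasurableSpace α] {μ : Measure α} {v : α → E3}
    (hv : AEStronglyMeasurable v μ) (k : Fin 3) : AEStronglyMeasurable (fun z => v z k) μ :=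
  (EuclideanSpace.proj (𝕜 := ℝ) k).continuous.comp_aestronglyMeasurable hv

theorem Wt.integrable_coord {T : EReal} {u : E3 → ℝ → E3} (hu : MemL2uloc T u) {g : E3 × ℝ → ℝ}
    (hg : Wt g) (k : Fin 3) : Integrable (fun z => u z.1 z.2 k * g z) (slabMeasure T) :=
  hg.integrable_mul hu (aestronglyMeasurable_coord hu.meas k) (B := 1) fun z => by
    rw [one_mul]; exact abs_coord_le _ _

theorem Wt.integrable_coord_mul {T : EReal} {u : E3 → ℝ → E3} (hu : MemL2uloc T u)
    {g : E3 × ℝ → ℝ} (hg : Wt g) (i j : Fin 3) :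
    Integrable (fun z => u z.1 z.2 i * u z.1 z.2 j * g z) (slabMeasure T) :=
  hg.integrable_mul hu ((aestronglyMeasurable_coord hu.meas i).mul
    (aestronglyMeasurable_coord hu.meas j)) (B := 1) fun z => by
    rw [one_mul]; exact abs_coord_mul_le _ _ _

theorem integral_slab {T : EReal} {F : E3 × ℝ → ℝ} (hF : Integrable F (slabMeasure T)) :
    ∫ t in (timeInterval T : Set ℝ), ∫ x, F (x, t) = ∫ z, F z ∂(slabMeasure T) :=
  (integral_prod_symm F hF).symm

/-! ### The pressure distribution built from Riesz transforms. -/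

theorem isTest_coe {Ω : TopologicalSpace.Opens (E3 × ℝ)} (ψ : 𝓓(Ω, ℝ)) : IsTest ψ :=
  ⟨ψ.contDiff, ψ.hasCompactSupport⟩

theorem coe_lineDeriv {Ω : TopologicalSpace.Opens (E3 × ℝ)} (v : E3 × ℝ) (ψ : 𝓓(Ω, ℝ)) :
    ((∂_{v} ψ : 𝓓(Ω, ℝ)) : E3 × ℝ → ℝ) = D v ψ := by
  funext z
  rw [TestFunction.lineDerivOp_eq_lineDerivCLM ℝ, TestFunction.lineDerivCLM_apply_of_le (by simp),
    ((isTest_coe ψ).differentiable z).lineDeriv_eq_fderiv]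
  rfl

theorem tsupport_D_subset (f : E3 × ℝ → ℝ) (v : E3 × ℝ) : tsupport (D v f) ⊆ tsupport f :=
  tsupport_fderiv_apply_subset ℝ v

/-- The quadratic expression `u_i u_j R_i R_j g`. -/
noncomputable def quad (u : E3 → ℝ → E3) (g : E3 × ℝ → ℝ) (z : E3 × ℝ) : ℝ :=
  ∑ i : Fin 3, ∑ j : Fin 3, u z.1 z.2 i * u z.1 z.2 j * RR i j g z

theorem integrable_quad {T : EReal} {u : E3 → ℝ → E3} (hu : MemL2uloc T u) {f : E3 × ℝ → ℝ}
    (hf : IsTest f) (h0 : ∀ t, mass f t = 0) : Integrable (quad u f) (slabMeasure T) :=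
  integrable_finsetSum _ fun i _ => integrable_finsetSum _ fun j _ =>
    (wt_RR hf h0 i j).integrable_coord_mul hu i j

/-- A smooth function of integral one with compact support. -/
noncomputable def rho (x : E3) : ℝ := bumpOne.normed volume x

theorem contDiff_rho : ContDiff ℝ ∞ rho := bumpOne.contDiff_normed

theorem hasCompactSupport_rho : HasCompactSupport rho := bumpOne.hasCompactSupport_normed

theorem integral_rho : ∫ x, rho x = 1 := bumpOne.integral_normed

theorem isTest_rho_mul {h : ℝ → ℝ} (hh : ContDiff ℝ ∞ h) (hc : HasCompactSupport h) :
    IsTest (fun z : E3 × ℝ => rho z.1 * h z.2) := by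
  refine ⟨(contDiff_rho.comp contDiff_fst).mul (hh.comp contDiff_snd), ?_⟩
  refine HasCompactSupport.intro (hasCompactSupport_rho.isCompact.prod hc.isCompact) fun z hz => ?_
  by_contra h0
  exact hz ⟨subset_tsupport _ (left_ne_zero_of_mul h0), subset_tsupport _ (right_ne_zero_of_mul h0)⟩

theorem hasCompactSupport_mass {f : E3 × ℝ → ℝ} (hf : IsTest f) : HasCompactSupport (mass f) := by
  obtain ⟨M, -, hM⟩ := hf.exists_support_bound
  refine HasCompactSupport.intro (isCompact_Icc (a := -M) (b := M)) fun t ht => ?_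
  exact mass_eq_zero_of_support hM (not_le.1 fun h => ht (abs_le.1 h))

theorem tsupport_mass_subset {f : E3 × ℝ → ℝ} (hf : IsTest f) :
    tsupport (mass f) ⊆ Prod.snd '' tsupport f := by
  refine closure_minimal (fun t ht => ?_) (hf.compact.isCompact.image continuous_snd).isClosed
  by_contra h
  refine ht (integral_eq_zero_of_ae (Eventually.of_forall fun y => ?_))
  by_contra h1
  exact h ⟨_, subset_tsupport _ h1, rfl⟩

theorem mass_rho_mul (h : ℝ → ℝ) (t : ℝ) : mass (fun z : E3 × ℝ => rho z.1 * h z.2) t = h t := by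
  simp [mass, integral_mul_const, integral_rho]

/-- Subtract a multiple of `rho` on each slice, so that the slices have integral zero. -/
noncomputable def centered (f : E3 × ℝ → ℝ) (z : E3 × ℝ) : ℝ := f z - rho z.1 * mass f z.2

theorem IsTest.rho_mass {f : E3 × ℝ → ℝ} (hf : IsTest f) :
    IsTest (fun z : E3 × ℝ => rho z.1 * mass f z.2) :=
  isTest_rho_mul (contDiff_mass hf) (hasCompactSupport_mass hf)

theorem IsTest.centered {f : E3 × ℝ → ℝ} (hf : IsTest f) : IsTest (centered f) := hf.sub hf.rho_mass

theorem mass_centered {f : E3 × ℝ → ℝ} (hf : IsTest f) (t : ℝ) : mass (centered f) t = 0 := by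
  have h : mass (centered f) t = mass f t - mass (fun z : E3 × ℝ => rho z.1 * mass f z.2) t :=
    integral_sub (hf.slice_integrable t) (hf.rho_mass.slice_integrable t)
  rw [h, mass_rho_mul, sub_self]

theorem centered_of_mass_zero {f : E3 × ℝ → ℝ} (h : ∀ t, mass f t = 0) : centered f = f := by
  funext z; simp [centered, h]

theorem rieszRR_const_mul {f : E3 → ℝ} (hf : ContDiff ℝ ∞ f) (hc : HasCompactSupport f) (c : ℝ)
    (i j : Fin 3) (x : E3) : rieszRR i j (fun y => f y * c) x = rieszRR i j f x * c := by
  rw [rieszRR_eq_gradNewton hf hc, rieszRR_eq_gradNewton (hf.mul contDiff_const) hc.mul_right,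
    ← integral_mul_const]
  congr 1
  funext y
  rw [fderiv_mul_const ((hf.differentiable (by simp)) _)]
  simp only [smul_apply, smul_eq_mul]
  ring

theorem RR_rho_mul (h : ℝ → ℝ) (i j : Fin 3) (z : E3 × ℝ) :
    RR i j (fun z => rho z.1 * h z.2) z = rieszRR i j rho z.1 * h z.2 :=
  rieszRR_const_mul contDiff_rho hasCompactSupport_rho _ i j _

theorem RR_centered {f : E3 × ℝ → ℝ} (hf : IsTest f) (i j : Fin 3) (z : E3 × ℝ) :
    RR i j (centered f) z = RR i j f z - rieszRR i j rho z.1 * mass f z.2 := by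
  rw [← RR_rho_mul]
  exact RR_sub hf hf.rho_mass i j z

/-- Exhibits `rho` as a time slice of a space-time test function, so that the estimates for the
latter carry over. -/
theorem rieszRR_rho_eq : ∃ f : E3 × ℝ → ℝ, IsTest f ∧ mass f 0 = 1 ∧
    ∀ i j x, rieszRR i j rho x = RR i j f (x, 0) := by
  let b : ContDiffBump (0 : ℝ) := ⟨1, 2, one_pos, one_lt_two⟩
  have hb : b 0 = 1 := b.one_of_mem_closedBall (by simp [b.rIn_pos.le])
  refine ⟨fun z => rho z.1 * b z.2, isTest_rho_mul b.contDiff b.hasCompactSupport, ?_, ?_⟩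
  · rw [mass_rho_mul, hb]
  · intro i j x
    rw [RR_rho_mul, hb, mul_one]

theorem exists_rieszRR_rho_sub_le : ∃ C : ℝ, 0 < C ∧
    ∀ i j x, |rieszRR i j rho x - kernelFar 1 i j x| ≤ C * weight x := by
  obtain ⟨f, hf, h0, h1⟩ := rieszRR_rho_eq
  obtain ⟨C, hC0, hC⟩ := exists_RR_sub_kernelFar_le hf
  refine ⟨C, hC0, fun i j x => ?_⟩
  have := hC i j (x, 0)
  simpa only [h0, mul_one, ← h1] using this

theorem measurable_rieszRR_rho (i j : Fin 3) : Measurable (rieszRR i j rho) := by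
  obtain ⟨f, hf, -, h1⟩ := rieszRR_rho_eq
  have : rieszRR i j rho = fun x => RR i j f (x, 0) := funext (h1 i j)
  rw [this]
  exact ((contDiff_RR hf i j).continuous.comp (by fun_prop : Continuous fun x : E3 => (x, (0 : ℝ)))).measurable

/-- R_i R_j f and R_i R_j `rho` times the mass of f have the same leading term at infinity, which
cancels. The bound is linear in the suprema of f and its second derivatives, as continuity of the
pressure distribution requires. -/
theorem RR_centered_le {M : ℝ} (hM : 0 ≤ M) : ∃ C : ℝ, 0 < C ∧ ∀ (i j : Fin 3)
    (f : E3 × ℝ → ℝ) (a : ℝ), IsTest f → (∀ z, f z ≠ 0 → ‖z.1‖ ≤ M) → (∀ z, |f z| ≤ a) →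
    (∀ z, |D (ex j) (D (ex i) f) z| ≤ a) →
    ∀ z, |RR i j (centered f) z| ≤ C * a * weight z.1 := by
  obtain ⟨C1, h10, h1⟩ := RR_sub_kernelFar_le hM
  obtain ⟨C2, h20, h2⟩ := exists_rieszRR_rho_sub_le
  set V := volume.real (Metric.closedBall (0 : E3) M) with hV
  have hV0 : 0 ≤ V := measureReal_nonneg
  refine ⟨C1 + C2 * V, by positivity, fun i j f a hf hs ha hda z => ?_⟩
  have hw := (weight_pos z.1).le
  have e1 := h1 i j f a hf hs ha hda z
  have e2 := h2 i j z.1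
  have e3 : |mass f z.2| ≤ a * V := integral_le_of_supported (fun y hy => by
      by_contra h
      exact absurd (hs _ h) (not_le.2 hy)) fun y _ => ha _
  have e4 : RR i j (centered f) z = (RR i j f z - kernelFar 1 i j z.1 * ∫ y, f (y, z.2)) -
      (rieszRR i j rho z.1 - kernelFar 1 i j z.1) * mass f z.2 := by
    rw [RR_centered hf, mass]; ring
  rw [e4]
  refine (abs_sub _ _).trans ?_
  rw [abs_mul]
  calc _ ≤ C1 * a * weight z.1 + (C2 * weight z.1) * (a * V) := by gcongr
    _ = _ := by ring

theorem centered_add {f g : E3 × ℝ → ℝ} (hf : IsTest f) (hg : IsTest g) :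
    centered (fun z => f z + g z) = fun z => centered f z + centered g z := by
  funext z
  have : mass (fun z => f z + g z) z.2 = mass f z.2 + mass g z.2 :=
    integral_add (hf.slice_integrable z.2) (hg.slice_integrable z.2)
  simp only [centered, this]; ring

theorem centered_const_mul (c : ℝ) (f : E3 × ℝ → ℝ) :
    centered (fun z => c * f z) = fun z => c * centered f z := by
  funext z
  have : mass (fun z => c * f z) z.2 = c * mass f z.2 := integral_const_mul _ _
  simp only [centered, this]; ring

theorem quad_add (u : E3 → ℝ → E3) {f g : E3 × ℝ → ℝ} (hf : IsTest f) (hg : IsTest g)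
    (z : E3 × ℝ) : quad u (fun z => f z + g z) z = quad u f z + quad u g z := by
  simp only [quad, RR_add hf hg, mul_add, Finset.sum_add_distrib]

theorem quad_const_mul (u : E3 → ℝ → E3) {f : E3 × ℝ → ℝ} (hf : IsTest f) (c : ℝ)
    (z : E3 × ℝ) : quad u (fun z => c * f z) z = c * quad u f z := by
  simp only [quad, RR_const_mul c hf, Finset.mul_sum]
  refine Finset.sum_congr rfl fun i _ => Finset.sum_congr rfl fun j _ => ?_
  ring

theorem quad_sub (u : E3 → ℝ → E3) {f g : E3 × ℝ → ℝ} (hf : IsTest f) (hg : IsTest g)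
    (z : E3 × ℝ) : quad u (fun z => f z - g z) z = quad u f z - quad u g z := by
  simp only [quad, RR_sub hf hg, mul_sub, Finset.sum_sub_distrib]

theorem abs_quad_le (u : E3 → ℝ → E3) {f : E3 × ℝ → ℝ} {b : ℝ} {z : E3 × ℝ}
    (hb : ∀ i j, |RR i j f z| ≤ b) : |quad u f z| ≤ 9 * b * (1 + ‖u z.1 z.2‖ ^ 2) := by
  have hb0 : 0 ≤ b := (abs_nonneg _).trans (hb 0 0)
  have h : ∀ i j, |u z.1 z.2 i * u z.1 z.2 j * RR i j f z| ≤ (1 + ‖u z.1 z.2‖ ^ 2) * b := by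
    intro i j
    rw [abs_mul]
    exact mul_le_mul (abs_coord_mul_le _ _ _) (hb i j) (abs_nonneg _) (by positivity)
  refine (Finset.abs_sum_le_sum_abs _ _).trans ?_
  calc _ ≤ ∑ i : Fin 3, ∑ j : Fin 3, (1 + ‖u z.1 z.2‖ ^ 2) * b :=
        Finset.sum_le_sum fun i _ => (Finset.abs_sum_le_sum_abs _ _).trans
          (Finset.sum_le_sum fun j _ => h i j)
    _ = _ := by simp; ring

/-- Continuity of a linear functional on test functions is checked on each space of functions
supported in a fixed compact set. -/
theorem continuous_pressure_on {T : EReal} {u : E3 → ℝ → E3} (hu : MemL2uloc T u)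
    (K : TopologicalSpace.Compacts (E3 × ℝ)) (hK : (K : Set (E3 × ℝ)) ⊆ slab T) :
    Continuous ((fun ψ : 𝓓(slab T, ℝ) => ∫ z, quad u (centered ψ) z ∂(slabMeasure T)) ∘
      TestFunction.ofSupportedIn hK) := by
  have ht : ∀ f : 𝓓_{K}(E3 × ℝ, ℝ), IsTest f := fun f => ⟨f.contDiff, f.compact_supp⟩
  obtain ⟨M0, hM0⟩ := K.isCompact.isBounded.exists_norm_le
  set M := max M0 0 with hM
  have hsupp : ∀ (f : 𝓓_{K}(E3 × ℝ, ℝ)) z, f z ≠ 0 → ‖z.1‖ ≤ M ∧ |z.2| ≤ M := by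
    intro f z hz
    have h1 := (hM0 z (f.support_subset hz)).trans (le_max_left M0 0)
    exact ⟨(norm_fst_le z).trans h1, (norm_snd_le z).trans h1⟩
  obtain ⟨C, hC0, hC⟩ := RR_centered_le (M := M) (le_max_right _ _)
  set I := ∫ z, dominator u M z ∂(slabMeasure T) with hI
  have hI0 : 0 ≤ I := integral_nonneg fun z =>
    indicator_nonneg (fun z _ => mul_nonneg (by positivity) (weight_pos _).le) z
  let L := ContDiffMapSupportedIn.mkCLMtoNormedSpace (𝕜 := ℝ) (n := ⊤) (K := K)
    (fun f : 𝓓_{K}(E3 × ℝ, ℝ) => ∫ z, quad u (centered f) z ∂(slabMeasure T))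
    (fun f g => by
      rw [← integral_add (integrable_quad hu (ht f).centered (mass_centered (ht f)))
        (integrable_quad hu (ht g).centered (mass_centered (ht g)))]
      congr 1
      funext z
      rw [← quad_add u (ht f).centered (ht g).centered, ← centered_add (ht f) (ht g)]
      rfl)
    (fun c f => by
      rw [smul_eq_mul, ← integral_const_mul]
      congr 1
      funext z
      rw [← quad_const_mul u (ht f).centered, ← centered_const_mul]
      rfl)
    -- Only the seminorms of orders 0 and 2 enter the bound on R_i R_j of a centered function; 9
    -- counts the index pairs.
    ⟨{0, 2}, 2 * (9 * C * I), by positivity, fun f => by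
      set N := (({0, 2} : Finset ℕ).sup fun i => N[ℝ]_{K, ⊤, i}) f with hN
      have hN0 : ∀ i ∈ ({0, 2} : Finset ℕ), N[ℝ]_{K, ⊤, i} f ≤ N := fun i hi =>
        (Finset.le_sup (f := fun i => N[ℝ]_{K, ⊤, i}) hi) f
      have hNnn : 0 ≤ N := apply_nonneg _ _
      have hf0 : ∀ z, |f z| ≤ N := fun z =>
        (ContDiffMapSupportedIn.norm_apply_le_seminorm ℝ).trans (hN0 0 (by simp))
      have hf2 : ∀ i j z, |D (ex j) (D (ex i) f) z| ≤ N := by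
        intro i j z
        have h1 := (ContDiffMapSupportedIn.norm_iteratedFDeriv_apply_le_seminorm_top ℝ
          (f := f) (i := 2) (x := z)).trans (hN0 2 (by simp))
        have h2 := (iteratedFDeriv ℝ 2 f z).le_opNorm ![ex j, ex i]
        have hn : ∀ k, ‖ex k‖ = 1 := by intro k; simp [ex, Prod.norm_def]
        rw [iteratedFDeriv_two_apply] at h2
        simp only [Fin.prod_univ_two, Matrix.cons_val_zero, Matrix.cons_val_one, hn, mul_one] at h2
        rw [D_D_eq (ht f).contDiff]
        exact h2.trans h1
      have hq : ∀ z, |quad u (centered f) z| ≤ 9 * C * N * dominator u M z := by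
        intro z
        by_cases hz : |z.2| ≤ M
        · rw [dominator, indicator_of_mem (by exact hz)]
          refine (abs_quad_le u fun i j => hC i j f N (ht f) (fun z hz => (hsupp f z hz).1) hf0
            (hf2 i j) z).trans_eq ?_
          ring
        · have h0 : ∀ y, f (y, z.2) = 0 := fun y => by
            by_contra h
            exact hz (hsupp f _ h).2
          have h1 : ∀ i j, RR i j (centered f) z = 0 := fun i j =>
            RR_eq_zero_of_slice (fun y => by simp [centered, mass, h0]) i j
          rw [dominator, indicator_of_notMem (by exact hz)]
          simp [quad, h1]
      have := norm_integral_le_of_norm_le (f := quad u (centered f)) ((hu.integrable_dominator M).const_mul (9 * C * N))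
        (Eventually.of_forall hq)
      rw [integral_const_mul, ← hI] at this
      refine this.trans ?_
      have : 0 ≤ C * N * I := by positivity
      linarith⟩
  exact L.continuous

/-- The pressure distribution determined by the Riesz transforms of `u ⊗ u`, normalized by
`⟨p, rho⟩ = 0`. -/
noncomputable def rieszPressure {T : EReal} {u : E3 → ℝ → E3} (hu : MemL2uloc T u) :
    𝓓'(slab T, ℝ) :=
  TestFunction.mkCLM ℝ (fun ψ : 𝓓(slab T, ℝ) => ∫ z, quad u (centered ψ) z ∂(slabMeasure T))
    (fun f g => by
      rw [← integral_add (integrable_quad hu (isTest_coe f).centered (mass_centered (isTest_coe f)))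
        (integrable_quad hu (isTest_coe g).centered (mass_centered (isTest_coe g)))]
      congr 1
      funext z
      rw [← quad_add u (isTest_coe f).centered (isTest_coe g).centered,
        ← centered_add (isTest_coe f) (isTest_coe g)]
      rfl)
    (fun c f => by
      rw [smul_eq_mul, ← integral_const_mul]
      congr 1
      funext z
      rw [← quad_const_mul u (isTest_coe f).centered, ← centered_const_mul]
      rfl)
    (continuous_pressure_on hu)

theorem rieszPressure_apply {T : EReal} {u : E3 → ℝ → E3} (hu : MemL2uloc T u)
    (ψ : 𝓓(slab T, ℝ)) :
    rieszPressure hu ψ = ∫ z, quad u (centered ψ) z ∂(slabMeasure T) := rfl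

/-! ### The local pressure expansion for the Riesz pressure. -/

theorem weight_le_inv_pow_three (x : E3) : weight x ≤ (1 + ‖x‖)⁻¹ ^ 3 := by
  unfold weight
  rw [inv_pow, ← Real.rpow_natCast, ← Real.rpow_neg (by positivity)]
  exact Real.rpow_le_rpow_of_exponent_le (by linarith [norm_nonneg x]) (by norm_num)

theorem exists_RR_le {f : E3 × ℝ → ℝ} (hf : IsTest f) : ∃ C : ℝ, 0 < C ∧
    ∀ i j z, |RR i j f z| ≤ C * (1 + ‖z.1‖)⁻¹ ^ 3 := by
  obtain ⟨C1, h10, h1⟩ := exists_RR_sub_kernelFar_le hf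
  obtain ⟨C2, h20, h2⟩ := exists_kernelFar_le
  obtain ⟨C3, hC3⟩ := (contDiff_mass hf).continuous.bounded_above_of_compact_support
    (hasCompactSupport_mass hf)
  refine ⟨C1 + C2 * max C3 1, by positivity, fun i j z => ?_⟩
  have e1 := h1 i j z
  have e2 := h2 i j z.1
  have e3 := (hC3 z.2).trans (le_max_left C3 1)
  rw [Real.norm_eq_abs] at e3
  have e4 : RR i j f z = (RR i j f z - kernelFar 1 i j z.1 * mass f z.2) +
    kernelFar 1 i j z.1 * mass f z.2 := by ring
  rw [e4]
  refine (abs_add_le _ _).trans ?_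
  rw [abs_mul]
  calc _ ≤ C1 * (1 + ‖z.1‖)⁻¹ ^ 3 + (C2 * (1 + ‖z.1‖)⁻¹ ^ 3) * max C3 1 := by
        gcongr
        exact e1.trans (by gcongr; exact weight_le_inv_pow_three _)
    _ = _ := by ring

theorem inv_one_add_norm_pow_le_one (x : E3) (n : ℕ) : (1 + ‖x‖)⁻¹ ^ n ≤ 1 :=
  pow_le_one₀ (by positivity) (inv_le_one_of_one_le₀ (by linarith [norm_nonneg x]))

theorem exists_kernelK_sub_kernelFar_le {r : ℝ} (hr : 0 < r) : ∃ C : ℝ, 0 < C ∧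
    ∀ i j z, r ≤ ‖z‖ → |kernelK i j z - kernelFar 1 i j z| ≤ C * weight z := by
  obtain ⟨C0, h00, h0⟩ := exists_kernelFar_le
  refine ⟨(r⁻¹ ^ 3 + C0) * (1 + 2) ^ 4, by positivity, fun i j z hz => ?_⟩
  have hw := (weight_pos z).le
  by_cases h2 : 2 < ‖z‖
  · rw [(kernelFar_eventuallyEq h2 i j).eq_of_nhds, sub_self, abs_zero]
    positivity
  · have h3 := one_le_weight (not_lt.1 h2)
    have h4 : |kernelK i j z| ≤ r⁻¹ ^ 3 := (norm_kernelK_le i j z).trans (by gcongr)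
    have h5 : |kernelFar 1 i j z| ≤ C0 := (h0 i j z).trans
      (mul_le_of_le_one_right h00.le (inv_one_add_norm_pow_le_one z 3))
    calc _ ≤ r⁻¹ ^ 3 + C0 := (abs_sub _ _).trans (add_le_add h4 h5)
      _ ≤ (r⁻¹ ^ 3 + C0) * ((1 + 2) ^ 4 * weight z) := le_mul_of_one_le_right (by positivity) h3
      _ = _ := by ring

theorem weight_neg (x : E3) : weight (-x) = weight x := by simp [weight]

theorem weight_sub_le (a y : E3) : weight (a - y) ≤ (1 + ‖a‖) ^ 4 * weight y := by
  have := weight_add_le (-y) a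
  rwa [weight_neg, neg_add_eq_sub] at this

/-- If |x - x₀| < R and |x₀ - y| ≥ 2R, then both arguments stay at distance R or more from the
singularity. There K may be replaced by the smooth kernel at the cost of a multiple of the weight,
and differences of the smooth kernel gain one order of decay. -/
theorem exists_kernelK_diff_le {R : ℝ} (hR : 0 < R) (x₀ : E3) : ∃ C : ℝ, 0 < C ∧
    ∀ i j x y, ‖x - x₀‖ < R → 2 * R ≤ ‖x₀ - y‖ →
      |kernelK i j (x - y) - kernelK i j (x₀ - y)| ≤ C * weight y := by
  obtain ⟨C1, h10, h1⟩ := exists_kernelK_sub_kernelFar_le hR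
  obtain ⟨C2, h20, h2⟩ := kernelFar_sub_le
  refine ⟨C1 * (1 + (‖x₀‖ + R)) ^ 4 + C1 * (1 + ‖x₀‖) ^ 4 +
    C2 * (1 + R) ^ 5 * (1 + ‖x₀‖) ^ 4, by positivity, fun i j x y hx hy => ?_⟩
  have hw := (weight_pos y).le
  have hxy : R ≤ ‖x - y‖ := by
    have : ‖x₀ - y‖ ≤ ‖x - y‖ + ‖x - x₀‖ := by
      calc ‖x₀ - y‖ = ‖(x - y) - (x - x₀)‖ := by congr 1; abel
        _ ≤ _ := norm_sub_le _ _
    linarith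
  have hxn : ‖x‖ ≤ ‖x₀‖ + R := by
    calc ‖x‖ = ‖x₀ + (x - x₀)‖ := by congr 1; abel
      _ ≤ _ := (norm_add_le _ _).trans (by linarith)
  have e1 := h1 i j (x - y) hxy
  have e2 := h1 i j (x₀ - y) (by linarith)
  have e3 := h2 i j 1 le_rfl (x₀ - y) (x₀ - x)
  rw [show x₀ - y - (x₀ - x) = x - y by abel, Real.one_rpow, mul_one, norm_sub_rev] at e3
  have e1' : |kernelK i j (x - y) - kernelFar 1 i j (x - y)| ≤
      C1 * ((1 + (‖x₀‖ + R)) ^ 4 * weight y) := e1.trans (by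
    gcongr
    exact (weight_sub_le x y).trans (by gcongr))
  have e2' : |kernelK i j (x₀ - y) - kernelFar 1 i j (x₀ - y)| ≤
      C1 * ((1 + ‖x₀‖) ^ 4 * weight y) := e2.trans (by
    gcongr
    exact weight_sub_le x₀ y)
  have e3' : |kernelFar 1 i j (x - y) - kernelFar 1 i j (x₀ - y)| ≤
      C2 * (1 + R) ^ 5 * ((1 + ‖x₀‖) ^ 4 * weight y) := e3.trans (by
    have := (weight_pos (x₀ - y)).le
    refine mul_le_mul ?_ (weight_sub_le x₀ y) this (by positivity)
    gcongr)
  have e4 : kernelK i j (x - y) - kernelK i j (x₀ - y) =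
      (kernelK i j (x - y) - kernelFar 1 i j (x - y)) -
      (kernelK i j (x₀ - y) - kernelFar 1 i j (x₀ - y)) +
      (kernelFar 1 i j (x - y) - kernelFar 1 i j (x₀ - y)) := by ring
  rw [e4]
  refine (abs_add_le _ _).trans ((add_le_add (abs_sub _ _) le_rfl).trans ?_)
  calc _ ≤ _ := add_le_add (add_le_add e1' e2') e3'
    _ = _ := by ring

theorem IsCutoff.exists_bound {Θ : E3 → ℝ} (hΘ : IsCutoff Θ) : ∃ B : ℝ, 0 < B ∧ ∀ x, |Θ x| ≤ B := by
  have hc : HasCompactSupport Θ := HasCompactSupport.of_support_subset_isCompact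
    (isCompact_closedBall (0 : E3) 4)
    ((subset_tsupport Θ).trans (hΘ.tsupport_subset.trans Metric.ball_subset_closedBall))
  obtain ⟨C, hC⟩ := hΘ.smooth.continuous.bounded_above_of_compact_support hc
  exact ⟨max C 1, by positivity, fun z => (hC z).trans (le_max_left _ _)⟩

theorem IsCutoff.cutoffR_eq_one {Θ : E3 → ℝ} (hΘ : IsCutoff Θ) {R : ℝ} (hR : 0 < R) {x : E3}
    (hx : ‖x‖ < 2 * R) : cutoffR Θ R x = 1 := by
  refine hΘ.eq_one _ ?_
  rw [mem_ball_zero_iff, norm_smul, norm_inv, Real.norm_of_nonneg hR.le, inv_mul_lt_iff₀ hR]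
  linarith

theorem IsCutoff.cutoffR_eq_zero {Θ : E3 → ℝ} (hΘ : IsCutoff Θ) {R : ℝ} (hR : 0 < R) {x : E3}
    (hx : 4 * R ≤ ‖x‖) : cutoffR Θ R x = 0 := by
  by_contra h
  have h1 := hΘ.tsupport_subset (subset_tsupport _ h)
  rw [mem_ball_zero_iff, norm_smul, norm_inv, Real.norm_of_nonneg hR.le, inv_mul_lt_iff₀ hR] at h1
  linarith

theorem IsCutoff.continuous_cutoffR {Θ : E3 → ℝ} (hΘ : IsCutoff Θ) (R : ℝ) : Continuous (cutoffR Θ R) :=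
  hΘ.smooth.continuous.comp (continuous_const_smul _)

/-- The kernel of the constant by which the two normalizations of the pressure differ. -/
noncomputable def constKernel (Θ : E3 → ℝ) (R : ℝ) (x₀ : E3) (i j : Fin 3) (y : E3) : ℝ :=
  (1 - cutoffR Θ R (x₀ - y)) * kernelK i j (x₀ - y) - rieszRR i j rho y

theorem measurable_constKernel {Θ : E3 → ℝ} (hΘ : IsCutoff Θ) (R : ℝ) (x₀ : E3) (i j : Fin 3) :
    Measurable (constKernel Θ R x₀ i j) := by
  have h1 : Measurable fun y => cutoffR Θ R (x₀ - y) :=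
    (hΘ.continuous_cutoffR R).measurable.comp (by fun_prop)
  have h2 : Measurable fun y => kernelK i j (x₀ - y) := (measurable_kernelK i j).comp (by fun_prop)
  exact ((measurable_const.sub h1).mul h2).sub (measurable_rieszRR_rho i j)

theorem one_sub_cutoff_mul_kernelK_le {Θ : E3 → ℝ} (hΘ : IsCutoff Θ) {R : ℝ} (hR : 0 < R)
    {B : ℝ} (hB : ∀ x, |Θ x| ≤ B) (i j : Fin 3) (z : E3) :
    |(1 - cutoffR Θ R z) * kernelK i j z| ≤ (1 + B) * (2 * R)⁻¹ ^ 3 := by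
  have hB0 : 0 ≤ B := (abs_nonneg _).trans (hB 0)
  by_cases hz : ‖z‖ < 2 * R
  · rw [hΘ.cutoffR_eq_one hR hz, sub_self, zero_mul, abs_zero]
    positivity
  · rw [abs_mul]
    refine mul_le_mul ((abs_sub _ _).trans ?_) ((norm_kernelK_le i j z).trans ?_) (abs_nonneg _)
      (by positivity)
    · rw [abs_one]
      gcongr
      exact hB _
    · gcongr
      exact not_lt.1 hz

/-- Both terms behave like K at infinity, so their difference decays one order better. For |x₀ - y|
≤ 4R boundedness suffices. -/
theorem exists_constKernel_le {Θ : E3 → ℝ} (hΘ : IsCutoff Θ) {R : ℝ} (hR : 0 < R) (x₀ : E3) :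
    ∃ C : ℝ, 0 < C ∧ ∀ i j y, |constKernel Θ R x₀ i j y| ≤ C * weight y := by
  obtain ⟨B, hB0, hB⟩ := hΘ.exists_bound
  obtain ⟨C1, h10, h1⟩ := exists_rieszRR_rho_sub_le
  obtain ⟨C2, h20, h2⟩ := exists_kernelFar_le
  obtain ⟨C3, h30, h3⟩ := exists_kernelK_sub_kernelFar_le hR
  obtain ⟨C4, h40, h4⟩ := kernelFar_sub_le
  refine ⟨((1 + B) * (2 * R)⁻¹ ^ 3 + (C1 + C2)) * (1 + (‖x₀‖ + 4 * R)) ^ 4 +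
    (C3 * (1 + ‖x₀‖) ^ 4 + C4 * (1 + ‖x₀‖) ^ 5 + C1), by positivity, fun i j y => ?_⟩
  have hw := (weight_pos y).le
  by_cases hy : ‖x₀ - y‖ ≤ 4 * R
  · have hyn : ‖y‖ ≤ ‖x₀‖ + 4 * R := by
      calc ‖y‖ = ‖x₀ - (x₀ - y)‖ := by congr 1; abel
        _ ≤ _ := (norm_sub_le _ _).trans (by linarith)
    have e1 := one_sub_cutoff_mul_kernelK_le hΘ hR hB i j (x₀ - y)
    have e2 : |rieszRR i j rho y| ≤ C1 + C2 := by
      have e4 : rieszRR i j rho y = (rieszRR i j rho y - kernelFar 1 i j y) + kernelFar 1 i j y := by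
        ring
      rw [e4]
      refine (abs_add_le _ _).trans (add_le_add ((h1 i j y).trans ?_) ((h2 i j y).trans ?_))
      · exact mul_le_of_le_one_right h10.le (weight_le_one y)
      · exact mul_le_of_le_one_right h20.le (inv_one_add_norm_pow_le_one y 3)
    calc |constKernel Θ R x₀ i j y| ≤ (1 + B) * (2 * R)⁻¹ ^ 3 + (C1 + C2) :=
          (abs_sub _ _).trans (add_le_add e1 e2)
      _ ≤ ((1 + B) * (2 * R)⁻¹ ^ 3 + (C1 + C2)) * ((1 + (‖x₀‖ + 4 * R)) ^ 4 * weight y) :=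
          le_mul_of_one_le_right (by positivity) (one_le_weight hyn)
      _ ≤ _ := by
          rw [← mul_assoc]
          gcongr
          have : 0 ≤ C3 * (1 + ‖x₀‖) ^ 4 + C4 * (1 + ‖x₀‖) ^ 5 + C1 := by positivity
          linarith
  · push Not at hy
    have e0 : constKernel Θ R x₀ i j y = (kernelK i j (y - x₀) - kernelFar 1 i j (y - x₀)) +
        (kernelFar 1 i j (y - x₀) - kernelFar 1 i j y) -
        (rieszRR i j rho y - kernelFar 1 i j y) := by
      rw [constKernel, hΘ.cutoffR_eq_zero hR hy.le, ← kernelK_neg i j (x₀ - y), neg_sub]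
      ring
    have e1 := h3 i j (y - x₀) (by rw [norm_sub_rev]; linarith)
    have e2 := h4 i j 1 le_rfl y x₀
    rw [Real.one_rpow, mul_one] at e2
    have e3 : weight (y - x₀) ≤ (1 + ‖x₀‖) ^ 4 * weight y := by
      rw [← weight_neg, neg_sub]; exact weight_sub_le x₀ y
    have e1' := e1.trans (mul_le_mul_of_nonneg_left e3 h30.le)
    rw [e0]
    refine (abs_sub _ _).trans ((add_le_add (abs_add_le _ _) le_rfl).trans ?_)
    calc _ ≤ _ := add_le_add (add_le_add e1' e2) (h1 i j y)
      _ = (C3 * (1 + ‖x₀‖) ^ 4 + C4 * (1 + ‖x₀‖) ^ 5 + C1) * weight y := by ring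
      _ ≤ _ := by
        have : 0 ≤ ((1 + B) * (2 * R)⁻¹ ^ 3 + (C1 + C2)) * (1 + (‖x₀‖ + 4 * R)) ^ 4 := by positivity
        exact mul_le_mul_of_nonneg_right (by linarith) hw

/-- Away from the support of f neither the local term nor the truncation plays a role. -/
theorem rieszRR_eq_integral_of_eq_zero_near {f : E3 → ℝ} {y : E3} {r : ℝ} (hr : 0 < r)
    (h : ∀ x, ‖y - x‖ < r → f x = 0) (i j : Fin 3) :
    rieszRR i j f y = ∫ x, kernelK i j (x - y) * f x := by
  have h1 : f y = 0 := h y (by simpa using hr)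
  have h2 : Tendsto (fun ε : ℝ => ∫ x in {x : E3 | ε < ‖y - x‖}, kernelK i j (y - x) * f x)
      (𝓝[>] 0) (𝓝 (∫ x, kernelK i j (x - y) * f x)) := by
    refine tendsto_const_nhds.congr' ?_
    filter_upwards [nhdsWithin_le_nhds (Iio_mem_nhds hr)] with ε hε
    have hε : ε < r := hε
    rw [setIntegral_eq_integral_of_forall_compl_eq_zero]
    · simp only [← kernelK_neg i j (y - _), neg_sub]
    · intro x hx
      rw [h x (lt_of_le_of_lt (not_lt.1 hx) hε), mul_zero]
  rw [rieszRR, h2.limUnder_eq, h1]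
  ring

theorem abs_sum_sum_le {a : Fin 3 → Fin 3 → ℝ} {b : ℝ} (h : ∀ i j, |a i j| ≤ b) :
    |∑ i, ∑ j, a i j| ≤ 9 * b := by
  refine (Finset.abs_sum_le_sum_abs _ _).trans ?_
  calc _ ≤ ∑ i : Fin 3, ∑ j : Fin 3, b :=
        Finset.sum_le_sum fun i _ => (Finset.abs_sum_le_sum_abs _ _).trans
          (Finset.sum_le_sum fun j _ => h i j)
    _ = _ := by simp; ring

/-- The far part of the pressure on a time slice, tested against a function supported near `x₀`. -/
theorem integral_far_slice {Θ : E3 → ℝ} (hΘ : IsCutoff Θ) {R : ℝ} (hR : 0 < R) (x₀ : E3) {C : ℝ}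
    {v : E3 → E3} (hv : UlocSlice C v) {f : E3 → ℝ} (hf : ContDiff ℝ ∞ f)
    (hc : HasCompactSupport f) (hs : ∀ x, f x ≠ 0 → ‖x - x₀‖ < R) :
    ∫ x, (∫ y, ∑ i : Fin 3, ∑ j : Fin 3,
      (kernelK i j (x - y) - kernelK i j (x₀ - y)) * (1 - cutoffR Θ R (x₀ - y))
        * (v y i * v y j)) * f x =
    ∫ y, ∑ i : Fin 3, ∑ j : Fin 3, v y i * v y j * ((1 - cutoffR Θ R (x₀ - y)) *
      (rieszRR i j f y - kernelK i j (x₀ - y) * ∫ x, f x)) := by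
  obtain ⟨B, hB0, hB⟩ := hΘ.exists_bound
  obtain ⟨C1, h10, h1⟩ := exists_kernelK_diff_le hR x₀
  have hfi : Integrable f := hf.continuous.integrable_of_hasCompactSupport hc
  have hvi : ∀ i, AEStronglyMeasurable (fun y => v y i) volume := aestronglyMeasurable_coord hv.meas
  have hsnd : ∀ {g : E3 → ℝ}, AEStronglyMeasurable g volume →
      AEStronglyMeasurable (fun q : E3 × E3 => g q.2) (volume.prod volume) := fun hg =>
    hg.comp_quasiMeasurePreserving Measure.quasiMeasurePreserving_snd
  have hθ : Continuous fun y => cutoffR Θ R (x₀ - y) :=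
    (hΘ.continuous_cutoffR R).comp (by fun_prop)
  -- Absolute integrability for Fubini: the cut-off factor vanishes for |x₀ - y| < 2R, and elsewhere
  -- the kernel difference is bounded by the weight in y.
  have hint : Integrable (Function.uncurry fun x y => (∑ i : Fin 3, ∑ j : Fin 3,
      (kernelK i j (x - y) - kernelK i j (x₀ - y)) * (1 - cutoffR Θ R (x₀ - y))
        * (v y i * v y j)) * f x) (volume.prod volume) := by
    refine ((hfi.norm.mul_prod hv.integrable_weight).const_mul (9 * (C1 * (1 + B)))).mono'
      ?_ (Eventually.of_forall ?_)
    · refine AEStronglyMeasurable.mul (Finset.aestronglyMeasurable_fun_sum _ fun i _ =>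
        Finset.aestronglyMeasurable_fun_sum _ fun j _ => ?_)
        (hf.continuous.comp continuous_fst).aestronglyMeasurable
      refine AEStronglyMeasurable.mul (AEStronglyMeasurable.mul ?_ ?_)
        (hsnd ((hvi i).mul (hvi j)))
      · exact (((measurable_kernelK i j).comp (measurable_fst.sub measurable_snd)).sub
          ((measurable_kernelK i j).comp (measurable_const.sub measurable_snd))).aestronglyMeasurable
      · exact hsnd (aestronglyMeasurable_const.sub hθ.aestronglyMeasurable)
    · rintro ⟨x, y⟩
      simp only [Function.uncurry_apply_pair, norm_mul, Real.norm_eq_abs]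
      by_cases hx : f x = 0
      · simp [hx]
      have key : |∑ i : Fin 3, ∑ j : Fin 3,
          (kernelK i j (x - y) - kernelK i j (x₀ - y)) * (1 - cutoffR Θ R (x₀ - y))
          * (v y i * v y j)| ≤ 9 * (C1 * weight y * (1 + B) * (1 + ‖v y‖ ^ 2)) := by
        refine abs_sum_sum_le fun i j => ?_
        have hw := (weight_pos y).le
        by_cases hy : ‖x₀ - y‖ < 2 * R
        · rw [hΘ.cutoffR_eq_one hR hy]
          simp only [sub_self, mul_zero, zero_mul, abs_zero]
          positivity
        · rw [abs_mul, abs_mul]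
          have e1 := h1 i j x y (hs x hx) (not_lt.1 hy)
          have e2 : |1 - cutoffR Θ R (x₀ - y)| ≤ 1 + B := by
            refine (abs_sub _ _).trans ?_
            rw [abs_one]
            gcongr
            exact hB _
          have e3 := abs_coord_mul_le (v y) i j
          gcongr
      calc _ ≤ 9 * (C1 * weight y * (1 + B) * (1 + ‖v y‖ ^ 2)) * |f x| := by gcongr
        _ = _ := by ring
  simp only [← integral_mul_const]
  rw [integral_integral_swap hint]
  congr 1
  funext y
  simp only [Finset.sum_mul]
  have hI : ∀ i j, (Integrable fun x => (kernelK i j (x - y) - kernelK i j (x₀ - y)) *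
      (1 - cutoffR Θ R (x₀ - y)) * (v y i * v y j) * f x) ∧
      ∫ x, (kernelK i j (x - y) - kernelK i j (x₀ - y)) *
      (1 - cutoffR Θ R (x₀ - y)) * (v y i * v y j) * f x =
      v y i * v y j * ((1 - cutoffR Θ R (x₀ - y)) *
      (rieszRR i j f y - kernelK i j (x₀ - y) * ∫ x, f x)) := by
    intro i j
    by_cases hy : ‖x₀ - y‖ < 2 * R
    · rw [hΘ.cutoffR_eq_one hR hy]
      simp
    -- Where the factor 1 - θ can be nonzero, y has distance at least R from the set where f does
    -- not vanish, so the Riesz transform at y is an ordinary integral.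
    have hfar : ∀ x, ‖y - x‖ < R → f x = 0 := by
      intro x hx
      by_contra h
      have h2 := hs x h
      have : ‖x₀ - y‖ ≤ ‖y - x‖ + ‖x - x₀‖ := by
        calc ‖x₀ - y‖ = ‖(y - x) + (x - x₀)‖ := by rw [norm_sub_rev]; congr 1; abel
          _ ≤ _ := norm_add_le _ _
      linarith
    have hKf : Integrable fun x => kernelK i j (x - y) * f x := by
      refine (hfi.norm.const_mul (R⁻¹ ^ 3)).mono' ?_ (Eventually.of_forall fun x => ?_)
      · exact ((measurable_kernelK i j).comp
          (measurable_id.sub measurable_const)).aestronglyMeasurable.mul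
          hf.continuous.aestronglyMeasurable
      · rw [norm_mul, Real.norm_eq_abs]
        by_cases hx : ‖y - x‖ < R
        · simp [hfar x hx]
        · gcongr
          refine (norm_kernelK_le i j _).trans ?_
          rw [norm_sub_rev]
          gcongr
          exact not_lt.1 hx
    have e : (fun x => (kernelK i j (x - y) - kernelK i j (x₀ - y)) *
        (1 - cutoffR Θ R (x₀ - y)) * (v y i * v y j) * f x) = fun x =>
        (1 - cutoffR Θ R (x₀ - y)) * (v y i * v y j) *
        (kernelK i j (x - y) * f x - kernelK i j (x₀ - y) * f x) := by funext x; ring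
    rw [e]
    have hKc : Integrable fun x => kernelK i j (x₀ - y) * f x := hfi.const_mul _
    refine ⟨(hKf.sub hKc).const_mul _, ?_⟩
    rw [integral_const_mul, integral_sub hKf hKc, integral_const_mul,
      rieszRR_eq_integral_of_eq_zero_near hR hfar]
    ring
  rw [integral_finsetSum _ fun i _ => integrable_finsetSum _ fun j _ => (hI i j).1]
  refine Finset.sum_congr rfl fun i _ => ?_
  rw [integral_finsetSum _ fun j _ => (hI i j).1]
  exact Finset.sum_congr rfl fun j _ => (hI i j).2

theorem wt_cutoff_mul_RR {Θ : E3 → ℝ} (hΘ : IsCutoff Θ) {R : ℝ} (hR : 0 < R) (x₀ : E3)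
    {f : E3 × ℝ → ℝ} (hf : IsTest f) (i j : Fin 3) :
    Wt (fun z => cutoffR Θ R (x₀ - z.1) * RR i j f z) := by
  obtain ⟨B, hB0, hB⟩ := hΘ.exists_bound
  obtain ⟨C, hC0, hC⟩ := exists_RR_le hf
  obtain ⟨M, hM1, hM⟩ := hf.exists_support_bound
  refine ⟨?_, B * C * (1 + (‖x₀‖ + 4 * R)) ^ 4, M, by positivity, fun z => ?_, fun z hz => ?_⟩
  · exact (((hΘ.continuous_cutoffR R).comp (by fun_prop)).mul
      (contDiff_RR hf i j).continuous).measurable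
  · have hw := (weight_pos z.1).le
    by_cases hz : 4 * R ≤ ‖x₀ - z.1‖
    · rw [hΘ.cutoffR_eq_zero hR hz, zero_mul, abs_zero]
      positivity
    · have hn : ‖z.1‖ ≤ ‖x₀‖ + 4 * R := by
        calc ‖z.1‖ = ‖x₀ - (x₀ - z.1)‖ := by congr 1; abel
          _ ≤ _ := (norm_sub_le _ _).trans (by linarith)
      have e1 : |RR i j f z| ≤ C :=
        (hC i j z).trans (mul_le_of_le_one_right hC0.le (inv_one_add_norm_pow_le_one _ _))
      rw [abs_mul]
      calc _ ≤ B * C := by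
            gcongr
            exact hB _
        _ ≤ B * C * ((1 + (‖x₀‖ + 4 * R)) ^ 4 * weight z.1) :=
            le_mul_of_one_le_right (by positivity) (one_le_weight hn)
        _ = _ := by ring
  · rw [RR_eq_zero_of_slice (fun y => ?_) i j, mul_zero]
    by_contra h
    exact absurd (hM _ h).2 (not_le.2 hz)

theorem wt_mul_mass {k : E3 → ℝ} (hk : Measurable k) {C : ℝ} (hC : 0 ≤ C)
    (h : ∀ y, |k y| ≤ C * weight y) {f : E3 × ℝ → ℝ} (hf : IsTest f) :
    Wt (fun z => k z.1 * mass f z.2) := by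
  obtain ⟨M, hM1, hM⟩ := hf.exists_support_bound
  obtain ⟨C3, hC3⟩ := (contDiff_mass hf).continuous.bounded_above_of_compact_support
    (hasCompactSupport_mass hf)
  refine ⟨(hk.comp measurable_fst).mul ((contDiff_mass hf).continuous.measurable.comp
    measurable_snd), C * max C3 1, M, by positivity, fun z => ?_, fun z hz => ?_⟩
  · have := (hC3 z.2).trans (le_max_left C3 1)
    have hw := (weight_pos z.1).le
    rw [abs_mul]
    calc _ ≤ (C * weight z.1) * max C3 1 := by
          gcongr
          · exact h _
          · exact this
      _ = _ := by ring
  · rw [mass_eq_zero_of_support hM hz, mul_zero]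

/-- The Riesz pressure satisfies the local pressure expansion. -/
theorem hasLocalPressureExpansion_rieszPressure {T : EReal} {Θ : E3 → ℝ} (hΘ : IsCutoff Θ)
    {u : E3 → ℝ → E3} (hu : MemL2uloc T u) :
    HasLocalPressureExpansion T Θ u (rieszPressure hu) := by
  intro R hR x₀
  obtain ⟨C, hC0, hC⟩ := hu.exists_slice
  obtain ⟨Ck, hCk0, hCk⟩ := exists_constKernel_le hΘ hR x₀
  -- Near and far parts add up to R_i R_j ψ - (1 - θ) K(x₀ - y) ∫ψ, whereas the Riesz pressure uses
  -- R_i R_j ψ - R_i R_j `rho` ∫ψ. The difference is `constKernel` times ∫ψ, which gives c.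
  refine ⟨fun t => ∫ y, ∑ i, ∑ j, u y t i * u y t j * constKernel Θ R x₀ i j y, ?_, ?_⟩
  · intro T' hT'
    have hsub : Ioo 0 T' ⊆ (timeInterval T : Set ℝ) := fun t ht =>
      ⟨ht.1, (EReal.coe_lt_coe_iff.2 ht.2).trans_le hT'⟩
    have hm : AEStronglyMeasurable (fun z : E3 × ℝ => ∑ i, ∑ j, u z.1 z.2 i * u z.1 z.2 j *
        constKernel Θ R x₀ i j z.1) (slabMeasure T) := by
      refine Finset.aestronglyMeasurable_fun_sum _ fun i _ =>
        Finset.aestronglyMeasurable_fun_sum _ fun j _ => ?_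
      exact ((aestronglyMeasurable_coord hu.meas i).mul (aestronglyMeasurable_coord hu.meas j)).mul
        ((measurable_constKernel hΘ R x₀ i j).comp measurable_fst).aestronglyMeasurable
    have hm2 : AEStronglyMeasurable (fun t => ∫ y, ∑ i, ∑ j, u y t i * u y t j *
        constKernel Θ R x₀ i j y) (volume.restrict (timeInterval T : Set ℝ)) :=
      hm.prod_swap.integral_prod_right'
    refine ⟨hm2.mono_set hsub, .restrict_of_bounded (C := 9 * Ck * C) measure_Ioo_lt_top ?_⟩
    refine ae_restrict_of_ae_restrict_of_subset hsub ?_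
    filter_upwards [hC] with t ht
    refine ht.abs_integral_le hC0.le (by positivity) fun y => ?_
    calc _ ≤ 9 * ((1 + ‖u y t‖ ^ 2) * (Ck * weight y)) := abs_sum_sum_le fun i j => by
          rw [abs_mul]
          exact mul_le_mul (abs_coord_mul_le _ _ _) (hCk i j y) (abs_nonneg _) (by positivity)
      _ = _ := by ring
  · intro ψ hψ
    have ht := isTest_coe ψ
    have h1 := integrable_quad hu ht.centered (mass_centered ht)
    have h2 : Integrable (fun z : E3 × ℝ => ∑ i, ∑ j, u z.1 z.2 i * u z.1 z.2 j *
        cutoffR Θ R (x₀ - z.1) * RR i j ψ z) (slabMeasure T) := by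
      refine integrable_finsetSum _ fun i _ => integrable_finsetSum _ fun j _ => ?_
      simpa only [mul_assoc] using (wt_cutoff_mul_RR hΘ hR x₀ ht i j).integrable_coord_mul hu i j
    have h3 : Integrable (fun z : E3 × ℝ => ∑ i, ∑ j, u z.1 z.2 i * u z.1 z.2 j *
        (constKernel Θ R x₀ i j z.1 * mass ψ z.2)) (slabMeasure T) :=
      integrable_finsetSum _ fun i _ => integrable_finsetSum _ fun j _ =>
        (wt_mul_mass (measurable_constKernel hΘ R x₀ i j) hCk0.le (hCk i j)
          ht).integrable_coord_mul hu i j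
    have hfar : pressureFar T Θ u R x₀ ψ = ∫ z, (quad u (centered ψ) z - (∑ i, ∑ j,
        u z.1 z.2 i * u z.1 z.2 j * cutoffR Θ R (x₀ - z.1) * RR i j ψ z) -
        ∑ i, ∑ j, u z.1 z.2 i * u z.1 z.2 j *
        (constKernel Θ R x₀ i j z.1 * mass ψ z.2)) ∂(slabMeasure T) := by
      refine Eq.trans ?_ (integral_slab ((h1.sub h2).sub h3))
      rw [pressureFar]
      refine integral_congr_ae ?_
      filter_upwards [hC] with t hut
      rw [integral_far_slice hΘ hR x₀ hut (ht.slice_contDiff t) (ht.slice_compact t)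
        fun x hx => by simpa [dist_eq_norm] using hψ (x, t) (subset_tsupport _ hx)]
      congr 1
      funext y
      simp only [quad, ← Finset.sum_sub_distrib]
      refine Finset.sum_congr rfl fun i _ => Finset.sum_congr rfl fun j _ => ?_
      rw [RR_centered ht]
      simp only [constKernel, RR, mass]
      ring
    have hc : ∫ t in (timeInterval T : Set ℝ), ∫ x, (∫ y, ∑ i, ∑ j, u y t i * u y t j *
        constKernel Θ R x₀ i j y) * ψ (x, t) = ∫ z, ∑ i, ∑ j, u z.1 z.2 i * u z.1 z.2 j *
        (constKernel Θ R x₀ i j z.1 * mass ψ z.2) ∂(slabMeasure T) := by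
      rw [← integral_slab h3]
      congr 1
      funext t
      rw [integral_const_mul, ← integral_mul_const]
      simp only [mass, Finset.sum_mul, mul_assoc]
    have hn : pressureNear T Θ u R x₀ ψ = ∫ z, ∑ i, ∑ j, u z.1 z.2 i * u z.1 z.2 j *
        cutoffR Θ R (x₀ - z.1) * RR i j ψ z ∂(slabMeasure T) := (integral_slab h2)
    have e : ∫ z, (quad u (centered ψ) z - (∑ i, ∑ j,
        u z.1 z.2 i * u z.1 z.2 j * cutoffR Θ R (x₀ - z.1) * RR i j ψ z) -
        ∑ i, ∑ j, u z.1 z.2 i * u z.1 z.2 j *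
        (constKernel Θ R x₀ i j z.1 * mass ψ z.2)) ∂(slabMeasure T) =
        (∫ z, quad u (centered ψ) z ∂(slabMeasure T)) - (∫ z, ∑ i, ∑ j, u z.1 z.2 i * u z.1 z.2 j *
        cutoffR Θ R (x₀ - z.1) * RR i j ψ z ∂(slabMeasure T)) - ∫ z, ∑ i, ∑ j,
        u z.1 z.2 i * u z.1 z.2 j * (constKernel Θ R x₀ i j z.1 * mass ψ z.2) ∂(slabMeasure T) := by
      rw [← integral_sub h1 h2]
      exact integral_sub (h1.sub h2) h3
    rw [hc, hfar, hn, e, rieszPressure_apply]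
    ring

/-! ### The residual of the momentum equation and its harmonicity in space. -/

/-- A smooth compactly supported function, as a test function. -/
def IsTest.toTest {Ω : TopologicalSpace.Opens (E3 × ℝ)} {f : E3 × ℝ → ℝ} (hf : IsTest f)
    (hs : tsupport f ⊆ Ω) : 𝓓(Ω, ℝ) := ⟨f, hf.contDiff, hf.compact, hs⟩

theorem IsTest.coe_toTest {Ω : TopologicalSpace.Opens (E3 × ℝ)} {f : E3 × ℝ → ℝ} (hf : IsTest f)
    (hs : tsupport f ⊆ Ω) : (hf.toTest hs : E3 × ℝ → ℝ) = f := rfl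

/-- The integrand `u_k (∂ₜf + Δf + u_j ∂_j f)`. -/
noncomputable def mom (u : E3 → ℝ → E3) (k : Fin 3) (f : E3 × ℝ → ℝ) (z : E3 × ℝ) : ℝ :=
  u z.1 z.2 k * (D et f z + lap f z + ∑ j : Fin 3, u z.1 z.2 j * D (ex j) f z)

/-- The integrand of the momentum equation with the Riesz pressure. -/
noncomputable def residual (u : E3 → ℝ → E3) (k : Fin 3) (f : E3 × ℝ → ℝ) (z : E3 × ℝ) : ℝ :=
  mom u k f z + quad u (D (ex k) f) z

theorem momentumIntegrand_eq {Ω : TopologicalSpace.Opens (E3 × ℝ)} (u : E3 → ℝ → E3) (k : Fin 3)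
    (ψ : 𝓓(Ω, ℝ)) (x : E3) (t : ℝ) : momentumIntegrand u k ψ x t = mom u k ψ (x, t) := by
  simp only [momentumIntegrand, mom, lap, coe_lineDeriv]

theorem D_add {f g : E3 × ℝ → ℝ} (hf : IsTest f) (hg : IsTest g) (v : E3 × ℝ) :
    D v (fun z => f z + g z) = fun z => D v f z + D v g z := by
  funext z
  simp only [D]
  rw [fderiv_fun_add (hf.differentiable z) (hg.differentiable z)]
  rfl

theorem D_sub {f g : E3 × ℝ → ℝ} (hf : IsTest f) (hg : IsTest g) (v : E3 × ℝ) :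
    D v (fun z => f z - g z) = fun z => D v f z - D v g z := by
  funext z
  simp only [D]
  rw [fderiv_fun_sub (hf.differentiable z) (hg.differentiable z)]
  rfl

theorem D_sum {ι : Type*} (s : Finset ι) {f : ι → E3 × ℝ → ℝ} (hf : ∀ i, IsTest (f i))
    (v : E3 × ℝ) : D v (fun z => ∑ i ∈ s, f i z) = fun z => ∑ i ∈ s, D v (f i) z := by
  funext z
  simp only [D]
  rw [fderiv_fun_sum fun i _ => (hf i).differentiable z]
  simp

theorem lap_add {f g : E3 × ℝ → ℝ} (hf : IsTest f) (hg : IsTest g) :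
    lap (fun z => f z + g z) = fun z => lap f z + lap g z := by
  funext z
  simp only [lap, D_add hf hg, D_add (hf.D _) (hg.D _), Finset.sum_add_distrib]

theorem lap_sub {f g : E3 × ℝ → ℝ} (hf : IsTest f) (hg : IsTest g) :
    lap (fun z => f z - g z) = fun z => lap f z - lap g z := by
  funext z
  simp only [lap, D_sub hf hg, D_sub (hf.D _) (hg.D _), Finset.sum_sub_distrib]

theorem D_lap {f : E3 × ℝ → ℝ} (hf : IsTest f) (v : E3 × ℝ) : D v (lap f) = lap (D v f) := by
  have : lap f = fun z => ∑ l : Fin 3, D (ex l) (D (ex l) f) z := rfl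
  rw [this, D_sum _ fun l => (hf.D _).D _]
  funext z
  simp only [lap]
  refine Finset.sum_congr rfl fun l _ => ?_
  rw [D_comm (hf.D _).contDiff, D_comm hf.contDiff]

theorem tsupport_subset_of_D {f : E3 × ℝ → ℝ} {S : Set (E3 × ℝ)} (h : tsupport f ⊆ S)
    (v : E3 × ℝ) : tsupport (D v f) ⊆ S := (tsupport_D_subset f v).trans h

theorem tsupport_lap_subset (f : E3 × ℝ → ℝ) : tsupport (lap f) ⊆ tsupport f := by
  refine closure_minimal (fun z hz => ?_) (isClosed_tsupport f)
  by_contra h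
  refine hz (Finset.sum_eq_zero fun l _ => ?_)
  by_contra h1
  exact h (tsupport_subset_of_D (tsupport_D_subset f _) _ (subset_tsupport _ h1))

theorem mom_eq (u : E3 → ℝ → E3) (k : Fin 3) (f : E3 × ℝ → ℝ) (z : E3 × ℝ) :
    mom u k f z = u z.1 z.2 k * D et f z + u z.1 z.2 k * lap f z +
      ∑ j : Fin 3, u z.1 z.2 k * u z.1 z.2 j * D (ex j) f z := by
  simp only [mom, mul_add, Finset.mul_sum, mul_assoc]

theorem integrable_mom {T : EReal} {u : E3 → ℝ → E3} (hu : MemL2uloc T u) (k : Fin 3)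
    {f : E3 × ℝ → ℝ} (hf : IsTest f) : Integrable (mom u k f) (slabMeasure T) := by
  have : mom u k f = fun z => u z.1 z.2 k * D et f z + u z.1 z.2 k * lap f z +
      ∑ j : Fin 3, u z.1 z.2 k * u z.1 z.2 j * D (ex j) f z := funext (mom_eq u k f)
  rw [this]
  exact (((hf.D _).wt.integrable_coord hu k).add (hf.lap.wt.integrable_coord hu k)).add
    (integrable_finsetSum _ fun j _ => (hf.D _).wt.integrable_coord_mul hu k j)

theorem integrable_residual {T : EReal} {u : E3 → ℝ → E3} (hu : MemL2uloc T u) (k : Fin 3)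
    {f : E3 × ℝ → ℝ} (hf : IsTest f) : Integrable (residual u k f) (slabMeasure T) :=
  (integrable_mom hu k hf).add (integrable_quad hu (hf.D _) (mass_D_ex hf k))

theorem mom_add (u : E3 → ℝ → E3) (k : Fin 3) {f g : E3 × ℝ → ℝ} (hf : IsTest f) (hg : IsTest g)
    (z : E3 × ℝ) : mom u k (fun z => f z + g z) z = mom u k f z + mom u k g z := by
  simp only [mom, D_add hf hg, lap_add hf hg, mul_add, Finset.sum_add_distrib]
  ring

theorem mom_sub (u : E3 → ℝ → E3) (k : Fin 3) {f g : E3 × ℝ → ℝ} (hf : IsTest f) (hg : IsTest g)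
    (z : E3 × ℝ) : mom u k (fun z => f z - g z) z = mom u k f z - mom u k g z := by
  simp only [mom, D_sub hf hg, lap_sub hf hg, mul_sub, Finset.sum_sub_distrib]
  ring

theorem residual_add (u : E3 → ℝ → E3) (k : Fin 3) {f g : E3 × ℝ → ℝ} (hf : IsTest f)
    (hg : IsTest g) (z : E3 × ℝ) :
    residual u k (fun z => f z + g z) z = residual u k f z + residual u k g z := by
  simp only [residual, mom_add u k hf hg, D_add hf hg, quad_add u (hf.D _) (hg.D _)]
  ring

theorem residual_sub (u : E3 → ℝ → E3) (k : Fin 3) {f g : E3 × ℝ → ℝ} (hf : IsTest f)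
    (hg : IsTest g) (z : E3 × ℝ) :
    residual u k (fun z => f z - g z) z = residual u k f z - residual u k g z := by
  simp only [residual, mom_sub u k hf hg, D_sub hf hg, quad_sub u (hf.D _) (hg.D _)]
  ring

theorem integrable_div {T : EReal} {u : E3 → ℝ → E3} (hu : MemL2uloc T u) {f : E3 × ℝ → ℝ}
    (hf : IsTest f) :
    Integrable (fun z => ∑ k : Fin 3, u z.1 z.2 k * D (ex k) f z) (slabMeasure T) :=
  integrable_finsetSum _ fun k _ => (hf.D _).wt.integrable_coord hu k

section NSE

variable {T : EReal} {u : E3 → ℝ → E3} {p : 𝓓'(slab T, ℝ)}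

theorem SolvesNSE.apply_lineDeriv (h : SolvesNSE T u p) (hu : MemL2uloc T u) (k : Fin 3)
    (ψ : 𝓓(slab T, ℝ)) : p (∂_{ex k} ψ) = - ∫ z, mom u k ψ z ∂(slabMeasure T) := by
  have h1 := h.momentum k ψ
  simp only [momentumIntegrand_eq] at h1
  rw [integral_slab (integrable_mom hu k (isTest_coe ψ))] at h1
  linarith

theorem SolvesNSE.integral_div (h : SolvesNSE T u p) (hu : MemL2uloc T u) {f : E3 × ℝ → ℝ}
    (hf : IsTest f) (hs : tsupport f ⊆ slab T) :
    ∫ z, ∑ k : Fin 3, u z.1 z.2 k * D (ex k) f z ∂(slabMeasure T) = 0 := by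
  rw [← integral_slab (integrable_div hu hf), ← h.divFree (hf.toTest hs)]
  simp only [coe_lineDeriv, hf.coe_toTest]

/-- Weak form of -Δp = ∂_i ∂_j (u_i u_j). Writing ∂_k Δg = ∑_l ∂_l (∂_l ∂_k g), the value of p is
the sum over l of the l-th momentum equation tested with ∂_l ∂_k g. The linear terms pair u with a
gradient and vanish; the quadratic ones cancel the Riesz term because R_i R_j Δ = -∂_i ∂_j. -/
theorem SolvesNSE.integral_residual_lap (h : SolvesNSE T u p) (hu : MemL2uloc T u) (k : Fin 3)
    {g : E3 × ℝ → ℝ} (hg : IsTest g) (hs : tsupport g ⊆ slab T) :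
    ∫ z, residual u k (lap g) z ∂(slabMeasure T) = 0 := by
  have hq := hg.D (ex k)
  have hqs := tsupport_subset_of_D hs (ex k)
  have hls : tsupport (lap g) ⊆ slab T := (tsupport_lap_subset g).trans hs
  have e1 : (∂_{ex k} (hg.lap.toTest hls) : 𝓓(slab T, ℝ)) =
      ∂_{ex 0} ((hq.D (ex 0)).toTest (tsupport_subset_of_D hqs _)) +
      ∂_{ex 1} ((hq.D (ex 1)).toTest (tsupport_subset_of_D hqs _)) +
      ∂_{ex 2} ((hq.D (ex 2)).toTest (tsupport_subset_of_D hqs _)) := by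
    ext z
    simp only [FunLike.coe_add, Pi.add_apply, coe_lineDeriv, IsTest.coe_toTest, D_lap hg, lap,
      Fin.sum_univ_three]
  have e2 := h.apply_lineDeriv hu k (hg.lap.toTest hls)
  rw [e1, map_add, map_add, h.apply_lineDeriv hu, h.apply_lineDeriv hu, h.apply_lineDeriv hu] at e2
  simp only [IsTest.coe_toTest] at e2
  have hH : IsTest (fun z => D et (D (ex k) g) z + lap (D (ex k) g) z) := (hq.D et).add hq.lap
  have hHs : tsupport (fun z => D et (D (ex k) g) z + lap (D (ex k) g) z) ⊆ slab T :=
    (tsupport_add _ _).trans (union_subset (tsupport_subset_of_D hqs _)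
      ((tsupport_lap_subset _).trans hqs))
  have e3 := h.integral_div hu hH hHs
  have hi : ∀ l, Integrable (mom u l (D (ex l) (D (ex k) g))) (slabMeasure T) := fun l =>
    integrable_mom hu l (hq.D _)
  have hquad := integrable_quad hu hq.lap (fun t => by
    rw [← D_lap hg]; exact mass_D_ex hg.lap k t)
  -- The linear part is u paired with the gradient of (∂_t + Δ) ∂_k g, the quadratic part is u_l u_j
  -- ∂_l ∂_j ∂_k g = -u_l u_j R_l R_j Δ∂_k g.
  have e4 : ∀ z, mom u 0 (D (ex 0) (D (ex k) g)) z + mom u 1 (D (ex 1) (D (ex k) g)) z +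
      mom u 2 (D (ex 2) (D (ex k) g)) z = (∑ l : Fin 3, u z.1 z.2 l *
      D (ex l) (fun z => D et (D (ex k) g) z + lap (D (ex k) g) z) z) -
      quad u (lap (D (ex k) g)) z := by
    intro z
    simp only [mom, quad, RR_lap hq, D_add (hq.D et) hq.lap, D_lap hq, Fin.sum_univ_three,
      D_comm hq.contDiff et, D_comm hq.contDiff (ex 1) (ex 0), D_comm hq.contDiff (ex 2) (ex 0),
      D_comm hq.contDiff (ex 2) (ex 1)]
    ring
  have e5 : (∫ z, mom u 0 (D (ex 0) (D (ex k) g)) z ∂(slabMeasure T)) +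
      (∫ z, mom u 1 (D (ex 1) (D (ex k) g)) z ∂(slabMeasure T)) +
      ∫ z, mom u 2 (D (ex 2) (D (ex k) g)) z ∂(slabMeasure T) =
      - ∫ z, quad u (lap (D (ex k) g)) z ∂(slabMeasure T) := by
    have h2 := integral_add ((hi 0).add (hi 1)) (hi 2)
    simp only [Pi.add_apply] at h2
    rw [← integral_add (hi 0) (hi 1), ← h2]
    simp only [e4]
    rw [integral_sub (integrable_div hu hH) hquad, e3, zero_sub]
  have e6 : ∫ z, residual u k (lap g) z ∂(slabMeasure T) = (∫ z, mom u k (lap g) z ∂(slabMeasure T)) +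
      ∫ z, quad u (lap (D (ex k) g)) z ∂(slabMeasure T) := by
    rw [← integral_add (integrable_mom hu k hg.lap) hquad]
    simp only [residual, D_lap hg]
  linarith

end NSE

/-! ### Liouville argument: the residual vanishes on functions of slice mass zero. -/

/-- The part of `f` that is seen at distances larger than `R` only. -/
noncomputable def far (R : ℝ) (f : E3 × ℝ → ℝ) (z : E3 × ℝ) : ℝ := f z + lap (cv (newtonNear R) f) z

theorem IsTest.cv_newtonNear {f : E3 × ℝ → ℝ} (hf : IsTest f) {R : ℝ} (hR : 0 < R) :
    IsTest (cv (newtonNear R) f) :=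
  isTest_cv (locallyIntegrable_newtonNear R) (hasCompactSupport_newtonNear hR) hf

theorem D_far {f : E3 × ℝ → ℝ} (hf : IsTest f) {R : ℝ} (hR : 0 < R) (v : E3 × ℝ) :
    D v (far R f) = far R (D v f) := by
  have h : NSStructure.far R f = fun z => f z + lap (cv (newtonNear R) f) z := rfl
  rw [h, D_add hf (hf.cv_newtonNear hR).lap, D_lap (hf.cv_newtonNear hR),
    D_cv (locallyIntegrable_newtonNear R) hf]
  rfl

theorem lap_far {f : E3 × ℝ → ℝ} (hf : IsTest f) {R : ℝ} (hR : 0 < R) :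
    lap (far R f) = far R (lap f) := by
  have h : NSStructure.far R f = fun z => f z + lap (cv (newtonNear R) f) z := rfl
  rw [h, lap_add hf (hf.cv_newtonNear hR).lap, lap_cv (locallyIntegrable_newtonNear R) hf,
    lap_cv (locallyIntegrable_newtonNear R) hf.lap]
  funext z
  rw [NSStructure.far, lap_cv (locallyIntegrable_newtonNear R) hf.lap]

theorem tsupport_cv_subset (κ : E3 → ℝ) {f : E3 × ℝ → ℝ} (hf : IsTest f) :
    tsupport (cv κ f) ⊆ Prod.snd ⁻¹' (Prod.snd '' tsupport f) := by
  refine closure_minimal (fun z hz => ?_)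
    ((hf.compact.isCompact.image continuous_snd).isClosed.preimage continuous_snd)
  by_contra h
  refine hz (integral_eq_zero_of_ae (Eventually.of_forall fun y => ?_))
  by_contra h1
  exact h ⟨(z.1 - y, z.2), subset_tsupport _ (right_ne_zero_of_mul h1), rfl⟩

theorem preimage_image_snd_subset_slab {T : EReal} {S : Set (E3 × ℝ)} (hS : S ⊆ slab T) :
    Prod.snd ⁻¹' (Prod.snd '' S) ⊆ (slab T : Set (E3 × ℝ)) := by
  rintro z ⟨w, hw, hwz⟩
  have := hS hw
  simpa [slab, ← hwz] using this

/-- Quantitative smallness of `far R f` for `f` of vanishing mass. -/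
theorem exists_far_le {f : E3 × ℝ → ℝ} (hf : IsTest f) (h0 : ∀ t, mass f t = 0) :
    ∃ C M : ℝ, 0 < C ∧ ∀ R : ℝ, 1 ≤ R → ∀ z,
      (M < |z.2| → far R f z = 0 ∧ ∀ i j, RR i j (far R f) z = 0) ∧
      |far R f z| ≤ C * R ^ (-(1 / 2) : ℝ) * weight z.1 ∧
      ∀ i j, |RR i j (far R f) z| ≤ C * R ^ (-(1 / 2) : ℝ) * weight z.1 := by
  obtain ⟨M, hM1, hM⟩ := hf.exists_support_bound
  obtain ⟨a, ha0, ha⟩ := hf.exists_bound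
  obtain ⟨C, hC0, hC⟩ := cv_kernelFar_sub_le (M := M) (by linarith)
  refine ⟨3 * (C * a), M, by positivity, fun R hR z => ?_⟩
  have hR0 : 0 < R := by linarith
  have hw := (weight_pos z.1).le
  have hRp : 0 ≤ R ^ (-(1 / 2) : ℝ) := by positivity
  have hk : ∀ i j, |cv (kernelFar R i j) f z| ≤ C * R ^ (-(1 / 2) : ℝ) * a * weight z.1 := by
    intro i j
    have := hC i j R hR f a hf (fun z hz => (hM z hz).1) ha z
    have hm : ∫ y, f (y, z.2) = 0 := h0 z.2
    simpa [hm] using this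
  generalize R ^ (-(1 / 2) : ℝ) = r at *
  have hr : 0 ≤ C * r * a * weight z.1 := by positivity
  have e1 : NSStructure.far R f z = - ∑ l : Fin 3, cv (kernelFar R l l) f z :=
    lap_cv_newtonNear hf hR0 z
  have e2 : ∀ i j, RR i j (NSStructure.far R f) z = cv (kernelFar R i j) f z := fun i j =>
    RR_add_lap_cv_newtonNear hf hR0 i j z
  refine ⟨fun hz => ?_, ?_, fun i j => ?_⟩
  · have hz0 : ∀ κ, cv κ f z = 0 := by
      intro κ
      refine integral_eq_zero_of_ae (Eventually.of_forall fun y => ?_)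
      by_contra h1
      exact absurd (hM _ (right_ne_zero_of_mul h1)).2 (not_le.2 hz)
    refine ⟨by simp [e1, hz0], fun i j => by rw [e2, hz0]⟩
  · rw [e1, abs_neg]
    refine (Finset.abs_sum_le_sum_abs _ _).trans ((Finset.sum_le_sum fun l _ => hk l l).trans_eq ?_)
    simp; ring
  · rw [e2]
    refine (hk i j).trans ?_
    linarith

/-- Replacing f by `far R f` changes f by a Laplacian only, hence does not change the integral. All
derivatives of f that enter have slice mass zero, so the new integrand is O(R^{-1/2}) times a fixed
integrable function, and R → ∞. -/
theorem SolvesNSE.integral_residual_eq_zero {T : EReal} {u : E3 → ℝ → E3} {p : 𝓓'(slab T, ℝ)}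
    (h : SolvesNSE T u p) (hu : MemL2uloc T u) (k : Fin 3) {f : E3 × ℝ → ℝ} (hf : IsTest f)
    (hs : tsupport f ⊆ slab T) (h0 : ∀ t, mass f t = 0) :
    ∫ z, residual u k f z ∂(slabMeasure T) = 0 := by
  have h1 : ∀ R : ℝ, 1 ≤ R → ∫ z, residual u k f z ∂(slabMeasure T) =
      ∫ z, residual u k (far R f) z ∂(slabMeasure T) := by
    intro R hR
    have hg := hf.cv_newtonNear (R := R) (by linarith)
    have e : far R f = fun z => f z + lap (cv (newtonNear R) f) z := rfl
    rw [e]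
    simp only [residual_add u k hf hg.lap]
    rw [integral_add (integrable_residual hu k hf) (integrable_residual hu k hg.lap),
      h.integral_residual_lap hu k hg ((tsupport_cv_subset _ hf).trans
        (preimage_image_snd_subset_slab hs)), add_zero]
  -- The operator `far R` commutes with derivatives, so the estimate is applied to ∂_t f, Δf and ∂_j
  -- f. Only for ∂_t f is the hypothesis on the masses of f needed.
  obtain ⟨C1, M1, h10, hb1⟩ := exists_far_le (hf.D et) fun t => by
    rw [← deriv_mass hf]
    simp [show mass f = fun _ => 0 from funext h0]
  obtain ⟨C2, M2, h20, hb2⟩ := exists_far_le hf.lap fun t => by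
    have e : mass (lap f) t = ∑ l : Fin 3, mass (D (ex l) (D (ex l) f)) t :=
      integral_finsetSum _ fun l _ => ((hf.D _).D _).slice_integrable t
    simp [e, mass_D_ex (hf.D _)]
  choose C3 M3 h30 hb3 using fun j => exists_far_le (hf.D (ex j)) (mass_D_ex hf j)
  set M := |M1| + |M2| + ∑ j, |M3 j| with hM
  have hMj : ∀ j, |M3 j| ≤ ∑ j, |M3 j| := fun j =>
    Finset.single_le_sum (f := fun j => |M3 j|) (fun _ _ => abs_nonneg _) (Finset.mem_univ j)
  have hS0 : 0 ≤ ∑ j, |M3 j| := Finset.sum_nonneg fun _ _ => abs_nonneg _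
  set C := C1 + C2 + (∑ j, C3 j) + 9 * C3 k with hC
  have hbound : ∀ R : ℝ, 1 ≤ R → ∀ z,
      |residual u k (far R f) z| ≤ R ^ (-(1 / 2) : ℝ) * C * dominator u M z := by
    intro R hR z
    have hR0 : 0 < R := by linarith
    have e0 : residual u k (far R f) z = u z.1 z.2 k * far R (D et f) z +
        u z.1 z.2 k * far R (lap f) z +
        (∑ j : Fin 3, u z.1 z.2 k * u z.1 z.2 j * far R (D (ex j) f) z) +
        quad u (far R (D (ex k) f)) z := by
      rw [residual, mom_eq, D_far hf hR0, lap_far hf hR0]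
      simp only [D_far hf hR0]
    obtain ⟨a1, a2, a3⟩ := hb1 R hR z
    obtain ⟨b1, b2, b3⟩ := hb2 R hR z
    have hRp : 0 ≤ R ^ (-(1 / 2) : ℝ) := by positivity
    have c1 := fun j => (hb3 j R hR z).1
    have c2 := fun j => (hb3 j R hR z).2.1
    have c3 := (hb3 k R hR z).2.2
    generalize R ^ (-(1 / 2) : ℝ) = r at *
    by_cases hz : |z.2| ≤ M
    · rw [dominator, indicator_of_mem (by exact hz), e0]
      have hw := (weight_pos z.1).le
      have f1 : |u z.1 z.2 k * far R (D et f) z| ≤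
          (1 + ‖u z.1 z.2‖ ^ 2) * (C1 * r * weight z.1) := by
        rw [abs_mul]
        exact mul_le_mul (abs_coord_le _ _) a2 (abs_nonneg _) (by positivity)
      have f2 : |u z.1 z.2 k * far R (lap f) z| ≤
          (1 + ‖u z.1 z.2‖ ^ 2) * (C2 * r * weight z.1) := by
        rw [abs_mul]
        exact mul_le_mul (abs_coord_le _ _) b2 (abs_nonneg _) (by positivity)
      have f3 : |∑ j : Fin 3, u z.1 z.2 k * u z.1 z.2 j * far R (D (ex j) f) z| ≤
          ∑ j, (1 + ‖u z.1 z.2‖ ^ 2) * (C3 j * r * weight z.1) := by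
        refine (Finset.abs_sum_le_sum_abs _ _).trans (Finset.sum_le_sum fun j _ => ?_)
        rw [abs_mul]
        exact mul_le_mul (abs_coord_mul_le _ _ _) (c2 j) (abs_nonneg _) (by positivity)
      have f4 := abs_quad_le u c3
      refine (abs_add_le _ _).trans (le_trans (add_le_add ((abs_add_le _ _).trans (add_le_add
        ((abs_add_le _ _).trans (add_le_add f1 f2)) f3)) f4) (le_of_eq ?_))
      rw [hC]
      simp only [Fin.sum_univ_three]
      ring
    · have hz := not_le.1 hz
      have := le_abs_self M1
      have := le_abs_self M2
      have d1 := (a1 (by linarith [abs_nonneg M2])).1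
      have d2 := (b1 (by linarith [abs_nonneg M1])).1
      have d3 : ∀ j, M3 j < |z.2| := fun j => by
        linarith [le_abs_self (M3 j), hMj j, abs_nonneg M1, abs_nonneg M2]
      have d4 := fun j => (c1 j (d3 j)).1
      have d5 := (c1 k (d3 k)).2
      rw [dominator, indicator_of_notMem (by simpa using hz), e0]
      simp [d1, d2, d4, d5, quad]
  have hle : ∀ R : ℝ, 1 ≤ R → |∫ z, residual u k f z ∂(slabMeasure T)| ≤
      R ^ (-(1 / 2) : ℝ) * (C * ∫ z, dominator u M z ∂(slabMeasure T)) := by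
    intro R hR
    rw [h1 R hR, ← Real.norm_eq_abs]
    refine (norm_integral_le_of_norm_le ((hu.integrable_dominator M).const_mul _)
      (Eventually.of_forall (hbound R hR))).trans_eq ?_
    rw [integral_const_mul, mul_assoc]
  have hlim := (tendsto_rpow_neg_atTop (y := 1 / 2) (by norm_num)).mul_const
    (C * ∫ z, dominator u M z ∂(slabMeasure T))
  rw [zero_mul] at hlim
  exact abs_nonpos_iff.1 (ge_of_tendsto hlim ((eventually_ge_atTop 1).mono hle))

/-! ### Weak derivatives in time and tail integrals. -/

theorem tsupport_rho_mul_subset {T : EReal} {r : E3 → ℝ} {h : ℝ → ℝ}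
    (hs : tsupport h ⊆ timeInterval T) :
    tsupport (fun z : E3 × ℝ => r z.1 * h z.2) ⊆ slab T := by
  have h1 : tsupport (fun z : E3 × ℝ => r z.1 * h z.2) ⊆ Prod.snd ⁻¹' tsupport h :=
    closure_minimal (fun z hz => subset_tsupport h (right_ne_zero_of_mul hz))
      ((isClosed_tsupport h).preimage continuous_snd)
  exact fun z hz => hs (h1 hz)

theorem tsupport_mass_subset_timeInterval {T : EReal} {f : E3 × ℝ → ℝ} (hf : IsTest f)
    (hs : tsupport f ⊆ slab T) : tsupport (mass f) ⊆ timeInterval T := by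
  refine (tsupport_mass_subset hf).trans ?_
  rintro _ ⟨z, hz, rfl⟩
  exact hs hz

theorem intervalIntegrable_of_locallyIntegrable {a : ℝ → ℝ} (ha : LocallyIntegrable a) (x y : ℝ) :
    IntervalIntegrable a volume x y :=
  intervalIntegrable_iff.2 ((ha.integrableOn_isCompact isCompact_uIcc).mono_set uIoc_subset_uIcc)

theorem integral_deriv_eq_zero {h : ℝ → ℝ} (hh : ContDiff ℝ 1 h) (hc : HasCompactSupport h) :
    ∫ t, deriv h t = 0 :=
  integral_eq_zero_of_hasDerivAt_of_integrable
    (fun t => ((hh.differentiable one_ne_zero) t).hasDerivAt)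
    ((hh.continuous_deriv le_rfl).integrable_of_hasCompactSupport hc.deriv)
    (hh.continuous.integrable_of_hasCompactSupport hc)

/-- Integration by parts for the primitive of a locally integrable function. -/
theorem integral_primitive_mul_deriv {a : ℝ → ℝ} (ha : LocallyIntegrable a) {h : ℝ → ℝ}
    (hh : ContDiff ℝ 1 h) (hc : HasCompactSupport h) :
    ∫ t, (∫ s in (0 : ℝ)..t, a s) * deriv h t = - ∫ t, a t * h t := by
  obtain ⟨M0, hM0⟩ := hc.isCompact.isBounded.exists_norm_le
  -- The summand 1 places the endpoints ±M outside the support, so that boundary terms vanish.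
  set M := max M0 0 + 1 with hM
  have hM1 : 0 < M := by positivity
  have hz : ∀ t, M ≤ |t| → t ∉ tsupport h := fun t ht h1 => by
    have := hM0 t h1
    rw [Real.norm_eq_abs] at this
    linarith [le_max_left M0 0]
  have hh0 : ∀ t, M ≤ |t| → h t = 0 := fun t ht => image_eq_zero_of_notMem_tsupport (hz t ht)
  have hd0 : ∀ t, M ≤ |t| → deriv h t = 0 := fun t ht =>
    image_eq_zero_of_notMem_tsupport fun h1 => hz t ht (tsupport_deriv_subset (f := h) h1)
  have hAC := (intervalIntegrable_of_locallyIntegrable ha (-M) M).absolutelyContinuousOnInterval_intervalIntegral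
    (c := 0) (by simp [uIcc_of_le, hM1.le])
  have hhAC : AbsolutelyContinuousOnInterval h (-M) M :=
    hh.contDiffOn.absolutelyContinuousOnInterval
  have e := hAC.integral_mul_deriv_eq_deriv_mul hhAC
  have hfull : ∀ F : ℝ → ℝ, (∀ t, M ≤ |t| → F t = 0) → ∫ t, F t = ∫ t in (-M)..M, F t := by
    intro F hF
    rw [intervalIntegral.integral_of_le (by linarith), setIntegral_eq_integral_of_forall_compl_eq_zero]
    intro t ht
    refine hF t ?_
    by_contra h1
    have := abs_lt.1 (not_le.1 h1)
    exact ht ⟨this.1, this.2.le⟩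
  rw [hfull _ fun t ht => by rw [hd0 t ht, mul_zero],
    hfull (fun t => a t * h t) fun t ht => by rw [hh0 t ht, mul_zero], e,
    hh0 M (by rw [abs_of_pos hM1]), hh0 (-M) (by rw [abs_neg, abs_of_pos hM1])]
  simp only [mul_zero, sub_self, zero_sub, neg_inj]
  refine intervalIntegral.integral_congr_ae ?_
  filter_upwards [LocallyIntegrable.ae_hasDerivAt_integral ha] with t ht _
  rw [(ht 0).deriv]

theorem exists_mem_timeInterval {T : EReal} (hT : 0 < T) : ∃ t, t ∈ timeInterval T := by
  obtain ⟨t, h1, h2⟩ := EReal.lt_iff_exists_real_btwn.1 hT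
  exact ⟨t, by exact_mod_cast h1, h2⟩

theorem mem_timeInterval_of_le {T : EReal} {s t : ℝ} (ht : t ∈ timeInterval T) (h0 : 0 < s)
    (hst : s ≤ t) : s ∈ timeInterval T :=
  ⟨h0, (EReal.coe_le_coe_iff.2 hst).trans_lt ht.2⟩

theorem timeInterval_mem_nhdsGT {T : EReal} (hT : 0 < T) :
    (timeInterval T : Set ℝ) ∈ 𝓝[>] (0 : ℝ) := by
  obtain ⟨t, ht⟩ := exists_mem_timeInterval hT
  filter_upwards [Ioo_mem_nhdsGT ht.1] with s hs
  exact mem_timeInterval_of_le ht hs.1 hs.2.le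

theorem measurableSet_timeInterval (T : EReal) : MeasurableSet (timeInterval T : Set ℝ) :=
  (timeInterval T).isOpen.measurableSet

theorem exists_Icc_of_compact_subset {T : EReal} (hT : 0 < T) {K : Set ℝ} (hK : IsCompact K)
    (hs : K ⊆ timeInterval T) :
    ∃ a b : ℝ, K ⊆ Icc a b ∧ Icc a b ⊆ (timeInterval T : Set ℝ) := by
  rcases K.eq_empty_or_nonempty with rfl | hne
  · obtain ⟨t, ht⟩ := exists_mem_timeInterval hT
    exact ⟨t, t, empty_subset _, by simpa using ht⟩
  · obtain ⟨a, ha⟩ := hK.exists_isLeast hne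
    obtain ⟨b, hb⟩ := hK.exists_isGreatest hne
    refine ⟨a, b, fun t ht => ⟨ha.2 ht, hb.2 ht⟩, fun t ht => ?_⟩
    exact mem_timeInterval_of_le (hs hb.1) ((hs ha.1).1.trans_le ht.1) ht.2

/-- A smooth function of integral zero is the derivative of a test function. -/
theorem exists_primitive {T : EReal} (hT : 0 < T) {ζ : ℝ → ℝ} (hζ : ContDiff ℝ ∞ ζ)
    (hc : HasCompactSupport ζ) (hs : tsupport ζ ⊆ timeInterval T) (h0 : ∫ t, ζ t = 0) :
    ∃ η : 𝓓(timeInterval T, ℝ), deriv η = ζ := by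
  obtain ⟨a, b, hab, hI⟩ := exists_Icc_of_compact_subset hT hc hs
  have hd : ∀ t, HasDerivAt (fun t => ∫ s in a..t, ζ s) (ζ t) t := fun t =>
    intervalIntegral.integral_hasDerivAt_right (hζ.continuous.intervalIntegrable _ _)
      hζ.continuous.aestronglyMeasurable.stronglyMeasurableAtFilter hζ.continuous.continuousAt
  have hz : ∀ t, t ∉ Icc a b → ζ t = 0 := fun t ht =>
    image_eq_zero_of_notMem_tsupport fun h => ht (hab h)
  have hsupp : ∀ t, t ∉ Icc a b → ∫ s in a..t, ζ s = 0 := by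
    intro t ht
    rcases lt_or_ge t a with h | h
    · refine intervalIntegral.integral_zero_ae (Eventually.of_forall fun s hs => ?_)
      rw [uIoc_of_ge h.le] at hs
      by_contra h1
      by_cases h2 : s ∈ Icc a b
      -- The half-open interval contains its endpoint a, where ζ vanishes by continuity from the
      -- left.
      · have h3 : s = a := le_antisymm hs.2 h2.1
        have h4 : ζ a = 0 := by
          have hcl : a ∈ closure (Iio a) := by simp
          have : IsClosed {s | ζ s = 0} := isClosed_eq hζ.continuous continuous_const
          exact this.closure_subset_iff.2 (fun s (hs : s < a) => hz s fun h => not_le.2 hs h.1) hcl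
        exact h1 (h3 ▸ h4)
      · exact h1 (hz s h2)
    · have hb : b < t := by
        by_contra h1
        exact ht ⟨h, not_lt.1 h1⟩
      rw [← h0, intervalIntegral.integral_of_le h, ← integral_Icc_eq_integral_Ioc]
      exact setIntegral_eq_integral_of_forall_compl_eq_zero fun s hs =>
        hz s fun h => hs ⟨h.1, h.2.trans hb.le⟩
  have hcd : ContDiff ℝ ∞ (fun t => ∫ s in a..t, ζ s) := by
    rw [contDiff_infty_iff_deriv]
    refine ⟨fun t => (hd t).differentiableAt, ?_⟩
    rwa [show deriv (fun t => ∫ s in a..t, ζ s) = ζ from funext fun t => (hd t).deriv]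
  have hts : tsupport (fun t => ∫ s in a..t, ζ s) ⊆ Icc a b :=
    closure_minimal (fun t ht => by
      by_contra h
      exact ht (hsupp t h)) isClosed_Icc
  exact ⟨⟨_, hcd, HasCompactSupport.of_support_subset_isCompact isCompact_Icc
    ((subset_tsupport _).trans hts), hts.trans hI⟩, funext fun t => (hd t).deriv⟩

/-- A function on an interval with vanishing weak derivative is constant. -/
theorem ae_eq_const_of_weak_deriv_zero {T : EReal} (hT : 0 < T) {g : ℝ → ℝ}
    (hg : LocallyIntegrableOn g (timeInterval T : Set ℝ))
    (h : ∀ η : 𝓓(timeInterval T, ℝ), ∫ t in (timeInterval T : Set ℝ), g t * deriv η t = 0) :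
    ∃ c : ℝ, ∀ᵐ t ∂(volume.restrict (timeInterval T : Set ℝ)), g t = c := by
  obtain ⟨t0, ht0⟩ := exists_mem_timeInterval hT
  obtain ⟨r, hr, hball⟩ := Metric.isOpen_iff.1 (timeInterval T).isOpen t0 ht0
  let b : ContDiffBump t0 := ⟨r / 4, r / 2, by positivity, by linarith⟩
  set χ : ℝ → ℝ := b.normed volume with hχ
  have hχs : tsupport χ ⊆ (timeInterval T : Set ℝ) := by
    rw [hχ, b.tsupport_normed_eq]
    exact (Metric.closedBall_subset_ball (by change r / 2 < r; linarith)).trans hball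
  have hχc : HasCompactSupport χ := b.hasCompactSupport_normed
  have hχd : ContDiff ℝ ∞ χ := b.contDiff_normed
  have hχ1 : ∫ t, χ t = 1 := b.integral_normed
  have hint : ∀ ζ : ℝ → ℝ, Continuous ζ → HasCompactSupport ζ →
      tsupport ζ ⊆ (timeInterval T : Set ℝ) →
      Integrable (fun t => g t * ζ t) (volume.restrict (timeInterval T : Set ℝ)) := by
    intro ζ hζ hc hs
    have h1 : IntegrableOn (fun t => g t * ζ t) (tsupport ζ) volume :=
      (hg.integrableOn_compact_subset hs hc).mul_continuousOn hζ.continuousOn hc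
    have h2 : Integrable (fun t => g t * ζ t) := (integrableOn_iff_integrable_of_support_subset
      (fun t (ht : g t * ζ t ≠ 0) => subset_tsupport _ (right_ne_zero_of_mul ht))).1 h1
    exact h2.restrict
  set c := ∫ t in (timeInterval T : Set ℝ), g t * χ t with hc
  refine ⟨c, ?_⟩
  rw [ae_restrict_iff' (measurableSet_timeInterval T)]
  have hconst : LocallyIntegrableOn (fun _ : ℝ => c) (timeInterval T : Set ℝ) :=
    (continuous_const.locallyIntegrable).locallyIntegrableOn _
  have key := (timeInterval T).isOpen.ae_eq_zero_of_integral_contDiff_smul_eq_zero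
    (hg.sub hconst) (fun ζ hζ hζc hζs => by
    set I := ∫ t, ζ t with hI
    -- Du Bois-Reymond: ζ minus its integral times χ has integral zero, so it is the derivative of a
    -- test function, and testing g with it shows that g and c have the same pairing with ζ.
    have hθd : ContDiff ℝ ∞ fun t => ζ t - I * χ t := hζ.sub (contDiff_const.mul hχd)
    have hθc : HasCompactSupport fun t => ζ t - I * χ t := hζc.sub hχc.mul_left
    have hθs : tsupport (fun t => ζ t - I * χ t) ⊆ (timeInterval T : Set ℝ) :=
      (tsupport_sub ζ fun t => I * χ t).trans (union_subset hζs
        ((tsupport_mul_subset_right (f := fun _ => I)).trans hχs))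
    have hζi := hζ.continuous.integrable_of_hasCompactSupport hζc (μ := volume)
    have hχi := hχd.continuous.integrable_of_hasCompactSupport hχc (μ := volume)
    obtain ⟨η, hη⟩ := exists_primitive hT hθd hθc hθs (by
      rw [integral_sub hζi (hχi.const_mul I), integral_const_mul, hχ1]; simp [hI])
    have h1 := h η
    rw [hη] at h1
    have h2 : ∫ t in (timeInterval T : Set ℝ), g t * (ζ t - I * χ t) =
        (∫ t in (timeInterval T : Set ℝ), g t * ζ t) - I * c := by
      rw [hc, ← integral_const_mul, ← integral_sub (hint ζ hζ.continuous hζc hζs)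
        ((hint χ hχd.continuous hχc hχs).const_mul I)]
      congr 1
      funext t
      ring
    have h3 : ∫ t, ζ t • (g - fun _ : ℝ => c) t =
        (∫ t in (timeInterval T : Set ℝ), g t * ζ t) - c * I := by
      have e1 : ∫ t, ζ t • (g - fun _ : ℝ => c) t =
          ∫ t in (timeInterval T : Set ℝ), (g t * ζ t - c * ζ t) := by
        rw [setIntegral_eq_integral_of_forall_compl_eq_zero]
        · congr 1
          funext t
          simp only [Pi.sub_apply, smul_eq_mul]
          ring
        · intro t ht
          rw [image_eq_zero_of_notMem_tsupport fun h => ht (hζs h)]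
          ring
      rw [e1, integral_sub (hint ζ hζ.continuous hζc hζs) (hζi.const_mul c).restrict,
        integral_const_mul, setIntegral_eq_integral_of_forall_compl_eq_zero (f := ζ)]
      intro t ht
      exact image_eq_zero_of_notMem_tsupport fun h => ht (hζs h)
    rw [h3]
    linarith)
  filter_upwards [key] with t ht hmem
  exact sub_eq_zero.1 (ht hmem)

/-- Tail integrals are unique. -/
theorem IsTailIntegral.ae_eq {T : EReal} (hT : 0 < T) {S : 𝓓(timeInterval T, ℝ) → ℝ} {G H : ℝ → ℝ}
    (hG : IsTailIntegral T S G) (hH : IsTailIntegral T S H) :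
    ∀ᵐ t ∂(volume.restrict (timeInterval T : Set ℝ)), G t = H t := by
  have hint : ∀ {G : ℝ → ℝ}, LocallyIntegrableOn G (timeInterval T : Set ℝ) →
      ∀ η : 𝓓(timeInterval T, ℝ),
      Integrable (fun t => G t * deriv η t) (volume.restrict (timeInterval T : Set ℝ)) := by
    intro G hG η
    have hcont : Continuous (deriv η) := η.contDiff.continuous_deriv (by simp)
    have hs : tsupport (deriv η) ⊆ tsupport η := tsupport_deriv_subset
    have h1 : IntegrableOn (fun t => G t * deriv η t) (tsupport η) volume :=
      (hG.integrableOn_compact_subset η.tsupport_subset η.hasCompactSupport).mul_continuousOn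
        hcont.continuousOn η.hasCompactSupport
    exact ((integrableOn_iff_integrable_of_support_subset
      (fun t (ht : G t * deriv η t ≠ 0) => hs (subset_tsupport _ (right_ne_zero_of_mul ht)))).1 h1).restrict
  obtain ⟨c, hc⟩ := ae_eq_const_of_weak_deriv_zero hT
    (hG.locallyIntegrable.sub hH.locallyIntegrable) fun η => by
      simp only [Pi.sub_apply, sub_mul]
      rw [integral_sub (hint hG.locallyIntegrable η) (hint hH.locallyIntegrable η),
        ← hG.primitive, ← hH.primitive, sub_self]
  obtain ⟨a, haT, ha⟩ := hG.eventually_zero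
  obtain ⟨b, hbT, hb⟩ := hH.eventually_zero
  -- Both tail integrals vanish almost everywhere on an interval (s, r) close to T, which has
  -- positive measure.
  have hc0 : c = 0 := by
    have hm : max (max (a : EReal) b) 0 < T := max_lt (max_lt haT hbT) hT
    obtain ⟨s, hs1, hs2⟩ := EReal.lt_iff_exists_real_btwn.1 hm
    obtain ⟨r, hr1, hr2⟩ := EReal.lt_iff_exists_real_btwn.1 hs2
    have hsr : s < r := by exact_mod_cast hr1
    have hs0 : 0 < s := by
      have := (le_max_right _ _).trans_lt hs1
      exact_mod_cast this
    have has : a < s := by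
      have := ((le_max_left _ _).trans (le_max_left _ _)).trans_lt hs1
      exact_mod_cast this
    have hbs : b < s := by
      have := ((le_max_right _ _).trans (le_max_left _ _)).trans_lt hs1
      exact_mod_cast this
    have hsub : Ioo s r ⊆ (timeInterval T : Set ℝ) := fun t ht =>
      ⟨hs0.trans ht.1, (EReal.coe_lt_coe_iff.2 ht.2).trans hr2⟩
    have hall := ae_restrict_of_ae_restrict_of_subset hsub ((hc.and ha).and hb)
    have hne : (ae (volume.restrict (Ioo s r))).NeBot := by
      rw [ae_neBot, Ne, Measure.restrict_eq_zero]
      simpa using hsr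
    obtain ⟨t, ⟨⟨h1, h2⟩, h3⟩, h4⟩ := (hall.and (ae_restrict_mem measurableSet_Ioo)).exists
    have := h1
    rw [Pi.sub_apply, h2 (has.trans h4.1), h3 (hbs.trans h4.1)] at this
    simpa using this.symm
  filter_upwards [hc] with t ht
  rw [hc0] at ht
  exact sub_eq_zero.1 ht

theorem eventually_of_ae_restrict {T : EReal} (hT : 0 < T) {P : ℝ → Prop}
    (h : ∀ᵐ t ∂(volume.restrict (timeInterval T : Set ℝ)), P t) :
    ∀ᶠ t in 𝓝[>] (0 : ℝ) ⊓ ae volume, P t := by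
  rw [ae_restrict_iff' (measurableSet_timeInterval T)] at h
  filter_upwards [mem_inf_of_left (timeInterval_mem_nhdsGT hT), mem_inf_of_right h] with t h1 h2
  exact h2 h1

/-- Right neighbourhoods of 0 have positive measure. This makes limits outside null sets unique. -/
instance neBot_nhdsGT_inf_ae : (𝓝[>] (0 : ℝ) ⊓ ae volume).NeBot := by
  rw [inf_neBot_iff]
  intro s hs s' hs'
  obtain ⟨u, hu, hsub⟩ := mem_nhdsGT_iff_exists_Ioo_subset.1 hs
  have h1 : volume (Ioo 0 u ∩ s') ≠ 0 := by
    rw [measure_inter_conull hs']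
    simpa using hu
  obtain ⟨t, ht⟩ := nonempty_of_measure_ne_zero h1
  exact ⟨t, hsub ht.1, ht.2⟩

/-- A function with a limit outside of null sets can be modified to have this limit. -/
theorem exists_ae_eq_tendsto {E : Type*} [PseudoMetricSpace E] {f : ℝ → E} {l : E}
    (h : Tendsto f (𝓝[>] (0 : ℝ) ⊓ ae volume) (𝓝 l)) :
    ∃ g : ℝ → E, g =ᵐ[volume] f ∧ (∀ t, g t = f t ∨ g t = l) ∧ Tendsto g (𝓝[>] 0) (𝓝 l) := by
  classical
  have h1 : ∀ n : ℕ, ∃ s ∈ 𝓝[>] (0 : ℝ), ∃ s' ∈ ae (volume : Measure ℝ), ∀ t ∈ s, t ∈ s' →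
      dist (f t) l < 1 / ((n : ℝ) + 1) := by
    intro n
    have h2 := Metric.tendsto_nhds.1 h (1 / ((n : ℝ) + 1)) (by positivity)
    obtain ⟨s, hs, s', hs', e⟩ := mem_inf_iff.1 h2
    refine ⟨s, hs, s', hs', fun t h3 h4 => ?_⟩
    have : t ∈ s ∩ s' := ⟨h3, h4⟩
    rw [← e] at this
    exact this
  choose s hs s' hs' hd using h1
  -- Each accuracy 1/(n+1) has its own null set; their union is still null, and setting the function
  -- equal to l there gives an ordinary limit.
  have hN : (⋂ n, s' n) ∈ ae (volume : Measure ℝ) := countable_iInter_mem.2 hs'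
  refine ⟨fun t => if t ∈ ⋂ n, s' n then f t else l, ?_, fun t => ?_, ?_⟩
  · filter_upwards [hN] with t ht
    exact if_pos ht
  · by_cases h2 : t ∈ ⋂ n, s' n
    · exact Or.inl (if_pos h2)
    · exact Or.inr (if_neg h2)
  · refine Metric.tendsto_nhds.2 fun ε hε => ?_
    obtain ⟨n, hn⟩ := exists_nat_one_div_lt hε
    filter_upwards [hs n] with t ht
    split_ifs with h2
    · exact (hd n t ht (mem_iInter.1 h2 n)).trans hn
    · simpa using hε

/-! ### Force, mean velocity and drift measured with a profile. -/

/-- The `j`-th partial derivative of a function on `ℝ³`. -/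
noncomputable def pd (j : Fin 3) (r : E3 → ℝ) (x : E3) : ℝ := fderiv ℝ r x (bv j)

/-- The Laplacian of a function on `ℝ³`. -/
noncomputable def lapl (r : E3 → ℝ) (x : E3) : ℝ := ∑ l : Fin 3, pd l (pd l r) x

theorem contDiff_pd {r : E3 → ℝ} (hr : ContDiff ℝ ∞ r) (j : Fin 3) : ContDiff ℝ ∞ (pd j r) :=
  (hr.fderiv_right (by simp)).clm_apply contDiff_const

theorem hasCompactSupport_pd {r : E3 → ℝ} (hc : HasCompactSupport r) (j : Fin 3) :
    HasCompactSupport (pd j r) := hc.fderiv_apply ℝ _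

theorem pd_const_mul_comp_smul {g : E3 → ℝ} (hg : ContDiff ℝ ∞ g) (c a : ℝ) (j : Fin 3) :
    pd j (fun x => c * g (a • x)) = fun x => c * a * pd j g (a • x) := by
  funext x
  have h1 : HasFDerivAt (fun x : E3 => a • x) (a • ContinuousLinearMap.id ℝ E3) x :=
    (hasFDerivAt_id x).const_smul a
  have h2 := (((hg.differentiable (by simp)) (a • x)).hasFDerivAt.comp x h1).const_mul c
  have h3 : fderiv ℝ (fun x => c * g (a • x)) x = _ := h2.fderiv
  rw [pd, h3]
  simp [pd]
  ring

theorem D_ex_mul {r : E3 → ℝ} (hr : ContDiff ℝ ∞ r) {h : ℝ → ℝ} (hh : ContDiff ℝ ∞ h) (k : Fin 3) :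
    D (ex k) (fun z => r z.1 * h z.2) = fun z => pd k r z.1 * h z.2 := by
  funext z
  have h1 := ((hr.differentiable (by simp)) z.1).hasFDerivAt.comp z hasFDerivAt_fst
  have h2 := ((hh.differentiable (by simp)) z.2).hasFDerivAt.comp z hasFDerivAt_snd
  have h3 : fderiv ℝ (fun z : E3 × ℝ => r z.1 * h z.2) z = _ := (h1.mul h2).fderiv
  rw [D, h3]
  simp [pd, ex, bv]
  ring

theorem D_et_mul {r : E3 → ℝ} (hr : ContDiff ℝ ∞ r) {h : ℝ → ℝ} (hh : ContDiff ℝ ∞ h) :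
    D et (fun z => r z.1 * h z.2) = fun z => r z.1 * deriv h z.2 := by
  funext z
  have h1 := ((hr.differentiable (by simp)) z.1).hasFDerivAt.comp z hasFDerivAt_fst
  have h2 := ((hh.differentiable (by simp)) z.2).hasFDerivAt.comp z hasFDerivAt_snd
  have h3 : fderiv ℝ (fun z : E3 × ℝ => r z.1 * h z.2) z = _ := (h1.mul h2).fderiv
  rw [D, h3]
  simp [et]

/-- The integrand of the force that a fluid exerts on the profile `r`. -/
noncomputable def flux (v : E3 → E3) (r : E3 → ℝ) (k : Fin 3) (x : E3) : ℝ :=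
  v x k * lapl r x + (∑ j : Fin 3, v x k * v x j * pd j r x) +
    ∑ i : Fin 3, ∑ j : Fin 3, v x i * v x j * rieszRR i j (pd k r) x

/-- On products r(x) h(t) the residual becomes the weak form of an ordinary differential equation:
the time derivative of the mean velocity against the force on the profile. -/
theorem residual_mul (u : E3 → ℝ → E3) (k : Fin 3) {r : E3 → ℝ} (hr : ContDiff ℝ ∞ r)
    (hc : HasCompactSupport r) {h : ℝ → ℝ} (hh : ContDiff ℝ ∞ h) (x : E3) (t : ℝ) :
    residual u k (fun z => r z.1 * h z.2) (x, t) =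
      deriv h t * (u x t k * r x) + h t * flux (fun x => u x t) r k x := by
  have e : ∀ i j, RR i j (fun z => pd k r z.1 * h z.2) (x, t) = rieszRR i j (pd k r) x * h t :=
    fun i j => rieszRR_const_mul (contDiff_pd hr k) (hasCompactSupport_pd hc k) _ i j _
  simp only [residual, mom_eq, quad, lap, D_ex_mul hr hh, D_et_mul hr hh, e,
    D_ex_mul (contDiff_pd hr _) hh, flux, lapl, mul_add, Finset.mul_sum]
  have e1 : ∀ a b c d a' b' c' d' : ℝ, a = a' → b = b' → c = c' → d = d' →
      a + b + c + d = a' + (b' + c' + d') := by intros; subst_vars; ring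
  refine e1 _ _ _ _ _ _ _ _ (by ring) ?_ ?_ ?_
  · exact Finset.sum_congr rfl fun l _ => by ring
  · exact Finset.sum_congr rfl fun l _ => by ring
  · exact Finset.sum_congr rfl fun l _ => Finset.sum_congr rfl fun l _ => by ring

/-- Every smooth compactly supported function on `ℝ³` is a time slice of a test function. -/
theorem exists_test_slice {r : E3 → ℝ} (hr : ContDiff ℝ ∞ r) (hc : HasCompactSupport r) :
    ∃ f : E3 × ℝ → ℝ, IsTest f ∧ (∀ x, f (x, 0) = r x) ∧ (∀ x, lap f (x, 0) = lapl r x) ∧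
      (∀ j x, D (ex j) f (x, 0) = pd j r x) ∧
      (∀ i j x, RR i j f (x, 0) = rieszRR i j r x) ∧
      ∀ i j k x, RR i j (D (ex k) f) (x, 0) = rieszRR i j (pd k r) x := by
  let b : ContDiffBump (0 : ℝ) := ⟨1, 2, one_pos, one_lt_two⟩
  have hb : b 0 = 1 := b.one_of_mem_closedBall (by simp [b.rIn_pos.le])
  refine ⟨fun z => r z.1 * b z.2, ⟨(hr.comp contDiff_fst).mul (b.contDiff.comp contDiff_snd), ?_⟩,
    ?_, ?_, ?_, ?_, ?_⟩
  · refine HasCompactSupport.intro (hc.isCompact.prod b.hasCompactSupport.isCompact) fun z hz => ?_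
    by_contra h0
    exact hz ⟨subset_tsupport _ (left_ne_zero_of_mul h0), subset_tsupport _ (right_ne_zero_of_mul h0)⟩
  · simp [hb]
  · simp [lap, lapl, D_ex_mul hr b.contDiff, D_ex_mul (contDiff_pd hr _) b.contDiff, hb]
  · simp [D_ex_mul hr b.contDiff, hb]
  · simp [RR, hb]
  · simp [D_ex_mul hr b.contDiff, RR, hb]

theorem exists_profile_bound {r : E3 → ℝ} (hr : ContDiff ℝ ∞ r) (hc : HasCompactSupport r) :
    ∃ B : ℝ, 0 < B ∧ ∀ x, |r x| ≤ B * weight x ∧ |lapl r x| ≤ B * weight x ∧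
      (∀ j, |pd j r x| ≤ B * weight x) ∧ ∀ i j k, |rieszRR i j (pd k r) x| ≤ B * weight x := by
  obtain ⟨f, hf, h1, h2, h3, -, h4⟩ := exists_test_slice hr hc
  obtain ⟨B1, -, h10, hb1, -⟩ := hf.wt.bound
  obtain ⟨B2, -, h20, hb2, -⟩ := hf.lap.wt.bound
  choose B3 M3 h30 hb3 hm3 using fun j => (hf.D (ex j)).wt.bound
  choose B4 M4 h40 hb4 hm4 using fun q : Fin 3 × Fin 3 × Fin 3 => (wt_RR_D hf q.1 q.2.1 q.2.2).bound
  have s3 : ∀ j, B3 j ≤ ∑ j, B3 j := fun j =>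
    Finset.single_le_sum (fun j _ => h30 j) (Finset.mem_univ j)
  have s4 : ∀ q, B4 q ≤ ∑ q, B4 q := fun q =>
    Finset.single_le_sum (fun q _ => h40 q) (Finset.mem_univ q)
  have s30 : 0 ≤ ∑ j, B3 j := Finset.sum_nonneg fun j _ => h30 j
  have s40 : 0 ≤ ∑ q, B4 q := Finset.sum_nonneg fun q _ => h40 q
  refine ⟨B1 + B2 + (∑ j, B3 j) + (∑ q, B4 q) + 1, by positivity, fun x => ⟨?_, ?_, ?_, ?_⟩⟩
  · have := hb1 (x, 0)
    rw [h1] at this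
    exact this.trans (mul_le_mul_of_nonneg_right (by linarith) (weight_pos x).le)
  · have := hb2 (x, 0)
    rw [h2] at this
    exact this.trans (mul_le_mul_of_nonneg_right (by linarith) (weight_pos x).le)
  · intro j
    have := hb3 j (x, 0)
    rw [h3] at this
    exact this.trans (mul_le_mul_of_nonneg_right (by linarith [s3 j]) (weight_pos x).le)
  · intro i j k
    have := hb4 (i, j, k) (x, 0)
    rw [h4] at this
    exact this.trans (mul_le_mul_of_nonneg_right (by linarith [s4 (i, j, k)]) (weight_pos x).le)

theorem continuous_rieszRR {r : E3 → ℝ} (hr : ContDiff ℝ ∞ r) (hc : HasCompactSupport r)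
    (i j : Fin 3) : Continuous (rieszRR i j r) := by
  obtain ⟨f, hf, -, -, -, h, -⟩ := exists_test_slice hr hc
  have : rieszRR i j r = fun x => RR i j f (x, 0) := funext fun x => (h i j x).symm
  rw [this]
  exact (contDiff_RR hf i j).continuous.comp (by fun_prop)

theorem aestronglyMeasurable_flux {α : Type*} [MeasurableSpace α] {μ : Measure α} {w : α → E3}
    {y : α → E3} (hw : AEStronglyMeasurable w μ) (hy : Measurable y) {r : E3 → ℝ}
    (hr : ContDiff ℝ ∞ r) (hc : HasCompactSupport r) (k : Fin 3) :
    AEStronglyMeasurable (fun q => w q k * lapl r (y q) + (∑ j : Fin 3, w q k * w q j * pd j r (y q)) +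
      ∑ i : Fin 3, ∑ j : Fin 3, w q i * w q j * rieszRR i j (pd k r) (y q)) μ := by
  have hc' := aestronglyMeasurable_coord hw
  have hl : Continuous (lapl r) := by
    refine continuous_finsetSum _ fun l _ => (contDiff_pd (contDiff_pd hr l) l).continuous
  have hm : ∀ {g : E3 → ℝ}, Continuous g → AEStronglyMeasurable (fun q => g (y q)) μ := fun hg =>
    (hg.measurable.comp hy).aestronglyMeasurable
  refine (((hc' k).mul (hm hl)).add ?_).add ?_
  · exact Finset.aestronglyMeasurable_fun_sum _ fun j _ =>
      ((hc' k).mul (hc' j)).mul (hm (contDiff_pd hr j).continuous)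
  · exact Finset.aestronglyMeasurable_fun_sum _ fun i _ => Finset.aestronglyMeasurable_fun_sum _
      fun j _ => ((hc' i).mul (hc' j)).mul
        (hm (continuous_rieszRR (contDiff_pd hr k) (hasCompactSupport_pd hc k) i j))

/-- The constant is 13 = 1 + 3 + 9, the number of summands. -/
theorem abs_flux_terms_le (w : E3) (k : Fin 3) {a l : ℝ} {p : Fin 3 → ℝ} {q : Fin 3 → Fin 3 → ℝ}
    (hl : |l| ≤ a) (hp : ∀ j, |p j| ≤ a) (hq : ∀ i j, |q i j| ≤ a) :
    |w k * l + (∑ j : Fin 3, w k * w j * p j) + ∑ i : Fin 3, ∑ j : Fin 3, w i * w j * q i j| ≤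
      13 * a * (1 + ‖w‖ ^ 2) := by
  have h1 : |w k * l| ≤ (1 + ‖w‖ ^ 2) * a := by
    rw [abs_mul]
    exact mul_le_mul (abs_coord_le _ _) hl (abs_nonneg _) (by positivity)
  have h2 : |∑ j : Fin 3, w k * w j * p j| ≤ ∑ j : Fin 3, (1 + ‖w‖ ^ 2) * a := by
    refine (Finset.abs_sum_le_sum_abs _ _).trans (Finset.sum_le_sum fun j _ => ?_)
    rw [abs_mul]
    exact mul_le_mul (abs_coord_mul_le _ _ _) (hp j) (abs_nonneg _) (by positivity)
  have h3 : |∑ i : Fin 3, ∑ j : Fin 3, w i * w j * q i j| ≤ 9 * ((1 + ‖w‖ ^ 2) * a) := by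
    refine abs_sum_sum_le fun i j => ?_
    rw [abs_mul]
    exact mul_le_mul (abs_coord_mul_le _ _ _) (hq i j) (abs_nonneg _) (by positivity)
  refine (abs_add_le _ _).trans (le_trans (add_le_add ((abs_add_le _ _).trans
    (add_le_add h1 h2)) h3) (le_of_eq ?_))
  simp
  ring

theorem UlocSlice.integrable_flux {C : ℝ} {v : E3 → E3} (hv : UlocSlice C v) {r : E3 → ℝ}
    (hr : ContDiff ℝ ∞ r) (hc : HasCompactSupport r) (k : Fin 3) : Integrable (flux v r k) := by
  obtain ⟨B, hB0, hB⟩ := exists_profile_bound hr hc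
  refine hv.integrable (a := 13 * B) (aestronglyMeasurable_flux hv.meas measurable_id hr hc k)
    fun x => ?_
  obtain ⟨-, h1, h2, h3⟩ := hB x
  refine (abs_flux_terms_le (v x) k h1 h2 fun i j => h3 i j k).trans_eq ?_
  ring

theorem UlocSlice.integrable_coord_mul {C : ℝ} {v : E3 → E3} (hv : UlocSlice C v) {r : E3 → ℝ}
    (hr : ContDiff ℝ ∞ r) (hc : HasCompactSupport r) (k : Fin 3) :
    Integrable (fun x => v x k * r x) := by
  obtain ⟨B, hB0, hB⟩ := exists_profile_bound hr hc
  refine hv.integrable (a := B) ((aestronglyMeasurable_coord hv.meas k).mul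
    hr.continuous.aestronglyMeasurable) fun x => ?_
  rw [abs_mul]
  calc _ ≤ (1 + ‖v x‖ ^ 2) * (B * weight x) :=
        mul_le_mul (abs_coord_le _ _) (hB x).1 (abs_nonneg _) (by positivity)
    _ = _ := by ring

/-- The dilation of a profile that preserves its integral. -/
noncomputable def dil (R : ℝ) (r : E3 → ℝ) (x : E3) : ℝ := R⁻¹ ^ 3 * r (R⁻¹ • x)

theorem contDiff_dil {r : E3 → ℝ} (hr : ContDiff ℝ ∞ r) (R : ℝ) : ContDiff ℝ ∞ (dil R r) :=
  contDiff_const.mul (hr.comp (contDiff_const_smul _))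

theorem hasCompactSupport_dil {r : E3 → ℝ} (hc : HasCompactSupport r) {R : ℝ} (hR : 0 < R) :
    HasCompactSupport (dil R r) :=
  (hc.comp_smul (inv_ne_zero hR.ne')).mul_left

theorem dil_one (r : E3 → ℝ) : dil 1 r = r := by funext x; simp [dil]

theorem integral_eq_mul_integral_smul {R : ℝ} (hR : 0 < R) (F : E3 → ℝ) :
    ∫ x, F x = R ^ 3 * ∫ x, F (R • x) := by
  rw [Measure.integral_comp_smul, finrank_euclideanSpace_fin, smul_eq_mul, ← mul_assoc,
    abs_of_pos (by positivity), mul_inv_cancel₀ (by positivity), one_mul]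

theorem integral_dil (r : E3 → ℝ) {R : ℝ} (hR : 0 < R) : ∫ x, dil R r x = ∫ x, r x := by
  rw [integral_eq_mul_integral_smul hR]
  simp only [dil, inv_smul_smul₀ hR.ne', integral_const_mul]
  field_simp

theorem rieszRR_comp_smul {r : E3 → ℝ} (hr : ContDiff ℝ ∞ r) (hc : HasCompactSupport r) {R : ℝ}
    (hR : 0 < R) (c : ℝ) (i j : Fin 3) (y : E3) :
    rieszRR i j (fun x => c * r (R⁻¹ • x)) (R • y) = c * rieszRR i j r y := by
  have h1 : ContDiff ℝ ∞ fun x => c * r (R⁻¹ • x) :=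
    contDiff_const.mul (hr.comp (contDiff_const_smul _))
  have h2 : HasCompactSupport fun x => c * r (R⁻¹ • x) :=
    (hc.comp_smul (inv_ne_zero hR.ne')).mul_left
  have h3 : ∀ x, fderiv ℝ (fun x => c * r (R⁻¹ • x)) x (bv i) = c * R⁻¹ * pd i r (R⁻¹ • x) :=
    fun x => congrFun (pd_const_mul_comp_smul hr c R⁻¹ i) x
  rw [rieszRR_eq_gradNewton h1 h2, rieszRR_eq_gradNewton hr hc, integral_eq_mul_integral_smul hR,
    ← integral_const_mul, ← integral_const_mul]
  congr 1
  funext z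
  have h4 : gradNewton j (R • z) = R⁻¹ ^ 2 * gradNewton j z := by
    simp only [gradNewton, PiLp.smul_apply, smul_eq_mul, norm_smul, Real.norm_of_nonneg hR.le]
    by_cases hz : z = 0
    · simp [hz]
    have := norm_pos_iff.2 hz
    field_simp
  rw [h3, h4, ← smul_sub, inv_smul_smul₀ hR.ne', pd]
  field_simp

/-- Each spatial derivative costs a factor R⁻¹, R_i R_j is homogeneous of degree zero, and R³ is the
Jacobian that cancels the normalization of the dilated profile. -/
theorem flux_dil (v : E3 → E3) {r : E3 → ℝ} (hr : ContDiff ℝ ∞ r) (hc : HasCompactSupport r)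
    {R : ℝ} (hR : 0 < R) (k : Fin 3) (y : E3) :
    R ^ 3 * flux v (dil R r) k (R • y) = v (R • y) k * (R⁻¹ ^ 2 * lapl r y) +
      (∑ j : Fin 3, v (R • y) k * v (R • y) j * (R⁻¹ * pd j r y)) +
      ∑ i : Fin 3, ∑ j : Fin 3, v (R • y) i * v (R • y) j * (R⁻¹ * rieszRR i j (pd k r) y) := by
  have e1 : ∀ j, pd j (dil R r) = fun x => R⁻¹ ^ 3 * R⁻¹ * pd j r (R⁻¹ • x) := fun j =>
    pd_const_mul_comp_smul hr _ _ _
  have hR0 := hR.ne'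
  simp only [flux, lapl, e1, pd_const_mul_comp_smul (contDiff_pd hr _),
    rieszRR_comp_smul (contDiff_pd hr k) (hasCompactSupport_pd hc k) hR, inv_smul_smul₀ hR.ne',
    mul_add, Finset.mul_sum]
  refine congrArg₂ _ (congrArg₂ _ ?_ ?_) ?_
  · exact Finset.sum_congr rfl fun l _ => by field_simp
  · exact Finset.sum_congr rfl fun l _ => by field_simp
  · exact Finset.sum_congr rfl fun l _ => Finset.sum_congr rfl fun l _ => by field_simp

/-- After rescaling every term carries at least one factor R⁻¹, and the dilated field has a weighted
norm bounded independently of R. -/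
theorem UlocSlice.abs_integral_flux_dil_le {C : ℝ} (hC : 0 ≤ C) {r : E3 → ℝ}
    (hr : ContDiff ℝ ∞ r) (hc : HasCompactSupport r) {B : ℝ} (hB : 0 < B)
    (hbound : ∀ x, |lapl r x| ≤ B * weight x ∧
      (∀ j, |pd j r x| ≤ B * weight x) ∧ ∀ i j k, |rieszRR i j (pd k r) x| ≤ B * weight x)
    {R : ℝ} (hR : 1 ≤ R) {v : E3 → E3} (hv : UlocSlice C fun x => v (R • x)) (k : Fin 3) :
    |∫ x, flux v (dil R r) k x| ≤ 13 * B * R⁻¹ * C := by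
  have hR0 : 0 < R := by linarith
  rw [integral_eq_mul_integral_smul hR0, ← integral_const_mul]
  refine hv.abs_integral_le hC (by positivity) fun y => ?_
  rw [flux_dil v hr hc hR0]
  obtain ⟨h1, h2, h3⟩ := hbound y
  have hi : R⁻¹ ≤ 1 := inv_le_one_of_one_le₀ hR
  have hi0 : 0 ≤ R⁻¹ := by positivity
  have hw := (weight_pos y).le
  refine (abs_flux_terms_le (v (R • y)) k (a := R⁻¹ * (B * weight y)) ?_ ?_ ?_).trans_eq ?_
  · rw [abs_mul, abs_of_nonneg (by positivity)]
    gcongr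
    nlinarith
  · intro j
    rw [abs_mul, abs_of_nonneg hi0]
    gcongr
    exact h2 j
  · intro i j
    rw [abs_mul, abs_of_nonneg hi0]
    gcongr
    exact h3 i j k
  · ring

theorem UlocSlice.abs_integral_dil_le {C : ℝ} (hC : 0 ≤ C) {r : E3 → ℝ} {B : ℝ} (hB : 0 < B)
    (hbound : ∀ x, |r x| ≤ B * weight x) {R : ℝ} (hR : 0 < R) {v : E3 → E3}
    (hv : UlocSlice C fun x => v (R • x)) (k : Fin 3) : |∫ x, v x k * dil R r x| ≤ B * C := by
  rw [integral_eq_mul_integral_smul hR, ← integral_const_mul]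
  refine hv.abs_integral_le hC hB.le fun y => ?_
  have e : R ^ 3 * (v (R • y) k * dil R r (R • y)) = v (R • y) k * r y := by
    rw [dil, inv_smul_smul₀ hR.ne']
    field_simp
  rw [e, abs_mul]
  calc _ ≤ (1 + ‖v (R • y)‖ ^ 2) * (B * weight y) :=
        mul_le_mul (abs_coord_le _ _) (hbound y) (abs_nonneg _) (by positivity)
    _ = _ := by ring

/-- The average velocity weighted with the profile `r`. -/
noncomputable def meanVelocity (u : E3 → ℝ → E3) (r : E3 → ℝ) (k : Fin 3) (t : ℝ) : ℝ :=
  ∫ x, u x t k * r x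

/-- The force exerted on the profile `r`, extended by zero outside of `(0, T)`. -/
noncomputable def force (T : EReal) (u : E3 → ℝ → E3) (r : E3 → ℝ) (k : Fin 3) (t : ℝ) : ℝ :=
  (timeInterval T : Set ℝ).indicator (fun t => ∫ x, flux (fun x => u x t) r k x) t

/-- The difference of the accumulated force and the average velocity. -/
noncomputable def driftOf (T : EReal) (u : E3 → ℝ → E3) (r : E3 → ℝ) (k : Fin 3) (t : ℝ) : ℝ :=
  (∫ s in (0 : ℝ)..t, force T u r k s) - meanVelocity u r k t

section

variable {T : EReal} {u : E3 → ℝ → E3}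

theorem aestronglyMeasurable_meanVelocity (hu : MemL2uloc T u) {r : E3 → ℝ} (hr : ContDiff ℝ ∞ r)
    (k : Fin 3) :
    AEStronglyMeasurable (meanVelocity u r k) (volume.restrict (timeInterval T : Set ℝ)) := by
  have h : AEStronglyMeasurable (fun z : E3 × ℝ => u z.1 z.2 k * r z.1) (slabMeasure T) :=
    (aestronglyMeasurable_coord hu.meas k).mul
      (hr.continuous.comp continuous_fst).aestronglyMeasurable
  exact h.prod_swap.integral_prod_right'

theorem aestronglyMeasurable_force (hu : MemL2uloc T u) {r : E3 → ℝ} (hr : ContDiff ℝ ∞ r)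
    (hc : HasCompactSupport r) (k : Fin 3) : AEStronglyMeasurable (force T u r k) volume := by
  have h : AEStronglyMeasurable (fun z : E3 × ℝ => flux (fun x => u x z.2) r k z.1)
      (slabMeasure T) := aestronglyMeasurable_flux hu.meas measurable_fst hr hc k
  exact (aestronglyMeasurable_indicator_iff (measurableSet_timeInterval T)).2
    h.prod_swap.integral_prod_right'

/-- Uniform bounds for the force and the average velocity for all dilations of a profile. -/
theorem MemL2uloc.exists_force_bound (hu : MemL2uloc T u) {r : E3 → ℝ} (hr : ContDiff ℝ ∞ r)
    (hc : HasCompactSupport r) : ∃ A : ℝ, 0 < A ∧ ∀ R : ℝ, 1 ≤ R → ∀ k,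
      (∀ᵐ t ∂(volume.restrict (timeInterval T : Set ℝ)), |meanVelocity u (dil R r) k t| ≤ A) ∧
      ∀ᵐ t, |force T u (dil R r) k t| ≤ A * R⁻¹ := by
  obtain ⟨C, hC0, hC⟩ := hu.exists_slice_smul
  obtain ⟨B, hB0, hB⟩ := exists_profile_bound hr hc
  refine ⟨13 * B * C, by positivity, fun R hR k => ⟨?_, ?_⟩⟩
  · filter_upwards [hC] with t ht
    refine ((ht R hR).abs_integral_dil_le (v := fun x => u x t) hC0.le hB0 (fun x => (hB x).1)
      (by linarith) k).trans ?_
    nlinarith [mul_pos hB0 hC0]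
  · rw [ae_restrict_iff' (measurableSet_timeInterval T)] at hC
    filter_upwards [hC] with t ht
    by_cases hmem : t ∈ (timeInterval T : Set ℝ)
    · rw [force, indicator_of_mem hmem]
      refine ((ht hmem R hR).abs_integral_flux_dil_le (v := fun x => u x t) hC0.le hr hc hB0
        (fun x => (hB x).2) hR k).trans_eq ?_
      ring
    · rw [force, indicator_of_notMem hmem, abs_zero]
      positivity

theorem locallyIntegrable_of_ae_bound {a : ℝ → ℝ} (hm : AEStronglyMeasurable a volume) {A : ℝ}
    (h : ∀ᵐ t, |a t| ≤ A) : LocallyIntegrable a :=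
  (locallyIntegrable_const A).mono hm (h.mono fun _ ht => ht.trans (le_abs_self A))

theorem integral_residual_mul (hu : MemL2uloc T u) {r : E3 → ℝ} (hr : ContDiff ℝ ∞ r)
    (hc : HasCompactSupport r) (k : Fin 3) (h : 𝓓(timeInterval T, ℝ)) :
    ∫ z, residual u k (fun z => r z.1 * h z.2) z ∂(slabMeasure T) =
      - ∫ t in (timeInterval T : Set ℝ), deriv h t * driftOf T u r k t := by
  have hh : ContDiff ℝ ∞ h := h.contDiff
  have hd : Continuous (deriv h) := hh.continuous_deriv (by simp)
  have htest : IsTest (fun z : E3 × ℝ => r z.1 * h z.2) := by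
    refine ⟨(hr.comp contDiff_fst).mul (hh.comp contDiff_snd), ?_⟩
    refine HasCompactSupport.intro (hc.isCompact.prod h.hasCompactSupport.isCompact) fun z hz => ?_
    by_contra h0
    exact hz ⟨subset_tsupport _ (left_ne_zero_of_mul h0),
      subset_tsupport _ (right_ne_zero_of_mul h0)⟩
  obtain ⟨C, hC0, hC⟩ := hu.exists_slice
  obtain ⟨A, hA0, hA⟩ := hu.exists_force_bound hr hc
  obtain ⟨hA1, hA2⟩ := hA 1 le_rfl k
  rw [dil_one] at hA1 hA2
  have hloc := locallyIntegrable_of_ae_bound (aestronglyMeasurable_force hu hr hc k) hA2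
  have hmv := aestronglyMeasurable_meanVelocity hu hr k
  rw [← integral_slab (integrable_residual hu k htest)]
  have e1 : ∫ t in (timeInterval T : Set ℝ), ∫ x, residual u k (fun z => r z.1 * h z.2) (x, t) =
      ∫ t in (timeInterval T : Set ℝ), (deriv h t * meanVelocity u r k t +
        h t * force T u r k t) := by
    refine integral_congr_ae ?_
    filter_upwards [hC, ae_restrict_mem (measurableSet_timeInterval T)] with t ht hmem
    simp only [residual_mul u k hr hc hh]
    rw [integral_add ((ht.integrable_coord_mul hr hc k).const_mul _)
      ((ht.integrable_flux hr hc k).const_mul _), integral_const_mul, integral_const_mul, force,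
      indicator_of_mem hmem]
    rfl
  have i1 : Integrable (fun t => deriv h t * meanVelocity u r k t)
      (volume.restrict (timeInterval T : Set ℝ)) :=
    ((hd.integrable_of_hasCompactSupport h.hasCompactSupport.deriv).restrict).mul_bdd (c := A) hmv
      (hA1.mono fun t ht => ht)
  have i2 : Integrable (fun t => h t * force T u r k t) :=
    (hh.continuous.integrable_of_hasCompactSupport h.hasCompactSupport).mul_bdd (c := A)
      (aestronglyMeasurable_force hu hr hc k) (hA2.mono fun t ht => by simpa using ht)
  have hcont : Continuous fun t => ∫ s in (0 : ℝ)..t, force T u r k s :=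
    intervalIntegral.continuous_primitive (intervalIntegrable_of_locallyIntegrable hloc) 0
  have i3 : Integrable (fun t => deriv h t * ∫ s in (0 : ℝ)..t, force T u r k s) :=
    (hd.mul hcont).integrable_of_hasCompactSupport h.hasCompactSupport.deriv.mul_right
  have hz : ∀ t, t ∉ (timeInterval T : Set ℝ) → deriv h t = 0 := fun t ht =>
    image_eq_zero_of_notMem_tsupport fun h1 => ht (h.tsupport_subset (tsupport_deriv_subset h1))
  have e2 : ∫ t in (timeInterval T : Set ℝ), h t * force T u r k t =
      -- The force is only bounded and measurable; it is integrated by parts through its absolutely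
      -- continuous primitive.
      - ∫ t in (timeInterval T : Set ℝ), deriv h t * ∫ s in (0 : ℝ)..t, force T u r k s := by
    rw [setIntegral_eq_integral_of_forall_compl_eq_zero fun t ht => by
        rw [force, indicator_of_notMem ht, mul_zero],
      setIntegral_eq_integral_of_forall_compl_eq_zero fun t ht => by rw [hz t ht, zero_mul]]
    have := integral_primitive_mul_deriv hloc (hh.of_le (by simp)) h.hasCompactSupport
    simp only [mul_comm (deriv h _), this, neg_neg, mul_comm (h _)]
  rw [e1, integral_add i1 i2.restrict, e2]
  simp only [driftOf, mul_sub]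
  rw [integral_sub i3.restrict i1]
  ring

theorem neBot_ae_timeInterval (hT : 0 < T) :
    (ae (volume.restrict (timeInterval T : Set ℝ))).NeBot := by
  rw [ae_neBot, Ne, Measure.restrict_eq_zero]
  exact ((timeInterval T).isOpen.measure_pos _ (exists_mem_timeInterval hT)).ne'

/-- The drift is bounded on `(0, T)`. -/
theorem SolvesNSE.exists_driftOf_bound {p : 𝓓'(slab T, ℝ)} (hT : 0 < T) (h : SolvesNSE T u p)
    (hu : MemL2uloc T u) (k : Fin 3) : ∃ B : ℝ, 0 ≤ B ∧
      ∀ᵐ t ∂(volume.restrict (timeInterval T : Set ℝ)), |driftOf T u rho k t| ≤ B := by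
  have hr := contDiff_rho
  have hc := hasCompactSupport_rho
  obtain ⟨A, hA0, hA⟩ := hu.exists_force_bound hr hc
  have hpos : ∀ n : ℕ, (1 : ℝ) ≤ (n : ℝ) + 1 := fun n => by linarith [n.cast_nonneg (α := ℝ)]
  have hpos' : ∀ n : ℕ, (0 : ℝ) < (n : ℝ) + 1 := fun n => by positivity
  have hloc : ∀ R : ℝ, 1 ≤ R → LocallyIntegrableOn (driftOf T u (dil R rho) k)
      (timeInterval T : Set ℝ) := by
    intro R hR
    have hR0 : 0 < R := by linarith
    have h1 := locallyIntegrable_of_ae_bound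
      (aestronglyMeasurable_force hu (contDiff_dil hr R) (hasCompactSupport_dil hc hR0) k)
      (hA R hR k).2
    have h2 : Continuous fun t => ∫ s in (0 : ℝ)..t, force T u (dil R rho) k s :=
      intervalIntegral.continuous_primitive (intervalIntegrable_of_locallyIntegrable h1) 0
    have h3 : LocallyIntegrable (meanVelocity u (dil R rho) k)
        (volume.restrict (timeInterval T : Set ℝ)) :=
      (locallyIntegrable_const A).mono (aestronglyMeasurable_meanVelocity hu (contDiff_dil hr R) k)
        ((hA R hR k).1.mono fun t ht => ht.trans (le_abs_self A))
    refine (h2.locallyIntegrable.locallyIntegrableOn _).sub ?_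
    exact locallyIntegrableOn_of_locallyIntegrable_restrict h3
  -- The dilated and the original profile have the same integral, so the residual vanishes on their
  -- difference times any η(t). Hence the difference of the two drifts has zero weak derivative.
  have hconst : ∀ n : ℕ, ∃ c : ℝ, ∀ᵐ t ∂(volume.restrict (timeInterval T : Set ℝ)),
      driftOf T u (dil ((n : ℝ) + 1) rho) k t - driftOf T u rho k t = c := by
    intro n
    have hl1 := hloc 1 le_rfl
    rw [dil_one] at hl1
    have hrn := contDiff_dil hr ((n : ℝ) + 1)
    have hcn := hasCompactSupport_dil hc (hpos' n)
    refine ae_eq_const_of_weak_deriv_zero hT ((hloc _ (hpos n)).sub hl1) fun η => ?_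
    have ht1 : IsTest (fun z : E3 × ℝ => rho z.1 * η z.2) := isTest_rho_mul η.contDiff η.hasCompactSupport
    have ht2 : IsTest (fun z : E3 × ℝ => dil ((n : ℝ) + 1) rho z.1 * η z.2) := by
      refine ⟨(hrn.comp contDiff_fst).mul (η.contDiff.comp contDiff_snd), ?_⟩
      refine HasCompactSupport.intro (hcn.isCompact.prod η.hasCompactSupport.isCompact)
        fun z hz => ?_
      by_contra h0
      exact hz ⟨subset_tsupport _ (left_ne_zero_of_mul h0),
        subset_tsupport _ (right_ne_zero_of_mul h0)⟩
    have e := h.integral_residual_eq_zero hu k (ht2.sub ht1)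
      ((tsupport_sub _ _).trans (union_subset (tsupport_rho_mul_subset η.tsupport_subset)
        (tsupport_rho_mul_subset η.tsupport_subset))) (fun t => by
        have e1 : mass (fun z : E3 × ℝ => dil ((n : ℝ) + 1) rho z.1 * η z.2 - rho z.1 * η z.2) t =
            mass (fun z : E3 × ℝ => dil ((n : ℝ) + 1) rho z.1 * η z.2) t -
            mass (fun z : E3 × ℝ => rho z.1 * η z.2) t :=
          integral_sub (ht2.slice_integrable t) (ht1.slice_integrable t)
        rw [e1, mass_rho_mul, mass]
        simp only [integral_mul_const, integral_dil rho (hpos' n), integral_rho]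
        ring)
    simp only [residual_sub u k ht2 ht1] at e
    rw [integral_sub (integrable_residual hu k ht2) (integrable_residual hu k ht1),
      integral_residual_mul hu hrn hcn, integral_residual_mul hu hr hc] at e
    have hint : ∀ {G : ℝ → ℝ}, LocallyIntegrableOn G (timeInterval T : Set ℝ) →
        Integrable (fun t => deriv η t * G t) (volume.restrict (timeInterval T : Set ℝ)) := by
      intro G hG
      have hcont : Continuous (deriv η) := η.contDiff.continuous_deriv (by simp)
      have h1 : IntegrableOn (fun t => deriv η t * G t) (tsupport η) volume :=
        (hG.integrableOn_compact_subset η.tsupport_subset η.hasCompactSupport).continuousOn_mul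
          hcont.continuousOn η.hasCompactSupport
      exact ((integrableOn_iff_integrable_of_support_subset
        (fun t (ht : deriv η t * G t ≠ 0) => tsupport_deriv_subset (f := η) (subset_tsupport _
          (left_ne_zero_of_mul ht)))).1 h1).restrict
    simp only [mul_comm _ (deriv η _), mul_sub]
    rw [integral_sub (hint (hloc _ (hpos n))) (hint hl1)]
    linarith
  choose c hc' using hconst
  have hF : ∀ n : ℕ, ∀ t : ℝ, 0 ≤ t →
      |∫ s in (0 : ℝ)..t, force T u (dil ((n : ℝ) + 1) rho) k s| ≤ A * ((n : ℝ) + 1)⁻¹ * t := by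
    intro n t ht
    have := intervalIntegral.norm_integral_le_of_norm_le_const_ae (a := 0) (b := t)
      (f := force T u (dil ((n : ℝ) + 1) rho) k) (C := A * ((n : ℝ) + 1)⁻¹) ((hA _ (hpos n) k).2.mono fun s hs _ => hs)
    rwa [sub_zero, abs_of_nonneg ht] at this
  -- For the dilated profile the mean velocity is at most A and the accumulated force at most A
  -- t/(n+1).
  have hall : ∀ᵐ t ∂(volume.restrict (timeInterval T : Set ℝ)), ∀ n : ℕ,
      |driftOf T u rho k t + c n| ≤ A + A * ((n : ℝ) + 1)⁻¹ * t := by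
    rw [ae_all_iff]
    intro n
    filter_upwards [hc' n, (hA _ (hpos n) k).1, ae_restrict_mem (measurableSet_timeInterval T)]
      with t h1 h2 h3
    have h4 := hF n t h3.1.le
    rw [← h1, add_sub_cancel, driftOf]
    refine (abs_sub _ _).trans ?_
    linarith
  have := neBot_ae_timeInterval hT
  obtain ⟨s, hs, hs0⟩ := (hall.and (ae_restrict_mem (measurableSet_timeInterval T))).exists
  refine ⟨2 * A + |driftOf T u rho k s|, by positivity, ?_⟩
  filter_upwards [hall] with t ht
  -- Comparing two times t and s eliminates the unknown constants c n. As n → ∞ the growth in t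
  -- disappears, which gives a bound uniform on (0, T) even for T = ∞.
  have hlim : Tendsto (fun n : ℕ => 2 * A + A * ((n : ℝ) + 1)⁻¹ * (t + s) + |driftOf T u rho k s|)
      atTop (𝓝 (2 * A + A * 0 * (t + s) + |driftOf T u rho k s|)) := by
    have h0 : Tendsto (fun n : ℕ => ((n : ℝ) + 1)⁻¹) atTop (𝓝 0) := by
      simpa using tendsto_one_div_add_atTop_nhds_zero_nat (𝕜 := ℝ)
    exact (((h0.const_mul A).mul_const _).const_add _).add_const _
  rw [mul_zero, zero_mul, add_zero] at hlim
  refine ge_of_tendsto' hlim fun n => ?_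
  have e : driftOf T u rho k t = (driftOf T u rho k t + c n) - (driftOf T u rho k s + c n) +
      driftOf T u rho k s := by ring
  calc |driftOf T u rho k t| = |(driftOf T u rho k t + c n) - (driftOf T u rho k s + c n) +
      driftOf T u rho k s| := by rw [← e]
    _ ≤ (|driftOf T u rho k t + c n| + |driftOf T u rho k s + c n|) + |driftOf T u rho k s| :=
        (abs_add_le _ _).trans (add_le_add (abs_sub _ _) le_rfl)
    _ ≤ _ := by linarith [ht n, hs n]

/-- The difference between the pressure gradient and the gradient of the Riesz pressure is the
time derivative of a bounded function of time. -/
theorem SolvesNSE.exists_drift {p : 𝓓'(slab T, ℝ)} (hT : 0 < T) (h : SolvesNSE T u p)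
    (hu : MemL2uloc T u) (k : Fin 3) : ∃ φ : ℝ → ℝ, Measurable φ ∧ (∃ B, ∀ t, |φ t| ≤ B) ∧
      ∀ f : E3 × ℝ → ℝ, IsTest f → tsupport f ⊆ slab T →
      ∫ z, residual u k f z ∂(slabMeasure T) =
        - ∫ t in (timeInterval T : Set ℝ), mass (D et f) t * φ t := by
  obtain ⟨B, hB0, hB⟩ := h.exists_driftOf_bound hT hu k
  have hr := contDiff_rho
  have hc := hasCompactSupport_rho
  have hm : AEStronglyMeasurable (driftOf T u rho k)
      (volume.restrict (timeInterval T : Set ℝ)) := by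
    obtain ⟨A, hA0, hA⟩ := hu.exists_force_bound hr hc
    have hA2 := (hA 1 le_rfl k).2
    rw [dil_one] at hA2
    have hloc := locallyIntegrable_of_ae_bound (aestronglyMeasurable_force hu hr hc k) hA2
    have hcont : Continuous fun t => ∫ s in (0 : ℝ)..t, force T u rho k s :=
      intervalIntegral.continuous_primitive (intervalIntegrable_of_locallyIntegrable hloc) 0
    exact hcont.aestronglyMeasurable.sub (aestronglyMeasurable_meanVelocity hu hr k)
  -- Truncating a measurable representative at ±B makes the bound hold at every time without
  -- changing the drift almost everywhere.
  refine ⟨fun t => max (-B) (min B (hm.mk _ t)), measurable_const.max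
    (measurable_const.min hm.stronglyMeasurable_mk.measurable), ⟨B, fun t => abs_le.2
    ⟨le_max_left _ _, max_le (by linarith) (min_le_left _ _)⟩⟩, fun f hf hs => ?_⟩
  have hae : ∀ᵐ t ∂(volume.restrict (timeInterval T : Set ℝ)),
      max (-B) (min B (hm.mk _ t)) = driftOf T u rho k t := by
    filter_upwards [hm.ae_eq_mk, hB] with t h1 h2
    rw [← h1, min_eq_right (abs_le.1 h2).2, max_eq_right (abs_le.1 h2).1]
  let η : 𝓓(timeInterval T, ℝ) := ⟨mass f, contDiff_mass hf, hasCompactSupport_mass hf,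
    tsupport_mass_subset_timeInterval hf hs⟩
  have hcs : tsupport (centered f) ⊆ slab T := (tsupport_sub _ _).trans (union_subset hs
    (tsupport_rho_mul_subset (tsupport_mass_subset_timeInterval hf hs)))
  -- The residual sees f only through its slice masses, so f may be replaced by `rho` times its
  -- mass.
  have e1 := h.integral_residual_eq_zero hu k hf.centered hcs (mass_centered hf)
  have e2 : ∀ z, residual u k (centered f) z = residual u k f z -
      residual u k (fun z : E3 × ℝ => rho z.1 * mass f z.2) z := residual_sub u k hf hf.rho_mass
  simp only [e2] at e1
  rw [integral_sub (integrable_residual hu k hf) (integrable_residual hu k hf.rho_mass),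
    sub_eq_zero] at e1
  rw [e1]
  refine (integral_residual_mul hu hr hc k η).trans ?_
  refine congrArg Neg.neg (integral_congr_ae ?_)
  filter_upwards [hae] with t ht
  rw [ht, ← deriv_mass hf]
  rfl

end

/-! ### Tail integrals of the pressure expressed through the drift. -/

section

variable {T : EReal} {u : E3 → ℝ → E3}

/-- A primitive that vanishes near `T` is a tail integral. -/
theorem isTailIntegral_primitive {q w : ℝ → ℝ} (hq : LocallyIntegrable q)
    (hw : LocallyIntegrableOn w (timeInterval T : Set ℝ)) {b : ℝ} (hb : (b : EReal) < T)
    (hq0 : ∀ t, b < t → q t = 0) (hw0 : ∀ t, b < t → w t = 0) {S : 𝓓(timeInterval T, ℝ) → ℝ}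
    (hS : ∀ η : 𝓓(timeInterval T, ℝ), S η = (∫ t in (timeInterval T : Set ℝ), q t * η t) +
      ∫ t in (timeInterval T : Set ℝ), w t * deriv η t) :
    IsTailIntegral T S (fun ε => (∫ s in ε..b, q s) + w ε) := by
  have hint := intervalIntegrable_of_locallyIntegrable hq
  obtain ⟨c, e0⟩ : ∃ c : ℝ, ∀ ε, ∫ s in ε..b, q s = c - ∫ s in (0 : ℝ)..ε, q s := ⟨_, fun ε =>
    (intervalIntegral.integral_interval_sub_left (hint 0 b) (hint 0 ε)).symm⟩
  have hcont : Continuous fun ε => ∫ s in (0 : ℝ)..ε, q s :=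
    intervalIntegral.continuous_primitive hint 0
  have hcont' : Continuous fun ε => ∫ s in ε..b, q s := by
    simp only [e0]
    exact continuous_const.sub hcont
  refine ⟨(hcont'.locallyIntegrable.locallyIntegrableOn _).add hw, ⟨b, hb, ?_⟩, fun η => ?_⟩
  · refine Eventually.of_forall fun t ht => ?_
    rw [hw0 t ht, add_zero]
    refine intervalIntegral.integral_zero_ae (Eventually.of_forall fun s hs => ?_)
    rw [uIoc_of_ge ht.le] at hs
    exact hq0 s hs.1
  · have hd : Continuous (deriv η) := η.contDiff.continuous_deriv (by simp)
    have hdc : HasCompactSupport (deriv η) := η.hasCompactSupport.deriv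
    have i1 : Integrable (fun t => (∫ s in t..b, q s) * deriv η t) :=
      (hcont'.mul hd).integrable_of_hasCompactSupport hdc.mul_left
    have i2 : Integrable (fun t => w t * deriv η t)
        (volume.restrict (timeInterval T : Set ℝ)) := by
      have h1 : IntegrableOn (fun t => w t * deriv η t) (tsupport η) volume :=
        (hw.integrableOn_compact_subset η.tsupport_subset η.hasCompactSupport).mul_continuousOn
          hd.continuousOn η.hasCompactSupport
      exact ((integrableOn_iff_integrable_of_support_subset
        (fun t (ht : w t * deriv η t ≠ 0) => tsupport_deriv_subset (f := η) (subset_tsupport _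
          (right_ne_zero_of_mul ht)))).1 h1).restrict
    have i3 : Integrable (fun t => (∫ s in (0 : ℝ)..t, q s) * deriv η t) :=
      (hcont.mul hd).integrable_of_hasCompactSupport hdc.mul_left
    have hz : ∀ t, t ∉ (timeInterval T : Set ℝ) → deriv η t = 0 := fun t ht =>
      image_eq_zero_of_notMem_tsupport fun h1 => ht (η.tsupport_subset (tsupport_deriv_subset h1))
    have hz' : ∀ t, t ∉ (timeInterval T : Set ℝ) → η t = 0 := fun t ht =>
      image_eq_zero_of_notMem_tsupport fun h1 => ht (η.tsupport_subset h1)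
    have hη : ContDiff ℝ 1 η := η.contDiff.of_le (by simp)
    simp only [add_mul]
    rw [hS, integral_add i1.restrict i2, add_left_inj,
      setIntegral_eq_integral_of_forall_compl_eq_zero fun t ht => by rw [hz' t ht, mul_zero],
      setIntegral_eq_integral_of_forall_compl_eq_zero fun t ht => by rw [hz t ht, mul_zero]]
    -- Up to sign and a constant, the tail integral is the primitive from 0; the constant
    -- contributes nothing because η' has integral zero.
    simp only [e0, sub_mul]
    rw [integral_sub ((hd.integrable_of_hasCompactSupport hdc).const_mul _) i3, integral_const_mul,
      integral_deriv_eq_zero hη η.hasCompactSupport,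
      integral_primitive_mul_deriv hq hη η.hasCompactSupport]
    ring

theorem tendsto_tail_integral {q : ℝ → ℝ} (hq : LocallyIntegrable q) (b : ℝ) :
    Tendsto (fun ε => ∫ s in ε..b, q s) (𝓝[>] 0) (𝓝 (∫ s in (0 : ℝ)..b, q s)) := by
  have hint := intervalIntegrable_of_locallyIntegrable hq
  obtain ⟨c, e0⟩ : ∃ c : ℝ, ∀ ε, ∫ s in ε..b, q s = c - ∫ s in (0 : ℝ)..ε, q s := ⟨_, fun ε =>
    (intervalIntegral.integral_interval_sub_left (hint 0 b) (hint 0 ε)).symm⟩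
  have hcont : Continuous fun ε => ∫ s in ε..b, q s := by
    simp only [e0]
    exact continuous_const.sub (intervalIntegral.continuous_primitive hint 0)
  exact (hcont.tendsto 0).mono_left nhdsWithin_le_nhds

theorem HasPressureLimit.unique (hT : 0 < T) {p : 𝓓'(slab T, ℝ)} {k : Fin 3} {ψ : 𝓓(pastSlab T, ℝ)}
    {L L' : ℝ} (h : HasPressureLimit T p k ψ L) (h' : HasPressureLimit T p k ψ L') : L = L' := by
  obtain ⟨G, hG, hGL⟩ := h
  obtain ⟨H, hH, hHL⟩ := h'
  exact tendsto_nhds_unique (hGL.congr' (eventually_of_ae_restrict hT (hG.ae_eq hT hH))) hHL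

/-- The spatial integral of `u_i u_j R_i R_j g`. -/
noncomputable def quadInt (u : E3 → ℝ → E3) (g : E3 × ℝ → ℝ) (t : ℝ) : ℝ := ∫ x, quad u g (x, t)

theorem aestronglyMeasurable_quadInt (hu : MemL2uloc T u) {g : E3 × ℝ → ℝ} (hg : IsTest g)
    (h0 : ∀ t, mass g t = 0) :
    AEStronglyMeasurable (quadInt u g) (volume.restrict (timeInterval T : Set ℝ)) :=
  (integrable_quad hu hg h0).aestronglyMeasurable.prod_swap.integral_prod_right'

theorem exists_quadInt_bound (hu : MemL2uloc T u) {g : E3 × ℝ → ℝ} (hg : IsTest g)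
    (h0 : ∀ t, mass g t = 0) : ∃ A : ℝ, 0 < A ∧
      ∀ᵐ t ∂(volume.restrict (timeInterval T : Set ℝ)), |quadInt u g t| ≤ A := by
  obtain ⟨C, hC0, hC⟩ := hu.exists_slice
  choose B M hB0 hB hM using fun q : Fin 3 × Fin 3 => (wt_RR hg h0 q.1 q.2).bound
  have s : ∀ q, B q ≤ ∑ q, B q := fun q =>
    Finset.single_le_sum (fun q _ => hB0 q) (Finset.mem_univ q)
  have s0 : 0 ≤ ∑ q, B q := Finset.sum_nonneg fun q _ => hB0 q
  refine ⟨9 * (∑ q, B q) * C + 1, by positivity, ?_⟩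
  filter_upwards [hC] with t ht
  refine (ht.abs_integral_le hC0.le (a := 9 * (∑ q, B q)) (by positivity) fun x => ?_).trans
    (by linarith)
  refine (abs_quad_le u (z := (x, t)) (b := (∑ q, B q) * weight x) fun i j => ?_).trans_eq (by ring)
  exact (hB (i, j) (x, t)).trans (mul_le_mul_of_nonneg_right (s _) (weight_pos x).le)

theorem quadInt_eq_zero {g : E3 × ℝ → ℝ} {t : ℝ} (h : ∀ x, g (x, t) = 0) : quadInt u g t = 0 := by
  refine integral_eq_zero_of_ae (Eventually.of_forall fun x => ?_)
  simp [quad, RR_eq_zero_of_slice (z := (x, t)) h]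

theorem exists_time_bound (hT : 0 < T) (ψ : 𝓓(pastSlab T, ℝ)) :
    ∃ b : ℝ, 0 ≤ b ∧ (b : EReal) < T ∧ ∀ z ∈ tsupport ψ, z.2 ≤ b := by
  rcases (tsupport ψ).eq_empty_or_nonempty with h | h
  · exact ⟨0, le_rfl, by exact_mod_cast hT, by simp [h]⟩
  · obtain ⟨z, hz, hmax⟩ := (ψ.hasCompactSupport.isCompact).exists_isMaxOn h continuous_snd.continuousOn
    have hzT : (z.2 : EReal) < T := ψ.tsupport_subset hz
    refine ⟨max z.2 0, le_max_right _ _, ?_, fun w hw => (hmax hw).trans (le_max_left _ _)⟩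
    rcases max_cases z.2 0 with h1 | h1 <;> rw [h1.1]
    · exact hzT
    · exact_mod_cast hT

theorem D_ex_time_mul {η : ℝ → ℝ} (hη : ContDiff ℝ ∞ η) {f : E3 × ℝ → ℝ} (hf : IsTest f) (k : Fin 3) :
    D (ex k) (fun z => η z.2 * f z) = fun z => η z.2 * D (ex k) f z := by
  funext z
  have h2 := ((hη.differentiable (by simp)) z.2).hasFDerivAt.comp z hasFDerivAt_snd
  have h3 : fderiv ℝ (fun z : E3 × ℝ => η z.2 * f z) z = _ :=
    (h2.mul (hf.differentiable z).hasFDerivAt).fderiv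
  rw [D, h3]
  simp [ex, D]

theorem D_et_time_mul {η : ℝ → ℝ} (hη : ContDiff ℝ ∞ η) {f : E3 × ℝ → ℝ} (hf : IsTest f) :
    D et (fun z => η z.2 * f z) = fun z => deriv η z.2 * f z + η z.2 * D et f z := by
  funext z
  have h2 := ((hη.differentiable (by simp)) z.2).hasFDerivAt.comp z hasFDerivAt_snd
  have h3 : fderiv ℝ (fun z : E3 × ℝ => η z.2 * f z) z = _ :=
    (h2.mul (hf.differentiable z).hasFDerivAt).fderiv
  rw [D, h3]
  simp [et, D]
  ring

theorem quad_time_mul (u : E3 → ℝ → E3) (η : ℝ → ℝ) {f : E3 × ℝ → ℝ} (hf : IsTest f)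
    (z : E3 × ℝ) : quad u (fun z => η z.2 * f z) z = η z.2 * quad u f z := by
  have h : ∀ i j, RR i j (fun z => η z.2 * f z) z = η z.2 * RR i j f z := by
    intro i j
    have := rieszRR_const_mul (hf.slice_contDiff z.2) (hf.slice_compact z.2) (η z.2) i j z.1
    simp only [RR, mul_comm (η z.2)]
    exact this
  simp only [quad, h, Finset.mul_sum]
  refine Finset.sum_congr rfl fun i _ => Finset.sum_congr rfl fun j _ => ?_
  ring

theorem coe_timeCut (η : 𝓓(timeInterval T, ℝ)) (ψ : 𝓓(pastSlab T, ℝ)) :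
    (timeCut η ψ : E3 × ℝ → ℝ) = fun z => η z.2 * ψ z := rfl

theorem timeCut_lineDeriv (η : 𝓓(timeInterval T, ℝ)) (ψ : 𝓓(pastSlab T, ℝ)) (k : Fin 3) :
    timeCut η (∂_{ex k} ψ) = ∂_{ex k} (timeCut η ψ) := by
  ext z
  rw [coe_lineDeriv, coe_timeCut, coe_timeCut, D_ex_time_mul η.contDiff (isTest_coe ψ), coe_lineDeriv]

/-- The density of the tail integrals of the pressure. -/
noncomputable def tailDensity (T : EReal) (u : E3 → ℝ → E3) (φ : ℝ → ℝ) (k : Fin 3)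
    (f : E3 × ℝ → ℝ) (t : ℝ) : ℝ :=
  (timeInterval T : Set ℝ).indicator (fun t => quadInt u (D (ex k) f) t + mass (D et f) t * φ t) t

theorem locallyIntegrable_tailDensity (hu : MemL2uloc T u) {φ : ℝ → ℝ}
    (hφ : AEStronglyMeasurable φ volume) {B : ℝ} (hB : ∀ t, |φ t| ≤ B) (k : Fin 3)
    {f : E3 × ℝ → ℝ} (hf : IsTest f) : LocallyIntegrable (tailDensity T u φ k f) := by
  obtain ⟨A, hA0, hA⟩ := exists_quadInt_bound hu (hf.D (ex k)) (mass_D_ex hf k)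
  obtain ⟨A', hA'⟩ := (contDiff_mass (hf.D et)).continuous.bounded_above_of_compact_support
    (hasCompactSupport_mass (hf.D et))
  have hB0 : 0 ≤ B := (abs_nonneg _).trans (hB 0)
  have hA'0 : 0 ≤ A' := (norm_nonneg _).trans (hA' 0)
  refine locallyIntegrable_of_ae_bound (A := A + A' * B) ?_ ?_
  · refine (aestronglyMeasurable_indicator_iff (measurableSet_timeInterval T)).2 ?_
    exact (aestronglyMeasurable_quadInt hu (hf.D (ex k)) (mass_D_ex hf k)).add
      ((contDiff_mass (hf.D et)).continuous.aestronglyMeasurable.mul hφ.restrict)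
  · rw [ae_restrict_iff' (measurableSet_timeInterval T)] at hA
    filter_upwards [hA] with t ht
    by_cases hmem : t ∈ (timeInterval T : Set ℝ)
    · rw [tailDensity, indicator_of_mem hmem]
      refine (abs_add_le _ _).trans (add_le_add (ht hmem) ?_)
      rw [abs_mul]
      exact mul_le_mul (hA' t) (hB t) (abs_nonneg _) hA'0
    · rw [tailDensity, indicator_of_notMem hmem, abs_zero]
      positivity

theorem tailDensity_eq_zero {φ : ℝ → ℝ} {k : Fin 3} {f : E3 × ℝ → ℝ} {b : ℝ}
    (hb : ∀ z ∈ tsupport f, z.2 ≤ b) {t : ℝ} (ht : b < t) : tailDensity T u φ k f t = 0 := by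
  have h : ∀ v x, D v f (x, t) = 0 := fun v x => image_eq_zero_of_notMem_tsupport fun h1 =>
    absurd (hb _ (tsupport_D_subset f v h1)) (not_le.2 ht)
  have h2 : mass (D et f) t = 0 := by simp [mass, h]
  simp [tailDensity, quadInt_eq_zero (h (ex k)), h2]

theorem integral_tailDensity (hu : MemL2uloc T u) {φ : ℝ → ℝ}
    (hφ : AEStronglyMeasurable φ volume) {B : ℝ} (hB : ∀ t, |φ t| ≤ B) (k : Fin 3)
    {f : E3 × ℝ → ℝ} (hf : IsTest f) {b : ℝ} (hb0 : 0 ≤ b) (hb : ∀ z ∈ tsupport f, z.2 ≤ b) :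
    ∫ t in (0 : ℝ)..b, tailDensity T u φ k f t = (∫ z, quad u (D (ex k) f) z ∂(slabMeasure T)) +
      ∫ t in (timeInterval T : Set ℝ), mass (D et f) t * φ t := by
  have h1 : ∫ t in (0 : ℝ)..b, tailDensity T u φ k f t = ∫ t, tailDensity T u φ k f t := by
    rw [intervalIntegral.integral_of_le hb0]
    refine setIntegral_eq_integral_of_forall_compl_eq_zero fun t ht => ?_
    by_cases h : b < t
    · exact tailDensity_eq_zero hb h
    · exact indicator_of_notMem (fun h2 => ht ⟨h2.1, not_lt.1 h⟩) _
  have i1 := integrable_quad hu (hf.D (ex k)) (mass_D_ex hf k)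
  have i2 : Integrable (fun t => mass (D et f) t * φ t) :=
    ((contDiff_mass (hf.D et)).continuous.integrable_of_hasCompactSupport
      (hasCompactSupport_mass (hf.D et))).mul_bdd (c := B) hφ (Eventually.of_forall hB)
  rw [h1]
  simp only [tailDensity]
  rw [integral_indicator (measurableSet_timeInterval T), integral_add _ i2.restrict,
    ← integral_slab i1]
  · rfl
  · exact i1.integral_prod_right

theorem tendsto_mass_mul {φ : ℝ → ℝ} {f : E3 × ℝ → ℝ} (hf : IsTest f) {l : Filter ℝ} {a : ℝ}
    (hl : l ≤ 𝓝 0) (hφ : Tendsto φ l (𝓝 a)) :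
    Tendsto (fun t => mass f t * φ t) l (𝓝 (mass f 0 * a)) :=
  (((contDiff_mass hf).continuous.tendsto 0).mono_left hl).mul hφ

/-- The tail integrals of the pressure, in terms of the drift. -/
theorem SolvesNSE.isTailIntegral {p : 𝓓'(slab T, ℝ)} (h : SolvesNSE T u p)
    (hu : MemL2uloc T u) {k : Fin 3} {φ : ℝ → ℝ} (hφ : AEStronglyMeasurable φ volume) {B : ℝ}
    (hB : ∀ t, |φ t| ≤ B)
    (hdrift : ∀ f : E3 × ℝ → ℝ, IsTest f → tsupport f ⊆ slab T →
      ∫ z, residual u k f z ∂(slabMeasure T) =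
        - ∫ t in (timeInterval T : Set ℝ), mass (D et f) t * φ t)
    (ψ : 𝓓(pastSlab T, ℝ)) {b : ℝ} (hb : (b : EReal) < T) (hψ : ∀ z ∈ tsupport ψ, z.2 ≤ b) :
    IsTailIntegral T (fun η => p (timeCut η (∂_{ex k} ψ)))
      (fun ε => (∫ s in ε..b, tailDensity T u φ k ψ s) + mass ψ ε * φ ε) := by
  have hf := isTest_coe ψ
  have hB0 : 0 ≤ B := (abs_nonneg _).trans (hB 0)
  have hφl : LocallyIntegrable φ := locallyIntegrable_of_ae_bound hφ (Eventually.of_forall hB)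
  have hw : LocallyIntegrable (fun t => mass ψ t * φ t) :=
    hφl.continuous_mul (contDiff_mass hf).continuous
  refine isTailIntegral_primitive (locallyIntegrable_tailDensity hu hφ hB k hf)
    (hw.locallyIntegrableOn _) hb (fun t ht => tailDensity_eq_zero hψ ht) (fun t ht => ?_)
    fun η => ?_
  · have : mass ψ t = 0 := integral_eq_zero_of_ae (Eventually.of_forall fun x =>
      image_eq_zero_of_notMem_tsupport fun h1 => absurd (hψ _ h1) (not_le.2 ht))
    rw [this, zero_mul]
  · have hχ : IsTest (timeCut η ψ) := isTest_coe _
    have e1 := h.apply_lineDeriv hu k (timeCut η ψ)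
    have e2 := hdrift _ hχ (timeCut η ψ).tsupport_subset
    have hq := integrable_quad hu (hχ.D (ex k)) (mass_D_ex hχ k)
    have e3 : ∫ z, residual u k (timeCut η ψ) z ∂(slabMeasure T) =
        (∫ z, mom u k (timeCut η ψ) z ∂(slabMeasure T)) +
        ∫ z, quad u (D (ex k) (timeCut η ψ)) z ∂(slabMeasure T) :=
      integral_add (integrable_mom hu k hχ) hq
    have e4 : ∫ z, quad u (D (ex k) (timeCut η ψ)) z ∂(slabMeasure T) =
        ∫ t in (timeInterval T : Set ℝ), η t * quadInt u (D (ex k) ψ) t := by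
      rw [← integral_slab hq]
      congr 1
      funext t
      rw [coe_timeCut, D_ex_time_mul η.contDiff hf, quadInt, ← integral_const_mul]
      congr 1
      funext x
      exact quad_time_mul u η (hf.D (ex k)) (x, t)
    -- The product rule separates the two parts of the tail integral: the term with η' yields the
    -- function `mass ψ * φ`, the term with η enters the density.
    have e5 : ∀ t, mass (D et (timeCut η ψ)) t = deriv η t * mass ψ t + η t * mass (D et ψ) t := by
      intro t
      rw [coe_timeCut, D_et_time_mul η.contDiff hf]
      have := integral_add ((hf.slice_integrable t).const_mul (deriv η t))
        (((hf.D et).slice_integrable t).const_mul (η t))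
      rw [integral_const_mul, integral_const_mul] at this
      exact this
    have hηi : ∀ {g : ℝ → ℝ}, LocallyIntegrable g → Integrable (fun t => g t * η t) := by
      intro g hg
      have h1 : IntegrableOn (fun t => g t * η t) (tsupport η) volume :=
        (hg.integrableOn_isCompact η.hasCompactSupport).mul_continuousOn
          η.contDiff.continuous.continuousOn η.hasCompactSupport
      exact (integrableOn_iff_integrable_of_support_subset
        (fun t (ht : g t * η t ≠ 0) => subset_tsupport _ (right_ne_zero_of_mul ht))).1 h1
    have hdi : Integrable (fun t => mass ψ t * φ t * deriv η t) := by
      have hd : Continuous (deriv η) := η.contDiff.continuous_deriv (by simp)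
      have h1 : IntegrableOn (fun t => mass ψ t * φ t * deriv η t) (tsupport (deriv η)) volume :=
        (hw.integrableOn_isCompact η.hasCompactSupport.deriv).mul_continuousOn
          hd.continuousOn η.hasCompactSupport.deriv
      exact (integrableOn_iff_integrable_of_support_subset
        (fun t (ht : mass ψ t * φ t * deriv η t ≠ 0) => subset_tsupport _
          (right_ne_zero_of_mul ht))).1 h1
    have hdens := hηi (locallyIntegrable_tailDensity (T := T) hu hφ hB k hf)
    have hmt : Integrable (fun t => mass (D et ψ) t * φ t * η t) :=
      hηi (hφl.continuous_mul (contDiff_mass (hf.D et)).continuous)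
    have hqi : Integrable (fun t => η t * quadInt u (D (ex k) ψ) t)
        (volume.restrict (timeInterval T : Set ℝ)) := by
      refine (hdens.restrict.sub hmt.restrict).congr ?_
      filter_upwards [ae_restrict_mem (measurableSet_timeInterval T)] with t ht
      simp only [Pi.sub_apply, tailDensity, indicator_of_mem ht]
      ring
    have e6 : ∫ t in (timeInterval T : Set ℝ), tailDensity T u φ k ψ t * η t =
        (∫ t in (timeInterval T : Set ℝ), η t * quadInt u (D (ex k) ψ) t) +
        ∫ t in (timeInterval T : Set ℝ), mass (D et ψ) t * φ t * η t := by
      rw [← integral_add hqi hmt.restrict]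
      refine setIntegral_congr_fun (measurableSet_timeInterval T) fun t ht => ?_
      simp only [tailDensity, indicator_of_mem ht]
      ring
    have e7 : ∫ t in (timeInterval T : Set ℝ), mass (D et (timeCut η ψ)) t * φ t =
        (∫ t in (timeInterval T : Set ℝ), mass ψ t * φ t * deriv η t) +
        ∫ t in (timeInterval T : Set ℝ), mass (D et ψ) t * φ t * η t := by
      rw [← integral_add hdi.restrict hmt.restrict]
      congr 1
      funext t
      rw [e5]
      ring
    rw [timeCut_lineDeriv, e1, e6]
    linarith

end

/-! ### The drift at the initial time and a criterion for weak solutions. -/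

section

variable {T : EReal} {u : E3 → ℝ → E3}

theorem integral_mass_D_et {f : E3 × ℝ → ℝ} (hf : IsTest f) (hs : tsupport f ⊆ pastSlab T) :
    ∫ t in (timeInterval T : Set ℝ), mass (D et f) t = - mass f 0 := by
  have h1 : ∫ t in Ioi (0 : ℝ), mass (D et f) t = ∫ t in (timeInterval T : Set ℝ), mass (D et f) t := by
    refine setIntegral_eq_of_subset_of_forall_sdiff_eq_zero measurableSet_Ioi
      (fun t ht => ht.1) fun t ht => ?_
    refine integral_eq_zero_of_ae (Eventually.of_forall fun x => ?_)
    refine image_eq_zero_of_notMem_tsupport fun h2 => ht.2 ⟨ht.1, ?_⟩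
    exact hs (tsupport_D_subset f _ h2)
  rw [← h1]
  have h2 := HasCompactSupport.integral_Ioi_deriv_eq ((contDiff_mass hf).of_le (by simp))
    (hasCompactSupport_mass hf) 0
  rw [← h2]
  simp only [deriv_mass hf]

/-- With slice mass one near t = 0, the drift itself appears as a summand of the tail integral and
its limit can be read off. -/
theorem IsTest.toTest_timeBump (hT : 0 < T) : ∃ (ψ : 𝓓(pastSlab T, ℝ)),
    ∀ᶠ t in 𝓝 (0 : ℝ), mass ψ t = 1 := by
  obtain ⟨t0, ht0⟩ := exists_mem_timeInterval hT
  have h0 : 0 < t0 := ht0.1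
  let σ : ContDiffBump (0 : ℝ) := ⟨t0 / 4, t0 / 2, by positivity, by linarith⟩
  have hf : IsTest (fun z : E3 × ℝ => rho z.1 * σ z.2) :=
    isTest_rho_mul σ.contDiff σ.hasCompactSupport
  have hs : tsupport (fun z : E3 × ℝ => rho z.1 * σ z.2) ⊆ pastSlab T := by
    have h1 : tsupport (fun z : E3 × ℝ => rho z.1 * σ z.2) ⊆ Prod.snd ⁻¹' Metric.closedBall 0 (t0 / 2) :=
      closure_minimal (fun z hz => by
        have := subset_tsupport σ (right_ne_zero_of_mul hz)
        rwa [σ.tsupport_eq] at this) (Metric.isClosed_closedBall.preimage continuous_snd)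
    intro z hz
    have h2 : |z.2| ≤ t0 / 2 := by simpa using h1 hz
    have h3 : z.2 < t0 := by linarith [le_abs_self z.2]
    exact (EReal.coe_lt_coe_iff.2 h3).trans ht0.2
  refine ⟨hf.toTest hs, ?_⟩
  filter_upwards [σ.eventuallyEq_one] with t ht
  rw [hf.coe_toTest, mass_rho_mul, ht]
  rfl

/-- Weak solutions satisfy the momentum equation with the Riesz pressure up to a bounded drift that
vanishes at the initial time. -/
theorem IsWeakSolution.exists_drift {u₀ : E3 → E3} {p : 𝓓'(slab T, ℝ)} (hT : 0 < T)
    (h : IsWeakSolution T u₀ u p) (k : Fin 3) : ∃ φ : ℝ → ℝ, AEStronglyMeasurable φ volume ∧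
      (∃ B, ∀ t, |φ t| ≤ B) ∧ Tendsto φ (𝓝[>] 0) (𝓝 0) ∧ ∀ ψ : 𝓓(pastSlab T, ℝ),
      (∫ z, residual u k ψ z ∂(slabMeasure T)) +
        (∫ t in (timeInterval T : Set ℝ), mass (D et ψ) t * φ t) = - ∫ x, u₀ x k * ψ (x, 0) := by
  have hu := h.memL2uloc
  obtain ⟨φ₀, hφm, ⟨B, hB⟩, hdrift⟩ := h.solves.exists_drift hT hu k
  have hφ := hφm.aestronglyMeasurable (μ := volume)
  have hl0 : 𝓝[>] (0 : ℝ) ⊓ ae volume ≤ 𝓝[>] 0 := inf_le_left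
  -- Near 0 the drift is the tail integral of the pressure, which converges outside a null set by
  -- assumption, minus a continuous function.
  obtain ⟨l, hl⟩ : ∃ l, Tendsto φ₀ (𝓝[>] (0 : ℝ) ⊓ ae volume) (𝓝 l) := by
    obtain ⟨ψ, hψ⟩ := IsTest.toTest_timeBump hT
    obtain ⟨b, hb0, hbT, hb⟩ := exists_time_bound hT ψ
    obtain ⟨L, G, hG, hGL⟩ := h.exists_limit k ψ
    have hH := h.solves.isTailIntegral hu hφ hB hdrift ψ hbT hb
    have h1 := hGL.congr' (eventually_of_ae_restrict hT (hG.ae_eq hT hH))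
    have h2 := (tendsto_tail_integral (locallyIntegrable_tailDensity (T := T) hu hφ hB k
      (isTest_coe ψ)) b).mono_left hl0
    refine ⟨_, (h1.sub h2).congr' ?_⟩
    filter_upwards [hl0 (nhdsWithin_le_nhds hψ)] with t ht
    have ht : mass ψ t = 1 := ht
    rw [ht]
    ring
  -- Changing the drift on a null set turns the essential limit into a genuine one, and subtracting
  -- l makes this limit zero.
  obtain ⟨g, hg1, hg2, hg3⟩ := exists_ae_eq_tendsto hl
  refine ⟨fun t => g t - l, (hφ.congr hg1.symm).sub aestronglyMeasurable_const,
    ⟨B + |l| + |l|, fun t => ?_⟩, by simpa using hg3.sub_const l, fun ψ => ?_⟩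
  · refine (abs_sub _ _).trans ?_
    rcases hg2 t with h1 | h1 <;> rw [h1]
    · linarith [hB t, abs_nonneg l]
    · linarith [(abs_nonneg _).trans (hB 0)]
  · have hf := isTest_coe ψ
    obtain ⟨b, hb0, hbT, hb⟩ := exists_time_bound hT ψ
    have hH := h.solves.isTailIntegral hu hφ hB hdrift ψ hbT hb
    have hlim : HasPressureLimit T p k ψ ((∫ s in (0 : ℝ)..b, tailDensity T u φ₀ k ψ s) +
        mass ψ 0 * l) := ⟨_, hH, ((tendsto_tail_integral (locallyIntegrable_tailDensity (T := T)
          hu hφ hB k hf) b).mono_left hl0).add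
          (tendsto_mass_mul hf (hl0.trans nhdsWithin_le_nhds) hl)⟩
    have e1 := h.weak_form k ψ _ hlim
    simp only [momentumIntegrand_eq] at e1
    rw [integral_slab (integrable_mom hu k hf), integral_tailDensity hu hφ hB k hf hb0 hb] at e1
    have e2 : ∫ z, residual u k ψ z ∂(slabMeasure T) = (∫ z, mom u k ψ z ∂(slabMeasure T)) +
        ∫ z, quad u (D (ex k) ψ) z ∂(slabMeasure T) :=
      integral_add (integrable_mom hu k hf) (integrable_quad hu (hf.D (ex k)) (mass_D_ex hf k))
    have i1 : Integrable (mass (D et ψ)) :=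
      (contDiff_mass (hf.D et)).continuous.integrable_of_hasCompactSupport
        (hasCompactSupport_mass (hf.D et))
    have i2 : Integrable (fun t => mass (D et ψ) t * φ₀ t) :=
      i1.mul_bdd (c := B) hφ (Eventually.of_forall hB)
    -- As the time derivative of the mass integrates to -`mass ψ 0`, subtracting l from the drift
    -- produces `mass ψ 0 * l`, which is the boundary term of the pressure limit.
    have e3 : ∫ t in (timeInterval T : Set ℝ), mass (D et ψ) t * (g t - l) =
        (∫ t in (timeInterval T : Set ℝ), mass (D et ψ) t * φ₀ t) + mass ψ 0 * l := by
      have e4 : ∫ t in (timeInterval T : Set ℝ), mass (D et ψ) t * (g t - l) =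
          ∫ t in (timeInterval T : Set ℝ), (mass (D et ψ) t * φ₀ t - mass (D et ψ) t * l) := by
        refine integral_congr_ae ?_
        filter_upwards [ae_restrict_of_ae hg1] with t ht
        rw [ht, mul_sub]
      rw [e4, integral_sub i2.restrict (i1.mul_const l).restrict, integral_mul_const,
        integral_mass_D_et hf ψ.tsupport_subset]
      ring
    rw [e2, e3]
    linarith

/-- A criterion for a velocity field with its Riesz pressure to be a weak solution. -/
theorem isWeakSolution_rieszPressure (hT : 0 < T) {u₀ : E3 → E3} (hu : MemL2uloc T u)
    (hdiv : ∀ f : E3 × ℝ → ℝ, IsTest f → tsupport f ⊆ slab T →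
      ∫ z, ∑ k : Fin 3, u z.1 z.2 k * D (ex k) f z ∂(slabMeasure T) = 0)
    (hmom : ∀ (k : Fin 3) (ψ : 𝓓(pastSlab T, ℝ)),
      ∫ z, residual u k ψ z ∂(slabMeasure T) = - ∫ x, u₀ x k * ψ (x, 0)) :
    IsWeakSolution T u₀ u (rieszPressure hu) := by
  have hslab : (slab T : Set (E3 × ℝ)) ⊆ pastSlab T := fun z hz => hz.2
  -- A test function supported in (0, T) vanishes at t = 0, so the initial data do not contribute.
  have hres : ∀ (k : Fin 3) (f : E3 × ℝ → ℝ), IsTest f → tsupport f ⊆ slab T →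
      ∫ z, residual u k f z ∂(slabMeasure T) = 0 := by
    intro k f hf hs
    have h1 := hmom k (hf.toTest (hs.trans hslab))
    rw [hf.coe_toTest] at h1
    rw [h1, neg_eq_zero]
    refine integral_eq_zero_of_ae (Eventually.of_forall fun x => ?_)
    have : f (x, 0) = 0 := image_eq_zero_of_notMem_tsupport fun h2 => lt_irrefl _ (hs h2).1
    simp [this]
  have hmq : ∀ (k : Fin 3) (f : E3 × ℝ → ℝ), IsTest f →
      ∫ z, residual u k f z ∂(slabMeasure T) = (∫ z, mom u k f z ∂(slabMeasure T)) +
        ∫ z, quad u (D (ex k) f) z ∂(slabMeasure T) := fun k f hf =>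
    integral_add (integrable_mom hu k hf) (integrable_quad hu (hf.D (ex k)) (mass_D_ex hf k))
  have hsol : SolvesNSE T u (rieszPressure hu) := by
    refine ⟨fun k ψ => ?_, fun ψ => ?_⟩
    · have hf := isTest_coe ψ
      simp only [momentumIntegrand_eq]
      rw [integral_slab (integrable_mom hu k hf), rieszPressure_apply, coe_lineDeriv,
        centered_of_mass_zero (mass_D_ex hf k), ← hmq k ψ hf, hres k ψ hf ψ.tsupport_subset]
    · have hf := isTest_coe ψ
      simp only [coe_lineDeriv]
      rw [integral_slab (integrable_div hu hf), hdiv ψ hf ψ.tsupport_subset]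
  -- For the Riesz pressure the drift is zero, so the tail integrals are continuous and converge to
  -- the full integral.
  have hlim : ∀ (k : Fin 3) (ψ : 𝓓(pastSlab T, ℝ)), HasPressureLimit T (rieszPressure hu) k ψ
      (∫ z, quad u (D (ex k) ψ) z ∂(slabMeasure T)) := by
    intro k ψ
    have hf := isTest_coe ψ
    obtain ⟨b, hb0, hbT, hb⟩ := exists_time_bound hT ψ
    have hφ : AEStronglyMeasurable (fun _ : ℝ => (0 : ℝ)) volume := aestronglyMeasurable_const
    have hB : ∀ t : ℝ, |(fun _ : ℝ => (0 : ℝ)) t| ≤ 0 := by simp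
    have hH := hsol.isTailIntegral hu (k := k) hφ hB
      (fun f hf hs => by simp [hres k f hf hs]) ψ hbT hb
    have e := integral_tailDensity hu hφ hB k hf hb0 hb
    simp only [mul_zero, integral_zero, add_zero] at e hH
    rw [← e]
    exact ⟨_, hH, (tendsto_tail_integral (locallyIntegrable_tailDensity (T := T) hu hφ hB k hf)
      b).mono_left inf_le_left⟩
  refine ⟨hu, hsol, fun k ψ => ⟨_, hlim k ψ⟩, fun k ψ L hL => ?_⟩
  have hf := isTest_coe ψ
  rw [hL.unique hT (hlim k ψ)]
  simp only [momentumIntegrand_eq]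
  rw [integral_slab (integrable_mom hu k hf), ← hmq k ψ hf, hmom]

end

/-! ### Divergence-free slices tested against slowly decaying functions. -/

/-- Almost every time slice of the velocity is divergence free. -/
theorem SolvesNSE.ae_slice_div {T : EReal} {u : E3 → ℝ → E3} {p : 𝓓'(slab T, ℝ)}
    (h : SolvesNSE T u p) (hu : MemL2uloc T u) {g : E3 → ℝ} (hg : ContDiff ℝ ∞ g)
    (hc : HasCompactSupport g) : ∀ᵐ t ∂(volume.restrict (timeInterval T : Set ℝ)),
      ∫ x, ∑ j : Fin 3, u x t j * pd j g x = 0 := by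
  have hpd := contDiff_pd hg
  have hpc := hasCompactSupport_pd hc
  obtain ⟨C, hC0, hC⟩ := hu.exists_slice
  have hF : ∀ᵐ t ∂(volume.restrict (timeInterval T : Set ℝ)),
      ∫ x, ∑ j : Fin 3, u x t j * pd j g x = ∑ j : Fin 3, meanVelocity u (pd j g) j t := by
    filter_upwards [hC] with t ht
    exact integral_finsetSum _ fun j _ => ht.integrable_coord_mul (hpd j) (hpc j) j
  have hloc : LocallyIntegrableOn (fun t => ∑ j : Fin 3, meanVelocity u (pd j g) j t)
      (timeInterval T : Set ℝ) := by
    refine locallyIntegrableOn_of_locallyIntegrable_restrict ?_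
    refine locallyIntegrable_finsetSum _ fun j _ => ?_
    obtain ⟨A, hA0, hA⟩ := hu.exists_force_bound (hpd j) (hpc j)
    have h1 := (hA 1 le_rfl j).1
    rw [dil_one] at h1
    exact (locallyIntegrable_const A).mono (aestronglyMeasurable_meanVelocity hu (hpd j) j)
      (h1.mono fun t ht => ht.trans (le_abs_self A))
  have key := (timeInterval T).isOpen.ae_eq_zero_of_integral_contDiff_smul_eq_zero hloc
    fun η hη hηc hηs => by
    have ht : IsTest (fun z : E3 × ℝ => g z.1 * η z.2) := by
      refine ⟨(hg.comp contDiff_fst).mul (hη.comp contDiff_snd), ?_⟩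
      refine HasCompactSupport.intro (hc.isCompact.prod hηc.isCompact) fun z hz => ?_
      by_contra h0
      exact hz ⟨subset_tsupport _ (left_ne_zero_of_mul h0),
        subset_tsupport _ (right_ne_zero_of_mul h0)⟩
    have e := h.integral_div hu ht (tsupport_rho_mul_subset hηs)
    rw [← integral_slab (integrable_div hu ht)] at e
    rw [← e, ← setIntegral_eq_integral_of_forall_compl_eq_zero (s := (timeInterval T : Set ℝ))]
    · refine integral_congr_ae ?_
      filter_upwards [hF] with t ht
      rw [← ht, smul_eq_mul, ← integral_const_mul]
      congr 1
      funext x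
      simp only [D_ex_mul hg hη, Finset.mul_sum]
      exact Finset.sum_congr rfl fun j _ => by ring
    · intro t ht
      rw [image_eq_zero_of_notMem_tsupport fun h1 => ht (hηs h1), zero_smul]
  rw [ae_restrict_iff' (measurableSet_timeInterval T)] at hF ⊢
  filter_upwards [hF, key] with t h1 h2 hmem
  rw [h1 hmem, h2 hmem]

/-- The cutoffs at scale `n + 1`. -/
noncomputable def bumpAt (n : ℕ) (x : E3) : ℝ := bumpOne (((n : ℝ) + 1)⁻¹ • x)

theorem contDiff_bumpAt (n : ℕ) : ContDiff ℝ ∞ (bumpAt n) :=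
  bumpOne.contDiff.comp (contDiff_const_smul _)

theorem hasCompactSupport_bumpAt (n : ℕ) : HasCompactSupport (bumpAt n) :=
  bumpOne.hasCompactSupport.comp_smul (by positivity)

theorem bumpAt_eq_one {n : ℕ} {x : E3} (h : ‖x‖ ≤ n) : bumpAt n x = 1 := by
  refine bumpOne.one_of_mem_closedBall ?_
  have hn : (0 : ℝ) < (n : ℝ) + 1 := by positivity
  rw [mem_closedBall_zero_iff, norm_smul, norm_inv, Real.norm_of_nonneg hn.le,
    inv_mul_le_iff₀ hn]
  change ‖x‖ ≤ ((n : ℝ) + 1) * 1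
  linarith

/-- The second bound gives pointwise convergence to zero. The first, valid since the gradient lives
in ‖x‖ ≤ 2(n+1), where 1 + ‖x‖ ≤ 3(n+1), is uniform in n and supplies the missing power of decay for
domination. -/
theorem exists_pd_bumpAt_le : ∃ C : ℝ, 0 < C ∧ ∀ n j x, |pd j (bumpAt n) x| ≤ C * (1 + ‖x‖)⁻¹ ∧
    |pd j (bumpAt n) x| ≤ C * ((n : ℝ) + 1)⁻¹ := by
  have h1 : ∀ j, ∃ C : ℝ, ∀ x, ‖pd j bumpOne x‖ ≤ C := fun j =>
    (contDiff_pd bumpOne.contDiff j).continuous.bounded_above_of_compact_support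
      (hasCompactSupport_pd bumpOne.hasCompactSupport j)
  choose C0 hC0 using h1
  set C := ∑ j, |C0 j| with hC
  have hCj : ∀ j x, |pd j bumpOne x| ≤ C := fun j x => (hC0 j x).trans ((le_abs_self _).trans
    (Finset.single_le_sum (f := fun j => |C0 j|) (fun _ _ => abs_nonneg _) (Finset.mem_univ j)))
  have hCn : 0 ≤ C := Finset.sum_nonneg fun _ _ => abs_nonneg _
  refine ⟨3 * C + 1, by positivity, fun n j x => ?_⟩
  have hn : (0 : ℝ) < (n : ℝ) + 1 := by positivity
  have e : pd j (bumpAt n) x = ((n : ℝ) + 1)⁻¹ * pd j bumpOne (((n : ℝ) + 1)⁻¹ • x) := by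
    have := congrFun (pd_const_mul_comp_smul bumpOne.contDiff 1 ((n : ℝ) + 1)⁻¹ j) x
    simp only [one_mul] at this
    exact this
  have e2 : |pd j (bumpAt n) x| ≤ C * ((n : ℝ) + 1)⁻¹ := by
    rw [e, abs_mul, abs_of_pos (by positivity), mul_comm]
    gcongr
    exact hCj _ _
  refine ⟨?_, e2.trans (by gcongr; linarith)⟩
  by_cases hx : ‖x‖ ≤ 2 * ((n : ℝ) + 1)
  · refine e2.trans ?_
    rw [← div_eq_mul_inv, ← div_eq_mul_inv, div_le_div_iff₀ hn (by positivity)]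
    nlinarith [norm_nonneg x, n.cast_nonneg (α := ℝ)]
  · have h0 : pd j bumpOne (((n : ℝ) + 1)⁻¹ • x) = 0 := by
      refine image_eq_zero_of_notMem_tsupport fun h => hx ?_
      have h2 := tsupport_fderiv_apply_subset ℝ (f := bumpOne) (bv j) h
      rw [bumpOne.tsupport_eq, mem_closedBall_zero_iff, norm_smul, norm_inv,
        Real.norm_of_nonneg hn.le, inv_mul_le_iff₀ hn] at h2
      change ‖x‖ ≤ ((n : ℝ) + 1) * 2 at h2
      linarith
    rw [e, h0, mul_zero, abs_zero]
    positivity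

theorem pd_mul {f g : E3 → ℝ} (hf : ContDiff ℝ ∞ f) (hg : ContDiff ℝ ∞ g) (j : Fin 3) (x : E3) :
    pd j (fun x => f x * g x) x = f x * pd j g x + pd j f x * g x := by
  simp only [pd]
  rw [fderiv_fun_mul ((hf.differentiable (by simp)) x) ((hg.differentiable (by simp)) x)]
  simp
  ring

/-- A slowly decaying function can be used as a test function for a divergence free field. -/
theorem UlocSlice.integral_div_eq_zero_of_decay {C : ℝ} {v : E3 → E3} (hv : UlocSlice C v)
    {g : E3 → ℝ} (hg : ContDiff ℝ ∞ g) {A : ℝ} (hA : ∀ x, |g x| ≤ A * (1 + ‖x‖)⁻¹ ^ 3)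
    (hA' : ∀ j x, |pd j g x| ≤ A * weight x)
    (h : ∀ n, ∫ x, ∑ j : Fin 3, v x j * pd j (fun x => bumpAt n x * g x) x = 0) :
    ∫ x, ∑ j : Fin 3, v x j * pd j g x = 0 := by
  obtain ⟨B, hB0, hB⟩ := exists_pd_bumpAt_le
  have hA0 : 0 ≤ A := by
    have := (abs_nonneg _).trans (hA 0)
    simpa using this
  have hlim : Tendsto (fun n => ∫ x, ∑ j : Fin 3, v x j * pd j (fun x => bumpAt n x * g x) x) atTop
      (𝓝 (∫ x, ∑ j : Fin 3, v x j * pd j g x)) := by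
    refine tendsto_integral_of_dominated_convergence
      (fun x => 3 * (A + B * A) * ((1 + ‖v x‖ ^ 2) * weight x)) (fun n => ?_)
      (hv.integrable_weight.const_mul _) (fun n => Eventually.of_forall fun x => ?_)
      (Eventually.of_forall fun x => ?_)
    · exact Finset.aestronglyMeasurable_fun_sum _ fun j _ =>
        (aestronglyMeasurable_coord hv.meas j).mul
          (contDiff_pd ((contDiff_bumpAt n).mul hg) j).continuous.aestronglyMeasurable
    · have hw := (weight_pos x).le
      have h1 : ∀ j, |v x j * pd j (fun x => bumpAt n x * g x) x| ≤
          (1 + ‖v x‖ ^ 2) * ((A + B * A) * weight x) := by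
        intro j
        rw [abs_mul]
        refine mul_le_mul (abs_coord_le _ _) ?_ (abs_nonneg _) (by positivity)
        rw [pd_mul (contDiff_bumpAt n) hg]
        refine (abs_add_le _ _).trans ?_
        rw [add_mul, abs_mul, abs_mul]
        refine add_le_add ?_ ?_
        · have : |bumpAt n x| ≤ 1 := by
            unfold bumpAt
            rw [abs_of_nonneg bumpOne.nonneg]
            exact bumpOne.le_one
          calc _ ≤ 1 * (A * weight x) := mul_le_mul this (hA' j x) (abs_nonneg _) one_pos.le
            _ = _ := one_mul _
        -- One power from the cut-off and three from g make four, which the weight dominates.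
        · calc |pd j (bumpAt n) x| * |g x| ≤ (B * (1 + ‖x‖)⁻¹) * (A * (1 + ‖x‖)⁻¹ ^ 3) :=
                mul_le_mul (hB n j x).1 (hA x) (abs_nonneg _) (by positivity)
            _ = B * A * (1 + ‖x‖)⁻¹ ^ 4 := by ring
            _ ≤ B * A * weight x := by
                gcongr
                exact inv_pow_four_le_weight x
      rw [Real.norm_eq_abs]
      refine (Finset.abs_sum_le_sum_abs _ _).trans ((Finset.sum_le_sum fun j _ => h1 j).trans_eq ?_)
      simp
      ring
    · refine tendsto_finsetSum _ fun j _ => Tendsto.const_mul _ ?_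
      have h1 : Tendsto (fun n => bumpAt n x * pd j g x + pd j (bumpAt n) x * g x) atTop
          (𝓝 (1 * pd j g x + 0 * g x)) := by
        refine (Tendsto.mul_const _ ?_).add (Tendsto.mul_const _ ?_)
        · refine tendsto_const_nhds.congr' ?_
          obtain ⟨N, hN⟩ := exists_nat_ge ‖x‖
          filter_upwards [eventually_ge_atTop N] with n hn
          exact (bumpAt_eq_one (hN.trans (by exact_mod_cast hn))).symm
        · refine squeeze_zero_norm (fun n => (hB n j x).2) ?_
          have h0 : Tendsto (fun n : ℕ => ((n : ℝ) + 1)⁻¹) atTop (𝓝 0) := by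
            simpa using tendsto_one_div_add_atTop_nhds_zero_nat (𝕜 := ℝ)
          simpa using h0.const_mul B
      rw [one_mul, zero_mul, add_zero] at h1
      exact h1.congr fun n => (pd_mul (contDiff_bumpAt n) hg j x).symm
  simp only [h] at hlim
  exact tendsto_nhds_unique tendsto_const_nhds hlim |>.symm

/-- Smooth functions on space-time with the decay of a Riesz transform of a test function. -/
structure Decays (G : E3 × ℝ → ℝ) : Prop where
  contDiff : ContDiff ℝ ∞ G
  bound : ∃ A : ℝ, 0 ≤ A ∧ (∀ z, |G z| ≤ A * (1 + ‖z.1‖)⁻¹ ^ 3) ∧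
    ∀ j z, |D (ex j) G z| ≤ A * weight z.1

theorem pd_slice_add {G : E3 × ℝ → ℝ} (hG : ContDiff ℝ ∞ G) (j : Fin 3) (a : E3) (s : ℝ) (x : E3) :
    pd j (fun x => G (x + a, s)) x = D (ex j) G (x + a, s) := by
  have h0 : HasFDerivAt (fun x : E3 => (x + a, s))
      ((ContinuousLinearMap.id ℝ E3).prod 0) x :=
    ((hasFDerivAt_id x).add_const a).prodMk (hasFDerivAt_const s x)
  have h := ((hG.differentiable (by simp)) (x + a, s)).hasFDerivAt.comp x h0
  have h2 : fderiv ℝ (fun x => G (x + a, s)) x = _ := h.fderiv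
  rw [pd, h2]
  simp [D, ex, bv]

theorem Decays.slice_bounds {G : E3 × ℝ → ℝ} (hG : Decays G) (a : E3) (s : ℝ) : ∃ A : ℝ,
    (∀ x, |G (x + a, s)| ≤ A * (1 + ‖x‖)⁻¹ ^ 3) ∧
    ∀ j x, |pd j (fun x => G (x + a, s)) x| ≤ A * weight x := by
  obtain ⟨A, hA0, h1, h2⟩ := hG.bound
  refine ⟨A * (1 + ‖a‖) ^ 4, fun x => (h1 (x + a, s)).trans ?_, fun j x => ?_⟩
  · rw [mul_assoc]
    gcongr
    have h3 : (1 + ‖x + a‖)⁻¹ ≤ (1 + ‖a‖) * (1 + ‖x‖)⁻¹ := by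
      rw [← div_eq_mul_inv, inv_eq_one_div, div_le_div_iff₀ (by positivity) (by positivity), one_mul]
      have : ‖x‖ ≤ ‖x + a‖ + ‖a‖ := by
        calc ‖x‖ = ‖(x + a) - a‖ := by rw [add_sub_cancel_right]
          _ ≤ _ := norm_sub_le _ _
      nlinarith [norm_nonneg a, norm_nonneg (x + a)]
    calc (1 + ‖x + a‖)⁻¹ ^ 3 ≤ ((1 + ‖a‖) * (1 + ‖x‖)⁻¹) ^ 3 := by gcongr
      _ = (1 + ‖a‖) ^ 3 * (1 + ‖x‖)⁻¹ ^ 3 := by ring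
      _ ≤ (1 + ‖a‖) ^ 4 * (1 + ‖x‖)⁻¹ ^ 3 := by
          gcongr
          · linarith [norm_nonneg a]
          · norm_num
  · rw [pd_slice_add hG.contDiff]
    refine (h2 j (x + a, s)).trans ?_
    rw [mul_assoc]
    gcongr
    exact weight_add_le x a

theorem contDiff_slice_add {G : E3 × ℝ → ℝ} (hG : ContDiff ℝ ∞ G) (a : E3) (s : ℝ) :
    ContDiff ℝ ∞ (fun x => G (x + a, s)) :=
  hG.comp ((contDiff_id.add contDiff_const).prodMk contDiff_const)

/-- Almost every slice of the velocity is orthogonal to the gradients of all slices of a decaying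
function. -/
theorem SolvesNSE.ae_slice_div_decays {T : EReal} {u : E3 → ℝ → E3} {p : 𝓓'(slab T, ℝ)}
    (h : SolvesNSE T u p) (hu : MemL2uloc T u) {G : E3 × ℝ → ℝ} (hG : Decays G) :
    ∀ᵐ t ∂(volume.restrict (timeInterval T : Set ℝ)), ∀ (a : E3) (s : ℝ),
      ∫ x, ∑ j : Fin 3, u x t j * D (ex j) G (x + a, s) = 0 := by
  obtain ⟨C, hC0, hC⟩ := hu.exists_slice
  obtain ⟨A, hA0, hA, hA'⟩ := hG.bound
  -- The null set of times depends on the test function, so the identity is first obtained for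
  -- countably many cut-offs and a dense sequence of shifts.
  have h1 : ∀ᵐ t ∂(volume.restrict (timeInterval T : Set ℝ)), ∀ m n : ℕ,
      ∫ x, ∑ j : Fin 3, u x t j * pd j (fun x => bumpAt n x *
        G (x + (TopologicalSpace.denseSeq (E3 × ℝ) m).1,
          (TopologicalSpace.denseSeq (E3 × ℝ) m).2)) x = 0 := by
    rw [ae_all_iff]
    intro m
    rw [ae_all_iff]
    intro n
    exact h.ae_slice_div hu ((contDiff_bumpAt n).mul (contDiff_slice_add hG.contDiff _ _))
      (hasCompactSupport_bumpAt n).mul_right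
  filter_upwards [hC, h1] with t ht h2
  have h3 : ∀ m : ℕ, ∫ x, ∑ j : Fin 3, u x t j *
      D (ex j) G (x + (TopologicalSpace.denseSeq (E3 × ℝ) m).1,
        (TopologicalSpace.denseSeq (E3 × ℝ) m).2) = 0 := by
    intro m
    obtain ⟨A', hb1, hb2⟩ := hG.slice_bounds (TopologicalSpace.denseSeq (E3 × ℝ) m).1
      (TopologicalSpace.denseSeq (E3 × ℝ) m).2
    have := ht.integral_div_eq_zero_of_decay (contDiff_slice_add hG.contDiff _ _) hb1 hb2 (h2 m)
    simpa only [pd_slice_add hG.contDiff] using this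
  -- Continuity in the shift extends the identity from the dense sequence to all (a, s), with one
  -- null set. This is needed because the shift used later is Φ(t) itself.
  have hcont : Continuous fun q : E3 × ℝ => ∫ x, ∑ j : Fin 3, u x t j *
      D (ex j) G (x + q.1, q.2) := by
    have hD : ∀ j, Continuous (D (ex j) G) := fun j => (contDiff_D hG.contDiff _).continuous
    refine continuous_iff_continuousAt.2 fun q₀ => ?_
    refine continuousAt_of_dominated
      (bound := fun x => 3 * (A * (1 + (‖q₀.1‖ + 1)) ^ 4) * ((1 + ‖u x t‖ ^ 2) * weight x))
      (Eventually.of_forall fun q => ?_) ?_ (ht.integrable_weight.const_mul _)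
      (Eventually.of_forall fun x => ?_)
    · refine Finset.aestronglyMeasurable_fun_sum _ fun j _ =>
        (aestronglyMeasurable_coord ht.meas j).mul ?_
      exact ((hD j).comp (by fun_prop)).aestronglyMeasurable
    · filter_upwards [Metric.ball_mem_nhds q₀ one_pos] with q hq
      refine Eventually.of_forall fun x => ?_
      have hq1 : ‖q.1‖ ≤ ‖q₀.1‖ + 1 := by
        have e1 : ‖q.1 - q₀.1‖ ≤ ‖q - q₀‖ := norm_fst_le (q - q₀)
        have e2 : ‖q - q₀‖ < 1 := by rwa [← dist_eq_norm]
        have e3 := norm_le_norm_add_norm_sub' q.1 q₀.1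
        linarith
      have hw := (weight_pos x).le
      have e : ∀ j, |u x t j * D (ex j) G (x + q.1, q.2)| ≤
          (1 + ‖u x t‖ ^ 2) * (A * ((1 + (‖q₀.1‖ + 1)) ^ 4 * weight x)) := by
        intro j
        rw [abs_mul]
        refine mul_le_mul (abs_coord_le _ _) ((hA' j _).trans ?_) (abs_nonneg _) (by positivity)
        gcongr
        exact (weight_add_le x q.1).trans (by gcongr)
      rw [Real.norm_eq_abs]
      refine (Finset.abs_sum_le_sum_abs _ _).trans ((Finset.sum_le_sum fun j _ => e j).trans_eq ?_)
      simp
      ring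
    · refine tendsto_finsetSum _ fun j _ => Tendsto.const_mul _ ?_
      have : Continuous fun q : E3 × ℝ => D (ex j) G (x + q.1, q.2) := (hD j).comp (by fun_prop)
      exact this.tendsto q₀
  have hzero : (fun q : E3 × ℝ => ∫ x, ∑ j : Fin 3, u x t j * D (ex j) G (x + q.1, q.2)) =
      fun _ => 0 :=
    hcont.ext_on (TopologicalSpace.denseRange_denseSeq (E3 × ℝ)) continuous_const
      (by rintro _ ⟨m, rfl⟩; exact h3 m)
  exact fun a s => congrFun hzero (a, s)

theorem ulocSlice_const (c : E3) : ∃ C : ℝ, UlocSlice C (fun _ => c) := by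
  refine ⟨(1 + ‖c‖ ^ 2) * ∫ x, weight x, aestronglyMeasurable_const, ?_⟩
  rw [← integral_const_mul, ofReal_integral_eq_lintegral_ofReal (integrable_weight.const_mul _)]
  exact Eventually.of_forall fun x => mul_nonneg (by positivity) (weight_pos x).le

/-- Constant fields are divergence free. -/
theorem Decays.integral_const_div {G : E3 × ℝ → ℝ} (hG : Decays G) (c a : E3) (s : ℝ) :
    ∫ x, ∑ j : Fin 3, c j * D (ex j) G (x + a, s) = 0 := by
  obtain ⟨C, hC⟩ := ulocSlice_const c
  obtain ⟨A', hb1, hb2⟩ := hG.slice_bounds a s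
  have := hC.integral_div_eq_zero_of_decay (contDiff_slice_add hG.contDiff a s) hb1 hb2
    fun n => by
      have hr := (contDiff_bumpAt n).mul (contDiff_slice_add hG.contDiff a s)
      have hc : HasCompactSupport fun x => bumpAt n x * G (x + a, s) :=
        (hasCompactSupport_bumpAt n).mul_right
      rw [integral_finsetSum _ fun j _ => hC.integrable_coord_mul (contDiff_pd hr j)
        (hasCompactSupport_pd hc j) j]
      refine Finset.sum_eq_zero fun j _ => ?_
      obtain ⟨f, hf, -, -, h3, -, -⟩ := exists_test_slice hr hc
      have e := mass_D_ex hf j 0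
      rw [mass] at e
      simp only [h3] at e
      rw [integral_const_mul, e, mul_zero]
  simpa only [pd_slice_add hG.contDiff] using this

theorem IsTest.decays {f : E3 × ℝ → ℝ} (hf : IsTest f) : Decays f := by
  obtain ⟨B1, M1, h10, hb1, -⟩ := hf.wt.bound
  choose B2 M2 h20 hb2 hm2 using fun j => (hf.D (ex j)).wt.bound
  have s : ∀ j, B2 j ≤ ∑ j, B2 j := fun j =>
    Finset.single_le_sum (fun j _ => h20 j) (Finset.mem_univ j)
  have s0 : 0 ≤ ∑ j, B2 j := Finset.sum_nonneg fun j _ => h20 j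
  refine ⟨hf.contDiff, B1 + ∑ j, B2 j, by positivity, fun z => (hb1 z).trans ?_,
    fun j z => (hb2 j z).trans ?_⟩
  · exact mul_le_mul (by linarith) (weight_le_inv_pow_three _) (weight_pos _).le (by positivity)
  · exact mul_le_mul_of_nonneg_right (by linarith [s j]) (weight_pos _).le

theorem decays_RR {f : E3 × ℝ → ℝ} (hf : IsTest f) (i k : Fin 3) : Decays (RR i k f) := by
  obtain ⟨B1, h10, hb1⟩ := exists_RR_le hf
  choose B2 M2 h20 hb2 hm2 using fun j => (wt_RR_D hf i k j).bound
  have s : ∀ j, B2 j ≤ ∑ j, B2 j := fun j =>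
    Finset.single_le_sum (fun j _ => h20 j) (Finset.mem_univ j)
  have s0 : 0 ≤ ∑ j, B2 j := Finset.sum_nonneg fun j _ => h20 j
  refine ⟨contDiff_RR hf i k, B1 + ∑ j, B2 j, by positivity, fun z => (hb1 i k z).trans ?_,
    fun j z => ?_⟩
  · exact mul_le_mul_of_nonneg_right (by linarith) (by positivity)
  · rw [D_RR hf]
    exact (hb2 j z).trans (mul_le_mul_of_nonneg_right (by linarith [s j]) (weight_pos _).le)

/-- Exchanging the derivative indices turns u_j R_i R_j ∂_k f into u paired with the gradient of R_i
R_k f, which vanishes by incompressibility. -/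
theorem RR_D_comm {f : E3 × ℝ → ℝ} (hf : IsTest f) (i j k : Fin 3) :
    RR i j (D (ex k) f) = D (ex j) (RR i k f) := by
  rw [D_RR hf, RR_eq_cv (hf.D _), RR_eq_cv (hf.D _), D_comm hf.contDiff (ex i) (ex k),
    D_comm (hf.D _).contDiff (ex j), D_comm hf.contDiff (ex j) (ex i),
    D_comm hf.contDiff (ex i) (ex j)]

/-! ### Shears of space-time and boosted velocities. -/

/-- The shear `(x, t) ↦ (x + Φ(t), t)` of space-time. -/
def shear (Φ : ℝ → E3) (z : E3 × ℝ) : E3 × ℝ := (z.1 + Φ z.2, z.2)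

theorem shear_shear_neg (Φ : ℝ → E3) (z : E3 × ℝ) : shear Φ (shear (fun t => -Φ t) z) = z := by
  simp [shear]

theorem shear_neg_shear (Φ : ℝ → E3) (z : E3 × ℝ) : shear (fun t => -Φ t) (shear Φ z) = z := by
  simp [shear]

theorem continuous_shear {Φ : ℝ → E3} (hΦ : Continuous Φ) : Continuous (shear Φ) :=
  (continuous_fst.add (hΦ.comp continuous_snd)).prodMk continuous_snd

/-- A continuous shear as a homeomorphism. -/
def shearHomeomorph {Φ : ℝ → E3} (hΦ : Continuous Φ) : (E3 × ℝ) ≃ₜ (E3 × ℝ) where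
  toFun := shear Φ
  invFun := shear fun t => -Φ t
  left_inv := shear_neg_shear Φ
  right_inv := shear_shear_neg Φ
  continuous_toFun := continuous_shear hΦ
  continuous_invFun := continuous_shear hΦ.neg

theorem measurePreserving_shear {Φ : ℝ → E3} (hΦ : Continuous Φ) (T : EReal) :
    MeasurePreserving (shear Φ) (slabMeasure T) (slabMeasure T) := by
  have h1 : MeasurePreserving (fun q : ℝ × E3 => (q.1, q.2 + Φ q.1))
      ((volume.restrict (timeInterval T : Set ℝ)).prod volume)
      ((volume.restrict (timeInterval T : Set ℝ)).prod volume) := by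
    refine (MeasurePreserving.id _).skew_product
      (g := fun (t : ℝ) (x : E3) => x + Φ t) ?_ (Eventually.of_forall fun t => ?_)
    · exact (continuous_snd.add (hΦ.comp continuous_fst)).measurable
    · exact (measurePreserving_add_right volume (Φ t)).map_eq
  exact (Measure.measurePreserving_swap.comp h1).comp Measure.measurePreserving_swap

theorem integral_comp_shear {Φ : ℝ → E3} (hΦ : Continuous Φ) (T : EReal) (F : E3 × ℝ → ℝ) :
    ∫ z, F (shear Φ z) ∂(slabMeasure T) = ∫ z, F z ∂(slabMeasure T) :=
  (measurePreserving_shear hΦ T).integral_comp (shearHomeomorph hΦ).measurableEmbedding F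

theorem integrable_comp_shear {Φ : ℝ → E3} (hΦ : Continuous Φ) {T : EReal} {F : E3 × ℝ → ℝ}
    (hF : Integrable F (slabMeasure T)) : Integrable (fun z => F (shear Φ z)) (slabMeasure T) :=
  (measurePreserving_shear hΦ T).integrable_comp_of_integrable hF

theorem aestronglyMeasurable_time {α : Type*} [TopologicalSpace α] {φ : ℝ → α}
    (hφ : AEStronglyMeasurable φ volume) (T : EReal) :
    AEStronglyMeasurable (fun z : E3 × ℝ => φ z.2) (slabMeasure T) :=
  (hφ.restrict (s := (timeInterval T : Set ℝ))).comp_snd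

/-- The velocity in a frame moving with velocity `φ`. -/
def boost (u : E3 → ℝ → E3) (φ Φ : ℝ → E3) (x : E3) (t : ℝ) : E3 := u (x - Φ t) t + φ t

theorem boost_shear (u : E3 → ℝ → E3) (φ Φ : ℝ → E3) (z : E3 × ℝ) :
    boost u φ Φ (shear Φ z).1 (shear Φ z).2 = u z.1 z.2 + φ z.2 := by
  simp [boost, shear]

theorem MemL2uloc.ae_slice_meas {T : EReal} {u : E3 → ℝ → E3} (hu : MemL2uloc T u) :
    ∀ᵐ t ∂(volume.restrict (timeInterval T : Set ℝ)),
      AEStronglyMeasurable (fun x => u x t) volume := by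
  obtain ⟨C, -, hC⟩ := hu.exists_slice
  exact hC.mono fun t ht => ht.meas

/-- The supremum over all unit balls is invariant under the spatial translation on each slice, and
the added constant is bounded by B. -/
theorem MemL2uloc.boost {T : EReal} {u : E3 → ℝ → E3} (hu : MemL2uloc T u) {φ Φ : ℝ → E3}
    (hφ : AEStronglyMeasurable φ volume) {B : ℝ} (hB : ∀ t, ‖φ t‖ ≤ B) (hΦ : Continuous Φ) :
    MemL2uloc T (boost u φ Φ) := by
  refine ⟨?_, ?_⟩
  · rw [restrict_slab]
    have h1 := hu.meas.comp_measurePreserving (measurePreserving_shear hΦ.neg T)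
    refine (h1.add (aestronglyMeasurable_time hφ T)).congr (Eventually.of_forall fun z => ?_)
    simp [NSStructure.boost, shear, sub_eq_add_neg]
  · set M := essSup (fun t : ℝ => ⨆ x₀ : E3,
      eLpNorm (fun x => u x t) 2 (volume.restrict (Metric.ball x₀ 1)))
      (volume.restrict (timeInterval T : Set ℝ)) with hM
    set K := volume (Metric.ball (0 : E3) 1) ^ (ENNReal.toReal 2)⁻¹ * ENNReal.ofReal B with hK
    have hKt : K < ⊤ := ENNReal.mul_lt_top
      (ENNReal.rpow_lt_top_of_nonneg (by positivity) measure_ball_lt_top.ne) ENNReal.ofReal_lt_top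
    refine lt_of_le_of_lt (essSup_le_of_ae_le (M + K) ?_) (ENNReal.add_lt_top.2 ⟨hu.2, hKt⟩)
    filter_upwards [hu.ae_slice_meas, ENNReal.ae_le_essSup (fun t : ℝ => ⨆ x₀ : E3,
      eLpNorm (fun x => u x t) 2 (volume.restrict (Metric.ball x₀ 1)))] with t hm ht
    refine iSup_le fun x₀ => ?_
    have hmp : MeasurePreserving (fun x : E3 => x - Φ t) (volume.restrict (Metric.ball x₀ 1))
        (volume.restrict (Metric.ball (x₀ - Φ t) 1)) := by
      have := (measurePreserving_sub_right volume (Φ t)).restrict_preimage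
        (measurableSet_ball (x := x₀ - Φ t) (ε := 1))
      have e : (fun x : E3 => x - Φ t) ⁻¹' Metric.ball (x₀ - Φ t) 1 = Metric.ball x₀ 1 := by
        ext x
        simp [dist_eq_norm]
      rwa [e] at this
    have hm' := hm.restrict (s := Metric.ball (x₀ - Φ t) 1)
    have h1 : eLpNorm (fun x => u (x - Φ t) t) 2 (volume.restrict (Metric.ball x₀ 1)) ≤ M := by
      have := eLpNorm_comp_measurePreserving (p := 2) hm' hmp
      refine this.le.trans (le_trans ?_ ht)
      exact le_iSup (fun x₀ : E3 => eLpNorm (fun x => u x t) 2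
        (volume.restrict (Metric.ball x₀ 1))) (x₀ - Φ t)
    have h2 : eLpNorm (fun _ : E3 => φ t) 2 (volume.restrict (Metric.ball x₀ 1)) ≤ K := by
      have := eLpNorm_le_of_ae_bound (p := 2) (μ := volume.restrict (Metric.ball x₀ 1))
        (f := fun _ : E3 => φ t) (Eventually.of_forall fun _ => hB t)
      rwa [Measure.restrict_apply_univ, Measure.addHaar_ball_center] at this
    refine le_trans ?_ (add_le_add h1 h2)
    exact eLpNorm_add_le (hm'.comp_measurePreserving hmp) aestronglyMeasurable_const (by norm_num)

/-- Functions of integral zero. -/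
def IsNull (F : E3 → ℝ) : Prop := Integrable F ∧ ∫ x, F x = 0

theorem IsNull.add {F G : E3 → ℝ} (hF : IsNull F) (hG : IsNull G) : IsNull fun x => F x + G x :=
  ⟨hF.1.add hG.1, by rw [integral_add hF.1 hG.1, hF.2, hG.2, add_zero]⟩

theorem IsNull.const_mul {F : E3 → ℝ} (hF : IsNull F) (c : ℝ) : IsNull fun x => c * F x :=
  ⟨hF.1.const_mul c, by rw [integral_const_mul, hF.2, mul_zero]⟩

theorem IsNull.sum {F : Fin 3 → E3 → ℝ} (hF : ∀ i, IsNull (F i)) : IsNull fun x => ∑ i, F i x :=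
  ⟨integrable_finsetSum _ fun i _ => (hF i).1, by
    rw [integral_finsetSum _ fun i _ => (hF i).1]
    exact Finset.sum_eq_zero fun i _ => (hF i).2⟩

theorem Decays.integrable_div {G : E3 × ℝ → ℝ} (hG : Decays G) {C : ℝ} {v : E3 → E3}
    (hv : UlocSlice C v) (a : E3) (s : ℝ) :
    Integrable fun x => ∑ j : Fin 3, v x j * D (ex j) G (x + a, s) := by
  obtain ⟨A, hA0, -, hA⟩ := hG.bound
  refine integrable_finsetSum _ fun j _ => hv.integrable (a := A * (1 + ‖a‖) ^ 4) ?_ fun x => ?_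
  · refine (aestronglyMeasurable_coord hv.meas j).mul ?_
    exact ((contDiff_D hG.contDiff _).continuous.comp (by fun_prop)).aestronglyMeasurable
  · rw [abs_mul]
    calc _ ≤ (1 + ‖v x‖ ^ 2) * (A * ((1 + ‖a‖) ^ 4 * weight x)) := by
          refine mul_le_mul (abs_coord_le _ _) ((hA j _).trans ?_) (abs_nonneg _) (by positivity)
          gcongr
          exact weight_add_le x a
      _ = _ := by ring

theorem Decays.isNull_const_div {G : E3 × ℝ → ℝ} (hG : Decays G) (c a : E3) (s : ℝ) :
    IsNull fun x => ∑ j : Fin 3, c j * D (ex j) G (x + a, s) := by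
  obtain ⟨C, hC⟩ := ulocSlice_const c
  exact ⟨hG.integrable_div hC a s, hG.integral_const_div c a s⟩

theorem SolvesNSE.ae_isNull_div {T : EReal} {u : E3 → ℝ → E3} {p : 𝓓'(slab T, ℝ)}
    (h : SolvesNSE T u p) (hu : MemL2uloc T u) {G : E3 × ℝ → ℝ} (hG : Decays G) :
    ∀ᵐ t ∂(volume.restrict (timeInterval T : Set ℝ)), ∀ (a : E3) (s : ℝ),
      IsNull fun x => ∑ j : Fin 3, u x t j * D (ex j) G (x + a, s) := by
  obtain ⟨C, -, hC⟩ := hu.exists_slice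
  filter_upwards [hC, h.ae_slice_div_decays hu hG] with t h1 h2 a s
  exact ⟨hG.integrable_div h1 a s, h2 a s⟩

theorem IsTest.integrable_slice_add {f : E3 × ℝ → ℝ} (hf : IsTest f) (a : E3) (s : ℝ) :
    Integrable fun x => f (x + a, s) :=
  (hf.slice_integrable s).comp_add_right a

theorem integral_slice_add (f : E3 × ℝ → ℝ) (a : E3) (s : ℝ) :
    ∫ x, f (x + a, s) = mass f s :=
  integral_add_right_eq_self (fun x => f (x, s)) a

theorem IsTest.isNull_lap {f : E3 × ℝ → ℝ} (hf : IsTest f) (a : E3) (s : ℝ) :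
    IsNull fun x => NSStructure.lap f (x + a, s) :=
  IsNull.sum (F := fun l x => NSStructure.D (ex l) (NSStructure.D (ex l) f) (x + a, s)) fun l =>
    ⟨((hf.D _).D _).integrable_slice_add a s, by
      rw [integral_slice_add, mass_D_ex (hf.D _)]⟩

/-- The boosted velocity is divergence free. -/
theorem SolvesNSE.integral_boost_div {T : EReal} {u : E3 → ℝ → E3} {p : 𝓓'(slab T, ℝ)}
    (h : SolvesNSE T u p) (hu : MemL2uloc T u) {φ Φ : ℝ → E3}
    (hφ : AEStronglyMeasurable φ volume) {B : ℝ} (hB : ∀ t, ‖φ t‖ ≤ B) (hΦ : Continuous Φ)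
    {f : E3 × ℝ → ℝ} (hf : IsTest f) :
    ∫ z, ∑ k : Fin 3, boost u φ Φ z.1 z.2 k * D (ex k) f z ∂(slabMeasure T) = 0 := by
  have hi := integrable_comp_shear hΦ (NSStructure.integrable_div (hu.boost hφ hB hΦ) hf)
  rw [← integral_comp_shear hΦ, ← integral_slab hi]
  refine integral_eq_zero_of_ae ?_
  filter_upwards [h.ae_isNull_div hu hf.decays] with t ht
  have h1 := (ht (Φ t) t).add (hf.decays.isNull_const_div (φ t) (Φ t) t)
  refine Eq.trans (integral_congr_ae (Eventually.of_forall fun x => ?_)) h1.2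
  simp only [boost_shear]
  simp [shear, add_mul, Finset.sum_add_distrib]

theorem contDiff_shear {Φ : ℝ → E3} (hΦ : ContDiff ℝ ∞ Φ) : ContDiff ℝ ∞ (shear Φ) :=
  (contDiff_fst.add (hΦ.comp contDiff_snd)).prodMk contDiff_snd

theorem IsTest.comp_shear {f : E3 × ℝ → ℝ} (hf : IsTest f) {Φ : ℝ → E3} (hΦ : ContDiff ℝ ∞ Φ) :
    IsTest fun z => f (shear Φ z) :=
  ⟨hf.contDiff.comp (contDiff_shear hΦ), hf.compact.comp_homeomorph (shearHomeomorph hΦ.continuous)⟩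

theorem tsupport_comp_shear_subset {f : E3 × ℝ → ℝ} {Φ : ℝ → E3} (hΦ : Continuous Φ)
    {T : EReal} (hs : tsupport f ⊆ pastSlab T) : tsupport (fun z => f (shear Φ z)) ⊆ pastSlab T := by
  have h : tsupport (fun z => f (shear Φ z)) ⊆ shear Φ ⁻¹' tsupport f :=
    closure_minimal (fun z hz => subset_tsupport f hz)
      ((isClosed_tsupport f).preimage (continuous_shear hΦ))
  exact fun z hz => (hs (h hz) : ((shear Φ z).2 : EReal) < T)

theorem fderiv_comp_shear {f : E3 × ℝ → ℝ} (hf : IsTest f) {Φ : ℝ → E3} {φ : ℝ → E3}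
    (hd : ∀ t, HasDerivAt Φ (φ t) t) (z v : E3 × ℝ) :
    D v (fun z => f (shear Φ z)) z = fderiv ℝ f (shear Φ z) (v.1 + v.2 • φ z.2, v.2) := by
  have h1 : HasFDerivAt (shear Φ) ((ContinuousLinearMap.fst ℝ E3 ℝ +
      (ContinuousLinearMap.toSpanSingleton ℝ (φ z.2)).comp (ContinuousLinearMap.snd ℝ E3 ℝ)).prod
      (ContinuousLinearMap.snd ℝ E3 ℝ)) z :=
    (hasFDerivAt_fst.add ((hd z.2).hasFDerivAt.comp z hasFDerivAt_snd)).prodMk hasFDerivAt_snd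
  have h2 : fderiv ℝ (fun z => f (shear Φ z)) z = _ :=
    ((hf.differentiable (shear Φ z)).hasFDerivAt.comp z h1).fderiv
  rw [D, h2]
  simp

theorem D_ex_comp_shear {f : E3 × ℝ → ℝ} (hf : IsTest f) {Φ : ℝ → E3} {φ : ℝ → E3}
    (hd : ∀ t, HasDerivAt Φ (φ t) t) (j : Fin 3) :
    D (ex j) (fun z => f (shear Φ z)) = fun z => D (ex j) f (shear Φ z) := by
  funext z
  rw [fderiv_comp_shear hf hd]
  simp [ex, D]

theorem D_et_comp_shear {f : E3 × ℝ → ℝ} (hf : IsTest f) {Φ : ℝ → E3} {φ : ℝ → E3}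
    (hd : ∀ t, HasDerivAt Φ (φ t) t) (z : E3 × ℝ) :
    D et (fun z => f (shear Φ z)) z =
      D et f (shear Φ z) + ∑ j : Fin 3, φ z.2 j * D (ex j) f (shear Φ z) := by
  rw [fderiv_comp_shear hf hd]
  have h : ((et.1 + et.2 • φ z.2, et.2) : E3 × ℝ) = et + ∑ j : Fin 3, φ z.2 j • ex j := by
    refine Prod.ext ?_ ?_
    · ext i
      fin_cases i <;> simp [et, ex, Fin.sum_univ_three]
    · simp [et, ex, Fin.sum_univ_three]
  rw [h, map_add, map_sum]
  simp [D]

theorem lap_comp_shear {f : E3 × ℝ → ℝ} (hf : IsTest f) {Φ : ℝ → E3} {φ : ℝ → E3}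
    (hd : ∀ t, HasDerivAt Φ (φ t) t) (z : E3 × ℝ) :
    lap (fun z => f (shear Φ z)) z = lap f (shear Φ z) := by
  simp only [lap, D_ex_comp_shear hf hd, D_ex_comp_shear (hf.D _) hd]

theorem RR_comp_shear (f : E3 × ℝ → ℝ) (Φ : ℝ → E3) (i j : Fin 3) (z : E3 × ℝ) :
    RR i j (fun z => f (shear Φ z)) z = RR i j f (shear Φ z) :=
  rieszRR_translate i j (fun y => f (y, z.2)) (Φ z.2) z.1

/-- The integrand of the momentum equation for a sheared test function. -/
noncomputable def shearedResidual (u : E3 → ℝ → E3) (k : Fin 3) (f : E3 × ℝ → ℝ) (φ Φ : ℝ → E3)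
    (z : E3 × ℝ) : ℝ :=
  u z.1 z.2 k * D et f (shear Φ z) + u z.1 z.2 k * lap f (shear Φ z) +
    (∑ j : Fin 3, (u z.1 z.2 k * (φ z.2 j + u z.1 z.2 j)) * D (ex j) f (shear Φ z)) +
    ∑ i : Fin 3, ∑ j : Fin 3, u z.1 z.2 i * u z.1 z.2 j * RR i j (D (ex k) f) (shear Φ z)

/-- The left side needs a differentiable Φ, while the right side makes sense for bounded measurable
φ. It is the right side that survives the approximation. -/
theorem residual_comp_shear (u : E3 → ℝ → E3) (k : Fin 3) {f : E3 × ℝ → ℝ} (hf : IsTest f)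
    {Φ : ℝ → E3} {φ : ℝ → E3} (hd : ∀ t, HasDerivAt Φ (φ t) t) (z : E3 × ℝ) :
    residual u k (fun z => f (shear Φ z)) z = shearedResidual u k f φ Φ z := by
  simp only [residual, mom, quad, D_et_comp_shear hf hd, lap_comp_shear hf hd,
    D_ex_comp_shear hf hd, RR_comp_shear (D (ex k) f), shearedResidual, Fin.sum_univ_three]
  ring

/-- On the bounded time support the shift is at most |B| |M|, so the weight is affected by a fixed
factor. The constants do not depend on Φ, as dominated convergence along a sequence of shears
requires. -/
theorem Wt.exists_comp_shear_le {g : E3 × ℝ → ℝ} (hg : Wt g) (B : ℝ) : ∃ C M : ℝ, 0 ≤ C ∧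
    ∀ Φ : ℝ → E3, (∀ t, ‖Φ t‖ ≤ B * |t|) → (∀ z, |g (shear Φ z)| ≤ C * weight z.1) ∧
      ∀ z, M < |z.2| → g (shear Φ z) = 0 := by
  obtain ⟨C, M, hC0, hC, hM⟩ := hg.bound
  refine ⟨C * (1 + |B| * |M|) ^ 4, M, by positivity, fun Φ hΦ => ⟨fun z => ?_, fun z hz => hM _ hz⟩⟩
  by_cases h : M < |z.2|
  · rw [hM (shear Φ z) h, abs_zero]
    have := (weight_pos z.1).le
    positivity
  · refine (hC _).trans ?_
    rw [mul_assoc]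
    gcongr
    refine (weight_add_le z.1 (Φ z.2)).trans ?_
    have hw := (weight_pos z.1).le
    gcongr
    have h1 : |z.2| ≤ |M| := (not_lt.1 h).trans (le_abs_self M)
    exact (hΦ z.2).trans (mul_le_mul (le_abs_self B) h1 (abs_nonneg _) (abs_nonneg _))

theorem Wt.comp_shear {g : E3 × ℝ → ℝ} (hg : Wt g) {B : ℝ} {Φ : ℝ → E3} (hΦ : Continuous Φ)
    (hB : ∀ t, ‖Φ t‖ ≤ B * |t|) : Wt fun z => g (shear Φ z) := by
  obtain ⟨C, M, hC0, h⟩ := hg.exists_comp_shear_le B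
  exact ⟨hg.meas.comp (continuous_shear hΦ).measurable, C, M, hC0, (h Φ hB).1, (h Φ hB).2⟩

/-! ### From smooth to bounded measurable drifts. -/

/-- Convergence of integrals along sequences of integrable functions with integrable limit. -/
structure IntegralTendsto {α : Type*} [MeasurableSpace α] (μ : Measure α) (F : ℕ → α → ℝ)
    (F₀ : α → ℝ) : Prop where
  integrable : ∀ n, Integrable (F n) μ
  integrable_limit : Integrable F₀ μ
  tendsto : Tendsto (fun n => ∫ z, F n z ∂μ) atTop (𝓝 (∫ z, F₀ z ∂μ))

theorem IntegralTendsto.add {α : Type*} [MeasurableSpace α] {μ : Measure α} {F G : ℕ → α → ℝ}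
    {F₀ G₀ : α → ℝ} (hF : IntegralTendsto μ F F₀) (hG : IntegralTendsto μ G G₀) :
    IntegralTendsto μ (fun n z => F n z + G n z) (fun z => F₀ z + G₀ z) := by
  refine ⟨fun n => (hF.1 n).add (hG.1 n), hF.2.add hG.2, ?_⟩
  simp only [integral_add (hF.1 _) (hG.1 _), integral_add hF.2 hG.2]
  exact hF.3.add hG.3

theorem IntegralTendsto.sum {α ι : Type*} [Fintype ι] [MeasurableSpace α] {μ : Measure α}
    {F : ι → ℕ → α → ℝ} {F₀ : ι → α → ℝ} (hF : ∀ i, IntegralTendsto μ (F i) (F₀ i)) :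
    IntegralTendsto μ (fun n z => ∑ i, F i n z) (fun z => ∑ i, F₀ i z) := by
  refine ⟨fun n => integrable_finsetSum _ fun i _ => (hF i).1 n,
    integrable_finsetSum _ fun i _ => (hF i).2, ?_⟩
  have h1 : ∀ n, ∫ z, ∑ i, F i n z ∂μ = ∑ i, ∫ z, F i n z ∂μ := fun n =>
    integral_finsetSum _ fun i _ => (hF i).1 n
  simp only [h1, integral_finsetSum _ fun i _ => (hF i).2]
  exact tendsto_finsetSum _ fun i _ => (hF i).3

/-- Dominated convergence for sheared weights. -/
theorem Wt.integralTendsto_shear {T : EReal} {u : E3 → ℝ → E3} (hu : MemL2uloc T u)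
    {g : E3 × ℝ → ℝ} (hg : Wt g) (hgc : Continuous g) {Φn : ℕ → ℝ → E3} {Φ : ℝ → E3} {B K : ℝ}
    (hΦn : ∀ n, Continuous (Φn n)) (hΦ : Continuous Φ) (hBn : ∀ n t, ‖Φn n t‖ ≤ B * |t|)
    (hB : ∀ t, ‖Φ t‖ ≤ B * |t|) (hlim : ∀ t, Tendsto (fun n => Φn n t) atTop (𝓝 (Φ t)))
    {cn : ℕ → E3 × ℝ → ℝ} {c : E3 × ℝ → ℝ} (hcn : ∀ n, AEStronglyMeasurable (cn n) (slabMeasure T))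
    (hc : AEStronglyMeasurable c (slabMeasure T))
    (hKn : ∀ n z, |cn n z| ≤ K * (1 + ‖u z.1 z.2‖ ^ 2)) (hK : ∀ z, |c z| ≤ K * (1 + ‖u z.1 z.2‖ ^ 2))
    (hclim : ∀ᵐ z ∂(slabMeasure T), Tendsto (fun n => cn n z) atTop (𝓝 (c z))) :
    IntegralTendsto (slabMeasure T) (fun n z => cn n z * g (shear (Φn n) z))
      (fun z => c z * g (shear Φ z)) := by
  refine ⟨fun n => (hg.comp_shear (hΦn n) (hBn n)).integrable_mul hu (hcn n) (hKn n),
    (hg.comp_shear hΦ hB).integrable_mul hu hc hK, ?_⟩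
  obtain ⟨C, M, hC0, h⟩ := hg.exists_comp_shear_le B
  refine tendsto_integral_of_dominated_convergence (fun z => (K * C) * dominator u M z)
    (fun n => ((hg.comp_shear (hΦn n) (hBn n)).integrable_mul hu (hcn n) (hKn n)).1)
    ((hu.integrable_dominator M).const_mul _) (fun n => Eventually.of_forall fun z => ?_) ?_
  · have hB0 : 0 ≤ K * (1 + ‖u z.1 z.2‖ ^ 2) := (abs_nonneg _).trans (hKn n z)
    obtain ⟨h1, h2⟩ := h (Φn n) (hBn n)
    by_cases hz : |z.2| ≤ M
    · rw [dominator, indicator_of_mem (by exact hz), norm_mul, Real.norm_eq_abs, Real.norm_eq_abs]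
      calc _ ≤ (K * (1 + ‖u z.1 z.2‖ ^ 2)) * (C * weight z.1) :=
            mul_le_mul (hKn n z) (h1 z) (abs_nonneg _) hB0
        _ = _ := by ring
    · rw [dominator, indicator_of_notMem (by exact hz), h2 z (not_le.1 hz)]
      simp
  · filter_upwards [hclim] with z hz
    refine hz.mul ((hgc.tendsto _).comp ?_)
    exact ((hlim z.2).const_add z.1).prodMk_nhds tendsto_const_nhds

theorem integralTendsto_shearedResidual {T : EReal} {u : E3 → ℝ → E3} (hu : MemL2uloc T u)
    (k : Fin 3) {f : E3 × ℝ → ℝ} (hf : IsTest f) {Φn φn : ℕ → ℝ → E3} {Φ φ : ℝ → E3} {B : ℝ}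
    (hΦn : ∀ n, Continuous (Φn n)) (hΦ : Continuous Φ) (hBn : ∀ n t, ‖Φn n t‖ ≤ B * |t|)
    (hB : ∀ t, ‖Φ t‖ ≤ B * |t|) (hlim : ∀ t, Tendsto (fun n => Φn n t) atTop (𝓝 (Φ t)))
    (hφn : ∀ n, AEStronglyMeasurable (φn n) volume) (hφ : AEStronglyMeasurable φ volume)
    (hbn : ∀ n t, ‖φn n t‖ ≤ B) (hb : ∀ t, ‖φ t‖ ≤ B)
    (hφlim : ∀ᵐ t, Tendsto (fun n => φn n t) atTop (𝓝 (φ t))) :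
    IntegralTendsto (slabMeasure T) (fun n => shearedResidual u k f (φn n) (Φn n))
      (shearedResidual u k f φ Φ) := by
  have hm := aestronglyMeasurable_coord hu.meas
  have key : ∀ {g : E3 × ℝ → ℝ}, Wt g → Continuous g → ∀ {c : E3 × ℝ → ℝ},
      AEStronglyMeasurable c (slabMeasure T) → (∀ z, |c z| ≤ 1 * (1 + ‖u z.1 z.2‖ ^ 2)) →
      IntegralTendsto (slabMeasure T) (fun n z => c z * g (shear (Φn n) z))
        (fun z => c z * g (shear Φ z)) := fun hg hgc _ hc hK =>
    hg.integralTendsto_shear hu hgc hΦn hΦ hBn hB hlim (fun _ => hc) hc (fun _ => hK) hK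
      (Eventually.of_forall fun _ => tendsto_const_nhds)
  have hk1 : ∀ z : E3 × ℝ, |u z.1 z.2 k| ≤ 1 * (1 + ‖u z.1 z.2‖ ^ 2) := fun z => by
    rw [one_mul]; exact abs_coord_le _ _
  have hB0 : 0 ≤ B := (norm_nonneg _).trans (hb 0)
  have hK : ∀ (ψ : ℝ → E3), (∀ t, ‖ψ t‖ ≤ B) → ∀ (j : Fin 3) (z : E3 × ℝ),
      |u z.1 z.2 k * (ψ z.2 j + u z.1 z.2 j)| ≤ (B + 1) * (1 + ‖u z.1 z.2‖ ^ 2) := by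
    intro ψ hψ j z
    rw [mul_add, add_mul, one_mul]
    refine (abs_add_le _ _).trans (add_le_add ?_ (abs_coord_mul_le _ _ _))
    rw [abs_mul, mul_comm]
    have h1 : |ψ z.2 j| ≤ B := (by simpa using PiLp.norm_apply_le (ψ z.2) j : _ ≤ ‖ψ z.2‖).trans (hψ _)
    exact mul_le_mul h1 (abs_coord_le _ _) (abs_nonneg _) hB0
  have hcm : ∀ (ψ : ℝ → E3), AEStronglyMeasurable ψ volume → ∀ j : Fin 3, AEStronglyMeasurable
      (fun z : E3 × ℝ => u z.1 z.2 k * (ψ z.2 j + u z.1 z.2 j)) (slabMeasure T) := fun ψ hψ j =>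
    (hm k).mul ((aestronglyMeasurable_coord (aestronglyMeasurable_time hψ T) j).add (hm j))
  have hae : ∀ᵐ z ∂(slabMeasure T), Tendsto (fun n => φn n z.2) atTop (𝓝 (φ z.2)) :=
    Measure.quasiMeasurePreserving_snd.ae (ae_restrict_of_ae hφlim)
  refine (((key (hf.D et).wt (hf.D et).continuous (hm k) hk1).add
    (key hf.lap.wt hf.lap.continuous (hm k) hk1)).add (IntegralTendsto.sum fun j => ?_)).add
    (IntegralTendsto.sum fun i => IntegralTendsto.sum fun j => ?_)
  · refine (hf.D (ex j)).wt.integralTendsto_shear hu (hf.D _).continuous hΦn hΦ hBn hB hlim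
      (fun n => hcm _ (hφn n) j) (hcm _ hφ j) (fun n => hK _ (hbn n) j) (hK _ hb j) ?_
    filter_upwards [hae] with z hz
    refine Tendsto.const_mul _ (Tendsto.add_const _ ?_)
    exact ((EuclideanSpace.proj (𝕜 := ℝ) j).continuous.tendsto _).comp hz
  · exact key (wt_RR_D hf i j k) (contDiff_RR (hf.D _) i j).continuous ((hm i).mul (hm j))
      fun z => by rw [one_mul]; exact abs_coord_mul_le _ _ _

/-- Bounded measurable curves are almost everywhere limits of bounded smooth curves. -/
theorem exists_smooth_approx {φ : ℝ → E3} (hφ : AEStronglyMeasurable φ volume) {B : ℝ}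
    (hB : ∀ t, ‖φ t‖ ≤ B) : ∃ φn : ℕ → ℝ → E3, (∀ n, ContDiff ℝ ∞ (φn n)) ∧
      (∀ n t, ‖φn n t‖ ≤ B) ∧ ∀ᵐ t, Tendsto (fun n => φn n t) atTop (𝓝 (φ t)) := by
  have hB0 : 0 ≤ B := (norm_nonneg _).trans (hB 0)
  have hl : LocallyIntegrable φ volume :=
    (locallyIntegrable_const B).mono hφ (Eventually.of_forall fun t =>
      (hB t).trans (le_abs_self B))
  -- The ratio 2 of outer to inner radius is fixed, so Lebesgue differentiation gives almost
  -- everywhere convergence of the mollifications.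
  let b : ℕ → ContDiffBump (0 : ℝ) := fun n =>
    ⟨((n : ℝ) + 1)⁻¹, 2 * ((n : ℝ) + 1)⁻¹, by positivity, by
      have : 0 < ((n : ℝ) + 1)⁻¹ := by positivity
      linarith⟩
  refine ⟨fun n => convolution ((b n).normed volume) φ (ContinuousLinearMap.lsmul ℝ ℝ) volume,
    fun n => ?_, fun n t => ?_, ?_⟩
  · exact (b n).hasCompactSupport_normed.contDiff_convolution_left _ (b n).contDiff_normed hl
  · have h1 : ‖∫ s, (b n).normed volume s • φ (t - s)‖ ≤ ∫ s, (b n).normed volume s * B := by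
      refine norm_integral_le_of_norm_le ((b n).integrable_normed.mul_const B)
        (Eventually.of_forall fun s => ?_)
      rw [norm_smul, Real.norm_of_nonneg ((b n).nonneg_normed s)]
      exact mul_le_mul_of_nonneg_left (hB _) ((b n).nonneg_normed s)
    rw [integral_mul_const, (b n).integral_normed, one_mul] at h1
    exact h1
  · refine ContDiffBump.ae_convolution_tendsto_right_of_locallyIntegrable (K := 2) ?_
      (Eventually.of_forall fun n => le_rfl) hl
    have h0 : Tendsto (fun n : ℕ => ((n : ℝ) + 1)⁻¹) atTop (𝓝 0) := by
      simpa using tendsto_one_div_add_atTop_nhds_zero_nat (𝕜 := ℝ)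
    simpa using h0.const_mul 2

theorem contDiff_primitive {φ : ℝ → E3} (hφ : ContDiff ℝ ∞ φ) :
    ContDiff ℝ ∞ (fun t => ∫ s in (0 : ℝ)..t, φ s) ∧
      ∀ t, HasDerivAt (fun t => ∫ s in (0 : ℝ)..t, φ s) (φ t) t := by
  have hd : ∀ t, HasDerivAt (fun t => ∫ s in (0 : ℝ)..t, φ s) (φ t) t := fun t =>
    intervalIntegral.integral_hasDerivAt_right (hφ.continuous.intervalIntegrable _ _)
      (hφ.continuous.stronglyMeasurableAtFilter _ _) hφ.continuous.continuousAt
  refine ⟨contDiff_infty_iff_deriv.2 ⟨fun t => (hd t).differentiableAt, ?_⟩, hd⟩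
  rwa [funext fun t => (hd t).deriv]

theorem norm_primitive_le {φ : ℝ → E3} {B : ℝ} (hB : ∀ t, ‖φ t‖ ≤ B) (t : ℝ) :
    ‖∫ s in (0 : ℝ)..t, φ s‖ ≤ B * |t| := by
  simpa using intervalIntegral.norm_integral_le_of_norm_le_const (a := 0) (b := t) (f := φ)
    fun s _ => hB s

theorem intervalIntegrable_of_bound {φ : ℝ → E3} (hφ : AEStronglyMeasurable φ volume) {B : ℝ}
    (hB : ∀ t, ‖φ t‖ ≤ B) (a b : ℝ) : IntervalIntegrable φ volume a b :=
  (intervalIntegrable_const (c := B)).mono_fun' hφ.restrict (Eventually.of_forall hB)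

/-- The momentum equation with a drift, tested against sheared test functions. -/
theorem integral_shearedResidual {T : EReal} {u : E3 → ℝ → E3} {u₀ : E3 → E3} (hu : MemL2uloc T u)
    (k : Fin 3) {ϕ : ℝ → ℝ} (h : ∀ ψ : 𝓓(pastSlab T, ℝ), (∫ z, residual u k ψ z ∂(slabMeasure T)) +
      (∫ t in (timeInterval T : Set ℝ), mass (D et ψ) t * ϕ t) = - ∫ x, u₀ x k * ψ (x, 0))
    {φ : ℝ → E3} (hφ : AEStronglyMeasurable φ volume) {B : ℝ} (hB : ∀ t, ‖φ t‖ ≤ B)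
    (ψ : 𝓓(pastSlab T, ℝ)) :
    Integrable (shearedResidual u k ψ φ (fun t => ∫ s in (0 : ℝ)..t, φ s)) (slabMeasure T) ∧
    (∫ z, shearedResidual u k ψ φ (fun t => ∫ s in (0 : ℝ)..t, φ s) z ∂(slabMeasure T)) +
      (∫ t in (timeInterval T : Set ℝ), mass (D et ψ) t * ϕ t) = - ∫ x, u₀ x k * ψ (x, 0) := by
  have hf := isTest_coe ψ
  obtain ⟨φn, hs, hbn, hlim⟩ := exists_smooth_approx hφ hB
  have hint := intervalIntegrable_of_bound hφ hB
  have hΦlim : ∀ t, Tendsto (fun n => ∫ s in (0 : ℝ)..t, φn n s) atTop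
      (𝓝 (∫ s in (0 : ℝ)..t, φ s)) := fun t =>
    intervalIntegral.tendsto_integral_filter_of_dominated_convergence (fun _ => B)
      (Eventually.of_forall fun n => (hs n).continuous.aestronglyMeasurable)
      (Eventually.of_forall fun n => Eventually.of_forall fun s _ => hbn n s)
      intervalIntegrable_const (hlim.mono fun s hs _ => hs)
  have hT := integralTendsto_shearedResidual hu k hf (fun n => (contDiff_primitive (hs n)).1.continuous)
    (intervalIntegral.continuous_primitive hint 0) (fun n => norm_primitive_le (hbn n))
    (norm_primitive_le hB) hΦlim (fun n => (hs n).continuous.aestronglyMeasurable) hφ hbn hB hlim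
  refine ⟨hT.integrable_limit, ?_⟩
  have e : ∀ n, (∫ z, shearedResidual u k ψ (φn n) (fun t => ∫ s in (0 : ℝ)..t, φn n s) z
      ∂(slabMeasure T)) + (∫ t in (timeInterval T : Set ℝ), mass (D et ψ) t * ϕ t) =
      - ∫ x, u₀ x k * ψ (x, 0) := by
    intro n
    obtain ⟨hc, hd⟩ := contDiff_primitive (hs n)
    have ht := hf.comp_shear hc
    have h1 := h (ht.toTest (tsupport_comp_shear_subset hc.continuous ψ.tsupport_subset))
    rw [ht.coe_toTest] at h1
    simp only [residual_comp_shear u k hf hd] at h1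
    -- Translating each slice does not change its mass, so the drift term is unaffected by the
    -- shear.
    have h2 : mass (D et fun z => ψ (shear (fun t => ∫ s in (0 : ℝ)..t, φn n s) z)) =
        mass (D et ψ) := by
      funext t
      rw [← deriv_mass ht, ← deriv_mass hf]
      congr 1
      funext t
      exact integral_slice_add ψ (∫ s in (0 : ℝ)..t, φn n s) t
    rw [h2] at h1
    rw [h1]
    -- The shear is the identity at t = 0, so the initial term is unchanged.
    simp [shear]
  have h3 := hT.tendsto.add_const (∫ t in (timeInterval T : Set ℝ), mass (D et ψ) t * ϕ t)
  simp only [e] at h3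
  exact tendsto_nhds_unique h3 tendsto_const_nhds

/-! ### The momentum equation for the boosted velocity. -/

/-- Apart from φ_k ∂_t f, the difference consists of a Laplacian and of u or constants contracted
with gradients of f and of R_i R_k f. The factor 2 comes from the symmetry of the mixed terms φ_i
u_j and u_i φ_j. -/
theorem residual_boost (u : E3 → ℝ → E3) (k : Fin 3) {f : E3 × ℝ → ℝ} (hf : IsTest f)
    (φ Φ : ℝ → E3) (z : E3 × ℝ) :
    residual (boost u φ Φ) k f (shear Φ z) - shearedResidual u k f φ Φ z =
      φ z.2 k * D et f (shear Φ z) + (φ z.2 k * lap f (shear Φ z) +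
      (φ z.2 k * ((∑ j : Fin 3, u z.1 z.2 j * D (ex j) f (shear Φ z)) +
        ∑ j : Fin 3, φ z.2 j * D (ex j) f (shear Φ z)) +
      ∑ i : Fin 3, φ z.2 i * ((2 * ∑ j : Fin 3, u z.1 z.2 j * D (ex j) (RR i k f) (shear Φ z)) +
        ∑ j : Fin 3, φ z.2 j * D (ex j) (RR i k f) (shear Φ z)))) := by
  have h : ∀ i j : Fin 3, D (ex j) (RR i k f) = RR i j (D (ex k) f) := fun i j =>
    (RR_D_comm hf i j k).symm
  simp only [residual, mom, quad, shearedResidual, boost_shear, h, PiLp.add_apply,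
    Fin.sum_univ_three, RR_symm 1 0, RR_symm 2 0, RR_symm 2 1]
  ring

/-- Almost every slice of these divergence terms integrates to zero, including those with R_i R_k f,
which is not compactly supported. What remains is φ_k times the mass of ∂_t f. -/
theorem SolvesNSE.integral_residual_boost {T : EReal} {u : E3 → ℝ → E3} {p : 𝓓'(slab T, ℝ)}
    (h : SolvesNSE T u p) (hu : MemL2uloc T u) (k : Fin 3) {φ Φ : ℝ → E3}
    (hφ : AEStronglyMeasurable φ volume) {B : ℝ} (hB : ∀ t, ‖φ t‖ ≤ B) (hΦ : Continuous Φ)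
    {f : E3 × ℝ → ℝ} (hf : IsTest f) (hi : Integrable (shearedResidual u k f φ Φ) (slabMeasure T)) :
    ∫ z, residual (boost u φ Φ) k f z ∂(slabMeasure T) =
      (∫ z, shearedResidual u k f φ Φ z ∂(slabMeasure T)) +
        ∫ t in (timeInterval T : Set ℝ), mass (D et f) t * φ t k := by
  have h1 := integrable_comp_shear hΦ (integrable_residual (hu.boost hφ hB hΦ) k hf)
  rw [← integral_comp_shear hΦ, ← sub_eq_iff_eq_add', ← integral_sub h1 hi]
  refine (integral_slab (h1.sub hi)).symm.trans (integral_congr_ae ?_)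
  have hG : ∀ᵐ t ∂(volume.restrict (timeInterval T : Set ℝ)), ∀ (i : Fin 3) (a : E3) (s : ℝ),
      IsNull fun x => ∑ j : Fin 3, u x t j * D (ex j) (RR i k f) (x + a, s) :=
    ae_all_iff.2 fun i => h.ae_isNull_div hu (decays_RR hf i k)
  filter_upwards [h.ae_isNull_div hu hf.decays, hG] with t h2 h3
  have h4 := ((hf.isNull_lap (Φ t) t).const_mul (φ t k)).add
    ((((h2 (Φ t) t).add (hf.decays.isNull_const_div (φ t) (Φ t) t)).const_mul (φ t k)).add
    (IsNull.sum fun i => (((h3 i (Φ t) t).const_mul 2).add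
      ((decays_RR hf i k).isNull_const_div (φ t) (Φ t) t)).const_mul (φ t i)))
  have h5 := ((hf.D et).integrable_slice_add (Φ t) t).const_mul (φ t k)
  have h6 := integral_add h5 h4.1
  rw [h4.2, integral_const_mul, integral_slice_add, add_zero, mul_comm (φ t k)] at h6
  rw [← h6]
  exact integral_congr_ae (Eventually.of_forall fun x => residual_boost u k hf φ Φ (x, t))

/-- The boost is taken with the drift itself as velocity: its contribution to the residual is then
exactly the drift term of the original equation, and the boosted field satisfies the equation with
the Riesz pressure and no drift. -/
theorem IsWeakSolution.exists_boost {T : EReal} (hT : 0 < T) {u₀ : E3 → E3} {u : E3 → ℝ → E3}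
    {p : 𝓓'(slab T, ℝ)} (h : IsWeakSolution T u₀ u p) : ∃ φ : ℝ → E3,
      AEStronglyMeasurable φ volume ∧ (∃ B, ∀ t, ‖φ t‖ ≤ B) ∧ Tendsto φ (𝓝[>] 0) (𝓝 0) ∧
      ∃ hu : MemL2uloc T (boost u φ fun t => ∫ s in (0 : ℝ)..t, φ s),
        IsWeakSolution T u₀ (boost u φ fun t => ∫ s in (0 : ℝ)..t, φ s) (rieszPressure hu) := by
  choose ϕ hm hb hlim hdrift using fun k => h.exists_drift hT k
  choose b hb using hb
  have hu := h.memL2uloc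
  set φ : ℝ → E3 := fun t => ∑ k : Fin 3, ϕ k t • bv k with hφ
  have hφm : AEStronglyMeasurable φ volume :=
    Finset.aestronglyMeasurable_fun_sum _ fun k _ => (hm k).smul_const _
  have hB : ∀ t, ‖φ t‖ ≤ ∑ k, b k := fun t => norm_sum_le_of_le _ fun k _ => by
    rw [norm_smul]
    simpa [bv] using hb k t
  have hφk : ∀ t k, φ t k = ϕ k t := by
    intro t k
    fin_cases k <;> simp [hφ, bv, Fin.sum_univ_three]
  have h0 : Tendsto φ (𝓝[>] 0) (𝓝 0) := by
    have := tendsto_finsetSum Finset.univ fun k _ => (hlim k).smul_const (bv k)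
    simpa using this
  have hΦ : Continuous fun t => ∫ s in (0 : ℝ)..t, φ s :=
    intervalIntegral.continuous_primitive (intervalIntegrable_of_bound hφm hB) 0
  have hub := hu.boost hφm hB hΦ
  refine ⟨φ, hφm, ⟨_, hB⟩, h0, hub, isWeakSolution_rieszPressure hT hub
    (fun f hf _ => h.solves.integral_boost_div hu hφm hB hΦ hf) fun k ψ => ?_⟩
  obtain ⟨hi, e⟩ := integral_shearedResidual hu k (hdrift k) hφm hB ψ
  rw [h.solves.integral_residual_boost hu k hφm hB hΦ (isTest_coe ψ) hi, ← e]
  simp only [hφk]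

end NSStructure

theorem theorem1p1 (T : EReal) (hT : 0 < T)
    (Θ : NSStructure.E3 → ℝ) (hΘ : NSStructure.IsCutoff Θ)
    (u₀ : NSStructure.E3 → NSStructure.E3)
    (hu₀ : LocallyIntegrable u₀) (hdiv : NSStructure.IsDivFree u₀)
    (u : NSStructure.E3 → ℝ → NSStructure.E3) (p : 𝓓'(NSStructure.slab T, ℝ))
    (hup : NSStructure.IsWeakSolution T u₀ u p) :
    ∃ (u' : NSStructure.E3 → ℝ → NSStructure.E3) (p' : 𝓓'(NSStructure.slab T, ℝ))
      (φ Φ : ℝ → NSStructure.E3),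
      NSStructure.IsWeakSolution T u₀ u' p' ∧
      NSStructure.HasLocalPressureExpansion T Θ u' p' ∧
      MemLp φ ⊤ (volume.restrict (NSStructure.timeInterval T : Set ℝ)) ∧
      Tendsto φ (𝓝[>] (0 : ℝ)) (𝓝 0) ∧
      (∀ t ∈ NSStructure.timeInterval T, Φ t = ∫ s in (0 : ℝ)..t, φ s) ∧
      (∀ (x : NSStructure.E3), ∀ t ∈ NSStructure.timeInterval T,
        u' x t = u (x - Φ t) t + φ t) := by
  obtain ⟨φ, hφ, ⟨B, hB⟩, hlim, hu, hw⟩ := hup.exists_boost hT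
  exact ⟨_, _, φ, _, hw, NSStructure.hasLocalPressureExpansion_rieszPressure hΘ hu,
    memLp_top_of_bound hφ.restrict B (Eventually.of_forall hB), hlim, fun _ _ => rfl,
    fun _ _ _ => rfl⟩
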